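/- **Conventions.** Let $a\colon P\to X$ be a morphism of schemes, $Y\subset P$ a closed subscheme with ideal sheaf $\mathscr I_Y$, and $R\subset X$ a closed subscheme with ideal sheaf $\mathscr I_R$. Let $\mathscr I=\mathscr I_Y+\mathscr I_R\mathscr O_P$, and let $P'$ be the blow-up of $P$ along $\mathscr I$. The *dilatation* $P^{(R)}$ of $P$ along $Y$ of thickening $R$ is the largest open subscheme $W$ of $P'$ such that $\mathscr I_R\mathscr O_W=\mathscr I\mathscr O_W$; let $q\colon P^{(R)}\to P$ be the canonical morphism. For a section $\sigma$ of a separated morphism, the dilatation along $\sigma$ is the dilatation along the closed subscheme $\sigma(X)$. For a quasi-coherent module $\mathscr E$, put $\mathbf V(\mathscr E)=\mathrm{Spec}(\mathrm{Sym}\,\mathscr E)$. **(I)** Let $X$ be a locally noetherian scheme, $a\colon P\to X$ a smooth separated morphism with a section $\sigma$, and $R$ an effective Cartier divisor on $X$. Let $P^{(R)}$ be the dilatation of $P$ along $\sigma$ of thickening $R$. Then: * $P^{(R)}$ is smooth over $X$. * The module $\mathscr E=\sigma^*\Omega^1_{P/X}\otimes_{\mathscr O_X}\mathscr O_X(R)$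 is locally free of finite type, and there is a canonical isomorphism over $R$ $$P^{(R)}\times_XR\;\xrightarrow{\ \sim\ }\;\mathbf V(\sigma^*\Omega^1_{P/X}\otimes_{\mathscr O_X}\mathscr O_X(R))\times_XR .$$ It is the unique $R$-isomorphism under which the function $\sigma^*(df)\otimes t^{-1}$ corresponds to $q^*f/t$ (restricted to the fibre over $R$), for every local equation $t$ of $R$ on an affine open $U\subset X$ and every function $f$ on an open $W\subset a^{-1}(U)$ containing $\sigma(U)$ with $\sigma^*f=0$. **(II)** Let $k$ be a perfect field, $X$ a smooth separated $k$-scheme of finite type, $D$ a divisor with strict normal crossings on $X$ with irreducible components $D_1,\dots,D_m$, and $R=\sum_i r_iD_i$ with integers $r_i\ge 0$. Let $X\ast_kX$ be the framed self-product of $(X,D)$: the open subscheme of the blow-up of $X\times_kX$ along $\prod_i\mathscr I_{D_i\times_kD_i}$ complementary to the strict transforms of $D\times_kX$ and $X\times_kD$; let $\mathrm{pr}_1,\mathrm{pr}_2\colon X\ast_kX\to X$ be the projections. Then the diagonal of $X$ lifts uniquely to a morphism $\delta\colon X\to X\ast_kX$. Let $E^{(R)}=(X\ast_kX)^{(R)}$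 be the dilatation of $X\ast_kX$, viewed as an $X$-scheme by $\mathrm{pr}_2$, along $\delta$ of thickening $R$. Then: * Both projections $E^{(R)}\to X$ (induced by $\mathrm{pr}_1$ and by $\mathrm{pr}_2$) are smooth. * The module $\Omega^1_{X/k}(\log D)\otimes_{\mathscr O_X}\mathscr O_X(R)$ is locally free of finite type, and there are canonical isomorphisms over $R$ $$R\times_{X}E^{(R)}\;\xrightarrow{\ \sim\ }\;\mathbf V(\Omega^1_{X/k}(\log D)\otimes_{\mathscr O_X}\mathscr O_X(R))\times_XR\;\xleftarrow{\ \sim\ }\;E^{(R)}\times_XR,$$ where $E^{(R)}$ is viewed over $X$ by $\mathrm{pr}_1$ on the left and by $\mathrm{pr}_2$ on the right. Each of them is the unique $R$-isomorphism under which $(df/f)\otimes t^{-1}$ corresponds to $(v-1)/\mathrm{pr}_j^*t$ (restricted to the fibre over $R$; $j=1$ on the left, $j=2$ on the right), for every local equation $t$ of $R$ on an affine open $U\subset X$, every function $f$ on $U$ invertible outside $D$, and every function $v$ on an open neighbourhood of $\delta(U)$ in $\mathrm{pr}_1^{-1}(U)\cap\mathrm{pr}_2^{-1}(U)$ with $\mathrm{pr}_1^*f=v\cdot\mathrm{pr}_2^*f$.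 -/

import Mathlib

open CategoryTheory Limits AlgebraicGeometry Polynomial HomogeneousLocalization

universe u

noncomputable section

section Rees

variable {A : Type u} [CommRing A]

/-- The degree `n` part `Iⁿ Tⁿ` of the Rees algebra `⨁ Iⁿ Tⁿ`. -/
def reesGrading (I : Ideal A) (n : ℕ) : Submodule A (reesAlgebra I) :=
  (LinearMap.range (monomial n : A →ₗ[A] A[X])).comap (reesAlgebra I).val.toLinearMap

theorem mem_reesGrading {I : Ideal A} {n : ℕ} {p : reesAlgebra I} :
    p ∈ reesGrading I n ↔ ∃ r, monomial n r = (p : A[X]) := Iff.rfl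

def reesMonomial (I : Ideal A) (n : ℕ) (r : A) (hr : r ∈ I ^ n) : reesAlgebra I :=
  ⟨monomial n r, reesAlgebra.monomial_mem.mpr hr⟩

theorem reesMonomial_mem (I : Ideal A) (n : ℕ) (r : A) (hr : r ∈ I ^ n) :
    reesMonomial I n r hr ∈ reesGrading I n := ⟨r, rfl⟩

theorem exists_reesMonomial {I : Ideal A} {n : ℕ} {p : reesAlgebra I} (hp : p ∈ reesGrading I n) :
    ∃ r hr, p = reesMonomial I n r hr := by
  obtain ⟨r, hr⟩ := hp
  have hr' : monomial n r = (p : A[X]) := hr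
  refine ⟨r, ?_, Subtype.ext hr'.symm⟩
  rw [← reesAlgebra.monomial_mem, hr']
  exact p.2

instance reesGradedMonoid (I : Ideal A) : SetLike.GradedMonoid (reesGrading I) where
  one_mem := ⟨1, by simp⟩
  mul_mem := by
    rintro i j p q ⟨a, ha⟩ ⟨b, hb⟩
    have ha' : monomial i a = (p : A[X]) := ha
    have hb' : monomial j b = (q : A[X]) := hb
    refine ⟨a * b, ?_⟩
    change monomial (i + j) (a * b) = (p : A[X]) * (q : A[X])
    rw [← ha', ← hb', monomial_mul_monomial]

def reesComponent (I : Ideal A) (i : ℕ) (p : reesAlgebra I) : reesGrading I i :=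
  ⟨reesMonomial I i _ (p.2 i), reesMonomial_mem ..⟩

def reesDecompose (I : Ideal A) (p : reesAlgebra I) : DirectSum ℕ fun i => reesGrading I i :=
  DirectSum.mk _ (p : A[X]).support fun i => reesComponent I i p

theorem reesDecompose_apply (I : Ideal A) (p : reesAlgebra I) (i : ℕ) :
    reesDecompose I p i = reesComponent I i p := by
  by_cases h : i ∈ (p : A[X]).support
  · exact DirectSum.mk_apply_of_mem h
  · rw [reesDecompose, DirectSum.mk_apply_of_notMem h]
    apply Subtype.ext; apply Subtype.ext
    change 0 = monomial i _
    rw [notMem_support_iff.mp h, monomial_zero_right]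

theorem reesDecompose_left (I : Ideal A) (p : reesAlgebra I) :
    DirectSum.coeAddMonoidHom (reesGrading I) (reesDecompose I p) = p := by
  classical
  have h : reesDecompose I p =
      ∑ i ∈ (p : A[X]).support, DirectSum.of (fun i => reesGrading I i) i (reesComponent I i p) := by
    apply DFinsupp.ext
    intro j
    rw [reesDecompose_apply]
    change _ = (∑ i ∈ (p : A[X]).support,
      DirectSum.of (fun i => reesGrading I i) i (reesComponent I i p)) j
    rw [DirectSum.sum_apply]
    by_cases hj : j ∈ (p : A[X]).support
    · rw [Finset.sum_eq_single j]
      · rw [DirectSum.of_eq_same]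
      · intro b _ hb
        exact DirectSum.of_eq_of_ne _ _ _ hb.symm
      · exact fun h => absurd hj h
    · rw [Finset.sum_eq_zero]
      · apply Subtype.ext; apply Subtype.ext
        change monomial j _ = 0
        rw [notMem_support_iff.mp hj, monomial_zero_right]
      · intro b hb
        exact DirectSum.of_eq_of_ne _ _ _ (fun e => hj (e ▸ hb))
  rw [h, map_sum]
  apply Subtype.ext
  rw [AddSubmonoidClass.coe_finsetSum]
  conv_rhs => rw [(p : A[X]).as_sum_support]
  refine Finset.sum_congr rfl fun i _ => ?_
  rw [DirectSum.coeAddMonoidHom_of]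
  rfl

theorem reesDecompose_of (I : Ideal A) (i : ℕ) (x : reesGrading I i) :
    reesDecompose I (x : reesAlgebra I) = DirectSum.of (fun i => reesGrading I i) i x := by
  classical
  obtain ⟨x, r, hr⟩ := x
  have hr' : monomial i r = (x : A[X]) := hr
  apply DFinsupp.ext
  intro j
  rw [reesDecompose_apply]
  by_cases hj : j = i
  · subst hj
    rw [DirectSum.of_eq_same (β := fun i => reesGrading I i)]
    apply Subtype.ext; apply Subtype.ext
    change monomial j ((x : A[X]).coeff j) = (x : A[X])
    rw [← hr', coeff_monomial_same]
  · rw [DirectSum.of_eq_of_ne (β := fun i => reesGrading I i) _ _ _ hj]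
    apply Subtype.ext; apply Subtype.ext
    change monomial j ((x : A[X]).coeff j) = 0
    rw [← hr', coeff_monomial_of_ne _ hj, monomial_zero_right]

theorem reesDecompose_add (I : Ideal A) (p q : reesAlgebra I) :
    reesDecompose I (p + q) = reesDecompose I p + reesDecompose I q := by
  apply DFinsupp.ext
  intro j
  change _ = reesDecompose I p j + reesDecompose I q j
  simp only [reesDecompose_apply]
  apply Subtype.ext; apply Subtype.ext
  exact (congrArg (monomial j) (coeff_add _ _ j)).trans (map_add (monomial j) _ _)

instance reesGradedAlgebra (I : Ideal A) : GradedAlgebra (reesGrading I) where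
  toGradedMonoid := reesGradedMonoid I
  toDecomposition :=
    { decompose' := reesDecompose I
      left_inv := reesDecompose_left I
      right_inv := fun x => by
        induction x using DirectSum.induction_on with
        | zero => 
          rw [map_zero]; apply DFinsupp.ext; intro j
          rw [reesDecompose_apply]; apply Subtype.ext; apply Subtype.ext
          exact monomial_zero_right j
        | of i x => rw [DirectSum.coeAddMonoidHom_of, reesDecompose_of]
        | add x y hx hy => rw [map_add, reesDecompose_add, hx, hy] }

end Rees

section ProjBase

variable {A B : Type u} [CommRing A] [CommRing B] {S T : Type u} [CommRing S] [CommRing T]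
  [Algebra A S] [Algebra B T] (𝒜 : ℕ → Submodule A S) (ℬ : ℕ → Submodule B T)
  [GradedAlgebra 𝒜] [GradedAlgebra ℬ]

/-- The structure morphism of the homogeneous spectrum of a graded `A`-algebra. -/
def projToSpec : Proj 𝒜 ⟶ Spec (.of A) :=
  Proj.toSpecZero 𝒜 ≫ Spec.map (CommRingCat.ofHom (algebraMap A (𝒜 0)))

def awayBase (s : S) : A →+* Away 𝒜 s :=
  (fromZeroRingHom 𝒜 (.powers s)).comp (algebraMap A (𝒜 0))

theorem awayι_projToSpec (s : S) {i : ℕ} (hs : s ∈ 𝒜 i) (hi : 0 < i) :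
    Proj.awayι 𝒜 s hs hi ≫ projToSpec 𝒜 = Spec.map (CommRingCat.ofHom (awayBase 𝒜 s)) := by
  rw [projToSpec, Proj.awayι_toSpecZero_assoc, ← Spec.map_comp, ← CommRingCat.ofHom_comp]
  rfl

theorem awayBase_val (s : S) (a : A) :
    (awayBase 𝒜 s a).val = Localization.mk (algebraMap A S a) 1 := by
  rfl

variable {𝒜 ℬ} (φ : A →+* B) (f : 𝒜 →+*ᵍ ℬ)

theorem awayMap_awayBase
    (hφ : ∀ a, f (algebraMap A S a) = algebraMap B T (φ a))
    (s : S) (a : A) :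
    Away.map f s (awayBase 𝒜 s a) = awayBase ℬ (f s) (φ a) := by
  apply HomogeneousLocalization.val_injective
  rw [awayBase_val]
  change HomogeneousLocalization.val (HomogeneousLocalization.mk _) = _
  rw [HomogeneousLocalization.val_mk, ← hφ]
  exact congrArg (Localization.mk _) (Subtype.ext (map_one f))

theorem awayι_projMap_projToSpec
    (hφ : ∀ a, f (algebraMap A S a) = algebraMap B T (φ a))
    (hf : HomogeneousIdeal.irrelevant ℬ ≤ (HomogeneousIdeal.irrelevant 𝒜).map f)
    (s : S) {i : ℕ} (hs : s ∈ 𝒜 i) (hi : 0 < i) :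
    Proj.awayι ℬ (f s) (f.2 hs) hi ≫ Proj.map f hf ≫ projToSpec 𝒜 =
    Proj.awayι ℬ (f s) (f.2 hs) hi ≫ projToSpec ℬ ≫ Spec.map (CommRingCat.ofHom φ) := by
  rw [Proj.awayι_comp_map_assoc f hf hi s hs, awayι_projToSpec, ← Category.assoc, awayι_projToSpec,
    ← Spec.map_comp, ← Spec.map_comp, ← CommRingCat.ofHom_comp, ← CommRingCat.ofHom_comp]
  congr 2
  ext a : 1
  exact awayMap_awayBase φ f hφ _ a

theorem projMap_projToSpec
    (hφ : ∀ a, f (algebraMap A S a) = algebraMap B T (φ a))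
    (hf : HomogeneousIdeal.irrelevant ℬ ≤ (HomogeneousIdeal.irrelevant 𝒜).map f)
    : Proj.map f hf ≫ projToSpec 𝒜 =
    projToSpec ℬ ≫ Spec.map (CommRingCat.ofHom φ) :=
  (Proj.mapAffineOpenCover f hf).openCover.hom_ext _ _ fun s ↦
    awayι_projMap_projToSpec φ f hφ hf s.2.1 s.2.2 s.1.2

theorem awayBase_mul_mk (s : S) {i : ℕ} (hs : s ∈ 𝒜 i) (a : A) (n : ℕ) (x : S) (hx) :
    awayBase 𝒜 s a * Away.mk 𝒜 hs n x hx =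
      Away.mk 𝒜 hs n (a • x) ((𝒜 (n • i)).smul_mem a hx) := by
  apply HomogeneousLocalization.val_injective
  rw [HomogeneousLocalization.val_mul, awayBase_val, Away.val_mk, Away.val_mk,
    Localization.mk_mul, one_mul, Algebra.smul_def]

theorem away_mk_eq_zero (s : S) {i : ℕ} (hs : s ∈ 𝒜 i) (n : ℕ) (x : S) (hx)
    (h : Away.mk 𝒜 hs n x hx = 0) : ∃ m : ℕ, s ^ m * x = 0 := by
  have h' := congrArg HomogeneousLocalization.val h
  rw [Away.val_mk, HomogeneousLocalization.val_zero, Localization.mk_eq_mk', IsLocalization.mk'_eq_zero_iff] at h'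
  obtain ⟨⟨_, m, rfl⟩, hm⟩ := h'
  exact ⟨m, hm⟩

theorem isLocalization_awayMap
    (hφ : ∀ a, f (algebraMap A S a) = algebraMap B T (φ a))
    (g : A)
    (hg : IsUnit (φ g))
    (h₁ : ∀ n, ∀ b ∈ ℬ n, ∃ k : ℕ, ∃ a ∈ 𝒜 n, f a = φ g ^ k • b)
    (h₂ : ∀ n, ∀ a ∈ 𝒜 n, f a = 0 → ∃ k : ℕ, g ^ k • a = 0)
    (s : S) {i : ℕ} (hs : s ∈ 𝒜 i) :
    letI := (Away.map f s).toAlgebra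
    IsLocalization.Away (awayBase 𝒜 s g) (Away ℬ (f s)) := by
  let _ := (Away.map f s).toAlgebra
  have hu : IsUnit (Away.map f s (awayBase 𝒜 s g)) := by
    rw [awayMap_awayBase φ f hφ]; exact hg.map _
  refine (isLocalization_iff _ _).mpr ⟨?_, ?_, ?_⟩
  · rintro ⟨_, n, rfl⟩
    change IsUnit (Away.map f s (awayBase 𝒜 s g ^ n))
    rw [map_pow]
    exact hu.pow n
  · intro z
    obtain ⟨n, b, hb, rfl⟩ := Away.mk_surjective ℬ (f.2 hs) z
    obtain ⟨k, a, ha, hab⟩ := h₁ _ b hb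
    refine ⟨⟨Away.mk 𝒜 hs n a ha, ⟨_, k, rfl⟩⟩, ?_⟩
    change _ * Away.map f s (awayBase 𝒜 s g ^ k) = Away.map f s (Away.mk 𝒜 hs n a ha)
    rw [Away.map_mk, ← map_pow, awayMap_awayBase φ f hφ, map_pow, mul_comm]
    refine (awayBase_mul_mk (𝒜 := ℬ) (f s) (f.2 hs) (φ g ^ k) n b hb).trans ?_
    congr 1
    exact hab.symm
  · intro x y hxy
    have h0 : Away.map f s (x - y) = 0 := by
      rw [map_sub]; exact sub_eq_zero.mpr hxy
    generalize hz : x - y = z at h0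
    obtain ⟨n, a, ha, rfl⟩ := Away.mk_surjective 𝒜 hs z
    rw [Away.map_mk] at h0
    obtain ⟨m, hm⟩ := away_mk_eq_zero (𝒜 := ℬ) (f s) _ _ _ _ h0
    rw [← map_pow, ← map_mul] at hm
    obtain ⟨k, hk⟩ := h₂ (m • i + n • i) _ (SetLike.mul_mem_graded (SetLike.pow_mem_graded m hs) ha) hm
    refine ⟨⟨_, k, rfl⟩, ?_⟩
    rw [← sub_eq_zero, ← mul_sub, hz]
    change awayBase 𝒜 s g ^ k * _ = 0
    rw [← map_pow, awayBase_mul_mk]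
    apply HomogeneousLocalization.val_injective
    rw [Away.val_mk, HomogeneousLocalization.val_zero, Localization.mk_eq_mk', IsLocalization.mk'_eq_zero_iff]
    exact ⟨⟨_, m, rfl⟩, by rw [mul_smul_comm]; exact hk⟩

theorem projMap_awayι_isPullback
    (hf : HomogeneousIdeal.irrelevant ℬ ≤ (HomogeneousIdeal.irrelevant 𝒜).map f)
    (s : S) {i : ℕ} (hs : s ∈ 𝒜 i) (hi : 0 < i) :
    IsPullback (Spec.map (CommRingCat.ofHom (Away.map f s))) (Proj.awayι ℬ (f s) (f.2 hs) hi)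
      (Proj.awayι 𝒜 s hs hi) (Proj.map f hf) :=
  IsOpenImmersion.isPullback _ _ _ _ (Proj.awayι_comp_map f hf hi s hs) (by
    rw [Proj.opensRange_awayι, Proj.opensRange_awayι, Proj.map_preimage_basicOpen])

theorem isOpenImmersion_projMap
    (hφ : ∀ a, f (algebraMap A S a) = algebraMap B T (φ a))
    (hf : HomogeneousIdeal.irrelevant ℬ ≤ (HomogeneousIdeal.irrelevant 𝒜).map f)
    (g : A)
    (hg : IsUnit (φ g))
    (h₁ : ∀ n, ∀ b ∈ ℬ n, ∃ k : ℕ, ∃ a ∈ 𝒜 n, f a = φ g ^ k • b)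
    (h₂ : ∀ n, ∀ a ∈ 𝒜 n, f a = 0 → ∃ k : ℕ, g ^ k • a = 0)
    : IsOpenImmersion (Proj.map f hf) := by
  refine (IsZariskiLocalAtTarget.iff_of_openCover (P := @IsOpenImmersion)
    (Proj.affineOpenCover 𝒜).openCover).mpr fun s ↦ ?_
  have hp := projMap_awayι_isPullback f hf s.2.1 s.2.2 s.1.2
  let _ := (Away.map f s.2.1).toAlgebra
  have := isLocalization_awayMap φ f hφ g hg h₁ h₂ s.2.1 s.2.2
  have : IsOpenImmersion (Spec.map (CommRingCat.ofHom (Away.map f s.2.1))) :=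
    IsOpenImmersion.of_isLocalization (awayBase 𝒜 s.2.1 g)
  exact (MorphismProperty.arrow_mk_iso_iff @IsOpenImmersion
    (Arrow.isoMk (hp.flip.isoPullback) (Iso.refl _)
      (hp.flip.isoPullback_hom_snd.trans (Category.comp_id _).symm))).mp this

theorem projMap_opensRange
    (hφ : ∀ a, f (algebraMap A S a) = algebraMap B T (φ a))
    (hf : HomogeneousIdeal.irrelevant ℬ ≤ (HomogeneousIdeal.irrelevant 𝒜).map f)
    (g : A)
    (hg : IsUnit (φ g))
    (h₁ : ∀ n, ∀ b ∈ ℬ n, ∃ k : ℕ, ∃ a ∈ 𝒜 n, f a = φ g ^ k • b)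
    (h₂ : ∀ n, ∀ a ∈ 𝒜 n, f a = 0 → ∃ k : ℕ, g ^ k • a = 0)
    (hB : letI := φ.toAlgebra; IsLocalization.Away g B) :
    projToSpec 𝒜 ⁻¹' Set.range (Spec.map (CommRingCat.ofHom φ)) = Set.range (Proj.map f hf) := by
  let _ := φ.toAlgebra
  have hr : ∀ x, x ∈ Set.range (Spec.map (CommRingCat.ofHom φ)) ↔
      x ∈ (PrimeSpectrum.basicOpen g : Set (PrimeSpectrum A)) := fun x => by
    rw [← PrimeSpectrum.localization_away_comap_range B g]; rfl
  apply le_antisymm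
  · intro x hx
    obtain ⟨s, y, hy⟩ := (Proj.affineOpenCover 𝒜).openCover.exists_eq x
    let _ := (Away.map f s.2.1).toAlgebra
    have := isLocalization_awayMap φ f hφ g hg h₁ h₂ s.2.1 s.2.2
    have hy' : y ∈ Set.range (Spec.map (CommRingCat.ofHom (Away.map f s.2.1))) := by
      have := PrimeSpectrum.localization_away_comap_range (Away ℬ (f s.2.1)) (awayBase 𝒜 s.2.1 g)
      refine (Set.ext_iff.mp this y).mpr ?_
      have h1 := (hr _).mp hx
      rw [← hy] at h1
      have h2 := congrArg (fun q => q.base y) (awayι_projToSpec 𝒜 s.2.1 s.2.2 s.1.2)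
      have h3 : projToSpec 𝒜 ((Proj.affineOpenCover 𝒜).openCover.f s y) =
        Spec.map (CommRingCat.ofHom (awayBase 𝒜 s.2.1)) y := h2
      rw [h3] at h1
      exact h1
    obtain ⟨z, rfl⟩ := hy'
    refine ⟨Proj.awayι ℬ (f s.2.1) (f.2 s.2.2) s.1.2 z, ?_⟩
    rw [← hy]
    exact congrArg (fun q => q.base z) (Proj.awayι_comp_map f hf s.1.2 s.2.1 s.2.2)
  · rintro _ ⟨x, rfl⟩
    refine ⟨projToSpec ℬ x, ?_⟩
    exact congrArg (fun q => q.base x) (projMap_projToSpec φ f hφ hf).symm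

theorem projMap_isPullback
    (hφ : ∀ a, f (algebraMap A S a) = algebraMap B T (φ a))
    (hf : HomogeneousIdeal.irrelevant ℬ ≤ (HomogeneousIdeal.irrelevant 𝒜).map f)
    (g : A)
    (hg : IsUnit (φ g))
    (h₁ : ∀ n, ∀ b ∈ ℬ n, ∃ k : ℕ, ∃ a ∈ 𝒜 n, f a = φ g ^ k • b)
    (h₂ : ∀ n, ∀ a ∈ 𝒜 n, f a = 0 → ∃ k : ℕ, g ^ k • a = 0)
    (hB : letI := φ.toAlgebra; IsLocalization.Away g B) :
    IsPullback (projToSpec ℬ) (Proj.map f hf) (Spec.map (CommRingCat.ofHom φ)) (projToSpec 𝒜) := by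
  have := isOpenImmersion_projMap φ f hφ hf g hg h₁ h₂
  let _ := φ.toAlgebra
  have : IsOpenImmersion (Spec.map (CommRingCat.ofHom φ)) := IsOpenImmersion.of_isLocalization g
  exact IsOpenImmersion.isPullback _ _ _ _ (projMap_projToSpec φ f hφ hf)
    (TopologicalSpace.Opens.ext (projMap_opensRange φ f hφ hf g hg h₁ h₂ hB))

end ProjBase

section ReesMap

variable {A B C : Type u} [CommRing A] [CommRing B] [CommRing C]

/-- The homomorphism of Rees algebras induced by `φ : A → B` with `φ(I) ⊆ J`. -/
def reesHom (φ : A →+* B) (I : Ideal A) (J : Ideal B) (h : I.map φ ≤ J) :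
    reesGrading I →+*ᵍ reesGrading J where
  __ := (((mapRingHom φ).comp (reesAlgebra I).val.toRingHom).codRestrict
      (reesAlgebra J).toSubring fun p i => by
    have h1 : φ ((p : A[X]).coeff i) ∈ (I ^ i).map φ := Ideal.mem_map_of_mem φ (p.2 i)
    rw [Ideal.map_pow] at h1
    change (Polynomial.map φ (p : A[X])).coeff i ∈ _
    rw [coeff_map]
    exact Ideal.pow_right_mono h i h1 : reesAlgebra I →+* reesAlgebra J)
  map_mem := by
    rintro i p ⟨r, hr⟩
    have hr' : monomial i r = (p : A[X]) := hr
    refine ⟨φ r, ?_⟩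
    change monomial i (φ r) = Polynomial.map φ (p : A[X])
    rw [← hr', map_monomial]

theorem reesHom_coe (φ : A →+* B) (I : Ideal A) (J : Ideal B) (h : I.map φ ≤ J)
    (p : reesAlgebra I) : (reesHom φ I J h p : B[X]) = Polynomial.map φ (p : A[X]) := rfl

theorem reesHom_algebraMap (φ : A →+* B) (I : Ideal A) (J : Ideal B) (h : I.map φ ≤ J) (a : A) :
    reesHom φ I J h (algebraMap A _ a) = algebraMap B _ (φ a) :=
  Subtype.ext ((reesHom_coe φ I J h _).trans (Polynomial.map_C φ))

theorem reesHom_irrelevant (φ : A →+* B) (I : Ideal A) (J : Ideal B) (h : I.map φ = J) :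
    HomogeneousIdeal.irrelevant (reesGrading J) ≤
      (HomogeneousIdeal.irrelevant (reesGrading I)).map (reesHom φ I J h.le) := by
  rw [HomogeneousIdeal.irrelevant_le]
  intro n hn b hb
  obtain ⟨r, hr, rfl⟩ := exists_reesMonomial hb
  change _ ∈ (Ideal.map _ _ : Ideal _)
  have hr' := hr
  rw [← h, ← Ideal.map_pow] at hr'
  suffices H : ∀ r (hr' : r ∈ (I ^ n).map φ), ∃ hr : r ∈ J ^ n, reesMonomial J n r hr ∈
      ((HomogeneousIdeal.irrelevant (reesGrading I)).toIdeal.map (reesHom φ I J h.le)) from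
    (H r hr').2
  intro r hr
  refine Submodule.span_induction ?_ ?_ ?_ ?_ hr
  · rintro _ ⟨a, ha, rfl⟩
    refine ⟨by rw [← h, ← Ideal.map_pow]; exact Ideal.mem_map_of_mem φ ha, ?_⟩
    have : reesMonomial J n (φ a) (by rw [← h, ← Ideal.map_pow]; exact Ideal.mem_map_of_mem φ ha) =
        reesHom φ I J h.le (reesMonomial I n a ha) :=
      Subtype.ext ((reesHom_coe φ I J h.le _).trans (map_monomial φ)).symm
    rw [this]
    refine Ideal.mem_map_of_mem _ ?_
    exact HomogeneousIdeal.mem_irrelevant_of_mem _ hn (reesMonomial_mem I n a ha)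
  · refine ⟨zero_mem _, ?_⟩
    have h0 : reesMonomial J n 0 (zero_mem _) = 0 := Subtype.ext (monomial_zero_right n)
    rw [h0]
    exact Ideal.zero_mem _
  · rintro x y - - ⟨hx, hx'⟩ ⟨hy, hy'⟩
    refine ⟨add_mem hx hy, ?_⟩
    convert add_mem hx' hy'
    exact Subtype.ext (map_add (monomial n) x y)
  · rintro b x - ⟨hx, hx'⟩
    refine ⟨Ideal.mul_mem_left _ b hx, ?_⟩
    convert Ideal.mul_mem_left _ (algebraMap B _ b) hx'
    exact Subtype.ext (C_mul_monomial).symm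

theorem reesHom_surj (φ : A →+* B) (I : Ideal A) (J : Ideal B) (h : I.map φ = J) (g : A)
    (hB : letI := φ.toAlgebra; IsLocalization.Away g B) (n : ℕ) (b) (hb : b ∈ reesGrading J n) :
    ∃ k : ℕ, ∃ a ∈ reesGrading I n, reesHom φ I J h.le a = φ g ^ k • b := by
  let _ := φ.toAlgebra
  obtain ⟨r, hr, rfl⟩ := exists_reesMonomial hb
  have hr' := hr
  rw [← h, ← Ideal.map_pow] at hr'
  obtain ⟨⟨⟨a, ha⟩, ⟨_, k, rfl⟩⟩, hk⟩ := (IsLocalization.mem_map_algebraMap_iff (.powers g) B).mp hr'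
  refine ⟨k, reesMonomial I n a ha, reesMonomial_mem I n a ha, Subtype.ext ?_⟩
  refine (reesHom_coe φ I J h.le _).trans ((map_monomial φ).trans ?_)
  change monomial n (φ a) = φ g ^ k • monomial n r
  rw [smul_monomial, smul_eq_mul, mul_comm, ← map_pow]
  exact congrArg _ hk.symm

theorem reesHom_ker (φ : A →+* B) (I : Ideal A) (J : Ideal B) (h : I.map φ = J) (g : A)
    (hB : letI := φ.toAlgebra; IsLocalization.Away g B) (n : ℕ) (a) (ha : a ∈ reesGrading I n)
    (h0 : reesHom φ I J h.le a = 0) : ∃ k : ℕ, g ^ k • a = 0 := by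
  let _ := φ.toAlgebra
  obtain ⟨r, hr, rfl⟩ := exists_reesMonomial ha
  have h1 : Polynomial.map φ (monomial n r) = 0 := congrArg Subtype.val h0
  rw [map_monomial, monomial_eq_zero_iff] at h1
  obtain ⟨⟨_, k, rfl⟩, hk⟩ := (IsLocalization.map_eq_zero_iff (.powers g) B r).mp h1
  refine ⟨k, Subtype.ext ?_⟩
  change g ^ k • monomial n r = 0
  rw [smul_monomial, smul_eq_mul]
  exact (congrArg _ hk).trans (monomial_zero_right n)

/-- The morphism of homogeneous spectra of Rees algebras induced by `φ : A → B` with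
`φ(I) B = J`. -/
def reesProjMap (φ : A →+* B) (I : Ideal A) (J : Ideal B) (h : I.map φ = J) :
    Proj (reesGrading J) ⟶ Proj (reesGrading I) :=
  Proj.map (reesHom φ I J h.le) (reesHom_irrelevant φ I J h)

theorem reesProjMap_id (I : Ideal A) (h : I.map (RingHom.id A) = I) :
    reesProjMap (RingHom.id A) I I h = 𝟙 _ := by
  have : reesHom (RingHom.id A) I I h.le = .id _ := by
    refine GradedRingHom.ext fun p => ?_
    exact Subtype.ext (Polynomial.map_id)
  rw [← Proj.map_id]
  unfold reesProjMap
  congr 1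

theorem reesProjMap_comp (φ : A →+* B) (ψ : B →+* C) (I : Ideal A) (J : Ideal B) (K : Ideal C)
    (h : I.map φ = J) (h' : J.map ψ = K) (h'' : I.map (ψ.comp φ) = K) :
    reesProjMap (ψ.comp φ) I K h'' = reesProjMap ψ J K h' ≫ reesProjMap φ I J h := by
  have : reesHom (ψ.comp φ) I K h''.le = (reesHom ψ J K h'.le).comp (reesHom φ I J h.le) := by
    refine GradedRingHom.ext fun p => ?_
    exact Subtype.ext (Polynomial.map_map φ ψ _).symm
  unfold reesProjMap
  rw [← Proj.map_comp]
  congr 1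

theorem reesProjMap_projToSpec (φ : A →+* B) (I : Ideal A) (J : Ideal B) (h : I.map φ = J) :
    reesProjMap φ I J h ≫ projToSpec (reesGrading I) =
      projToSpec (reesGrading J) ≫ Spec.map (CommRingCat.ofHom φ) :=
  projMap_projToSpec φ _ (reesHom_algebraMap φ I J h.le) _

theorem reesProjMap_isPullback (φ : A →+* B) (I : Ideal A) (J : Ideal B) (h : I.map φ = J) (g : A)
    (hB : letI := φ.toAlgebra; IsLocalization.Away g B) :
    IsPullback (projToSpec (reesGrading J)) (reesProjMap φ I J h) (Spec.map (CommRingCat.ofHom φ))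
      (projToSpec (reesGrading I)) :=
  projMap_isPullback φ _ (reesHom_algebraMap φ I J h.le) _ g
    (by let _ := φ.toAlgebra; exact IsLocalization.Away.algebraMap_isUnit g)
    (reesHom_surj φ I J h g hB) (reesHom_ker φ I J h g hB) hB

end ReesMap

section BlowUp

variable {X : Scheme.{u}} (I : X.IdealSheafData)

def affineRes {U V : X.AffineZariskiSite} (f : U ⟶ V) : Γ(X, V.1) →+* Γ(X, U.1) :=
  (X.presheaf.map ((Scheme.AffineZariskiSite.toOpensFunctor X).map f).op).hom

theorem affineRes_ideal {U V : X.AffineZariskiSite} (f : U ⟶ V) :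
    (I.ideal V).map (affineRes f) = I.ideal U :=
  I.map_ideal' (U := U) (V := V) _

theorem affineRes_isLocalization {U V : X.AffineZariskiSite} (f : U ⟶ V) (r : Γ(X, V.1))
    (hr : X.basicOpen r = U.1) :
    letI := (affineRes f).toAlgebra
    IsLocalization.Away r Γ(X, U.1) :=
  V.2.isLocalization_of_eq_basicOpen r _ hr.symm

theorem affineRes_id (U : X.AffineZariskiSite) : affineRes (𝟙 U) = RingHom.id _ := by
  unfold affineRes
  rw [CategoryTheory.Functor.map_id, op_id, CategoryTheory.Functor.map_id]
  rfl

theorem affineRes_comp {U V W : X.AffineZariskiSite} (f : U ⟶ V) (g : V ⟶ W) :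
    affineRes (f ≫ g) = (affineRes f).comp (affineRes g) := by
  unfold affineRes
  rw [CategoryTheory.Functor.map_comp, op_comp, CategoryTheory.Functor.map_comp]
  rfl

theorem reesProjMap_congr {A B : Type u} [CommRing A] [CommRing B] {φ ψ : A →+* B} (h : φ = ψ)
    (I : Ideal A) (J : Ideal B) (hI : I.map φ = J) :
    reesProjMap φ I J hI = reesProjMap ψ I J (h ▸ hI) := by
  subst h; rfl

/-- The homogeneous spectra of the Rees algebras `⨁ I(U)ⁿ`, for `U` affine open in `X`. -/
def blowUpFunctor : X.AffineZariskiSite ⥤ Scheme.{u} where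
  obj U := Proj (reesGrading (I.ideal U))
  map f := reesProjMap (affineRes f) _ _ (affineRes_ideal I f)
  map_id U := (reesProjMap_congr (affineRes_id U) _ _ _).trans (reesProjMap_id _ _)
  map_comp f g := (reesProjMap_congr (affineRes_comp f g) _ _ _).trans
    (reesProjMap_comp (affineRes g) (affineRes f) _ _ _ _ _ _)

def blowUpNatTrans : blowUpFunctor I ⟶
    Scheme.AffineZariskiSite.toOpensFunctor X ⋙ X.presheaf.rightOp ⋙ Scheme.Spec where
  app U := projToSpec (reesGrading (I.ideal U))
  naturality _ _ f := reesProjMap_projToSpec (affineRes f) _ _ (affineRes_ideal I f)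

theorem blowUpNatTrans_equifibered : (blowUpNatTrans I).Equifibered := by
  intro U V f
  obtain ⟨r, hr⟩ := f.le
  refine (reesProjMap_isPullback (affineRes f) _ _ (affineRes_ideal I f) r
    (affineRes_isLocalization f r hr)).flip

def blowUpGluingData : (Scheme.AffineZariskiSite.directedCover X).RelativeGluingData where
  functor := blowUpFunctor I
  natTrans := blowUpNatTrans I ≫ (Scheme.AffineZariskiSite.restrictIsoSpec X).inv
  equifibered :=
    have : IsIso (Scheme.AffineZariskiSite.restrictIsoSpec X).inv := inferInstance
    (blowUpNatTrans_equifibered I).comp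
      (.of_isIso (Scheme.AffineZariskiSite.restrictIsoSpec X).inv)

/-- The blow-up of `X` along the closed subscheme with ideal sheaf `I`, i.e. the relative
homogeneous spectrum of `⨁ Iⁿ`. -/
def blowUp : Scheme.{u} := (blowUpGluingData I).glued

/-- The structure morphism of the blow-up. -/
def blowUpπ : blowUp I ⟶ X := (blowUpGluingData I).toBase

end BlowUp

section Quasicoherent

variable {X : Scheme.{u}} (E : X.Modules) {U : X.Opens} (hU : IsAffineOpen U)

theorem fromSpec_image_le (W : (Spec Γ(X, U)).Opens) : hU.fromSpec ''ᵁ W ≤ U := by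
  rintro _ ⟨x, -, rfl⟩
  exact hU.range_fromSpec.le ⟨x, rfl⟩

theorem fromSpec_appIso_inv (W : (Spec Γ(X, U)).Opens) :
    (Scheme.ΓSpecIso Γ(X, U)).inv ≫ (Spec Γ(X, U)).presheaf.map W.leTop.op ≫
      (hU.fromSpec.appIso W).inv = X.presheaf.map (homOfLE (fromSpec_image_le hU W)).op := by
  have e : W ≤ hU.fromSpec ⁻¹ᵁ U := by rw [hU.fromSpec_preimage_self]; exact le_top
  have h := hU.fromSpec.appLE_appIso_inv (U := U) (V := W) e
  rw [← h, Scheme.Hom.appLE, hU.fromSpec_app_self, Category.assoc, Category.assoc,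
    ← Functor.map_comp_assoc]
  rfl

theorem restrict_fromSpec_smul (W : (Spec Γ(X, U)).Opens) (r : Γ(X, U))
    (x : Γ(E.restrict hU.fromSpec, W)) :
    (E.restrictAppIso hU.fromSpec W).hom (r • x) =
      X.presheaf.map (homOfLE (fromSpec_image_le hU W)).op r •
        (E.restrictAppIso hU.fromSpec W).hom x := by
  rw [Scheme.Modules.smul_Spec_def, ← fromSpec_appIso_inv]
  rfl

def specBasicOpen {R : CommRingCat.{u}} (f : R) : (Spec R).Opens := PrimeSpectrum.basicOpen f

theorem spec_exists_smul {R : CommRingCat.{u}} (N : (Spec R).Modules) [N.IsQuasicoherent] (f : R)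
    (y : Γ(N, specBasicOpen f)) : ∃ (n : ℕ) (m : Γ(N, ⊤)),
      N.presheaf.map (homOfLE le_top : specBasicOpen f ⟶ ⊤).op m = f ^ n • y := by
  have hl : IsLocalizedModule.Away f ((modulesSpecToSheaf.obj N).obj.map
    (PrimeSpectrum.basicOpen f).leTop.op).hom :=
    (isIso_fromTildeΓ_iff_isLocalizing N).mp inferInstance f
  obtain ⟨n, m, hm⟩ := hl.surj _ _ y
  exact ⟨n, m, hm.symm⟩

theorem spec_smul_eq_zero {R : CommRingCat.{u}} (N : (Spec R).Modules) [N.IsQuasicoherent] (f : R)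
    (m : Γ(N, ⊤)) (h : N.presheaf.map (homOfLE le_top : specBasicOpen f ⟶ ⊤).op m = 0) :
    ∃ n : ℕ, f ^ n • m = 0 := by
  have hl : IsLocalizedModule (.powers f) ((modulesSpecToSheaf.obj N).obj.map
    (PrimeSpectrum.basicOpen f).leTop.op).hom :=
    (isIso_fromTildeΓ_iff_isLocalizing N).mp inferInstance f
  have h' : ((modulesSpecToSheaf.obj N).obj.map (PrimeSpectrum.basicOpen f).leTop.op).hom m = 0 := h
  obtain ⟨⟨_, n, rfl⟩, hn⟩ := (IsLocalizedModule.eq_zero_iff (.powers f) _).mp h'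
  exact ⟨n, hn⟩

theorem image_smul_eq_zero [E.IsQuasicoherent] (f : Γ(X, U)) (m : Γ(E, hU.fromSpec ''ᵁ ⊤))
    (h : E.presheaf.map (homOfLE (hU.fromSpec.image_mono le_top) :
      hU.fromSpec ''ᵁ specBasicOpen f ⟶ hU.fromSpec ''ᵁ ⊤).op m = 0) :
    ∃ n : ℕ, X.presheaf.map (homOfLE (fromSpec_image_le hU ⊤)).op (f ^ n) • m = 0 := by
  obtain ⟨n, hn⟩ := spec_smul_eq_zero (E.restrict hU.fromSpec) f
    ((E.restrictAppIso hU.fromSpec ⊤).inv m) h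
  refine ⟨n, ?_⟩
  have h2 := restrict_fromSpec_smul E hU ⊤ (f ^ n) ((E.restrictAppIso hU.fromSpec ⊤).inv m)
  rw [hn, map_zero] at h2
  exact h2.symm

theorem image_exists_smul [E.IsQuasicoherent] (f : Γ(X, U))
    (y : Γ(E, hU.fromSpec ''ᵁ specBasicOpen f)) :
    ∃ (n : ℕ) (m : Γ(E, hU.fromSpec ''ᵁ ⊤)),
      E.presheaf.map (homOfLE (hU.fromSpec.image_mono le_top) :
      hU.fromSpec ''ᵁ specBasicOpen f ⟶ hU.fromSpec ''ᵁ ⊤).op m =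
      X.presheaf.map (homOfLE (fromSpec_image_le hU (specBasicOpen f))).op (f ^ n) • y := by
  obtain ⟨n, m, hm⟩ := spec_exists_smul (E.restrict hU.fromSpec) f
    ((E.restrictAppIso hU.fromSpec _).inv y)
  refine ⟨n, (E.restrictAppIso hU.fromSpec ⊤).hom m, ?_⟩
  have h2 := restrict_fromSpec_smul E hU _ (f ^ n) ((E.restrictAppIso hU.fromSpec _).inv y)
  rw [← hm] at h2
  exact h2

theorem presheaf_map_map {W₁ W₂ W₃ : X.Opens} (i : W₁ ⟶ W₂) (j : W₂ ⟶ W₃) (k : W₁ ⟶ W₃)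
    (x : Γ(E, W₃)) : E.presheaf.map i.op (E.presheaf.map j.op x) = E.presheaf.map k.op x := by
  rw [Subsingleton.elim k (i ≫ j), op_comp, E.presheaf.map_comp]
  rfl

theorem presheaf_map_self {W : X.Opens} (i : W ⟶ W) (x : Γ(E, W)) :
    E.presheaf.map i.op x = x := by
  rw [Subsingleton.elim i (𝟙 W), op_id, E.presheaf.map_id]
  rfl

theorem exists_pow_smul_eq_zero (hU : IsAffineOpen U) [E.IsQuasicoherent] (f : Γ(X, U)) (m : Γ(E, U))
    {V : X.Opens} (hV : V = X.basicOpen f) (i : V ⟶ U)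
    (h : E.presheaf.map i.op m = 0) : ∃ n : ℕ, f ^ n • m = 0 := by
  have h0 : hU.fromSpec ''ᵁ ⊤ = U :=
    hU.fromSpec.image_top_eq_opensRange.trans hU.opensRange_fromSpec
  have h1 : hU.fromSpec ''ᵁ specBasicOpen f = V :=
    (hU.fromSpec_image_basicOpen f).trans hV.symm
  obtain ⟨n, hn⟩ := image_smul_eq_zero E hU f (E.presheaf.map (homOfLE h0.le).op m) (by
    rw [presheaf_map_map E _ _ (homOfLE h1.le ≫ i), ← presheaf_map_map E (homOfLE h1.le) i, h,
      map_zero])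
  refine ⟨n, ?_⟩
  rw [← E.map_smul] at hn
  have h4 := congrArg (E.presheaf.map (homOfLE h0.ge).op) hn
  rwa [presheaf_map_map E _ _ (𝟙 U), presheaf_map_self, map_zero] at h4

theorem exists_pow_smul_eq_map (hU : IsAffineOpen U) [E.IsQuasicoherent] (f : Γ(X, U))
    {V : X.Opens} (hV : V = X.basicOpen f) (i : V ⟶ U) (y : Γ(E, V)) :
    ∃ (n : ℕ) (m : Γ(E, U)), E.presheaf.map i.op m = X.presheaf.map i.op (f ^ n) • y := by
  have h0 : hU.fromSpec ''ᵁ ⊤ = U :=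
    hU.fromSpec.image_top_eq_opensRange.trans hU.opensRange_fromSpec
  have h1 : hU.fromSpec ''ᵁ specBasicOpen f = V :=
    (hU.fromSpec_image_basicOpen f).trans hV.symm
  obtain ⟨n, m, hm⟩ := image_exists_smul E hU f (E.presheaf.map (homOfLE h1.le).op y)
  refine ⟨n, E.presheaf.map (homOfLE h0.ge).op m, ?_⟩
  have h4 := congrArg (E.presheaf.map (homOfLE h1.ge).op) hm
  rw [E.map_smul, presheaf_map_map E _ _ (𝟙 V), presheaf_map_self] at h4
  rw [presheaf_map_map E i (homOfLE h0.ge)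
    (homOfLE h1.ge ≫ homOfLE (hU.fromSpec.image_mono le_top)),
    ← presheaf_map_map E (homOfLE h1.ge), h4]
  congr 1
  rw [← ConcreteCategory.comp_apply, ← Functor.map_comp]
  rfl

end Quasicoherent

section SymmetricAlgebra

variable {A B C : Type u} [CommRing A] [CommRing B] [CommRing C] {M N P : Type u}
  [AddCommGroup M] [AddCommGroup N] [AddCommGroup P] [Module A M] [Module B N] [Module C P]
  (φ : A →+* B) (ψ : B →+* C) (l : M →ₛₗ[φ] N) (l' : N →ₛₗ[ψ] P)

/-- The homomorphism of symmetric algebras induced by a semilinear map. -/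
def symMap : SymmetricAlgebra A M →+* SymmetricAlgebra B N :=
  letI : Algebra A (SymmetricAlgebra B N) := ((algebraMap B _).comp φ).toAlgebra
  (SymmetricAlgebra.lift (R := A) (M := M) (A := SymmetricAlgebra B N)
    { toFun := fun m => SymmetricAlgebra.ι B N (l m)
      map_add' := fun x y => by rw [map_add, map_add]
      map_smul' := fun a x => by
        rw [map_smulₛₗ, map_smul, Algebra.smul_def]
        rfl }).toRingHom

theorem symMap_algebraMap (a : A) :
    symMap φ l (algebraMap A _ a) = algebraMap B _ (φ a) := by
  let _ : Algebra A (SymmetricAlgebra B N) := ((algebraMap B _).comp φ).toAlgebra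
  exact AlgHom.commutes (SymmetricAlgebra.lift (R := A) (M := M) (A := SymmetricAlgebra B N) _) a

theorem symMap_ι (m : M) :
    symMap φ l (SymmetricAlgebra.ι A M m) = SymmetricAlgebra.ι B N (l m) := by
  let _ : Algebra A (SymmetricAlgebra B N) := ((algebraMap B _).comp φ).toAlgebra
  exact SymmetricAlgebra.lift_ι_apply (R := A) (M := M) (A := SymmetricAlgebra B N) _ m

theorem symAlg_ringHom_ext {D : Type u} [CommRing D] {f g : SymmetricAlgebra A M →+* D}
    (h : ∀ a, f (algebraMap A _ a) = g (algebraMap A _ a))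
    (h' : ∀ m, f (SymmetricAlgebra.ι A M m) = g (SymmetricAlgebra.ι A M m)) : f = g := by
  refine RingHom.ext fun x => ?_
  induction x using SymmetricAlgebra.induction with
  | algebraMap r => exact h r
  | ι x => exact h' x
  | mul a b ha hb => rw [map_mul, map_mul, ha, hb]
  | add a b ha hb => rw [map_add, map_add, ha, hb]

theorem symMap_surj (g : A)
    (h₁ : ∀ b, ∃ (n : ℕ) (a : A), φ a = φ g ^ n * b)
    (h₂ : ∀ y, ∃ (n : ℕ) (m : M), l m = φ g ^ n • y) (z : SymmetricAlgebra B N) :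
    ∃ (n : ℕ) (x : SymmetricAlgebra A M), symMap φ l x = algebraMap B _ (φ g) ^ n * z := by
  induction z using SymmetricAlgebra.induction with
  | algebraMap b =>
    obtain ⟨n, a, ha⟩ := h₁ b
    exact ⟨n, algebraMap A _ a, by rw [symMap_algebraMap, ha, map_mul, map_pow]⟩
  | ι y =>
    obtain ⟨n, m, hm⟩ := h₂ y
    exact ⟨n, SymmetricAlgebra.ι A M m, by
      rw [symMap_ι, hm, map_smul, Algebra.smul_def, map_pow]⟩
  | mul a b ha hb =>
    obtain ⟨n, x, hx⟩ := ha
    obtain ⟨m, y, hy⟩ := hb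
    exact ⟨n + m, x * y, by rw [map_mul, hx, hy]; ring⟩
  | add a b ha hb =>
    obtain ⟨n, x, hx⟩ := ha
    obtain ⟨m, y, hy⟩ := hb
    refine ⟨n + m, algebraMap A _ g ^ m * x + algebraMap A _ g ^ n * y, ?_⟩
    rw [map_add, map_mul, map_mul, hx, hy, map_pow, map_pow, symMap_algebraMap]
    ring

theorem symMap_inj (g : A) (hB : letI := φ.toAlgebra; IsLocalization.Away g B)
    (h₂ : ∀ y, ∃ (n : ℕ) (m : M), l m = φ g ^ n • y)
    (h₃ : ∀ m, l m = 0 → ∃ n : ℕ, g ^ n • m = 0) (x y : SymmetricAlgebra A M)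
    (hxy : symMap φ l x = symMap φ l y) :
    ∃ n : ℕ, algebraMap A _ g ^ n * x = algebraMap A _ g ^ n * y := by
  let _ := φ.toAlgebra
  let S := SymmetricAlgebra A M
  let γ : S := algebraMap A S g
  let L := Localization.Away γ
  have hγ : IsUnit (algebraMap A L g) := IsLocalization.Away.algebraMap_isUnit γ
  let χ : B →+* L := IsLocalization.Away.lift (S := B) g hγ
  have hχ : ∀ a, χ (φ a) = algebraMap A L a := fun a => IsLocalization.Away.lift_eq g hγ a
  let _ : Module A N := Module.compHom N φ
  let lA : M →ₗ[A] N := { l with map_smul' := fun a m => l.map_smulₛₗ a m }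
  have hg : IsUnit (φ g) := IsLocalization.Away.algebraMap_isUnit g
  have : IsLocalizedModule.Away g lA := by
    refine IsLocalizedModule.Away.mk_of_addCommGroup ?_ ?_ h₃
    · rw [Module.End.isUnit_iff]
      have h := (Module.End.isUnit_iff _).mp (hg.map (algebraMap B (Module.End B N)))
      exact h
    · intro y
      obtain ⟨n, m, hm⟩ := h₂ y
      refine ⟨n, m, ?_⟩
      change φ (g ^ n) • y = l m
      rw [hm, map_pow]
  let κ₀ : M →ₗ[A] L := (Algebra.linearMap S L).restrictScalars A ∘ₗ SymmetricAlgebra.ι A M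
  have hL : ∀ (a : A) (x : L), a • x = algebraMap A L a * x := fun a x => Algebra.smul_def a x
  let κ : N →ₗ[A] L := IsLocalizedModule.lift (.powers g) lA κ₀ (by
    rintro ⟨_, n, rfl⟩
    rw [Module.End.isUnit_iff]
    have h := (Module.End.isUnit_iff _).mp ((hγ.pow n).map (algebraMap L (Module.End L L)))
    convert h using 1
    funext x
    change g ^ n • x = algebraMap A L g ^ n * x
    rw [hL, map_pow])
  have hκ : ∀ m, κ (l m) = algebraMap S L (SymmetricAlgebra.ι A M m) := fun m =>
    IsLocalizedModule.lift_apply (.powers g) lA κ₀ _ m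
  have hκB : ∀ (b : B) (y : N), κ (b • y) = χ b * κ y := by
    intro b y
    obtain ⟨⟨a, ⟨_, n, rfl⟩⟩, ha⟩ := IsLocalization.surj (.powers g) b
    have ha' : φ (g ^ n) * b = φ a := (mul_comm _ _).trans ha
    have h1 : (g ^ n) • (b • y) = a • y := by
      change φ (g ^ n) • b • y = φ a • y
      rw [smul_smul, ha']
    have h2 := congrArg κ h1
    have h4 : κ ((g ^ n) • (b • y)) = (g ^ n) • κ (b • y) := κ.map_smul _ _
    have h5 : κ (a • y) = a • κ y := κ.map_smul _ _
    rw [h4, h5, hL, hL, ← hχ, ← hχ, ← ha', map_mul χ, mul_assoc] at h2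
    have h3 : IsUnit (χ (φ (g ^ n))) := by rw [hχ, map_pow]; exact hγ.pow n
    exact h3.mul_left_cancel h2
  let _ : Algebra B L := χ.toAlgebra
  have hκB' : ∀ (b : B) (y : N), κ (b • y) = b • κ y := fun b y =>
    Eq.trans (hκB b y) (Algebra.smul_def b (κ y)).symm
  let κB : N →ₗ[B] L := { toFun := κ, map_add' := map_add κ, map_smul' := hκB' }
  let Θ : SymmetricAlgebra B N →ₐ[B] L := SymmetricAlgebra.lift κB
  have hΘ : Θ.toRingHom.comp (symMap φ l) = algebraMap S L := by
    refine symAlg_ringHom_ext (fun a => ?_) (fun m => ?_)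
    · change Θ (symMap φ l _) = _
      rw [symMap_algebraMap, AlgHom.commutes]
      exact hχ a
    · change Θ (symMap φ l _) = _
      rw [symMap_ι]
      exact (SymmetricAlgebra.lift_ι_apply κB (l m)).trans (hκ m)
  have hx : algebraMap S L x = algebraMap S L y := by
    rw [← hΘ]
    exact congrArg Θ hxy
  obtain ⟨⟨_, n, rfl⟩, hn⟩ := (IsLocalization.eq_iff_exists (.powers γ) L).mp hx
  exact ⟨n, hn⟩

theorem symMap_isLocalization (g : A) (hB : letI := φ.toAlgebra; IsLocalization.Away g B)
    (h₂ : ∀ y, ∃ (n : ℕ) (m : M), l m = φ g ^ n • y)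
    (h₃ : ∀ m, l m = 0 → ∃ n : ℕ, g ^ n • m = 0) :
    letI := (symMap φ l).toAlgebra
    IsLocalization.Away (algebraMap A (SymmetricAlgebra A M) g) (SymmetricAlgebra B N) := by
  let _ := (symMap φ l).toAlgebra
  have hg : IsUnit (φ g) := by let _ := φ.toAlgebra; exact IsLocalization.Away.algebraMap_isUnit g
  refine (isLocalization_iff _ _).mpr ⟨?_, ?_, ?_⟩
  · rintro ⟨_, n, rfl⟩
    change IsUnit (symMap φ l (algebraMap A _ g ^ n))
    rw [map_pow, symMap_algebraMap]
    exact (hg.map _).pow n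
  · intro z
    obtain ⟨n, x, hx⟩ := symMap_surj φ l g (fun b => by
      let _ := φ.toAlgebra
      obtain ⟨⟨a, ⟨_, n, rfl⟩⟩, ha⟩ := IsLocalization.surj (.powers g) b
      refine ⟨n, a, ha.symm.trans ?_⟩
      rw [mul_comm, ← map_pow]
      rfl) h₂ z
    refine ⟨⟨x, ⟨_, n, rfl⟩⟩, ?_⟩
    change z * symMap φ l (algebraMap A _ g ^ n) = symMap φ l x
    rw [map_pow, symMap_algebraMap, hx, mul_comm]
  · intro x y hxy
    obtain ⟨n, hn⟩ := symMap_inj φ l g hB h₂ h₃ x y hxy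
    exact ⟨⟨_, n, rfl⟩, hn⟩

end SymmetricAlgebra

section VectorBundle

variable {X : Scheme.{u}} (E : X.Modules)

def affineResModule {U V : X.AffineZariskiSite} (f : U ⟶ V) :
    Γ(E, V.1) →ₛₗ[affineRes f] Γ(E, U.1) where
  toFun := E.presheaf.map ((Scheme.AffineZariskiSite.toOpensFunctor X).map f).op
  map_add' := map_add _
  map_smul' r x := E.map_smul ((Scheme.AffineZariskiSite.toOpensFunctor X).map f) r x

def symFunctor : X.AffineZariskiSiteᵒᵖ ⥤ CommRingCat.{u} where
  obj U := .of (SymmetricAlgebra Γ(X, U.unop.1) Γ(E, U.unop.1))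
  map f := CommRingCat.ofHom (symMap (affineRes f.unop) (affineResModule E f.unop))
  map_id U := by
    refine CommRingCat.hom_ext (symAlg_ringHom_ext (fun a => ?_) (fun m => ?_))
    · refine (symMap_algebraMap _ _ _).trans (congrArg _ ?_)
      exact congrArg (fun φ => φ a) (affineRes_id U.unop)
    · refine (symMap_ι _ _ _).trans (congrArg _ ?_)
      exact presheaf_map_self E _ m
  map_comp f g := by
    refine CommRingCat.hom_ext (symAlg_ringHom_ext (fun a => ?_) (fun m => ?_))
    · refine (symMap_algebraMap _ _ _).trans (Eq.trans ?_ (congrArg _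
        (symMap_algebraMap _ _ _)).symm)
      refine Eq.trans ?_ (symMap_algebraMap _ _ _).symm
      exact congrArg _ (congrArg (fun φ => φ a) (affineRes_comp g.unop f.unop))
    · refine (symMap_ι _ _ _).trans (Eq.trans ?_ (congrArg _ (symMap_ι _ _ _)).symm)
      refine Eq.trans ?_ (symMap_ι _ _ _).symm
      exact congrArg _ (presheaf_map_map E _ _ _ m).symm

def symFunctorUnit :
    (Scheme.AffineZariskiSite.toOpensFunctor X).op ⋙ X.presheaf ⟶ symFunctor E where
  app U := CommRingCat.ofHom (algebraMap Γ(X, U.unop.1) (SymmetricAlgebra _ Γ(E, U.unop.1)))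
  naturality _ _ f := CommRingCat.hom_ext (RingHom.ext fun a =>
    (symMap_algebraMap (affineRes f.unop) (affineResModule E f.unop) a).symm)

theorem symFunctorUnit_coequifibered [E.IsQuasicoherent] : (symFunctorUnit E).Coequifibered := by
  rw [Scheme.AffineZariskiSite.coequifibered_iff_forall_isLocalizationAway]
  intro U f
  exact symMap_isLocalization (affineRes (homOfLE (U.basicOpen_le f)))
    (affineResModule E (homOfLE (U.basicOpen_le f))) f
    (affineRes_isLocalization _ f rfl)
    (fun y => by
      obtain ⟨n, m, hm⟩ := exists_pow_smul_eq_map E U.2 f rfl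
        ((Scheme.AffineZariskiSite.toOpensFunctor X).map (homOfLE (U.basicOpen_le f))) y
      rw [map_pow] at hm
      exact ⟨n, m, hm⟩)
    (fun m hm => exists_pow_smul_eq_zero E U.2 f m rfl
        ((Scheme.AffineZariskiSite.toOpensFunctor X).map (homOfLE (U.basicOpen_le f))) hm)

variable [E.IsQuasicoherent]

def vectorBundleGluingData : (Scheme.AffineZariskiSite.directedCover X).RelativeGluingData :=
  Scheme.AffineZariskiSite.relativeGluingData (symFunctorUnit_coequifibered E)

/-- The vector bundle `V(E) = Spec (Sym E)` of a quasi-coherent module `E`. -/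
def vectorBundle : Scheme.{u} := (vectorBundleGluingData E).glued

/-- The projection of `V(E)` to the base. -/
def vectorBundleπ : vectorBundle E ⟶ X := (vectorBundleGluingData E).toBase

/-- The canonical chart `Spec (Sym Γ(E, U)) ⟶ V(E)`, for `U` affine. -/
def vectorBundleι (U : X.affineOpens) :
    Spec (.of (SymmetricAlgebra Γ(X, U.1) Γ(E, U.1))) ⟶ vectorBundle E :=
  (vectorBundleGluingData E).cover.f (⟨U.1, U.2⟩ : X.AffineZariskiSite)

instance vectorBundleι_isOpenImmersion (U : X.affineOpens) :
    IsOpenImmersion (vectorBundleι E U) :=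
  (vectorBundleGluingData E).cover.map_prop (⟨U.1, U.2⟩ : X.AffineZariskiSite)

theorem vectorBundleι_opensRange (U : X.affineOpens) :
    vectorBundleπ E ⁻¹ᵁ U.1 = (vectorBundleι E U).opensRange := by
  have h := (vectorBundleGluingData E).toBase_preimage_eq_opensRange_ι
    (⟨U.1, U.2⟩ : X.AffineZariskiSite)
  refine Eq.trans ?_ h
  exact congrArg (fun W => vectorBundleπ E ⁻¹ᵁ W) (Scheme.Opens.opensRange_ι U.1).symm

/-- The tautological function on `V(E)` over `U` given by a section of `E` over `U`. -/
def vectorBundleFun (U : X.affineOpens) (m : Γ(E, U.1)) :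
    Γ(vectorBundle E, vectorBundleπ E ⁻¹ᵁ U.1) :=
  (vectorBundle E).presheaf.map (eqToHom ((vectorBundleι_opensRange E U).trans
      (vectorBundleι E U).image_top_eq_opensRange.symm)).op
    (((vectorBundleι E U).appIso ⊤).inv
      ((Scheme.ΓSpecIso (.of (SymmetricAlgebra Γ(X, U.1) Γ(E, U.1)))).inv
        (SymmetricAlgebra.ι _ _ m)))

end VectorBundle

section Sheaves

variable {X S : Scheme.{u}}

/-- The sheaf of modules associated with a presheaf of modules on a scheme. -/
def sheafifyModule (M : X.PresheafOfModules) : X.Modules :=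
  (PresheafOfModules.sheafification (𝟙 X.ringCatSheaf.obj)).obj M

def sheafifyModuleUnit (M : X.PresheafOfModules) :
    M ⟶ (PresheafOfModules.restrictScalars (𝟙 X.ringCatSheaf.obj)).obj (sheafifyModule M).val :=
  (PresheafOfModules.sheafificationAdjunction (𝟙 X.ringCatSheaf.obj)).unit.app M

/-- The section of the associated sheaf defined by a section of a presheaf. -/
def sheafifySection (M : X.PresheafOfModules) (U : X.Opens) (m : M.obj (.op U)) :
    Γ(sheafifyModule M, U) :=
  ((sheafifyModuleUnit M).app (.op U)).hom m

/-- The morphism of presheaves of rings `f⁻¹ 𝒪_S ⟶ 𝒪_X` of a morphism `f : X ⟶ S`. -/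
def inverseImageHom (f : X ⟶ S) :
    (TopCat.Presheaf.pullback CommRingCat f.base).obj S.presheaf ⟶ X.presheaf :=
  ((TopCat.Presheaf.pullbackPushforwardAdjunction CommRingCat f.base).homEquiv
    S.presheaf X.presheaf).symm f.c

def presheafDifferentials (f : X ⟶ S) : X.PresheafOfModules :=
  PresheafOfModules.DifferentialsConstruction.relativeDifferentials' (inverseImageHom f)

/-- The sheaf of relative differentials `Ω¹_{X/S}`. -/
def differentials (f : X ⟶ S) : X.Modules := sheafifyModule (presheafDifferentials f)

/-- The universal derivation `𝒪_X ⟶ Ω¹_{X/S}` on sections. -/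
def differential (f : X ⟶ S) (U : X.Opens) (a : Γ(X, U)) : Γ(differentials f, U) :=
  sheafifySection (presheafDifferentials f) U
    ((PresheafOfModules.DifferentialsConstruction.derivation' (inverseImageHom f)).d a)

/-- The tensor product `M ⊗ N` of two modules on a scheme. -/
def tensorModule (M N : X.Modules) : X.Modules :=
  sheafifyModule (PresheafOfModules.Monoidal.tensorObj (R := X.presheaf) M.val N.val)

/-- The section `m ⊗ n` of `M ⊗ N`. -/
def tensorSection (M N : X.Modules) (U : X.Opens) (m : Γ(M, U)) (n : Γ(N, U)) :
    Γ(tensorModule M N, U) :=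
  sheafifySection (PresheafOfModules.Monoidal.tensorObj (R := X.presheaf) M.val N.val) U
    (TensorProduct.tmul Γ(X, U) m n)

/-- The section `f^* m` of `f^* M` over an open subset of the preimage of `W`. -/
def pullbackSection (f : X ⟶ S) (M : S.Modules) (W : S.Opens) (U : X.Opens) (h : U ≤ f ⁻¹ᵁ W)
    (m : Γ(M, W)) : Γ((Scheme.Modules.pullback f).obj M, U) :=
  ((Scheme.Modules.pullback f).obj M).presheaf.map (homOfLE h).op
    ((((Scheme.Modules.pullbackPushforwardAdjunction f).unit.app M).app W) m)

/-- The module `j_* j^* M`, where `j` is the inclusion of the open subscheme `U`. -/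
def openPush (M : X.Modules) (U : X.Opens) : X.Modules :=
  (Scheme.Modules.pushforward U.ι).obj (M.restrict U.ι)

/-- The canonical map `M ⟶ j_* j^* M`. -/
def openPushUnit (M : X.Modules) (U : X.Opens) : M ⟶ openPush M U :=
  (Scheme.Modules.restrictAdjunction U.ι).unit.app M

end Sheaves

section Divisors

variable {X S : Scheme.{u}}

/-- The structure sheaf as a module over itself. -/
def structureModule (X : Scheme.{u}) : X.Modules := SheafOfModules.unit X.ringCatSheaf

/-- A function, as a section of the structure sheaf viewed as a module. -/
def structureSection {V : X.Opens} (a : Γ(X, V)) : Γ(structureModule X, V) := a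

/-- The open complement of the closed subscheme defined by an ideal sheaf. -/
def complement (R : X.IdealSheafData) : X.Opens := R.support.compl

/-- `R` is the ideal sheaf of an effective Cartier divisor: locally, it is generated by one
nonzerodivisor. -/
def IsEffectiveCartier (R : X.IdealSheafData) : Prop :=
  ∀ x : X, ∃ U : X.affineOpens, x ∈ U.1 ∧ ∃ t ∈ nonZeroDivisors Γ(X, U.1),
    R.ideal U = Ideal.span {t}

/-- The submodule presheaf of the presheaf underlying `M` with given spaces of sections. -/
def submodulePresheaf (M : X.Modules) (N : ∀ V : X.Opens, Submodule Γ(X, V) Γ(M, V))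
    (h : ∀ (V V' : X.Opens) (i : V' ⟶ V), ∀ s ∈ N V, M.presheaf.map i.op s ∈ N V') :
    M.val.Submodule where
  obj V :=
    { carrier := (N V.unop : Set Γ(M, V.unop))
      add_mem' := fun ha hb => (N V.unop).add_mem ha hb
      zero_mem' := (N V.unop).zero_mem
      smul_mem' := fun r _ hs => (N V.unop).smul_mem r hs }
  map {V V'} i s hs := h V.unop V'.unop i.unop s hs

/-- The sheaf of submodules generated by a presheaf of submodules of `M`. -/
def subsheafModule (M : X.Modules) (N : ∀ V : X.Opens, Submodule Γ(X, V) Γ(M, V))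
    (h : ∀ (V V' : X.Opens) (i : V' ⟶ V), ∀ s ∈ N V, M.presheaf.map i.op s ∈ N V') : X.Modules :=
  sheafifyModule (submodulePresheaf M N h).toPresheafOfModules

def subsheafSection (M : X.Modules) (N : ∀ V : X.Opens, Submodule Γ(X, V) Γ(M, V))
    (h : ∀ (V V' : X.Opens) (i : V' ⟶ V), ∀ s ∈ N V, M.presheaf.map i.op s ∈ N V')
    (V : X.Opens) (s : Γ(M, V)) (hs : s ∈ N V) : Γ(subsheafModule M N h, V) :=
  sheafifySection (submodulePresheaf M N h).toPresheafOfModules V ⟨s, hs⟩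

/-- The functions `s` on `V ∖ R` with `I_R s ⊆ 𝒪_V`. -/
def divisorSections (R : X.IdealSheafData) (V : X.Opens) :
    Submodule Γ(X, V) Γ(openPush (structureModule X) (complement R), V) where
  carrier := { s | ∀ (W : X.affineOpens) (h : W.1 ≤ V), ∀ a ∈ R.ideal W,
    ∃ b : Γ(structureModule X, W.1),
      a • (openPush (structureModule X) (complement R)).presheaf.map (homOfLE h).op s =
        (openPushUnit (structureModule X) (complement R)).app W.1 b }
  add_mem' := by
    intro s t hs ht W h a ha
    obtain ⟨b, hb⟩ := hs W h a ha
    obtain ⟨c, hc⟩ := ht W h a ha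
    exact ⟨b + c, by rw [map_add, smul_add, hb, hc, map_add]⟩
  zero_mem' := fun W h a ha => ⟨0, by rw [map_zero, smul_zero, map_zero]⟩
  smul_mem' := by
    intro r s hs W h a ha
    obtain ⟨b, hb⟩ := hs W h a ha
    refine ⟨X.presheaf.map (homOfLE h).op r • b, ?_⟩
    rw [Scheme.Modules.map_smul, Scheme.Modules.Hom.app_smul, ← hb, smul_comm]

theorem divisorSections_map (R : X.IdealSheafData) (V V' : X.Opens) (i : V' ⟶ V) :
    ∀ s ∈ divisorSections R V,
      (openPush (structureModule X) (complement R)).presheaf.map i.op s ∈ divisorSections R V' := by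
  intro s hs W h a ha
  obtain ⟨b, hb⟩ := hs W (h.trans i.le) a ha
  refine ⟨b, Eq.trans ?_ hb⟩
  rw [presheaf_map_map _ (homOfLE h) i (homOfLE (h.trans i.le))]

/-- The invertible module `𝒪_X(R)` of an effective Cartier divisor. -/
def divisorModule (R : X.IdealSheafData) : X.Modules :=
  subsheafModule _ (divisorSections R) (divisorSections_map R)

/-- The section of `𝒪_X(R)` defined by a function on `V ∖ R`. -/
def divisorSection (R : X.IdealSheafData) (V : X.Opens)
    (s : Γ(openPush (structureModule X) (complement R), V)) (hs : s ∈ divisorSections R V) :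
    Γ(divisorModule R, V) :=
  subsheafSection _ (divisorSections R) (divisorSections_map R) V s hs

/-- The part of `j_* j^* Ω¹_{X/S}` generated by `Ω¹_{X/S}` and by the logarithmic differentials
`m = da / a` of the functions `a` which are invertible on `U`, where `j : U ⟶ X`. -/
def logSections (f : X ⟶ S) (U : X.Opens) (V : X.Opens) :
    Submodule Γ(X, V) Γ(openPush (differentials f) U, V) :=
  Submodule.span Γ(X, V)
    (Set.range ((openPushUnit (differentials f) U).app V) ∪
      { m | ∃ a : Γ(X, V), IsUnit (X.presheaf.map (homOfLE (inf_le_left : V ⊓ U ≤ V)).op a) ∧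
          a • m = (openPushUnit (differentials f) U).app V (differential f V a) })

theorem differential_map (f : X ⟶ S) {V V' : X.Opens} (i : V' ⟶ V) (a : Γ(X, V)) :
    (differentials f).presheaf.map i.op (differential f V a) =
      differential f V' (X.presheaf.map i.op a) := by
  have h := PresheafOfModules.naturality_apply (sheafifyModuleUnit (presheafDifferentials f)) i.op
    ((PresheafOfModules.DifferentialsConstruction.derivation' (inverseImageHom f)).d a)
  refine h.symm.trans ?_
  exact congrArg (sheafifySection (presheafDifferentials f) V')
    ((PresheafOfModules.DifferentialsConstruction.derivation' (inverseImageHom f)).d_map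
      i.op a).symm

theorem hom_app_map {M N : X.Modules} (φ : M ⟶ N) {V V' : X.Opens} (i : V' ⟶ V) (m : Γ(M, V)) :
    N.presheaf.map i.op (φ.app V m) = φ.app V' (M.presheaf.map i.op m) :=
  (congrArg (fun g => g m) (congrArg ConcreteCategory.hom (φ.mapPresheaf.naturality i.op))).symm

theorem logSections_map (f : X ⟶ S) (U : X.Opens) (V V' : X.Opens) (i : V' ⟶ V) :
    ∀ s ∈ logSections f U V,
      (openPush (differentials f) U).presheaf.map i.op s ∈ logSections f U V' := by
  intro s hs
  induction hs using Submodule.span_induction with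
  | mem x hx =>
    refine Submodule.subset_span ?_
    rcases hx with ⟨ω, rfl⟩ | ⟨a, ha, hm⟩
    · exact Or.inl ⟨_, (hom_app_map _ i ω).symm⟩
    · refine Or.inr ⟨X.presheaf.map i.op a, ?_, ?_⟩
      · have h := ha.map (X.presheaf.map (homOfLE (inf_le_inf_right U i.le)).op).hom
        rw [← ConcreteCategory.comp_apply, ← Functor.map_comp]
        change IsUnit ((X.presheaf.map _ ≫ X.presheaf.map _) a) at h
        rw [← Functor.map_comp] at h
        exact h
      · rw [← Scheme.Modules.map_smul, hm, hom_app_map, differential_map]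
  | zero => rw [map_zero]; exact Submodule.zero_mem _
  | add x y _ _ hx hy => rw [map_add]; exact Submodule.add_mem _ hx hy
  | smul r x _ hx => rw [Scheme.Modules.map_smul]; exact Submodule.smul_mem _ _ hx

/-- The module `Ω¹(log D)` of differentials of `X / S` with logarithmic poles along the complement
`D` of `U`. -/
def logDifferentials (f : X ⟶ S) (U : X.Opens) : X.Modules :=
  subsheafModule _ (logSections f U) (logSections_map f U)

/-- The section of `Ω¹(log D)` defined by a differential on `V ∖ D`. -/
def logSection (f : X ⟶ S) (U V : X.Opens) (m : Γ(openPush (differentials f) U, V))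
    (hm : m ∈ logSections f U V) : Γ(logDifferentials f U, V) :=
  subsheafSection _ (logSections f U) (logSections_map f U) V m hm

end Divisors

section Dilatations

/-- The largest open subscheme on which the ideal sheaves `I` and `J` coincide. -/
def agreementOpen {X : Scheme.{u}} (I J : X.IdealSheafData) : X.Opens :=
  sSup { V : X.Opens | I.comap V.ι = J.comap V.ι }

variable {P X : Scheme.{u}} (a : P ⟶ X) (Y : P.IdealSheafData) (R : X.IdealSheafData)

/-- The ideal sheaf `I_Y + I_R 𝒪_P` of the closed subscheme `Y ∩ a⁻¹(R)` of `P`. -/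
def dilatationIdeal : P.IdealSheafData := Y ⊔ R.comap a

/-- The dilatation of the `X`-scheme `P` along `Y` of thickening `R`: the largest open subscheme of
the blow-up of `P` along `Y ∩ a⁻¹(R)` on which the exceptional divisor is the pull-back of `R`. -/
def dilatation : Scheme.{u} :=
  (agreementOpen (R.comap (blowUpπ (dilatationIdeal a Y R) ≫ a))
    ((dilatationIdeal a Y R).comap (blowUpπ (dilatationIdeal a Y R)))).toScheme

/-- The canonical morphism of the dilatation to `P`. -/
def dilatationMap : dilatation a Y R ⟶ P :=
  (agreementOpen (R.comap (blowUpπ (dilatationIdeal a Y R) ≫ a))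
    ((dilatationIdeal a Y R).comap (blowUpπ (dilatationIdeal a Y R)))).ι ≫
      blowUpπ (dilatationIdeal a Y R)

end Dilatations

section BundleOverDivisor

variable {Q X : Scheme.{u}}

/-- `Corresponds b R E θ U m V g`: under the isomorphism `θ` from `Q ×_X R` to `V(E) ×_X R`, the
function on `V(E)` over `U` given by the section `m` of `E` goes to the function `g` on the open
subscheme `V` of `Q`. -/
def Corresponds (b : Q ⟶ X) (R : X.IdealSheafData) (E : X.Modules) [E.IsQuasicoherent]
    (θ : pullback b R.subschemeι ≅ pullback (vectorBundleπ E) R.subschemeι)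
    (U : X.affineOpens) (m : Γ(E, U.1)) (V : Q.Opens) (g : Γ(Q, V)) : Prop :=
  ∀ (O : (pullback b R.subschemeι).Opens)
    (h₁ : O ≤ pullback.fst b R.subschemeι ⁻¹ᵁ V)
    (h₂ : O ≤ (θ.hom ≫ pullback.fst (vectorBundleπ E) R.subschemeι) ⁻¹ᵁ
      (vectorBundleπ E ⁻¹ᵁ U.1)),
    (θ.hom ≫ pullback.fst (vectorBundleπ E) R.subschemeι).appLE _ O h₂
        (vectorBundleFun E U m) =
      (pullback.fst b R.subschemeι).appLE V O h₁ g

/-- The module `σ^* Ω¹_{P/X} ⊗ 𝒪_X(R)`. -/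
def twistedDifferentials {P : Scheme.{u}} (a : P ⟶ X) (σ : X ⟶ P) (R : X.IdealSheafData) :
    X.Modules :=
  tensorModule ((Scheme.Modules.pullback σ).obj (differentials a)) (divisorModule R)

/-- The canonical isomorphism from `P^{(R)} ×_X R` to `V(σ^* Ω¹_{P/X} ⊗ 𝒪_X(R)) ×_X R`: it is an
isomorphism over `R`, and it makes `σ^*(df) ⊗ t⁻¹` correspond to `f / t` for every local
equation `t` of `R` and every function `f` on `P` which vanishes on the image of `σ`. -/
structure IsCanonicalIso {P : Scheme.{u}} (a : P ⟶ X) (σ : X ⟶ P) (R : X.IdealSheafData)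
    [(twistedDifferentials a σ R).IsQuasicoherent]
    (θ : pullback (dilatationMap a σ.ker R ≫ a) R.subschemeι ≅
      pullback (vectorBundleπ (twistedDifferentials a σ R)) R.subschemeι) : Prop where
  comm : θ.hom ≫ pullback.snd _ _ = pullback.snd _ _
  formula : ∀ (U : X.affineOpens) (W : P.Opens) (hW : W ≤ a ⁻¹ᵁ U.1) (hU : U.1 ≤ σ ⁻¹ᵁ W)
    (t : Γ(X, U.1)) (_ : R.ideal U = Ideal.span {t})
    (s : Γ(openPush (structureModule X) (complement R), U.1)) (hs : s ∈ divisorSections R U.1)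
    (_ : t • s = (openPushUnit (structureModule X) (complement R)).app U.1
      (structureSection (1 : Γ(X, U.1))))
    (f : Γ(P, W)) (_ : σ.appLE W U.1 hU f = 0)
    (g : Γ(dilatation a σ.ker R, dilatationMap a σ.ker R ⁻¹ᵁ W))
    (_ : (dilatationMap a σ.ker R).app W (a.appLE U.1 W hW t) * g =
      (dilatationMap a σ.ker R).app W f),
    Corresponds (dilatationMap a σ.ker R ≫ a) R (twistedDifferentials a σ R) θ U
      (tensorSection _ _ U.1 (pullbackSection σ (differentials a) W U.1 hU (differential a W f))
        (divisorSection R U.1 s hs))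
      (dilatationMap a σ.ker R ⁻¹ᵁ W) g

end BundleOverDivisor

section NormalCrossings

/-- The closed subschemes `D i` are the (distinct) irreducible components of a divisor with strict
normal crossings: they are irreducible, and those which contain a given point are locally defined by
functions whose germs have linearly independent classes in the cotangent space. -/
structure IsStrictNormalCrossing {X : Scheme.{u}} {ι : Type} (D : ι → X.IdealSheafData) :
    Prop where
  irreducible : ∀ i, IsIrreducible ((D i).support : Set X)
  parameters : ∀ x : X, ∃ (U : X.affineOpens) (hx : x ∈ U.1) (t : ι → Γ(X, U.1))
    (c : { i // x ∈ (D i).support } → IsLocalRing.maximalIdeal (X.presheaf.stalk x)),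
    (∀ i, (D i).ideal U = Ideal.span {t i}) ∧
    (∀ i, (c i : X.presheaf.stalk x) = X.presheaf.germ U.1 x hx (t i.1)) ∧
    LinearIndependent (IsLocalRing.ResidueField (X.presheaf.stalk x))
      (fun i => (IsLocalRing.maximalIdeal (X.presheaf.stalk x)).toCotangent (c i))

variable {X S : Scheme.{u}} (b : X ⟶ S) {ι : Type} [Fintype ι] (D : ι → X.IdealSheafData)

/-- The product of the ideal sheaves of the closed subschemes `D i × D i` of `X × X`. -/
def framedCenter : (pullback b b).IdealSheafData :=
  ∏ i, ((D i).comap (pullback.fst b b) ⊔ (D i).comap (pullback.snd b b))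

/-- The strict transform of the closed subset `Z` in the blow-up along `C`. -/
def strictTransform {Y : Scheme.{u}} (C : Y.IdealSheafData) (Z : Set Y) : Set (blowUp C) :=
  closure (blowUpπ C ⁻¹' (Z \ (C.support : Set Y)))

/-- The complement of the strict transforms of `D × X` and of `X × D`, where `D` is the sum
of the `D i`. -/
def framedOpen : (blowUp (framedCenter b D)).Opens where
  carrier :=
    (strictTransform (framedCenter b D) (((∏ i, D i).comap (pullback.fst b b)).support) ∪
      strictTransform (framedCenter b D) (((∏ i, D i).comap (pullback.snd b b)).support))ᶜ
  is_open' := (isClosed_closure.union isClosed_closure).isOpen_compl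

/-- The framed self-product of `(X, D)`. -/
def framedProduct : Scheme.{u} := (framedOpen b D).toScheme

/-- The canonical morphism from the framed self-product to `X × X`. -/
def framedProductMap : framedProduct b D ⟶ pullback b b :=
  (framedOpen b D).ι ≫ blowUpπ (framedCenter b D)

def framedFst : framedProduct b D ⟶ X := framedProductMap b D ≫ pullback.fst b b

def framedSnd : framedProduct b D ⟶ X := framedProductMap b D ≫ pullback.snd b b

/-- The effective divisor `∑ rᵢ Dᵢ`. -/
def divisorSum (r : ι → ℕ) : X.IdealSheafData := ∏ i, D i ^ r i

/-- The open complement of the union of the `D i`. -/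
def divisorCompl : X.Opens := complement (∏ i, D i)

/-- The module `Ω¹_{X/S}(log D) ⊗ 𝒪_X(R)`. -/
def twistedLogDifferentials (R : X.IdealSheafData) : X.Modules :=
  tensorModule (logDifferentials b (divisorCompl D)) (divisorModule R)

/-- The dilatation of the framed self-product, viewed over `X` by the second projection, along the
framed diagonal `δ`. -/
def framedDilatation (δ : X ⟶ framedProduct b D) (R : X.IdealSheafData) : Scheme.{u} :=
  dilatation (framedSnd b D) δ.ker R

def framedDilatationMap (δ : X ⟶ framedProduct b D) (R : X.IdealSheafData) :
    framedDilatation b D δ R ⟶ framedProduct b D :=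
  dilatationMap (framedSnd b D) δ.ker R

/-- The canonical isomorphism from the base change to `R` of the dilatation of the framed
self-product, viewed over `X` by the projection `pr`, to that of `V(Ω¹(log D) ⊗ 𝒪_X(R))`: it is an
isomorphism over `R`, and it makes `(df / f) ⊗ t⁻¹` correspond to `(v - 1) / t`, where `v` is the
quotient of the two pull-backs of `f`, for every local equation `t` of `R` and every local function
`f` which is invertible outside `D`. -/
structure IsCanonicalLogIso (δ : X ⟶ framedProduct b D) (R : X.IdealSheafData)
    (pr : framedProduct b D ⟶ X) [(twistedLogDifferentials b D R).IsQuasicoherent]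
    (θ : pullback (framedDilatationMap b D δ R ≫ pr) R.subschemeι ≅
      pullback (vectorBundleπ (twistedLogDifferentials b D R)) R.subschemeι) : Prop where
  comm : θ.hom ≫ pullback.snd _ _ = pullback.snd _ _
  formula : ∀ (U : X.affineOpens) (W : (framedProduct b D).Opens)
    (hfst : W ≤ framedFst b D ⁻¹ᵁ U.1) (hsnd : W ≤ framedSnd b D ⁻¹ᵁ U.1)
    (hpr : W ≤ pr ⁻¹ᵁ U.1) (_ : U.1 ≤ δ ⁻¹ᵁ W)
    (t : Γ(X, U.1)) (_ : R.ideal U = Ideal.span {t})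
    (s : Γ(openPush (structureModule X) (complement R), U.1)) (hs : s ∈ divisorSections R U.1)
    (_ : t • s = (openPushUnit (structureModule X) (complement R)).app U.1
      (structureSection (1 : Γ(X, U.1))))
    (f : Γ(X, U.1))
    (_ : IsUnit (X.presheaf.map (homOfLE (inf_le_left : U.1 ⊓ divisorCompl D ≤ U.1)).op f))
    (m : Γ(openPush (differentials b) (divisorCompl D), U.1))
    (hm : m ∈ logSections b (divisorCompl D) U.1)
    (_ : f • m = (openPushUnit (differentials b) (divisorCompl D)).app U.1 (differential b U.1 f))
    (v : Γ(framedProduct b D, W))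
    (_ : (framedFst b D).appLE U.1 W hfst f = v * (framedSnd b D).appLE U.1 W hsnd f)
    (g : Γ(framedDilatation b D δ R, framedDilatationMap b D δ R ⁻¹ᵁ W))
    (_ : (framedDilatationMap b D δ R).app W (pr.appLE U.1 W hpr t) * g =
      (framedDilatationMap b D δ R).app W (v - 1)),
    Corresponds (framedDilatationMap b D δ R ≫ pr) R (twistedLogDifferentials b D R) θ U
      (tensorSection _ _ U.1 (logSection b (divisorCompl D) U.1 m hm) (divisorSection R U.1 s hs))
      (framedDilatationMap b D δ R ⁻¹ᵁ W) g

end NormalCrossings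

end

/-!
Both parts are local computations of a dilatation in étale coordinates, followed by a gluing of
canonical isomorphisms.

*Charts of blow-ups.* The chart of the blow-up along `I` on which `e ∈ I` generates the exceptional
divisor is characterized by ring theory (`IsAwayChart`): `e` is a nonzerodivisor, it divides `I`, all
functions are fractions `r / e ^ n` with `r ∈ I ^ n`, and the kernel is `e`-torsion. This is stable
under flat base change. The dilatation of thickening `R = (t)` is the chart defined by `t`
(`isAwayChart_dilatation`).

*The first part.* A smooth morphism has, near a section `σ`, étale coordinates `yᵢ` which vanish along
`σ` (`exists_isSectionCoords`), and after shrinking they generate the ideal of `σ`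
(`IsSectionCoords.exists_generatesKer`). So `P` is étale over an affine space in which `σ` is the zero
section. The dilatation of the zero section of affine space is affine space with coordinates `xᵢ / t`;
by flat base change the `yᵢ / t` are étale coordinates on `P^(R)`, and modulo `t` its ring of functions
is the polynomial ring in the `yᵢ / t` (`dilatation_ring`). Away from the section the dilatation is
the open subscheme where `t` is invertible. This proves smoothness (`smooth_dilatation`), and the fibre
over `R` is locally the vector bundle on the basis `dyᵢ ⊗ t⁻¹`. For any `f` vanishing along `σ` one has
`f = ∑ cᵢ yᵢ`, hence `f / t = ∑ cᵢ (yᵢ / t)` and `σ^*(df) = ∑ σ^*(cᵢ) σ^*(dyᵢ)`: the local isomorphisms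
respect all required correspondences, so they agree on overlaps and are unique
(`existsUnique_bundleIso`). The argument is carried out in `existsUnique_dilatationIso` for any module
`N` and any relation between functions vanishing along `σ` and sections of `N` which is compatible
with such expansions.

*The second part.* Over a perfect field, equations `tᵢ` of the components of `D` through a point are
part of étale coordinates `(t, z)` with `z` invertible (`exists_isLogCoords`, by the Jacobian
criterion). On the product the blown-up ideal is `∏ (tᵢ ⊗ 1, 1 ⊗ tᵢ)`, and on a chart of the blow-up
étale coordinates arise by replacing one function of each pair by its quotient by the other one
(`IsCrossing.exists_coords`). The complement of the strict transforms is where all the quotients `vᵢ`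
of `tᵢ ⊗ 1` by `1 ⊗ tᵢ` are invertible (`IsLogCoords.framedOpen_inf`), and there `vᵢ - 1`, `vⱼ - 1`,
with `vⱼ` the quotients of the two pull-backs of the `zⱼ`, are étale coordinates for both projections
(`IsLogCoords.exists_quotients`). The diagonal lifts by the universal property of the blow-up, as the
`tᵢ` are nonzerodivisors, and the coordinates vanish along the lift. The two inverse images of `R`
agree, so a dilatation formed with one projection is also one for the other (`comap_framed_eq`).

It remains to apply `existsUnique_dilatationIso` to the relation between `v - 1` and `df / f`
(`LogRelation`). The `dtᵢ / tᵢ`, `dzⱼ / zⱼ` are a basis of the logarithmic differentials: étale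
coordinates are primes of the local rings, so a function invertible off `D` is locally a unit times a
product of `tᵢ` (`IsLogCoords.exists_factorization`). If `v - 1 = ∑ cᵢ yᵢ`, with `yᵢ` the coordinates,
the corresponding relation between logarithmic differentials may be checked off `D`. There it follows
because `g ↦ δ^*(d(pr₁^* g) - d(pr₂^* g))` is a derivation with value `g δ^*(dv)` at `g` if
`pr₁^* g = v pr₂^* g` (`diagonalDerivation`, `mres_eq_sum_of_logRelation`).
-/

open MvPolynomial (eval₂Hom eval₂Hom_C eval₂Hom_X')

universe v₁ u₁

noncomputable section

/-! ### Sheafification, gluing of sections, and bases of modules -/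

section

variable {X S : Scheme.{u}}

theorem sheafifySection_map (M : X.PresheafOfModules) {U V : X.Opens} (i : V ⟶ U)
    (m : M.obj (.op U)) : (sheafifyModule M).presheaf.map i.op (sheafifySection M U m) =
      sheafifySection M V (M.map i.op m) :=
  (PresheafOfModules.naturality_apply (sheafifyModuleUnit M) i.op m).symm

theorem sheafifySection_add (M : X.PresheafOfModules) (U : X.Opens)
    (m n : M.obj (.op U)) : sheafifySection M U (m + n) =
      sheafifySection M U m + sheafifySection M U n :=
  map_add ((sheafifyModuleUnit M).app (.op U)).hom m n

theorem sheafifySection_smul (M : X.PresheafOfModules) (U : X.Opens) (a : Γ(X, U))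
    (m : M.obj (.op U)) : sheafifySection M U ((show X.ringCatSheaf.obj.obj (.op U) from a) • m) =
      a • sheafifySection M U m :=
  map_smul ((sheafifyModuleUnit M).app (.op U)).hom _ m

theorem toPresheaf_map_sheafifyModuleUnit (M : X.PresheafOfModules) :
    (PresheafOfModules.toPresheaf _).map (sheafifyModuleUnit M) =
      CategoryTheory.toSheafify (Opens.grothendieckTopology X) M.presheaf := by
  have h := PresheafOfModules.toPresheaf_map_sheafificationHomEquiv_def (𝟙 X.ringCatSheaf.obj)
    (𝟙 ((PresheafOfModules.sheafification (𝟙 X.ringCatSheaf.obj)).obj M))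
  refine Eq.trans ?_ (h.trans ?_)
  · rfl
  · exact (congrArg _ (CategoryTheory.Functor.map_id _ _)).trans (Category.comp_id _)

theorem sheafifySection_eq (M : X.PresheafOfModules) (U : X.Opens) (m : M.obj (.op U)) :
    sheafifySection M U m =
      (CategoryTheory.toSheafify (Opens.grothendieckTopology X) M.presheaf).app (.op U) m := by
  rw [← toPresheaf_map_sheafifyModuleUnit]; rfl

theorem exists_sheafifySection_eq (M : X.PresheafOfModules) {U : X.Opens}
    (s : Γ(sheafifyModule M, U)) (x : X) (hx : x ∈ U) :
    ∃ (V : X.Opens) (i : V ⟶ U) (_ : x ∈ V) (m : M.obj (.op V)),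
      sheafifySection M V m = (sheafifyModule M).presheaf.map i.op s := by
  have h := Presheaf.imageSieve_mem (Opens.grothendieckTopology X)
    (CategoryTheory.toSheafify (Opens.grothendieckTopology X) M.presheaf) s
  obtain ⟨V, i, ⟨m, hm⟩, hxV⟩ := h x hx
  refine ⟨V, i, hxV, m, ?_⟩
  exact (sheafifySection_eq M V m).trans hm

theorem exists_map_eq_zero_of_sheafifySection (M : X.PresheafOfModules) {U : X.Opens}
    (m : M.obj (.op U)) (h : sheafifySection M U m = 0) (x : X) (hx : x ∈ U) :
    ∃ (V : X.Opens) (i : V ⟶ U) (_ : x ∈ V), M.map i.op m = 0 := by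
  have h := Presheaf.equalizerSieve_mem (Opens.grothendieckTopology X)
    (CategoryTheory.toSheafify (Opens.grothendieckTopology X) M.presheaf) m 0 (by
      refine (sheafifySection_eq M U m).symm.trans (h.trans ?_)
      exact (map_zero ((CategoryTheory.toSheafify (Opens.grothendieckTopology X)
        M.presheaf).app (.op U)).hom).symm)
  obtain ⟨V, i, hi, hxV⟩ := h x hx
  exact ⟨V, i, hxV, hi.trans (map_zero (M.presheaf.map i.op).hom)⟩

/-- A morphism of modules from compatible linear maps on sections. -/
def modulesHomMk {M N : X.Modules} (f : ∀ U : X.Opens, Γ(M, U) →ₗ[Γ(X, U)] Γ(N, U))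
    (h : ∀ (U V : X.Opens) (i : V ⟶ U) (m : Γ(M, U)),
      f V (M.presheaf.map i.op m) = N.presheaf.map i.op (f U m)) : M ⟶ N :=
  ⟨{ app := fun U => ModuleCat.ofHom (X := M.val.obj U) (Y := N.val.obj U) (f U.unop)
     naturality := fun {U V} i => by
      ext m
      exact h U.unop V.unop i.unop m }⟩

section Restriction

variable (E : X.Modules)

/-- Restriction of functions to a smaller open subset. -/
abbrev fres {U V : X.Opens} (h : V ≤ U) : Γ(X, U) →+* Γ(X, V) := (X.presheaf.map (homOfLE h).op).hom

/-- Restriction of sections of a module to a smaller open subset. -/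
abbrev mres {U V : X.Opens} (h : V ≤ U) : Γ(E, U) →+ Γ(E, V) :=
  (E.presheaf.map (homOfLE h).op).hom

theorem fres_fres {U V W : X.Opens} (h : V ≤ U) (h' : W ≤ V) (a : Γ(X, U)) :
    fres h' (fres h a) = fres (h'.trans h) a :=
  (congrArg (fun φ => φ.hom a) (X.presheaf.map_comp (homOfLE h).op (homOfLE h').op)).symm

theorem fres_self {U : X.Opens} (h : U ≤ U) (a : Γ(X, U)) : fres h a = a :=
  congrArg (fun φ => φ.hom a) (X.presheaf.map_id (.op U))

theorem mres_mres {U V W : X.Opens} (h : V ≤ U) (h' : W ≤ V) (m : Γ(E, U)) :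
    mres E h' (mres E h m) = mres E (h'.trans h) m :=
  presheaf_map_map E _ _ _ m

theorem mres_self {U : X.Opens} (h : U ≤ U) (m : Γ(E, U)) : mres E h m = m :=
  presheaf_map_self E _ m

theorem mres_smul {U V : X.Opens} (h : V ≤ U) (a : Γ(X, U)) (m : Γ(E, U)) :
    mres E h (a • m) = fres h a • mres E h m :=
  E.map_smul _ a m

theorem functions_ext {V : X.Opens} {f g : Γ(X, V)}
    (H : ∀ x ∈ V, ∃ (W : X.Opens) (h : W ≤ V), x ∈ W ∧ fres h f = fres h g) : f = g := by
  choose! W hW hx hW' using H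
  refine X.sheaf.eq_of_locally_eq' (fun x : V => W x.1) V (fun x => homOfLE (hW x.1 x.2)) ?_ _ _ ?_
  · exact fun x hxV => TopologicalSpace.Opens.mem_iSup.mpr ⟨⟨x, hxV⟩, hx x hxV⟩
  · exact fun x => hW' x.1 x.2

theorem sections_ext {V : X.Opens} {f g : Γ(E, V)}
    (H : ∀ x ∈ V, ∃ (W : X.Opens) (h : W ≤ V), x ∈ W ∧ mres E h f = mres E h g) : f = g := by
  choose! W hW hx hW' using H
  refine TopCat.Sheaf.eq_of_locally_eq' ⟨E.presheaf, E.isSheaf⟩ (fun x : V => W x.1) V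
    (fun x => homOfLE (hW x.1 x.2)) ?_ _ _ ?_
  · exact fun x hxV => TopologicalSpace.Opens.mem_iSup.mpr ⟨⟨x, hxV⟩, hx x hxV⟩
  · exact fun x => hW' x.1 x.2

/-- Families of functions which are characterised by a local property exist globally as soon as
they exist locally. -/
theorem exists_functions_of_local {ι : Type*} {V : X.Opens}
    (P : ∀ W : X.Opens, W ≤ V → (ι → Γ(X, W)) → Prop)
    (hres : ∀ (W W' : X.Opens) (h : W ≤ V) (h' : W' ≤ W) c, P W h c →
      P W' (h'.trans h) fun i => fres h' (c i))
    (huniq : ∀ (W : X.Opens) (h : W ≤ V) c c', P W h c → P W h c' → c = c')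
    (hex : ∀ x ∈ V, ∃ (W : X.Opens) (h : W ≤ V), x ∈ W ∧ ∃ c, P W h c) :
    ∃ c : ι → Γ(X, V), ∀ x ∈ V, ∃ (W : X.Opens) (h : W ≤ V), x ∈ W ∧
      P W h fun i => fres h (c i) := by
  choose! W hW hx c hc using hex
  have hcompat : ∀ i, TopCat.Presheaf.IsCompatible X.presheaf (fun x : V => W x.1)
      fun x => c x.1 i := by
    intro i x y
    have h1 := hres _ (W x ⊓ W y) (hW x x.2) inf_le_left _ (hc x x.2)
    have h2 := hres _ (W x ⊓ W y) (hW y y.2) inf_le_right _ (hc y y.2)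
    exact congrFun (huniq _ _ _ _ h1 h2) i
  have hglue : ∀ i, ∃ s : Γ(X, V), ∀ x : V, fres (hW x.1 x.2) s = c x.1 i := by
    intro i
    obtain ⟨s, hs, -⟩ := X.sheaf.existsUnique_gluing' (fun x : V => W x.1) V
      (fun x => homOfLE (hW x.1 x.2))
      (fun x hxV => TopologicalSpace.Opens.mem_iSup.mpr ⟨⟨x, hxV⟩, hx x hxV⟩) _ (hcompat i)
    exact ⟨s, hs⟩
  choose s hs using hglue
  refine ⟨s, fun x hxV => ⟨W x, hW x hxV, hx x hxV, ?_⟩⟩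
  convert hc x hxV using 2
  exact hs _ ⟨x, hxV⟩

end Restriction

section LocalBases

variable {E : X.Modules} {U : X.Opens} {ι : Type*} [Fintype ι]

/-- The sections `e i` of `E` over `U` form a basis of the restriction of `E` to `U`. -/
def IsBasisOn (E : X.Modules) (U : X.Opens) (e : ι → Γ(E, U)) : Prop :=
  ∀ (V : X.Opens) (h : V ≤ U), Function.Bijective
    fun c : ι → Γ(X, V) => ∑ i, c i • mres E h (e i)

theorem isBasisOn_of_local {e : ι → Γ(E, U)}
    (hspan : ∀ (V : X.Opens) (_ : V ≤ U) (m : Γ(E, V)) (x : X), x ∈ V →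
      ∃ (W : X.Opens) (hW : W ≤ V) (hWU : W ≤ U), x ∈ W ∧ ∃ c : ι → Γ(X, W),
        mres E hW m = ∑ i, c i • mres E hWU (e i))
    (hind : ∀ (V : X.Opens) (h : V ≤ U) (c : ι → Γ(X, V)),
      ∑ i, c i • mres E h (e i) = 0 → c = 0) : IsBasisOn E U e := by
  have hinj : ∀ (V : X.Opens) (h : V ≤ U) (c c' : ι → Γ(X, V)),
      ∑ i, c i • mres E h (e i) = ∑ i, c' i • mres E h (e i) → c = c' := by
    intro V h c c' hcc
    rw [← sub_eq_zero]
    refine hind V h _ ?_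
    simp only [Pi.sub_apply, sub_smul, Finset.sum_sub_distrib, hcc, sub_self]
  refine fun V h => ⟨fun c c' => hinj V h c c', fun m => ?_⟩
  obtain ⟨c, hc⟩ := exists_functions_of_local (V := V)
    (fun W hW c => mres E hW m = ∑ i, c i • mres E (hW.trans h) (e i))
    (fun W W' hW hW' c hc => by
      rw [← mres_mres E hW hW', hc, map_sum]
      simp only [mres_smul, mres_mres])
    (fun W hW c c' hc hc' => hinj W _ _ _ (hc.symm.trans hc'))
    (fun x hx => by
      obtain ⟨W, hW, hWU, hxW, c, hc⟩ := hspan V h m x hx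
      exact ⟨W, hW, hxW, c, hc⟩)
  refine ⟨c, sections_ext E fun x hx => ?_⟩
  obtain ⟨W, hW, hxW, hm⟩ := hc x hx
  refine ⟨W, hW, hxW, Eq.trans ?_ hm.symm⟩
  rw [map_sum]
  simp only [mres_smul, mres_mres]

/-- A presheaf of modules with sections which form a basis locally has an associated sheaf with a
basis. -/
theorem isBasisOn_sheafifyModule {M : X.PresheafOfModules} {e : ι → M.obj (.op U)}
    (hspan : ∀ (V : X.Opens) (_ : V ≤ U) (m : M.obj (.op V)) (x : X), x ∈ V →
      ∃ (W : X.Opens) (hW : W ≤ V) (hWU : W ≤ U), x ∈ W ∧ ∃ c : ι → Γ(X, W),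
        M.map (homOfLE hW).op m =
          ∑ i, (show X.ringCatSheaf.obj.obj (.op W) from c i) • M.map (homOfLE hWU).op (e i))
    (hind : ∀ (V : X.Opens) (h : V ≤ U) (c : ι → Γ(X, V)),
      ∑ i, (show X.ringCatSheaf.obj.obj (.op V) from c i) • M.map (homOfLE h).op (e i) = 0 →
        ∀ x ∈ V, ∃ (W : X.Opens) (h : W ≤ V), x ∈ W ∧ ∀ i, fres h (c i) = 0) :
    IsBasisOn (sheafifyModule M) U fun i => sheafifySection M U (e i) := by
  have hsum : ∀ (V : X.Opens) (h : V ≤ U) (c : ι → Γ(X, V)),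
      sheafifySection M V (∑ i, (show X.ringCatSheaf.obj.obj (.op V) from c i) •
        M.map (homOfLE h).op (e i)) =
      ∑ i, c i • mres (sheafifyModule M) h (sheafifySection M U (e i)) := by
    intro V h c
    refine (map_sum ((sheafifyModuleUnit M).app (.op V)).hom _ _).trans ?_
    refine Finset.sum_congr rfl fun i _ => ?_
    refine (sheafifySection_smul M V (c i) _).trans ?_
    exact congrArg _ (sheafifySection_map M _ _).symm
  refine isBasisOn_of_local ?_ ?_
  · intro V hV m x hx
    obtain ⟨V', i, hxV', m', hm'⟩ := exists_sheafifySection_eq M m x hx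
    obtain ⟨W, hW, hWU, hxW, c, hc⟩ := hspan V' (i.le.trans hV) m' x hxV'
    refine ⟨W, hW.trans i.le, hWU, hxW, c, ?_⟩
    refine (mres_mres (sheafifyModule M) i.le hW m).symm.trans ?_
    refine Eq.trans ?_ (hsum W hWU c)
    refine Eq.trans ?_ (congrArg (sheafifySection M W) hc)
    refine Eq.trans ?_ (sheafifySection_map M (homOfLE hW) m')
    exact congrArg _ hm'.symm
  · intro V hV c hc
    replace hc := (hsum V hV c).trans hc
    funext i
    refine functions_ext fun x hx => ?_
    obtain ⟨V', j, hxV', h0⟩ := exists_map_eq_zero_of_sheafifySection M _ hc x hx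
    have h1 : ∑ i, (show X.ringCatSheaf.obj.obj (.op V') from fres j.le (c i)) •
        M.map (homOfLE (j.le.trans hV)).op (e i) = 0 := by
      refine Eq.trans ?_ h0
      refine Eq.trans ?_ (map_sum (M.map j.op).hom _ _).symm
      refine Finset.sum_congr rfl fun i _ => ?_
      refine Eq.trans ?_ (M.map_smul j.op _ _).symm
      congr 1
      exact (congrArg (fun φ => φ.hom (e i)) (M.map_comp (homOfLE hV).op j.op))
    obtain ⟨W, hW, hxW, h⟩ := hind V' _ _ h1 x hxV'
    refine ⟨W, hW.trans j.le, hxW, ?_⟩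
    rw [Pi.zero_apply, map_zero, ← h i, fres_fres]

namespace IsBasisOn

variable {e : ι → Γ(E, U)} (he : IsBasisOn E U e)
include he

theorem restrict {V : X.Opens} (h : V ≤ U) : IsBasisOn E V fun i => mres E h (e i) := by
  intro W hW
  simp only [mres_mres]
  exact he W _

theorem eq_zero {V : X.Opens} (h : V ≤ U) {c : ι → Γ(X, V)}
    (hc : ∑ i, c i • mres E h (e i) = 0) : c = 0 :=
  (he V h).1 (hc.trans (by simp))

theorem exists_eq {V : X.Opens} (h : V ≤ U) (m : Γ(E, V)) :
    ∃ c : ι → Γ(X, V), ∑ i, c i • mres E h (e i) = m := (he V h).2 m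

/-- The isomorphism of a free module with the sections of `E` given by a basis. -/
def equiv {V : X.Opens} (h : V ≤ U) : (ι → Γ(X, V)) ≃ₗ[Γ(X, V)] Γ(E, V) :=
  LinearEquiv.ofBijective
    ({ toFun := fun c => ∑ i, c i • mres E h (e i)
       map_add' := fun c c' => by simp only [Pi.add_apply, add_smul, Finset.sum_add_distrib]
       map_smul' := fun a c => by
        simp only [Pi.smul_apply, smul_eq_mul, mul_smul, Finset.smul_sum, RingHom.id_apply] } :
      (ι → Γ(X, V)) →ₗ[Γ(X, V)] Γ(E, V)) (he V h)

/-- The coordinates of a section with respect to a basis. -/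
def coord {V : X.Opens} (h : V ≤ U) : Γ(E, V) →ₗ[Γ(X, V)] (ι → Γ(X, V)) :=
  (he.equiv h).symm.toLinearMap

theorem sum_coord {V : X.Opens} (h : V ≤ U) (m : Γ(E, V)) :
    ∑ i, he.coord h m i • mres E h (e i) = m :=
  (he.equiv h).apply_symm_apply m

theorem coord_eq {V : X.Opens} (h : V ≤ U) {m : Γ(E, V)} {c : ι → Γ(X, V)}
    (hc : ∑ i, c i • mres E h (e i) = m) : he.coord h m = c :=
  (he V h).1 ((he.sum_coord h m).trans hc.symm)

theorem coord_mres {V W : X.Opens} (h : V ≤ U) (h' : W ≤ V) (m : Γ(E, V)) :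
    he.coord (h'.trans h) (mres E h' m) = fun i => fres h' (he.coord h m i) := by
  refine he.coord_eq _ ?_
  conv_rhs => rw [← he.sum_coord h m, map_sum]
  simp only [mres_smul, mres_mres]

theorem coord_basis [DecidableEq ι] {V : X.Opens} (h : V ≤ U) (i : ι) :
    he.coord h (mres E h (e i)) = Pi.single i 1 := by
  refine he.coord_eq _ ?_
  rw [Finset.sum_eq_single i]
  · simp
  · intro j _ hj; simp [hj]
  · simp

end IsBasisOn

end LocalBases

end

/-! ### Modules with local bases are locally free -/

section

variable {X S : Scheme.{u}}

section
variable {C : Type u₁} [Category.{v₁} C] {J : GrothendieckTopology C} {R : Sheaf J RingCat.{u}}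
  [HasWeakSheafify J AddCommGrpCat.{u}] [J.WEqualsLocallyBijective AddCommGrpCat.{u}]

set_option linter.unusedSectionVars false
theorem ιFree_freeHomEquiv_symm {M : SheafOfModules.{u} R} {I : Type u} (s : I → M.sections)
    (i : I) : SheafOfModules.ιFree i ≫ M.freeHomEquiv.symm s = M.unitHomEquiv.symm (s i) := by
  rw [← SheafOfModules.unitHomEquiv_symm_freeHomEquiv_apply, Equiv.apply_symm_apply]

theorem sum_val_app {M N : SheafOfModules.{u} R} {I : Type*} (t : Finset I) (f : I → (M ⟶ N))
    (U : Cᵒᵖ) (m : M.val.obj U) :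
    (∑ i ∈ t, f i).val.app U m = ∑ i ∈ t, (f i).val.app U m := by
  classical
  induction t using Finset.induction_on with
  | empty => simp; rfl
  | insert i t hi ih =>
    rw [Finset.sum_insert hi, Finset.sum_insert hi, ← ih]; rfl

/-- A family of sections with coordinate functions identifies a sheaf of modules with a free one. -/
theorem isIso_freeHomEquiv_symm {M : SheafOfModules.{u} R} {I : Type u} [Fintype I]
    [DecidableEq I] (s : I → M.sections) (c : I → (M ⟶ SheafOfModules.unit R))
    (h₁ : ∀ (U : Cᵒᵖ) (m : M.val.obj U),
      ∑ i, (show R.obj.obj U from (c i).val.app U m) • (s i).eval U = m)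
    (h₂ : ∀ (U : Cᵒᵖ) (i j), (show R.obj.obj U from (c i).val.app U ((s j).eval U)) =
      if i = j then 1 else 0) :
    IsIso (M.freeHomEquiv.symm s) := by
  refine ⟨∑ i, c i ≫ SheafOfModules.ιFree i, ?_, ?_⟩
  · suffices H : ∀ j, SheafOfModules.ιFree j ≫ M.freeHomEquiv.symm s ≫
        (∑ i, c i ≫ SheafOfModules.ιFree i) = SheafOfModules.ιFree j ≫ 𝟙 _ from
      Cofan.IsColimit.hom_ext (SheafOfModules.isColimitFreeCofan I) _ _ H
    intro j
    rw [← Category.assoc, ιFree_freeHomEquiv_symm, Category.comp_id, Preadditive.comp_sum,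
      Finset.sum_eq_single j]
    · rw [← Category.assoc, SheafOfModules.unitHomEquiv_symm_comp]
      convert Category.id_comp _
      apply (SheafOfModules.unitHomEquiv _).injective
      rw [Equiv.apply_symm_apply]
      refine PresheafOfModules.sections_ext _ _ fun U => ?_
      exact (h₂ U j j).trans (if_pos rfl)
    · intro i _ hij
      rw [← Category.assoc, SheafOfModules.unitHomEquiv_symm_comp]
      convert Limits.zero_comp
      apply (SheafOfModules.unitHomEquiv _).injective
      rw [Equiv.apply_symm_apply]
      refine PresheafOfModules.sections_ext _ _ fun U => ?_
      exact (h₂ U i j).trans (if_neg hij)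
    · simp
  · rw [Preadditive.sum_comp]
    simp only [Category.assoc, ιFree_freeHomEquiv_symm]
    apply SheafOfModules.hom_ext
    ext U m
    refine (sum_val_app _ _ U m).trans ?_
    exact h₁ U m
end

section
variable {E : X.Modules} {U : X.Opens} {ι : Type u} [Fintype ι] [DecidableEq ι]
  {e : ι → Γ(E, U)}

/-- The sections of the restriction of `E` to the site of `U` defined by a section over `U`. -/
def overSections (e : Γ(E, U)) : (SheafOfModules.over E U).sections :=
  PresheafOfModules.sectionsMk (M := (SheafOfModules.over E U).val)
    (fun V => E.presheaf.map V.unop.hom.op e)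
    (fun V W f => presheaf_map_map E f.unop.left V.unop.hom W.unop.hom e)

/-- A coordinate with respect to a basis, as a morphism on the site of `U`. -/
def IsBasisOn.coordHom (he : IsBasisOn E U e) (i : ι) :
    SheafOfModules.over E U ⟶ SheafOfModules.unit (X.ringCatSheaf.over U) :=
  ⟨{ app := fun V => ModuleCat.ofHom (X := (SheafOfModules.over E U).val.obj V)
        (Y := (SheafOfModules.unit (X.ringCatSheaf.over U)).val.obj V)
        { toFun := fun m => he.coord (V := V.unop.left) V.unop.hom.le m i
          map_add' := fun m n => congrFun (map_add _ m n) i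
          map_smul' := fun a m => by
            have h := map_smul (he.coord (V := V.unop.left) V.unop.hom.le)
              (show Γ(X, V.unop.left) from a) (show Γ(E, V.unop.left) from m)
            exact congrFun h i }
     naturality := fun {V W} f => by
      ext m
      exact congrFun (he.coord_mres V.unop.hom.le f.unop.left.le m) i }⟩

theorem IsBasisOn.isIso_freeHomEquiv_symm (he : IsBasisOn E U e) :
    IsIso ((SheafOfModules.over E U).freeHomEquiv.symm fun i => overSections (e i)) := by
  refine _root_.isIso_freeHomEquiv_symm _ he.coordHom ?_ ?_
  · intro V m
    exact he.sum_coord (V := V.unop.left) V.unop.hom.le m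
  · intro V i j
    refine (congrFun (he.coord_basis (V := V.unop.left) V.unop.hom.le j) i).trans ?_
    exact Pi.single_apply j _ i

/-- A basis, as a generating family on the site of `U`. -/
def IsBasisOn.generatingSections (he : IsBasisOn E U e) :
    (SheafOfModules.over E U).GeneratingSections where
  I := ι
  s i := overSections (e i)
  epi := have := he.isIso_freeHomEquiv_symm; inferInstance

theorem IsBasisOn.reindex {κ κ' : Type*} [Fintype κ] [Fintype κ'] (σ : κ' ≃ κ) {e : κ → Γ(E, U)}
    (he : IsBasisOn E U e) : IsBasisOn E U (e ∘ σ) := by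
  intro V h
  have := (he V h).comp (σ.arrowCongr (Equiv.refl Γ(X, V))).bijective
  convert this using 2 with c
  refine Fintype.sum_equiv σ _ _ fun i => ?_
  simp

end

/-- Bases of `E` exist locally. -/
def HasLocalBases (E : X.Modules) : Prop :=
  ∀ x : X, ∃ (U : X.Opens) (n : ℕ) (e : Fin n → Γ(E, U)), x ∈ U ∧ IsBasisOn E U e

namespace HasLocalBases
variable {E : X.Modules} (hE : HasLocalBases E)
include hE

theorem exists_localGeneratorsData :
    ∃ q : SheafOfModules.LocalGeneratorsData.{u} E, q.IsLocallyFreeData ∧ q.IsFiniteType := by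
  choose U n e hx he using hE
  let q : SheafOfModules.LocalGeneratorsData.{u} E :=
    { I := X
      X := U
      coversTop := by
        intro V x hxV
        exact ⟨V ⊓ U x, homOfLE inf_le_left, ⟨x, ⟨homOfLE inf_le_right⟩⟩, hxV, hx x⟩
      generators := fun x => ((he x).reindex Equiv.ulift.{u}).generatingSections }
  refine ⟨q, SheafOfModules.LocalGeneratorsData.IsLocallyFreeData.mk.{u,u,u} fun x => ?_,
    SheafOfModules.LocalGeneratorsData.IsFiniteType.mk.{u,u,u,u} fun x => ?_⟩
  · exact ((he x).reindex Equiv.ulift.{u}).isIso_freeHomEquiv_symm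
  · exact SheafOfModules.GeneratingSections.IsFiniteType.mk
      (inferInstanceAs (Finite (ULift (Fin (n x)))))

theorem isLocallyFree : E.IsLocallyFree := by
  obtain ⟨q, h, -⟩ := hE.exists_localGeneratorsData
  exact SheafOfModules.IsLocallyFree.mk.{u,u,u} ⟨q, h⟩

theorem isFiniteType : E.IsFiniteType := by
  obtain ⟨q, -, h⟩ := hE.exists_localGeneratorsData
  exact SheafOfModules.IsFiniteType.mk.{u,u,u} ⟨q, h⟩

theorem isQuasicoherent : E.IsQuasicoherent := by
  obtain ⟨q, h, -⟩ := hE.exists_localGeneratorsData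
  have := h
  exact SheafOfModules.QuasicoherentData.isQuasicoherent.{u,u,u,u} q.quasiCoherentData

end HasLocalBases

end

/-! ### Tensor products and the module of an effective Cartier divisor -/

section

variable {X S : Scheme.{u}}

section Tensor
variable {M N : X.Modules} {U : X.Opens} {ι : Type*} [Fintype ι]

theorem exists_eq_sum_tmul {A M N ι : Type*} [CommRing A] [AddCommGroup M] [AddCommGroup N]
    [Module A M] [Module A N] [Fintype ι] {e : ι → M} {s : N}
    (he : ∀ m : M, ∃ c : ι → A, ∑ i, c i • e i = m) (hs : ∀ n : N, ∃ a : A, n = a • s)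
    (m : TensorProduct A M N) :
    ∃ c : ι → A, m = ∑ i, c i • TensorProduct.tmul A (e i) s := by
  induction m with
  | zero => exact ⟨0, by simp⟩
  | add x y hx hy =>
    obtain ⟨c, rfl⟩ := hx
    obtain ⟨d, rfl⟩ := hy
    exact ⟨c + d, by simp [add_smul, Finset.sum_add_distrib]⟩
  | tmul m n =>
    obtain ⟨a, rfl⟩ := hs n
    obtain ⟨c, rfl⟩ := he m
    refine ⟨fun i => a * c i, ?_⟩
    rw [TensorProduct.sum_tmul]
    refine Finset.sum_congr rfl fun i _ => ?_
    rw [← TensorProduct.smul_tmul, smul_smul, TensorProduct.smul_tmul']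

theorem eq_zero_of_sum_tmul {A M N ι : Type*} [CommRing A] [AddCommGroup M] [AddCommGroup N]
    [Module A M] [Module A N] [Fintype ι] {e : ι → M} {s : N} (f : M →ₗ[A] (ι → A))
    (hf : ∀ c : ι → A, f (∑ i, c i • e i) = c) (g : N →ₗ[A] A) (hg : g s = 1) {c : ι → A}
    (hc : ∑ i, c i • TensorProduct.tmul A (e i) s = 0) : c = 0 := by
  have h : TensorProduct.tmul A (∑ i, c i • e i) s = 0 := by
    rw [TensorProduct.sum_tmul, ← hc]
    exact Finset.sum_congr rfl fun i _ => (TensorProduct.smul_tmul' ..).symm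
  have h2 := congrArg (TensorProduct.lift ((LinearMap.lsmul A (ι → A)).flip.comp f |>.compl₂ g)) h
  rw [TensorProduct.lift.tmul, map_zero] at h2
  rw [← hf c]
  simpa [hg] using h2

/-- Tensoring a basis with a generator of an invertible module gives a basis. -/
theorem IsBasisOn.tensor {e : ι → Γ(M, U)} {s : Γ(N, U)} (he : IsBasisOn M U e)
    (hs : IsBasisOn N U fun _ : Unit => s) :
    IsBasisOn (tensorModule M N) U fun i => tensorSection M N U (e i) s := by
  have hmap : ∀ {V W : X.Opens} (h : V ≤ W) (m : Γ(M, W)) (n : Γ(N, W)),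
      (PresheafOfModules.Monoidal.tensorObj (R := X.presheaf) M.val N.val).map (homOfLE h).op
        (TensorProduct.tmul Γ(X, W) m n) =
      TensorProduct.tmul Γ(X, V) (mres M h m) (mres N h n) := fun h m n =>
    PresheafOfModules.Monoidal.tensorObj_map_tmul (R := X.presheaf) (M₁ := M.val) (M₂ := N.val)
      (homOfLE h).op m n
  refine isBasisOn_sheafifyModule
    (M := PresheafOfModules.Monoidal.tensorObj (R := X.presheaf) M.val N.val)
    (e := fun i => TensorProduct.tmul Γ(X, U) (e i) s) ?_ ?_
  · intro V hV m x hx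
    refine ⟨V, le_rfl, hV, hx, ?_⟩
    obtain ⟨c, hc⟩ := exists_eq_sum_tmul (A := Γ(X, V)) (M := Γ(M, V)) (N := Γ(N, V))
      (fun m => he.exists_eq hV m) (s := mres N hV s) (fun n => by
        obtain ⟨c, hc⟩ := hs.exists_eq hV n
        exact ⟨c (), by simpa using hc.symm⟩) m
    refine ⟨c, ?_⟩
    refine Eq.trans ?_ (hc.trans ?_)
    · exact congrArg (fun φ => φ.hom m) ((PresheafOfModules.Monoidal.tensorObj (R := X.presheaf) M.val N.val).map_id (.op V))
    · exact congrArg (fun z : ι → TensorProduct Γ(X, V) Γ(M, V) Γ(N, V) => ∑ i, c i • z i)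
        (funext fun i => (hmap hV (e i) s).symm)
  · intro V hV c hc x hx
    refine ⟨V, le_rfl, hx, fun i => ?_⟩
    have h := eq_zero_of_sum_tmul (A := Γ(X, V)) (M := Γ(M, V)) (N := Γ(N, V))
      (e := fun i => mres M hV (e i)) (s := mres N hV s) (c := c)
      (he.coord hV) (fun c => he.coord_eq hV rfl)
      ((LinearMap.proj ()).comp (hs.coord hV)) (by
        have := hs.coord_basis hV ()
        exact (congrFun this ()).trans (by simp)) (by
        refine Eq.trans ?_ hc
        exact congrArg (fun z : ι → TensorProduct Γ(X, V) Γ(M, V) Γ(N, V) => ∑ i, c i • z i)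
          (funext fun i => (hmap hV (e i) s).symm))
    rw [h]; exact map_zero _
end Tensor

section OpenPush

theorem openPush_smul (M : X.Modules) (O V : X.Opens) (a : Γ(X, V)) (s : Γ(openPush M O, V)) :
    a • s = (show Γ(M, O.ι ''ᵁ O.ι ⁻¹ᵁ V) from
      fres (O.ι.image_preimage_le V) a • (show Γ(M, O.ι ''ᵁ O.ι ⁻¹ᵁ V) from s)) := by
  have h := congrArg (fun φ => φ.hom a) (O.ι.app_appIso_inv V)
  exact congrArg (fun b : Γ(X, O.ι ''ᵁ O.ι ⁻¹ᵁ V) => b • (show Γ(M, O.ι ''ᵁ O.ι ⁻¹ᵁ V) from s)) h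

theorem openPushUnit_app (M : X.Modules) (O V : X.Opens) (m : Γ(M, V)) :
    (openPushUnit M O).app V m = mres M (O.ι.image_preimage_le V) m := rfl

theorem structure_smul {V : X.Opens} (a b : Γ(X, V)) :
    a • structureSection b = structureSection (a * b) := rfl

theorem structure_mres {V W : X.Opens} (h : W ≤ V) (b : Γ(X, V)) :
   mres (structureModule X) h (structureSection b) = structureSection (fres h b) := rfl

theorem mem_image_preimage {O V : X.Opens} {x : X} : x ∈ O.ι ''ᵁ O.ι ⁻¹ᵁ V ↔ x ∈ O ∧ x ∈ V := by
  rw [O.ι.image_preimage_eq_opensRange_inf, Scheme.Opens.opensRange_ι]; rfl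

end OpenPush

section Cartier

variable {R : X.IdealSheafData}

theorem ideal_eq_span_fres {U V : X.affineOpens} (h : V.1 ≤ U.1) {t : Γ(X, U.1)}
    (ht : R.ideal U = Ideal.span {t}) : R.ideal V = Ideal.span {fres h t} := by
  rw [← R.map_ideal h, ht, Ideal.map_span, Set.image_singleton]
  rfl

theorem exists_affine_nhd {V : X.Opens} {x : X} (hx : x ∈ V) :
    ∃ W : X.affineOpens, x ∈ W.1 ∧ W.1 ≤ V := by
  obtain ⟨_, ⟨W, hW, rfl⟩, hxW, hWV⟩ := X.isBasis_affineOpens.exists_subset_of_mem_open hx V.2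
  exact ⟨⟨W, hW⟩, hxW, hWV⟩

theorem IsEffectiveCartier.exists_nhd (hR : IsEffectiveCartier R) {U : X.affineOpens}
    {t : Γ(X, U.1)} (ht : R.ideal U = Ideal.span {t}) {V : X.Opens} (hV : V ≤ U.1) {x : X}
    (hx : x ∈ V) : ∃ (W : X.affineOpens) (h : W.1 ≤ V), x ∈ W.1 ∧
      fres (h.trans hV) t ∈ nonZeroDivisors Γ(X, W.1) := by
  obtain ⟨U', hxU', t', ht', hU'⟩ := hR x
  obtain ⟨f, hf, hxf⟩ := U'.2.exists_basicOpen_le ⟨x, hx⟩ hxU'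
  obtain ⟨W, hWf⟩ : ∃ W : X.affineOpens, W.1 = X.basicOpen f := ⟨X.affineBasicOpen f, rfl⟩
  have hW : W.1 ≤ U'.1 := hWf.trans_le (X.basicOpen_le f)
  rw [← hWf] at hf hxf
  refine ⟨W, hf, hxf, ?_⟩
  have h1 := ideal_eq_span_fres (V := W) hW hU'
  rw [ideal_eq_span_fres (V := W) (hf.trans hV) ht] at h1
  have h2 : fres hW t' ∈ nonZeroDivisors Γ(X, W.1) := by
    let _ := (fres hW).toAlgebra
    have : IsLocalization.Away f Γ(X, W.1) :=
      U'.2.isLocalization_of_eq_basicOpen f (homOfLE hW) hWf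
    exact IsLocalization.map_nonZeroDivisors_le (.powers f) Γ(X, W.1) ⟨t', ht', rfl⟩
  obtain ⟨a, ha⟩ := Ideal.mem_span_singleton.mp
    (show fres hW t' ∈ Ideal.span {fres (hf.trans hV) t} from
      h1 ▸ Ideal.mem_span_singleton_self _)
  rw [ha, mul_mem_nonZeroDivisors] at h2
  exact h2.1

/-- A local equation of an effective Cartier divisor is a nonzerodivisor. -/
theorem IsEffectiveCartier.eq_zero (hR : IsEffectiveCartier R) {U : X.affineOpens}
    {t : Γ(X, U.1)} (ht : R.ideal U = Ideal.span {t}) {V : X.Opens} (hV : V ≤ U.1)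
    {a : Γ(X, V)} (h : fres hV t * a = 0) : a = 0 := by
  refine functions_ext fun x hx => ?_
  obtain ⟨W, hW, hxW, hn⟩ := hR.exists_nhd ht hV hx
  refine ⟨W.1, hW, hxW, ?_⟩
  rw [map_zero]
  refine (mul_left_mem_nonZeroDivisors_eq_zero_iff hn).mp ?_
  have := congrArg (fres hW) h
  rwa [map_mul, fres_fres, map_zero] at this

theorem IsEffectiveCartier.fres_mem (hR : IsEffectiveCartier R) {U : X.affineOpens}
    {t : Γ(X, U.1)} (ht : R.ideal U = Ideal.span {t}) {V : X.Opens} (hV : V ≤ U.1) :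
    fres hV t ∈ nonZeroDivisors Γ(X, V) :=
  mem_nonZeroDivisors_iff_left.mpr fun _ h => hR.eq_zero ht hV h

theorem mem_complement_iff {U : X.affineOpens} {t : Γ(X, U.1)}
    (ht : R.ideal U = Ideal.span {t}) {x : X} (hx : x ∈ U.1) :
    x ∈ complement R ↔ x ∈ X.basicOpen t := by
  change x ∉ R.support ↔ _
  rw [Scheme.IdealSheafData.mem_support_iff_of_mem hx, ht, Scheme.zeroLocus_span,
    Scheme.mem_zeroLocus_iff]
  simp

/-- A function which vanishes outside of an effective Cartier divisor is zero. -/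
theorem IsEffectiveCartier.eq_zero_of_complement (hR : IsEffectiveCartier R) {V O : X.Opens}
    (hO : O ≤ V) (hOV : ∀ x ∈ V, x ∈ complement R → x ∈ O)
    {a : Γ(X, V)} (h : fres hO a = 0) : a = 0 := by
  refine functions_ext fun x hx => ?_
  obtain ⟨U', hxU', t', ht', hU'⟩ := hR x
  obtain ⟨W, hxW, hW⟩ := exists_affine_nhd (V := U'.1 ⊓ V) ⟨hxU', hx⟩
  have hWU' := hW.trans inf_le_left
  refine ⟨W.1, hW.trans inf_le_right, hxW, ?_⟩
  rw [map_zero]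
  have ht := ideal_eq_span_fres (V := W) hWU' hU'
  have h0 : fres (X.basicOpen_le (fres hWU' t')) (fres (hW.trans inf_le_right) a) = 0 := by
    have hle : X.basicOpen (fres hWU' t') ≤ O := fun y hy => by
      have hyW := X.basicOpen_le _ hy
      exact hOV y (hW.trans inf_le_right hyW) ((mem_complement_iff ht hyW).mpr hy)
    rw [fres_fres, ← fres_fres hO hle, h, map_zero]
  have := W.2.isLocalization_basicOpen (fres hWU' t')
  obtain ⟨⟨_, n, rfl⟩, hn⟩ := (IsLocalization.map_eq_zero_iff (.powers (fres hWU' t'))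
    Γ(X, X.basicOpen (fres hWU' t')) _).mp h0
  exact (mul_left_mem_nonZeroDivisors_eq_zero_iff (pow_mem (hR.fres_mem hU' hWU') n)).mp hn

section DivisorModule

theorem openPushUnit_mres_one (O : X.Opens) {U V : X.Opens} (h : V ≤ U) :
    mres (openPush (structureModule X) O) h
      ((openPushUnit (structureModule X) O).app U (structureSection 1)) =
    (openPushUnit (structureModule X) O).app V (structureSection 1) := by
  refine (hom_app_map (openPushUnit (structureModule X) O) (homOfLE h) _).trans ?_
  exact congrArg _ ((structure_mres h 1).trans (congrArg _ (map_one _)))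

/-- The function `1 / t` on the complement of the divisor with local equation `t`. -/
theorem exists_divisorSections {U : X.affineOpens} {t : Γ(X, U.1)}
    (ht : R.ideal U = Ideal.span {t}) :
    ∃ s ∈ divisorSections R U.1, t • s =
      (openPushUnit (structureModule X) (complement R)).app U.1 (structureSection 1) := by
  have hu : IsUnit (fres ((complement R).ι.image_preimage_le U.1) t) := by
    have hle : (complement R).ι ''ᵁ (complement R).ι ⁻¹ᵁ U.1 ≤ X.basicOpen t := fun x hx =>
      (mem_complement_iff ht (mem_image_preimage.mp hx).2).mp (mem_image_preimage.mp hx).1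
    have h := (RingedSpace.isUnit_res_basicOpen _ t).map (fres hle)
    rwa [← fres_fres (X.basicOpen_le t) hle]
  obtain ⟨s, hs⟩ := hu.exists_right_inv
  have h : t • (show Γ(openPush (structureModule X) (complement R), U.1) from s) =
      (openPushUnit (structureModule X) (complement R)).app U.1 (structureSection 1) := by
    rw [openPush_smul, openPushUnit_app, structure_mres, map_one, ← hs]
    rfl
  refine ⟨s, fun W hW a ha => ?_, h⟩
  rw [ideal_eq_span_fres (V := W) hW ht, Ideal.mem_span_singleton] at ha
  obtain ⟨b, rfl⟩ := ha
  refine ⟨structureSection b, ?_⟩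
  have h2 := congrArg (mres _ hW) h
  rw [mres_smul] at h2
  rw [mul_comm, mul_smul]
  refine (congrArg (b • ·) (h2.trans (openPushUnit_mres_one _ hW))).trans ?_
  rw [← Scheme.Modules.Hom.app_smul, structure_smul, mul_one]

theorem isBasisOn_divisorModule (hR : IsEffectiveCartier R) {U : X.affineOpens} {t : Γ(X, U.1)}
    (ht : R.ideal U = Ideal.span {t}) {s : Γ(openPush (structureModule X) (complement R), U.1)}
    (hs : s ∈ divisorSections R U.1)
    (hts : t • s = (openPushUnit (structureModule X) (complement R)).app U.1
      (structureSection 1)) :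
    IsBasisOn (divisorModule R) U.1 fun _ : Unit => divisorSection R U.1 s hs := by
  have hts' : ∀ {V : X.Opens} (hV : V ≤ U.1), fres hV t •
      mres (openPush (structureModule X) (complement R)) hV s =
      (openPushUnit (structureModule X) (complement R)).app V (structureSection 1) := by
    intro V hV
    rw [← mres_smul, hts]
    exact openPushUnit_mres_one _ hV
  have hinj : ∀ {V : X.Opens} (hV : V ≤ U.1)
      (m : Γ(openPush (structureModule X) (complement R), V)), fres hV t • m = 0 → m = 0 := by
    intro V hV m hm
    rw [openPush_smul, fres_fres] at hm
    exact hR.eq_zero ht _ hm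
  refine isBasisOn_sheafifyModule (M := (submodulePresheaf _ (divisorSections R)
    (divisorSections_map R)).toPresheafOfModules) (e := fun _ : Unit => ⟨s, hs⟩) ?_ ?_
  · rintro V hV ⟨m, hm⟩ x hx
    obtain ⟨W, hxW, hW⟩ := exists_affine_nhd hx
    obtain ⟨b, hb⟩ := hm W hW (fres (hW.trans hV) t) (by
      rw [ideal_eq_span_fres (V := W) (hW.trans hV) ht]
      exact Ideal.mem_span_singleton_self _)
    refine ⟨W.1, hW, hW.trans hV, hxW, fun _ => b, ?_⟩
    rw [Fintype.sum_unique]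
    refine Subtype.ext ?_
    change mres (openPush (structureModule X) (complement R)) hW m =
      (show Γ(X, W.1) from b) • mres (openPush (structureModule X) (complement R)) (hW.trans hV) s
    rw [← sub_eq_zero]
    refine hinj (hW.trans hV) _ ?_
    rw [smul_sub, sub_eq_zero, smul_comm, hts' (hW.trans hV)]
    refine hb.trans ?_
    rw [← Scheme.Modules.Hom.app_smul, structure_smul, mul_one]
    rfl
  · intro V hV c hc x hx
    refine ⟨V, le_rfl, hx, fun _ => ?_⟩
    rw [Fintype.sum_unique] at hc
    have h : c () • mres (openPush (structureModule X) (complement R)) hV s = 0 :=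
      congrArg Subtype.val hc
    have h2 := congrArg (fres hV t • ·) h
    simp only [smul_zero] at h2
    rw [smul_comm, hts' hV, ← Scheme.Modules.Hom.app_smul, structure_smul, mul_one,
      openPushUnit_app, structure_mres] at h2
    rw [fres_self]
    exact hR.eq_zero_of_complement _ (fun y hy hyR => mem_image_preimage.mpr ⟨hyR, hy⟩) h2

end DivisorModule

end Cartier

end

/-! ### Pull-backs of bases -/

section

variable {X S : Scheme.{u}}

section Pullback

variable (σ : X ⟶ S) (E : S.Modules)

/-- The pull-back of a section of `E` over `O` to the preimage of `O`. -/
def pullSec (O : S.Opens) (m : Γ(E, O)) : Γ((Scheme.Modules.pullback σ).obj E, σ ⁻¹ᵁ O) :=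
  ((Scheme.Modules.pullbackPushforwardAdjunction σ).unit.app E).app O m

theorem pullSec_add (O : S.Opens) (m n : Γ(E, O)) :
    pullSec σ E O (m + n) = pullSec σ E O m + pullSec σ E O n :=
  map_add (((Scheme.Modules.pullbackPushforwardAdjunction σ).unit.app E).app O).hom m n

theorem pullSec_sum {ι : Type*} (s : Finset ι) (O : S.Opens) (m : ι → Γ(E, O)) :
    pullSec σ E O (∑ i ∈ s, m i) = ∑ i ∈ s, pullSec σ E O (m i) :=
  map_sum (((Scheme.Modules.pullbackPushforwardAdjunction σ).unit.app E).app O).hom m s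

theorem pullSec_smul (O : S.Opens) (a : Γ(S, O)) (m : Γ(E, O)) :
    pullSec σ E O (a • m) = σ.app O a • pullSec σ E O m :=
  Scheme.Modules.Hom.app_smul ((Scheme.Modules.pullbackPushforwardAdjunction σ).unit.app E) a m

theorem pullSec_mres {O O' : S.Opens} (h : O' ≤ O) (m : Γ(E, O)) :
    pullSec σ E O' (mres E h m) = mres _ (σ.preimage_mono h) (pullSec σ E O m) :=
  (hom_app_map ((Scheme.Modules.pullbackPushforwardAdjunction σ).unit.app E) (homOfLE h) m).symm

theorem pullbackSection_eq {W : S.Opens} {U : X.Opens} (h : U ≤ σ ⁻¹ᵁ W) (m : Γ(E, W)) :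
    pullbackSection σ E W U h m = mres _ h (pullSec σ E W m) := rfl

theorem pullbackSection_mres {W W' : S.Opens} {U U' : X.Opens} (h : U ≤ σ ⁻¹ᵁ W) (hW : W' ≤ W)
    (hU : U' ≤ U) (h' : U' ≤ σ ⁻¹ᵁ W') (m : Γ(E, W)) :
    pullbackSection σ E W' U' h' (mres E hW m) = mres _ hU (pullbackSection σ E W U h m) := by
  rw [pullbackSection_eq, pullbackSection_eq, pullSec_mres, mres_mres, mres_mres]

variable {σ E}

theorem pullback_hom_ext {N : X.Modules} {φ ψ : (Scheme.Modules.pullback σ).obj E ⟶ N}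
    (h : ∀ (O : S.Opens) (m : Γ(E, O)),
      φ.app _ (pullSec σ E O m) = ψ.app _ (pullSec σ E O m)) : φ = ψ := by
  apply ((Scheme.Modules.pullbackPushforwardAdjunction σ).homEquiv _ _).injective
  rw [Adjunction.homEquiv_unit, Adjunction.homEquiv_unit]
  refine Scheme.Modules.hom_ext _ _ fun O => ?_
  ext m
  exact h O m

/-- The morphism from `σ^* E` associated with a morphism from `E` to a direct image. -/
def pullbackDesc {N : X.Modules} (φ : E ⟶ (Scheme.Modules.pushforward σ).obj N) :
    (Scheme.Modules.pullback σ).obj E ⟶ N :=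
  ((Scheme.Modules.pullbackPushforwardAdjunction σ).homEquiv _ _).symm φ

theorem pullbackDesc_pullSec {N : X.Modules} (φ : E ⟶ (Scheme.Modules.pushforward σ).obj N)
    (O : S.Opens) (m : Γ(E, O)) : (pullbackDesc φ).app _ (pullSec σ E O m) = φ.app O m := by
  have h : (Scheme.Modules.pullbackPushforwardAdjunction σ).unit.app E ≫
      (Scheme.Modules.pushforward σ).map (pullbackDesc φ) = φ :=
    (Adjunction.homEquiv_unit ..).symm.trans (Equiv.apply_symm_apply _ _)
  exact congrArg (fun ψ : E ⟶ (Scheme.Modules.pushforward σ).obj N => ψ.app O m) h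

variable {ι : Type*} [Fintype ι] {W : S.Opens} {U : X.Opens} {e : ι → Γ(E, W)}

theorem image_preimage_le_preimage_inf (hU : U ≤ σ ⁻¹ᵁ W) (O : S.Opens) :
    U.ι ''ᵁ U.ι ⁻¹ᵁ σ ⁻¹ᵁ O ≤ σ ⁻¹ᵁ (O ⊓ W) := fun _ hx =>
  ⟨(mem_image_preimage.mp hx).2, hU (mem_image_preimage.mp hx).1⟩

theorem fres_appLE {V : S.Opens} {O O' : X.Opens} (h : O ≤ σ ⁻¹ᵁ V) (h' : O' ≤ O) (a : Γ(S, V)) :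
    fres h' (σ.appLE V O h a) = σ.appLE V O' (h'.trans h) a :=
  congrArg (fun φ => φ.hom a) (σ.appLE_map h (homOfLE h').op)

theorem appLE_fres {V V' : S.Opens} {O : X.Opens} (h : O ≤ σ ⁻¹ᵁ V') (h' : V' ≤ V) (a : Γ(S, V)) :
    σ.appLE V' O h (fres h' a) = σ.appLE V O (h.trans (σ.preimage_mono h')) a :=
  congrArg (fun φ => φ.hom a) (σ.map_appLE h (homOfLE h').op)

/-- The coordinate functions of `σ^* E` with respect to the pull-back of a basis. -/
def IsBasisOn.pullbackCoord (he : IsBasisOn E W e) (hU : U ≤ σ ⁻¹ᵁ W) (i : ι) :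
    (Scheme.Modules.pullback σ).obj E ⟶ openPush (structureModule X) U :=
  pullbackDesc (modulesHomMk
    (fun O =>
      { toFun := fun m => structureSection (σ.appLE (O ⊓ W) _ (image_preimage_le_preimage_inf hU O)
          (he.coord inf_le_right (mres E inf_le_left m) i))
        map_add' := fun m n => by
          rw [map_add, map_add, Pi.add_apply, map_add]; rfl
        map_smul' := fun a m => by
          rw [mres_smul, map_smul, Pi.smul_apply, smul_eq_mul, map_mul]
          rw [appLE_fres]
          refine Eq.trans ?_ (openPush_smul (structureModule X) U (σ ⁻¹ᵁ O) (σ.app O a) _).symm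
          refine (structure_smul _ _).symm.trans ?_
          congr 1 })
    (fun O O' j m => by
      have h := he.coord_mres (V := O ⊓ W) (W := O' ⊓ W) inf_le_right
        (inf_le_inf_right W j.le) (mres E inf_le_left m)
      rw [mres_mres] at h
      refine Eq.trans (b := structureSection (σ.appLE (O' ⊓ W) _
        (image_preimage_le_preimage_inf hU O') (he.coord inf_le_right
          (mres E (inf_le_inf_right W j.le |>.trans inf_le_left) m) i))) ?_ ?_
      · exact congrArg (fun n => structureSection (σ.appLE (O' ⊓ W) _
          (image_preimage_le_preimage_inf hU O') (he.coord inf_le_right n i)))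
          (mres_mres E j.le inf_le_left m)
      · rw [h, appLE_fres]
        exact (fres_appLE (image_preimage_le_preimage_inf hU O)
          (U.ι.image_mono (U.ι.preimage_mono (σ.preimage_mono j.le))) _).symm))

theorem IsBasisOn.pullbackCoord_pullSec (he : IsBasisOn E W e) (hU : U ≤ σ ⁻¹ᵁ W) (i : ι)
    (O : S.Opens) (m : Γ(E, O)) : (he.pullbackCoord hU i).app _ (pullSec σ E O m) =
      structureSection (σ.appLE (O ⊓ W) _ (image_preimage_le_preimage_inf hU O)
          (he.coord inf_le_right (mres E inf_le_left m) i)) :=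
  pullbackDesc_pullSec _ O m

theorem IsBasisOn.pullbackCoord_pullbackSection [DecidableEq ι] (he : IsBasisOn E W e)
    (hU : U ≤ σ ⁻¹ᵁ W) (i j : ι) : (he.pullbackCoord hU i).app _ (pullbackSection σ E W U hU (e j)) =
      structureSection (if i = j then 1 else 0) := by
  refine (hom_app_map (he.pullbackCoord hU i) (homOfLE hU) (pullSec σ E W (e j))).symm.trans ?_
  rw [he.pullbackCoord_pullSec, he.coord_basis, Pi.single_apply]
  refine (structure_mres _ _).trans (congrArg structureSection ?_)
  split_ifs <;> simp only [map_one, map_zero]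

/-- A section of `j_* j^* N`, as a section of `N`. -/
def ofOpenPush (N : X.Modules) (U V : X.Opens) :
    Γ(openPush N U, V) →+ Γ(N, U.ι ''ᵁ U.ι ⁻¹ᵁ V) where
  toFun s := s
  map_zero' := rfl
  map_add' _ _ := rfl

theorem ofOpenPush_injective (N : X.Modules) (U V : X.Opens) :
    Function.Injective (ofOpenPush N U V) := fun _ _ h => h

theorem ofOpenPush_unit (N : X.Modules) (U V : X.Opens) (m : Γ(N, V)) :
    ofOpenPush N U V ((openPushUnit N U).app V m) = mres N (U.ι.image_preimage_le V) m := rfl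

/-- Multiplication of functions on open subsets of `U` by a section of a module over `U`. -/
def smulSec {N : X.Modules} (p : Γ(N, U)) : openPush (structureModule X) U ⟶ openPush N U :=
  modulesHomMk (fun O =>
    { toFun := fun a => (show Γ(N, U.ι ''ᵁ U.ι ⁻¹ᵁ O) from
        (show Γ(X, U.ι ''ᵁ U.ι ⁻¹ᵁ O) from a) • mres N (U.ι_image_le _) p)
      map_add' := fun a b => add_smul (show Γ(X, U.ι ''ᵁ U.ι ⁻¹ᵁ O) from a)
        (show Γ(X, U.ι ''ᵁ U.ι ⁻¹ᵁ O) from b) (mres N (U.ι_image_le _) p)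
      map_smul' := fun r a => by
        refine Eq.trans ?_ (openPush_smul N U O r _).symm
        refine Eq.trans ?_ (mul_smul (α := Γ(X, U.ι ''ᵁ U.ι ⁻¹ᵁ O))
          (β := Γ(N, U.ι ''ᵁ U.ι ⁻¹ᵁ O)) _ (show Γ(X, U.ι ''ᵁ U.ι ⁻¹ᵁ O) from a)
          (mres N (U.ι_image_le _) p))
        exact congrArg (fun b : Γ(X, U.ι ''ᵁ U.ι ⁻¹ᵁ O) => b • mres N (U.ι_image_le _) p)
          (openPush_smul (structureModule X) U O r a) })
    (fun O O' j a => by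
      refine Eq.trans ?_ (mres_smul N (U.ι.image_mono (U.ι.preimage_mono j.le)) _ _).symm
      rw [mres_mres]
      rfl)

theorem ofOpenPush_smulSec {N : X.Modules} (p : Γ(N, U)) (O : X.Opens)
    (a : Γ(openPush (structureModule X) U, O)) : ofOpenPush N U O ((smulSec p).app O a) =
      (show Γ(X, U.ι ''ᵁ U.ι ⁻¹ᵁ O) from ofOpenPush _ U O a) • mres N (U.ι_image_le _) p := rfl

theorem modules_sum_app {M N : X.Modules} {κ : Type*} (t : Finset κ) (f : κ → (M ⟶ N))
    (V : X.Opens) (m : Γ(M, V)) : (∑ i ∈ t, f i).app V m = ∑ i ∈ t, (f i).app V m :=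
  sum_val_app t f (.op V) m

theorem isBasisOn_of_coordinates [DecidableEq ι] {N : X.Modules}
    {φ : ι → (N ⟶ openPush (structureModule X) U)} {p : ι → Γ(N, U)}
    (h₁ : ∑ i, φ i ≫ smulSec (p i) = openPushUnit _ U)
    (h₂ : ∀ i j, (φ i).app U (p j) = structureSection (if i = j then 1 else 0)) :
    IsBasisOn N U p := by
  have hV' : ∀ {V : X.Opens}, V ≤ U → V ≤ U.ι ''ᵁ U.ι ⁻¹ᵁ V := fun hV x hx =>
    mem_image_preimage.mpr ⟨hV hx, hx⟩
  refine isBasisOn_of_local ?_ ?_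
  · intro V hV m x hx
    refine ⟨V, le_rfl, hV, hx, fun i => fres (hV' hV) ((φ i).app V m), ?_⟩
    have h1 := (modules_sum_app _ _ V m).symm.trans (congrArg (fun ψ => ψ.app V m) h₁)
    have h2 := congrArg (fun z => mres N (hV' hV) (ofOpenPush N U V z)) h1
    simp only [map_sum, ofOpenPush_unit, mres_mres] at h2
    refine h2.symm.trans (Finset.sum_congr rfl fun i _ => ?_)
    refine (congrArg (mres N (hV' hV)) (ofOpenPush_smulSec (p i) V ((φ i).app V m))).trans ?_
    refine (mres_smul N (hV' hV) _ _).trans ?_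
    rw [mres_mres]
    rfl
  · intro V hV c hc
    funext i
    have h := congrArg ((φ i).app V) hc
    rw [map_sum, map_zero, Finset.sum_eq_single i, Scheme.Modules.Hom.app_smul] at h
    · have h3 : (φ i).app V (mres N hV (p i)) =
          structureSection (V := U.ι ''ᵁ U.ι ⁻¹ᵁ V) 1 := by
        refine (hom_app_map (φ i) (homOfLE hV) (p i)).symm.trans ?_
        rw [h₂, if_pos rfl]
        exact (structure_mres _ _).trans (congrArg structureSection (map_one _))
      have h4 : fres (U.ι.image_preimage_le V) (c i) * 1 = 0 :=
        (openPush_smul (structureModule X) U V (c i) (structureSection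
          (V := U.ι ''ᵁ U.ι ⁻¹ᵁ V) 1)).symm.trans ((congrArg (c i • ·) h3).symm.trans h)
      have h5 := congrArg (fres (hV' hV)) h4
      rwa [mul_one, fres_fres, fres_self, map_zero] at h5
    · intro j _ hj
      rw [Scheme.Modules.Hom.app_smul]
      have h3 : (φ i).app V (mres N hV (p j)) = 0 := by
        refine (hom_app_map (φ i) (homOfLE hV) (p j)).symm.trans ?_
        rw [h₂, if_neg hj.symm]
        exact (structure_mres _ _).trans (congrArg structureSection (map_zero _))
      rw [h3, smul_zero]
    · simp

theorem IsBasisOn.ofOpenPush_smulSec_pullbackCoord (he : IsBasisOn E W e) (hU : U ≤ σ ⁻¹ᵁ W)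
    (i : ι) (O : S.Opens) (m : Γ(E, O)) :
    ofOpenPush _ U _ ((he.pullbackCoord hU i ≫ smulSec (pullbackSection σ E W U hU (e i))).app _
      (pullSec σ E O m)) =
      mres _ (image_preimage_le_preimage_inf hU O) (pullSec σ E (O ⊓ W)
        (he.coord inf_le_right (mres E inf_le_left m) i • mres E inf_le_right (e i))) := by
  refine (ofOpenPush_smulSec (pullbackSection σ E W U hU (e i)) _
    ((he.pullbackCoord hU i).app _ (pullSec σ E O m))).trans ?_
  rw [pullSec_smul, mres_smul, pullSec_mres, mres_mres, pullbackSection_eq, mres_mres,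
    he.pullbackCoord_pullSec hU i O m]
  rfl

theorem IsBasisOn.sum_pullbackCoord (he : IsBasisOn E W e) (hU : U ≤ σ ⁻¹ᵁ W) :
    ∑ i, he.pullbackCoord hU i ≫ smulSec (pullbackSection σ E W U hU (e i)) =
      openPushUnit _ U := by
  refine pullback_hom_ext fun O m => ?_
  refine (modules_sum_app _ _ _ _).trans ?_
  apply ofOpenPush_injective
  rw [map_sum, ofOpenPush_unit]
  simp only [he.ofOpenPush_smulSec_pullbackCoord]
  rw [← map_sum, ← pullSec_sum, he.sum_coord, pullSec_mres, mres_mres]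

/-- The pull-back of a basis is a basis. -/
theorem IsBasisOn.pullback (he : IsBasisOn E W e) (hU : U ≤ σ ⁻¹ᵁ W) :
    IsBasisOn ((Scheme.Modules.pullback σ).obj E) U fun i => pullbackSection σ E W U hU (e i) := by
  classical
  exact isBasisOn_of_coordinates (he.sum_pullbackCoord hU) (he.pullbackCoord_pullbackSection hU)

end Pullback

end

/-! ### Differentials -/

section

variable {X S : Scheme.{u}}

section LocalizedDerivations
open TensorProduct

variable {A B L ι : Type*} [CommRing A] [CommRing B] [CommRing L] [Algebra A B] [Algebra B L]
  [Algebra A L] [IsScalarTower A B L] (N : Submonoid B) [IsLocalization N L]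
  (e : Module.Basis ι B Ω[B⁄A]) (y : ι → B) (he : ∀ i, e i = KaehlerDifferential.D A B (y i))
include N he

theorem exists_dual_derivation [DecidableEq ι] (i : ι) : ∃ δ : Derivation A L L, ∀ j,
    δ (algebraMap B L (y j)) = if i = j then 1 else 0 := by
  have := Algebra.FormallyEtale.of_isLocalization (Rₘ := L) N
  let f : Ω[L⁄A] →ₗ[L] L := ((e.baseChange L).coord i).comp
    (KaehlerDifferential.tensorKaehlerEquivOfFormallyEtale A B L).symm.toLinearMap
  refine ⟨f.compDer (KaehlerDifferential.D A L), fun j => ?_⟩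
  change (e.baseChange L).coord i ((KaehlerDifferential.tensorKaehlerEquivOfFormallyEtale A B L).symm
    (KaehlerDifferential.D A L (algebraMap B L (y j)))) = _
  rw [KaehlerDifferential.tensorKaehlerEquivOfFormallyEtale_symm_D_algebraMap, ← he,
    ← Module.Basis.baseChange_apply, Module.Basis.coord_apply, Module.Basis.repr_self,
    Finsupp.single_apply]
  simp [eq_comm]

theorem exists_D_eq_sum [Fintype ι] (l : L) : ∃ c : ι → L,
    KaehlerDifferential.D A L l = ∑ i, c i • KaehlerDifferential.D A L (algebraMap B L (y i)) := by
  have := Algebra.FormallyEtale.of_isLocalization (Rₘ := L) N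
  let e' := (e.baseChange L).map (KaehlerDifferential.tensorKaehlerEquivOfFormallyEtale A B L)
  have he' : ∀ i, e' i = KaehlerDifferential.D A L (algebraMap B L (y i)) := by
    intro i
    rw [Module.Basis.map_apply, Module.Basis.baseChange_apply, he,
      ← KaehlerDifferential.tensorKaehlerEquivOfFormallyEtale_symm_D_algebraMap,
      LinearEquiv.apply_symm_apply]
  refine ⟨fun i => e'.repr (KaehlerDifferential.D A L l) i, ?_⟩
  simp only [← he', e'.sum_repr]

end LocalizedDerivations

section InverseImage

variable (f : X ⟶ S)

theorem inverseImageHom_unit (V : S.Opens) (a : Γ(S, V)) :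
    (inverseImageHom f).app (.op (f ⁻¹ᵁ V)) (((TopCat.Presheaf.pullbackPushforwardAdjunction
      CommRingCat f.base).unit.app S.presheaf).app (.op V) a) = f.app V a := by
  have h : (TopCat.Presheaf.pullbackPushforwardAdjunction CommRingCat f.base).unit.app S.presheaf ≫
      (TopCat.Presheaf.pushforward CommRingCat f.base).map (inverseImageHom f) = f.c :=
    (Adjunction.homEquiv_unit ..).symm.trans (Equiv.apply_symm_apply _ _)
  exact congrArg (fun φ => φ.app (.op V) a) h

theorem exists_inverseImageHom_eq (V : S.Opens) (W : X.Opens) (h : W ≤ f ⁻¹ᵁ V) (a : Γ(S, V)) :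
    ∃ z, (inverseImageHom f).app (.op W) z = f.appLE V W h a := by
  refine ⟨((TopCat.Presheaf.pullback CommRingCat f.base).obj S.presheaf).map (homOfLE h).op
    (((TopCat.Presheaf.pullbackPushforwardAdjunction
      CommRingCat f.base).unit.app S.presheaf).app (.op V) a), ?_⟩
  refine (NatTrans.naturality_apply (inverseImageHom f) (homOfLE h).op _).trans ?_
  exact congrArg (fres h) (inverseImageHom_unit f V a)

/-- Locally, the functions which come from the inverse image of the structure sheaf of `S` are
pull-backs of functions on `S`. -/
theorem exists_appLE_eq_inverseImageHom (W : X.Opens) (z) (p : X) (hp : p ∈ W) :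
    ∃ (V : S.Opens) (a : Γ(S, V)) (W' : X.Opens) (hW : W' ≤ W) (hV : W' ≤ f ⁻¹ᵁ V), p ∈ W' ∧
      fres hW ((inverseImageHom f).app (.op W) z) = f.appLE V W' hV a := by
  let F := (TopCat.Presheaf.pullback CommRingCat f.base).obj S.presheaf
  obtain ⟨V, hV, a, ha⟩ := TopCat.Presheaf.exists_germ_eq S.presheaf (x := f.base p)
    (S.presheaf.germToPullbackStalk CommRingCat f.base W p hp z)
  have h1 := congrArg (fun φ => φ z)
    (congrArg ConcreteCategory.hom (TopCat.Presheaf.germToPullbackStalk_stalkPullbackHom CommRingCat f.base S.presheaf W p hp))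
  have h2 := congrArg (fun φ => φ a)
    (congrArg ConcreteCategory.hom (TopCat.Presheaf.germ_stalkPullbackHom CommRingCat f.base S.presheaf p V hV))
  obtain ⟨W', hpW', i, j, hij⟩ := F.germ_eq p hp hV z
    (((TopCat.Presheaf.pullbackPushforwardAdjunction
      CommRingCat f.base).unit.app S.presheaf).app (.op V) a) (by
      refine h1.symm.trans (Eq.trans ?_ h2)
      exact congrArg (fun w => TopCat.Presheaf.stalkPullbackHom CommRingCat f.base S.presheaf p w)
        ha.symm)
  refine ⟨V, a, W', i.le, j.le, hpW', ?_⟩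
  have n1 := NatTrans.naturality_apply (inverseImageHom f) i.op z
  refine n1.symm.trans ((congrArg ((inverseImageHom f).app (.op W')) hij).trans ?_)
  refine (NatTrans.naturality_apply (inverseImageHom f) j.op _).trans ?_
  exact congrArg (fres j.le) (inverseImageHom_unit f V a)

end InverseImage

section Kaehler

theorem derivation_eq_sum {A₀ B M ι : Type*} [CommRing A₀] [CommRing B] [Algebra A₀ B]
    [AddCommGroup M] [Module B M] [Fintype ι] (d : B → M) (h₁ : ∀ a b, d (a + b) = d a + d b)
    (h₂ : ∀ a b, d (a * b) = a • d b + b • d a) (h₃ : ∀ a, d (algebraMap A₀ B a) = 0)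
    {l : B} {c y : ι → B}
    (h : KaehlerDifferential.D A₀ B l = ∑ i, c i • KaehlerDifferential.D A₀ B (y i)) :
    d l = ∑ i, c i • d (y i) := by
  let _ : Module A₀ M := Module.compHom _ (algebraMap A₀ B)
  have : IsScalarTower A₀ B M := ⟨fun a b m => by rw [Algebra.smul_def, mul_smul]; rfl⟩
  let D : Derivation A₀ B M := Derivation.mk'
    { toFun := d
      map_add' := h₁
      map_smul' := fun a b => by
        rw [Algebra.smul_def, h₂, h₃, smul_zero, add_zero]
        rfl }
    h₂
  have h2 := congrArg D.liftKaehlerDifferential h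
  simp only [map_sum, map_smul, Derivation.liftKaehlerDifferential_comp_D] at h2
  exact h2

/-- The differentials over a ring `A` are generated by those elements which generate the
differentials over a ring `A₀` whose image is contained in that of `A`. -/
theorem kaehlerDifferential_exists_eq_sum {A₀ A B ι : Type*} [CommRing A₀] [CommRing A]
    [CommRing B] [Algebra A B] [Algebra A₀ B] [Fintype ι]
    (h : ∀ a : A₀, ∃ z : A, algebraMap A B z = algebraMap A₀ B a) (y : ι → B)
    (H : ∀ l : B, ∃ c : ι → B,
      KaehlerDifferential.D A₀ B l = ∑ i, c i • KaehlerDifferential.D A₀ B (y i))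
    (m : Ω[B⁄A]) : ∃ c : ι → B, m = ∑ i, c i • KaehlerDifferential.D A B (y i) := by
  have hm : m ∈ Submodule.span B (Set.range (KaehlerDifferential.D A B)) := by
    rw [KaehlerDifferential.span_range_derivation]; trivial
  have hle : Submodule.span B (Set.range (KaehlerDifferential.D A B)) ≤
      Submodule.span B (Set.range fun i => KaehlerDifferential.D A B (y i)) := by
    rw [Submodule.span_le]
    rintro _ ⟨l, rfl⟩
    obtain ⟨c, hc⟩ := H l
    refine (Submodule.mem_span_range_iff_exists_fun B).mpr ⟨c, Eq.symm ?_⟩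
    refine derivation_eq_sum (A₀ := A₀) _ (map_add _) (Derivation.leibniz _) (fun a => ?_) hc
    obtain ⟨z, hz⟩ := h a
    rw [← hz, Derivation.map_algebraMap]
  obtain ⟨c, hc⟩ := (Submodule.mem_span_range_iff_exists_fun B).mp (hle hm)
  exact ⟨c, hc.symm⟩

theorem commRingCat_kaehler_exists_eq_sum {A B : CommRingCat.{u}} (φ : A ⟶ B) {A₀ ι : Type*}
    [CommRing A₀] [Algebra A₀ B] [Fintype ι] (h : ∀ a : A₀, ∃ z, φ z = algebraMap A₀ B a)
    (y : ι → B) (H : ∀ l : B, ∃ c : ι → B,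
      KaehlerDifferential.D A₀ B l = ∑ i, c i • KaehlerDifferential.D A₀ B (y i))
    (m : CommRingCat.KaehlerDifferential φ) :
    ∃ c : ι → B, m = ∑ i, c i • CommRingCat.KaehlerDifferential.d (y i) := by
  let _ := φ.hom.toAlgebra
  exact kaehlerDifferential_exists_eq_sum (A₀ := A₀) (A := A) h y H m

theorem commRingCat_kaehler_sum_eq_zero {A B : CommRingCat.{u}} (φ : A ⟶ B) {L ι : Type*}
    [CommRing L] [Fintype ι] (γ : B →+* L) (δ : L → L) (h₁ : ∀ a b, δ (a + b) = δ a + δ b)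
    (h₂ : ∀ a b, δ (a * b) = a * δ b + b * δ a) (h₃ : ∀ a, δ (γ (φ a)) = 0) (c y : ι → B)
    (h : ∑ i, c i • CommRingCat.KaehlerDifferential.d (f := φ) (y i) = 0) :
    ∑ i, γ (c i) * δ (γ (y i)) = 0 := by
  let _ := φ.hom.toAlgebra
  let _ := γ.toAlgebra
  let _ := (γ.comp φ.hom).toAlgebra
  have : IsScalarTower A B L := .of_algebraMap_eq fun _ => rfl
  let d : Derivation A B L := Derivation.mk'
    { toFun := fun b => δ (γ b)
      map_add' := fun a b => by rw [map_add, h₁]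
      map_smul' := fun a b => by
        rw [Algebra.smul_def, map_mul, h₂, RingHom.id_apply, Algebra.smul_def]
        change γ (φ a) * δ (γ b) + γ b * δ (γ (φ a)) = γ (φ a) * δ (γ b)
        rw [h₃, mul_zero, add_zero] }
    (fun a b => by
      change δ (γ (a * b)) = a • δ (γ b) + b • δ (γ a)
      rw [map_mul, h₂, Algebra.smul_def, Algebra.smul_def]; rfl)
  have h' : ∑ i, c i • KaehlerDifferential.D A B (y i) = 0 := h
  have h4 := congrArg d.liftKaehlerDifferential h'
  rw [map_sum, map_zero] at h4
  rw [← h4]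
  refine Finset.sum_congr rfl fun i _ => ?_
  rw [map_smul, Derivation.liftKaehlerDifferential_comp_D, Algebra.smul_def]
  rfl

end Kaehler

section Differentials

variable (f : X ⟶ S)

/-- The sheaf of differentials is computed on affine charts. Its definition involves the inverse image
of the structure sheaf of `S`, whence the comparison of base rings. -/
theorem isBasisOn_differentials {V₀ : S.Opens} {W : X.Opens} (hV : IsAffineOpen V₀)
    (hW : IsAffineOpen W) (h : W ≤ f ⁻¹ᵁ V₀) {ι : Type*} [Fintype ι] (y : ι → Γ(X, W))
    (H : letI := (f.appLE V₀ W h).hom.toAlgebra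
      ∃ e : Module.Basis ι Γ(X, W) Ω[Γ(X, W)⁄Γ(S, V₀)],
        ∀ i, e i = KaehlerDifferential.D Γ(S, V₀) Γ(X, W) (y i)) :
    IsBasisOn (differentials f) W fun i => differential f W (y i) := by
  classical
  let _ := (f.appLE V₀ W h).hom.toAlgebra
  obtain ⟨e, he⟩ := H
  refine isBasisOn_sheafifyModule (M := presheafDifferentials f) ?_ ?_
  · intro V hVW m x hx
    obtain ⟨g, hgV, hxg⟩ := hW.exists_basicOpen_le ⟨x, hx⟩ (hVW hx)
    let D := X.basicOpen g
    have hDW : D ≤ W := hgV.trans hVW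
    let _ := (fres hDW).toAlgebra
    have : IsLocalization (.powers g) Γ(X, D) := hW.isLocalization_basicOpen g
    let _ := ((fres hDW).comp (f.appLE V₀ W h).hom).toAlgebra
    have : IsScalarTower Γ(S, V₀) Γ(X, W) Γ(X, D) := .of_algebraMap_eq fun _ => rfl
    have key := commRingCat_kaehler_exists_eq_sum ((inverseImageHom f).app (.op D))
      (A₀ := Γ(S, V₀)) (fun a => by
        obtain ⟨z, hz⟩ := exists_inverseImageHom_eq f V₀ D (hDW.trans h) a
        exact ⟨z, hz.trans (fres_appLE h hDW a).symm⟩)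
      (fun i => fres hDW (y i)) (exists_D_eq_sum (.powers g) e y he)
    obtain ⟨c, hc⟩ := key ((presheafDifferentials f).map (homOfLE hgV).op m)
    refine ⟨D, hgV, hDW, hxg, c, hc.trans ?_⟩
    refine congrArg (fun z : ι → CommRingCat.KaehlerDifferential ((inverseImageHom f).app (.op D))
      => ∑ i, c i • z i) (funext fun i => ?_)
    exact ((PresheafOfModules.DifferentialsConstruction.derivation' (inverseImageHom f)).d_map
      (homOfLE hDW).op (y i))
  · intro V hVW c hc p hp
    refine ⟨V, le_rfl, hp, fun i => ?_⟩
    rw [fres_self]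
    refine TopCat.Presheaf.section_ext X.sheaf V _ _ fun x hx => ?_
    let L := X.presheaf.stalk x
    let _ : Algebra Γ(X, W) L := (X.presheaf.germ W x (hVW hx)).hom.toAlgebra
    have : IsLocalization.AtPrime L (hW.primeIdealOf ⟨x, hVW hx⟩).asIdeal :=
      hW.isLocalization_stalk ⟨x, hVW hx⟩
    let _ := ((X.presheaf.germ W x (hVW hx)).hom.comp (f.appLE V₀ W h).hom).toAlgebra
    have : IsScalarTower Γ(S, V₀) Γ(X, W) L := .of_algebraMap_eq fun _ => rfl
    obtain ⟨δ, hδ⟩ := exists_dual_derivation (A := Γ(S, V₀)) (L := L)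
      (hW.primeIdealOf ⟨x, hVW hx⟩).asIdeal.primeCompl e y he i
    have hgerm : ∀ {V' V'' : X.Opens} (hle : V'' ≤ V') (hx : x ∈ V'') (a : Γ(X, V')),
        X.presheaf.germ V'' x hx (fres hle a) = X.presheaf.germ V' x (hle hx) a := by
      intro V' V'' hle hx a
      exact TopCat.Presheaf.germ_res_apply X.presheaf (homOfLE hle) x hx a
    have hδ₀ : ∀ z, δ (X.presheaf.germ V x hx ((inverseImageHom f).app (.op V) z)) = 0 := by
      intro z
      obtain ⟨V₁, a, W', hW'V, hW'V₁, hxW', ha⟩ := exists_appLE_eq_inverseImageHom f V z x hx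
      rw [← hgerm hW'V hxW', ha]
      obtain ⟨s, hs, hxs⟩ := hV.exists_basicOpen_le ⟨f.base x, hW'V₁ hxW'⟩ (h (hVW hx))
      let D := S.basicOpen s
      replace hxs : x ∈ f ⁻¹ᵁ D := hxs
      have : IsLocalization (.powers s) Γ(S, D) := hV.isLocalization_basicOpen s
      obtain ⟨⟨a', ⟨_, n, rfl⟩⟩, ha'⟩ := IsLocalization.surj (.powers s) (fres hs a)
      have hDle : f ⁻¹ᵁ D ≤ f ⁻¹ᵁ V₁ := f.preimage_mono hs
      have hDle' : f ⁻¹ᵁ D ≤ f ⁻¹ᵁ V₀ := f.preimage_mono (S.basicOpen_le s)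
      have e1 : X.presheaf.germ W' x hxW' (f.appLE V₁ W' hW'V₁ a) =
          X.presheaf.germ (f ⁻¹ᵁ D) x hxs (f.appLE D _ le_rfl (fres hs a)) := by
        rw [appLE_fres, ← fres_appLE (O := f ⁻¹ᵁ V₁) le_rfl hW'V₁, hgerm,
          ← fres_appLE (O := f ⁻¹ᵁ V₁) le_rfl hDle, hgerm]
      have e2 : ∀ b : Γ(S, V₀), X.presheaf.germ (f ⁻¹ᵁ D) x hxs
          (f.appLE D _ le_rfl (fres (S.basicOpen_le s) b)) = algebraMap Γ(S, V₀) L b := by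
        intro b
        rw [appLE_fres, ← fres_appLE (O := f ⁻¹ᵁ V₀) le_rfl hDle', hgerm]
        change _ = X.presheaf.germ W x (hVW hx) (f.appLE V₀ W h b)
        rw [← fres_appLE (O := f ⁻¹ᵁ V₀) le_rfl h, hgerm]
      have e3 := congrArg (fun z => X.presheaf.germ (f ⁻¹ᵁ D) x hxs (f.appLE D _ le_rfl z)) ha'
      have e4 : (X.presheaf.germ W' x hxW' (f.appLE V₁ W' hW'V₁ a)) *
          algebraMap Γ(S, V₀) L (s ^ n) = algebraMap Γ(S, V₀) L a' := by
        rw [e1, ← e2, ← e2, ← map_mul, ← map_mul]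
        exact e3
      have hu : IsUnit (algebraMap Γ(S, V₀) L (s ^ n)) := by
        rw [map_pow, ← e2]
        refine IsUnit.pow n ?_
        refine IsUnit.map (X.presheaf.germ (f ⁻¹ᵁ D) x hxs).hom ?_
        refine IsUnit.map (f.appLE D _ le_rfl).hom ?_
        exact RingedSpace.isUnit_res_basicOpen _ s
      have e5 := congrArg δ e4
      rw [Derivation.leibniz, Derivation.map_algebraMap, Derivation.map_algebraMap, smul_zero,
        zero_add, smul_eq_mul] at e5
      exact hu.mul_right_eq_zero.mp e5
    have key := commRingCat_kaehler_sum_eq_zero ((inverseImageHom f).app (.op V))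
      (X.presheaf.germ V x hx).hom δ (map_add δ) (Derivation.leibniz δ) hδ₀ c
      (fun i => fres hVW (y i)) (by
        refine Eq.trans ?_ hc
        refine congrArg (fun z : ι → CommRingCat.KaehlerDifferential
          ((inverseImageHom f).app (.op V)) => ∑ i, c i • z i) (funext fun i => ?_)
        exact ((PresheafOfModules.DifferentialsConstruction.derivation' (inverseImageHom f)).d_map
          (homOfLE hVW).op (y i)))
    rw [Finset.sum_eq_single i] at key
    · have h6 := (congrArg δ (hgerm hVW hx (y i))).trans (hδ i)
      rw [if_pos rfl] at h6
      refine Eq.trans ?_ (key.trans (map_zero (X.presheaf.germ V x hx).hom).symm)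
      refine (mul_one _).symm.trans ?_
      exact congrArg (X.presheaf.germ V x hx (c i) * ·) h6.symm
    · intro j _ hj
      have h6 := (congrArg δ (hgerm hVW hx (y j))).trans (hδ j)
      rw [if_neg hj.symm] at h6
      exact (congrArg (X.presheaf.germ V x hx (c j) * ·) h6).trans (mul_zero _)
    · simp

end Differentials

end

/-! ### The ring-theoretic characterization of charts of blow-ups -/

section

variable {X Y S : Scheme.{u}}

open Scheme.IdealSheafData in
theorem ideal_comap_top (f : X ⟶ Y) (I : Y.IdealSheafData) (hX : IsAffineOpen (⊤ : X.Opens))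
    (hY : IsAffineOpen (⊤ : Y.Opens)) :
    (I.comap f).ideal ⟨⊤, hX⟩ = (I.ideal ⟨⊤, hY⟩).map (f.app ⊤).hom := by
  have : IsAffine X := @IsAffine.of_isIso _ _ X.topIso.inv _ hX
  have : IsAffine Y := @IsAffine.of_isIso _ _ Y.topIso.inv _ hY
  have key : ∀ J : X.IdealSheafData, (J.map f).ideal ⟨⊤, hY⟩ =
      (J.ideal ⟨⊤, hX⟩).comap (f.app ⊤).hom := fun J => ideal_map J f ⟨⊤, hY⟩ hX
  have h₀ := equivOfIsAffine (X := X).apply_symm_apply ((I.ideal ⟨⊤, hY⟩).map (f.app ⊤).hom)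
  apply le_antisymm
  · have h : I.comap f ≤ ofIdealTop ((I.ideal ⟨⊤, hY⟩).map (f.app ⊤).hom) := by
      refine le_map_iff_comap_le.mp (le_of_isAffine ?_)
      refine le_of_le_of_eq (Ideal.map_le_iff_le_comap.mp ?_) (key _).symm
      exact h₀.ge
    exact (h _).trans h₀.le
  · exact Ideal.map_le_iff_le_comap.mpr ((le_map_comap I f _).trans (key _).le)

theorem ideal_comap_ι (I : X.IdealSheafData) (V : X.Opens) (h : IsAffineOpen (⊤ : V.toScheme.Opens))
    (h' : IsAffineOpen (V.ι ''ᵁ ⊤)) :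
    (I.comap V.ι).ideal ⟨⊤, h⟩ = I.ideal ⟨V.ι ''ᵁ ⊤, h'⟩ := by
  refine (Scheme.IdealSheafData.ideal_comap_of_isOpenImmersion I V.ι ⟨⊤, h⟩).trans ?_
  refine Ideal.ext fun a => ?_
  change (V.ι.appIso ⊤).inv a ∈ I.ideal ⟨V.ι ''ᵁ ⊤, h'⟩ ↔ a ∈ I.ideal ⟨V.ι ''ᵁ ⊤, h'⟩
  rw [Scheme.Opens.ι_appIso]
  exact Iff.rfl

theorem ideal_map_map_map {A B C D : Type*} [CommRing A] [CommRing B] [CommRing C] [CommRing D]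
    (I : Ideal A) {p : A →+* B} {q : B →+* C} {r : C →+* D} {s : A →+* D}
    (h : ∀ a, r (q (p a)) = s a) : ((I.map p).map q).map r = I.map s := by
  rw [Ideal.map_map, Ideal.map_map]
  exact congrArg (fun φ => I.map φ) (RingHom.ext h)

/-- On affine open subschemes, the inverse image of an ideal sheaf is the ideal generated by the
images of the functions it contains. -/
theorem ideal_comap (f : X ⟶ Y) (I : Y.IdealSheafData) {U : Y.affineOpens} {V : X.affineOpens}
    (h : V.1 ≤ f ⁻¹ᵁ U.1) : (I.comap f).ideal V = (I.ideal U).map (f.appLE U.1 V.1 h).hom := by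
  have hV : IsAffineOpen (⊤ : V.1.toScheme.Opens) := by
    have : IsAffine V.1.toScheme := V.2
    exact isAffineOpen_top _
  have hU : IsAffineOpen (⊤ : U.1.toScheme.Opens) := by
    have : IsAffine U.1.toScheme := U.2
    exact isAffineOpen_top _
  have hV' : IsAffineOpen (V.1.ι ''ᵁ ⊤) := hV.image_of_isOpenImmersion _
  have hU' : IsAffineOpen (U.1.ι ''ᵁ ⊤) := hU.image_of_isOpenImmersion _
  have h1 := ideal_comap_top (f.resLE U.1 V.1 h) (I.comap U.1.ι) hV hU
  rw [← Scheme.IdealSheafData.comap_comp, Scheme.Hom.resLE_comp_ι,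
    Scheme.IdealSheafData.comap_comp, ideal_comap_ι _ _ _ hV', ideal_comap_ι _ _ _ hU'] at h1
  have h2 := (I.comap f).map_ideal' (U := V) (V := ⟨_, hV'⟩) (homOfLE (by simp)).op
  have h3 := I.map_ideal' (U := ⟨_, hU'⟩) (V := U) (homOfLE (by simp)).op
  rw [← h2, h1, ← h3]
  have h4 : (f.resLE U.1 V.1 h).app ⊤ = f.appLE (U.1.ι ''ᵁ ⊤) (V.1.ι ''ᵁ ⊤) (by
      simpa using h) := by
    exact (Scheme.Hom.app_eq_appLE _).trans (Scheme.Hom.resLE_appLE f h ⊤ ⊤ le_rfl)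
  refine ideal_map_map_map _ fun a => ?_
  rw [h4]
  exact (fres_appLE _ _ _).trans (appLE_fres _ _ _)

variable {C C' D : Type*} [CommRing C] [CommRing C'] [CommRing D]

/-- `C'` is the ring of functions on the chart of the blow-up of `Spec C` along `I` on which `e ∈ I`
generates the exceptional divisor: it is the subring of `C[1/e]` of all `r / e ^ n`, `r ∈ I ^ n`. -/
structure IsAwayChart (φ : C →+* C') (I : Ideal C) (e : C) : Prop where
  mem : e ∈ I
  mem_nonZeroDivisors : φ e ∈ nonZeroDivisors C'
  dvd : ∀ f ∈ I, φ e ∣ φ f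
  exists_pow_mul_eq : ∀ z, ∃ n, ∃ r ∈ I ^ n, φ e ^ n * z = φ r
  exists_pow_mul_eq_zero : ∀ r, φ r = 0 → ∃ n : ℕ, e ^ n * r = 0

namespace IsAwayChart

variable {φ : C →+* C'} {I : Ideal C} {e : C}

theorem pow_dvd_of_mem {ψ : C →+* D} (h : ∀ f ∈ I, ψ e ∣ ψ f) {n : ℕ} {r : C} (hr : r ∈ I ^ n) :
    ψ e ^ n ∣ ψ r := by
  have h1 : I.map ψ ≤ Ideal.span {ψ e} := Ideal.map_le_iff_le_comap.mpr fun f hf =>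
    Ideal.mem_span_singleton.mpr (h f hf)
  have h2 := Ideal.pow_right_mono h1 n
  rw [← Ideal.map_pow, Ideal.span_singleton_pow] at h2
  exact Ideal.mem_span_singleton.mp (h2 (Ideal.mem_map_of_mem ψ hr))

theorem exists_lift_aux (hφ : IsAwayChart φ I e) (ψ : C →+* D) (he : ψ e ∈ nonZeroDivisors D)
    (h : ∀ f ∈ I, ψ e ∣ ψ f) (z : C') :
    ∃ w : D, ∀ (n : ℕ) (r : C), φ e ^ n * z = φ r → ψ e ^ n * w = ψ r := by
  obtain ⟨n, r, hr, hz⟩ := hφ.exists_pow_mul_eq z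
  obtain ⟨w, hw⟩ := pow_dvd_of_mem h hr
  refine ⟨w, fun m s hs => ?_⟩
  have h1 : φ (e ^ m * r - e ^ n * s) = 0 := by
    simp only [map_sub, map_mul, map_pow]
    rw [← hz, ← hs]; ring
  obtain ⟨k, hk⟩ := hφ.exists_pow_mul_eq_zero _ h1
  have h2 := congrArg ψ hk
  simp only [map_sub, map_mul, map_pow, map_zero, hw] at h2
  have h3 : ψ e ^ (k + n) * (ψ e ^ m * w - ψ s) = 0 := by rw [← h2]; ring
  have h4 := (mul_left_mem_nonZeroDivisors_eq_zero_iff (pow_mem he (k + n))).mp h3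
  exact sub_eq_zero.mp h4

/-- The universal property of the charts of a blow-up. -/
def lift (hφ : IsAwayChart φ I e) (ψ : C →+* D) (he : ψ e ∈ nonZeroDivisors D)
    (h : ∀ f ∈ I, ψ e ∣ ψ f) : C' →+* D where
  toFun z := (hφ.exists_lift_aux ψ he h z).choose
  map_one' := by
    have h1 := (hφ.exists_lift_aux ψ he h 1).choose_spec 0 1 (by simp)
    simpa using h1
  map_zero' := by
    have h1 := (hφ.exists_lift_aux ψ he h 0).choose_spec 0 0 (by simp)
    simpa using h1
  map_mul' x y := by
    obtain ⟨n, r, hr, hx⟩ := hφ.exists_pow_mul_eq x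
    obtain ⟨m, s, hs, hy⟩ := hφ.exists_pow_mul_eq y
    have h1 := (hφ.exists_lift_aux ψ he h x).choose_spec n r hx
    have h2 := (hφ.exists_lift_aux ψ he h y).choose_spec m s hy
    have h3 := (hφ.exists_lift_aux ψ he h (x * y)).choose_spec (n + m) (r * s) (by
      rw [map_mul, ← hx, ← hy]; ring)
    refine mul_cancel_left_mem_nonZeroDivisors (pow_mem he (n + m)) |>.mp ?_
    rw [h3, map_mul, ← h1, ← h2]; ring
  map_add' x y := by
    obtain ⟨n, r, hr, hx⟩ := hφ.exists_pow_mul_eq x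
    obtain ⟨m, s, hs, hy⟩ := hφ.exists_pow_mul_eq y
    have h1 := (hφ.exists_lift_aux ψ he h x).choose_spec n r hx
    have h2 := (hφ.exists_lift_aux ψ he h y).choose_spec m s hy
    have h3 := (hφ.exists_lift_aux ψ he h (x + y)).choose_spec (n + m) (e ^ m * r + e ^ n * s) (by
      simp only [map_add, map_mul, map_pow]; rw [← hx, ← hy]; ring)
    refine mul_cancel_left_mem_nonZeroDivisors (pow_mem he (n + m)) |>.mp ?_
    rw [h3]
    simp only [map_add, map_mul, map_pow]; rw [← h1, ← h2]; ring

theorem lift_spec (hφ : IsAwayChart φ I e) (ψ : C →+* D) (he : ψ e ∈ nonZeroDivisors D)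
    (h : ∀ f ∈ I, ψ e ∣ ψ f) {z : C'} {n : ℕ} {r : C} (hr : φ e ^ n * z = φ r) :
    ψ e ^ n * hφ.lift ψ he h z = ψ r :=
  (hφ.exists_lift_aux ψ he h z).choose_spec n r hr

theorem lift_comp (hφ : IsAwayChart φ I e) (ψ : C →+* D) (he : ψ e ∈ nonZeroDivisors D)
    (h : ∀ f ∈ I, ψ e ∣ ψ f) (c : C) : hφ.lift ψ he h (φ c) = ψ c := by
  simpa using hφ.lift_spec ψ he h (z := φ c) (n := 0) (r := c) (by simp)

theorem hom_ext (hφ : IsAwayChart φ I e) {α β : C' →+* D} (he : α (φ e) ∈ nonZeroDivisors D)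
    (h : ∀ c, α (φ c) = β (φ c)) : α = β := by
  refine RingHom.ext fun z => ?_
  obtain ⟨n, r, hr, hz⟩ := hφ.exists_pow_mul_eq z
  refine mul_cancel_left_mem_nonZeroDivisors (pow_mem he n) |>.mp ?_
  rw [← map_pow, ← map_mul, hz, h, ← hz, map_mul, map_pow, map_pow, h]

/-- Two charts of a blow-up defined by the same function are isomorphic. -/
theorem exists_ringEquiv {φ' : C →+* D} (hφ : IsAwayChart φ I e) (hφ' : IsAwayChart φ' I e) :
    ∃ α : C' ≃+* D, ∀ c, α (φ c) = φ' c := by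
  let α := hφ.lift φ' hφ'.mem_nonZeroDivisors hφ'.dvd
  let β := hφ'.lift φ hφ.mem_nonZeroDivisors hφ.dvd
  have hα : ∀ c, α (φ c) = φ' c := hφ.lift_comp _ _ _
  have hβ : ∀ c, β (φ' c) = φ c := hφ'.lift_comp _ _ _
  have h1 : β.comp α = RingHom.id _ := hφ.hom_ext (by
    simpa [hα, hβ] using hφ.mem_nonZeroDivisors) fun c => by simp [hα, hβ]
  have h2 : α.comp β = RingHom.id _ := hφ'.hom_ext (by
    simpa [hα, hβ] using hφ'.mem_nonZeroDivisors) fun c => by simp [hα, hβ]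
  exact ⟨RingEquiv.ofRingHom α β h2 h1, hα⟩

theorem exists_pow_mul_add (hmem : e ∈ I) {x y : C'} (hx : ∃ n, ∃ r ∈ I ^ n, φ e ^ n * x = φ r)
    (hy : ∃ n, ∃ r ∈ I ^ n, φ e ^ n * y = φ r) : ∃ n, ∃ r ∈ I ^ n, φ e ^ n * (x + y) = φ r := by
  obtain ⟨n, r, hr, hx⟩ := hx
  obtain ⟨m, s, hs, hy⟩ := hy
  refine ⟨n + m, r * e ^ m + e ^ n * s, ?_, by
    simp only [map_add, map_mul, map_pow]; rw [← hx, ← hy]; ring⟩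
  rw [pow_add]
  exact add_mem (Ideal.mul_mem_mul hr (Ideal.pow_mem_pow hmem m))
    (Ideal.mul_mem_mul (Ideal.pow_mem_pow hmem n) hs)

/-- A criterion for `C'` to be a chart of a blow-up, in terms of generators. -/
theorem of_generators (hmem : e ∈ I) (hnzd : φ e ∈ nonZeroDivisors C')
    (hdvd : ∀ f ∈ I, φ e ∣ φ f) (hker : ∀ r, φ r = 0 → ∃ n : ℕ, e ^ n * r = 0) (S : Set C')
    (hS : ∀ u ∈ S, ∃ r ∈ I, φ e * u = φ r)
    (hgen : letI := φ.toAlgebra; Algebra.adjoin C S = ⊤) : IsAwayChart φ I e := by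
  refine ⟨hmem, hnzd, hdvd, fun z => ?_, hker⟩
  let _ := φ.toAlgebra
  have hz : z ∈ Algebra.adjoin C S := by rw [hgen]; trivial
  induction hz using Algebra.adjoin_induction with
  | mem u hu =>
    obtain ⟨r, hr, h⟩ := hS u hu
    exact ⟨1, r, by simpa using hr, by simpa using h⟩
  | algebraMap c => exact ⟨0, c, by simp, by rw [pow_zero, one_mul]; rfl⟩
  | add x y _ _ hx hy => exact exists_pow_mul_add hmem hx hy
  | mul x y _ _ hx hy =>
    obtain ⟨n, r, hr, hx⟩ := hx
    obtain ⟨m, s, hs, hy⟩ := hy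
    refine ⟨n + m, r * s, ?_, by rw [map_mul, ← hx, ← hy]; ring⟩
    rw [pow_add]
    exact Ideal.mul_mem_mul hr hs

/-- If the functions `φ c` with `c ∈ I` are divisible by `e` in a ring over `C`, an algebra which
embeds in it has kernel consisting of `e`-torsion. -/
theorem exists_pow_mul_eq_zero_of_lift {χ : C' →+* Localization.Away e}
    (hχ : ∀ c, χ (φ c) = algebraMap C _ c) (r : C) (hr : φ r = 0) : ∃ n : ℕ, e ^ n * r = 0 := by
  have h := hχ r
  rw [hr, map_zero] at h
  obtain ⟨⟨_, n, rfl⟩, hn⟩ := (IsLocalization.map_eq_zero_iff (.powers e) _ r).mp h.symm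
  exact ⟨n, hn⟩

section BaseChange
open TensorProduct
variable {Λ Λ' : Type*} [CommRing Λ] [CommRing Λ'] [Algebra Λ Λ'] {J : Ideal Λ} {ε : Λ}

/-- The charts of blow-ups are compatible with flat base change. -/
theorem baseChange (h : IsAwayChart (algebraMap Λ Λ') J ε) [Algebra Λ C] [Module.Flat Λ C] :
    IsAwayChart (algebraMap C (C ⊗[Λ] Λ')) (J.map (algebraMap Λ C)) (algebraMap Λ C ε) := by
  have hcomm : ∀ l : Λ, algebraMap C (C ⊗[Λ] Λ') (algebraMap Λ C l) =
      1 ⊗ₜ algebraMap Λ Λ' l := fun l => by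
    rw [Algebra.TensorProduct.algebraMap_apply, Algebra.algebraMap_self, RingHom.id_apply,
      Algebra.algebraMap_eq_smul_one, TensorProduct.smul_tmul, Algebra.algebraMap_eq_smul_one]
  let L := Localization.Away (algebraMap Λ C ε)
  have hu : IsUnit (algebraMap Λ L ε) :=
    IsLocalization.Away.algebraMap_isUnit (S := L) (algebraMap Λ C ε)
  let χ₀ : Λ' →+* L := h.lift (algebraMap Λ L) hu.mem_nonZeroDivisors fun f _ => hu.dvd
  let χ₁ : Λ' →ₐ[Λ] L := { χ₀ with commutes' := h.lift_comp _ _ _ }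
  let χ : C ⊗[Λ] Λ' →ₐ[C] L := Algebra.TensorProduct.lift (Algebra.ofId C L) χ₁
    fun _ _ => .all _ _
  refine ⟨Ideal.mem_map_of_mem _ h.mem, ?_, ?_, fun z => ?_,
    exists_pow_mul_eq_zero_of_lift (χ := χ.toRingHom) fun c => χ.commutes c⟩
  · have hinj : Function.Injective (LinearMap.lTensor C (LinearMap.mulLeft Λ (algebraMap Λ Λ' ε))) :=
      Module.Flat.lTensor_preserves_injective_linearMap _ fun x y hxy =>
        mul_cancel_left_mem_nonZeroDivisors h.mem_nonZeroDivisors |>.mp hxy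
    rw [mem_nonZeroDivisors_iff_right]
    intro z hz
    refine hinj ((Eq.trans ?_ hz).trans (map_zero _).symm)
    rw [hcomm]
    clear hz
    induction z with
    | zero => rw [map_zero, zero_mul]
    | tmul c l => rw [LinearMap.lTensor_tmul, Algebra.TensorProduct.tmul_mul_tmul, mul_one,
        LinearMap.mulLeft_apply, mul_comm]
    | add x y hx hy => rw [map_add, hx, hy, add_mul]
  · intro f hf
    have hle : J.map (algebraMap Λ C) ≤ (Ideal.span {algebraMap C (C ⊗[Λ] Λ') (algebraMap Λ C ε)}).comap
        (algebraMap C (C ⊗[Λ] Λ')) := Ideal.map_le_iff_le_comap.mpr fun l hl => by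
      rw [Ideal.mem_comap, Ideal.mem_comap, Ideal.mem_span_singleton, hcomm, hcomm]
      exact map_dvd (Algebra.TensorProduct.includeRight : Λ' →ₐ[Λ] C ⊗[Λ] Λ') (h.dvd l hl)
    exact Ideal.mem_span_singleton.mp (hle hf)
  · induction z with
    | zero => exact ⟨0, 0, by simp, by simp⟩
    | tmul c l =>
      obtain ⟨n, r, hr, hl⟩ := h.exists_pow_mul_eq l
      refine ⟨n, c * algebraMap Λ C r, ?_, ?_⟩
      · rw [← Ideal.map_pow]
        exact Ideal.mul_mem_left _ _ (Ideal.mem_map_of_mem _ hr)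
      · rw [map_mul, hcomm, hcomm, ← hl, Algebra.TensorProduct.tmul_pow, one_pow,
          Algebra.TensorProduct.tmul_mul_tmul, one_mul, Algebra.TensorProduct.algebraMap_apply,
          Algebra.algebraMap_self, RingHom.id_apply, Algebra.TensorProduct.tmul_mul_tmul, mul_one,
          one_mul]
    | add x y hx hy => exact exists_pow_mul_add (Ideal.mem_map_of_mem _ h.mem) hx hy
end BaseChange
end IsAwayChart

end

/-! ### Charts of the blow-up -/

section

variable {X Y S : Scheme.{u}}

/-- Functions on an affine chart, in terms of its ring. -/
theorem exists_ringEquiv_of_chart {R : CommRingCat.{u}} (j : Spec R ⟶ Y) [IsOpenImmersion j]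
    (π : Y ⟶ X) {U : X.Opens} (hU : IsAffineOpen U) (φ : Γ(X, U) ⟶ R)
    (h : j ≫ π = Spec.map φ ≫ hU.fromSpec) {D : Y.Opens} (hD : D = j.opensRange) :
    ∃ (hle : D ≤ π ⁻¹ᵁ U) (β : R ≃+* Γ(Y, D)), (∀ c, β (φ c) = π.appLE U D hle c) ∧
      ∀ r, Y.basicOpen (β r) = j ''ᵁ (PrimeSpectrum.basicOpen r) := by
  rw [← Scheme.Hom.image_top_eq_opensRange] at hD
  subst hD
  have hle : j ''ᵁ ⊤ ≤ π ⁻¹ᵁ U := by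
    rintro _ ⟨x, -, rfl⟩
    change π (j x) ∈ U
    rw [← Scheme.Hom.comp_apply, h, Scheme.Hom.comp_apply]
    exact hU.range_fromSpec.le ⟨_, rfl⟩
  let β := (Scheme.ΓSpecIso R).symm ≪≫ (j.appIso ⊤).symm
  refine ⟨hle, β.commRingCatIsoToRingEquiv, fun c => ?_, fun r => ?_⟩
  · have h1 : φ ≫ β.hom = π.appLE U _ hle := by
      rw [← Iso.eq_comp_inv]
      change _ = _ ≫ (j.appIso ⊤).hom ≫ (Scheme.ΓSpecIso R).hom
      rw [Scheme.Hom.appIso_hom', Scheme.Hom.appLE_comp_appLE_assoc]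
      have h2 : ∀ (g : Spec R ⟶ X) (hg : g = Spec.map φ ≫ hU.fromSpec) (e : ⊤ ≤ g ⁻¹ᵁ U),
          g.appLE U ⊤ e = φ ≫ (Scheme.ΓSpecIso R).inv := by
        rintro _ rfl e
        rw [Scheme.ΓSpecIso_inv_naturality]
        have h3 : (⊤ : (Spec Γ(X, U)).Opens) ≤ hU.fromSpec ⁻¹ᵁ U := hU.fromSpec_preimage_self.ge
        rw [← Scheme.Hom.appLE_comp_appLE (Spec.map φ) hU.fromSpec U ⊤ ⊤ h3 le_top]
        congr 1
        · rw [Scheme.Hom.appLE, hU.fromSpec_app_self]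
          rw [Category.assoc, ← Functor.map_comp]
          exact (congrArg (_ ≫ ·) ((Spec Γ(X, U)).presheaf.map_id _)).trans (Category.comp_id _)
      rw [h2 _ h]
      simp
    exact congrArg (fun g => g c) (congrArg ConcreteCategory.hom h1)
  · change Y.basicOpen ((j.appIso ⊤).inv ((Scheme.ΓSpecIso R).inv r)) = _
    rw [← Scheme.image_basicOpen, basicOpen_eq_of_affine]

section Rees
variable {A : Type u} [CommRing A] {I : Ideal A} {e : A}

theorem reesMonomial_mul {n m : ℕ} {r s : A} (hr : r ∈ I ^ n) (hs : s ∈ I ^ m)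
    (hrs : r * s ∈ I ^ (n + m)) :
    reesMonomial I n r hr * reesMonomial I m s hs = reesMonomial I (n + m) (r * s) hrs :=
  Subtype.ext (monomial_mul_monomial n m r s)

theorem reesMonomial_pow (he : e ∈ I ^ 1) (n : ℕ) :
    reesMonomial I 1 e he ^ n = reesMonomial I n (e ^ n) (by
      have := Ideal.pow_mem_pow he n; rwa [pow_one] at this) :=
  Subtype.ext ((monomial_pow 1 e n).trans (by rw [one_mul]; rfl))

theorem reesMonomial_eq_zero {n : ℕ} {r : A} (hr : r ∈ I ^ n) :
    reesMonomial I n r hr = 0 ↔ r = 0 := by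
  rw [← Subtype.coe_inj]
  exact monomial_eq_zero_iff r n

theorem smul_reesMonomial {n : ℕ} {r : A} (hr : r ∈ I ^ n) (a : A) :
    a • reesMonomial I n r hr = reesMonomial I n (a * r) (Ideal.mul_mem_left _ a hr) :=
  Subtype.ext (smul_monomial a n r)

theorem IsAwayChart.of_fractions {B : Type*} [CommRing B] {φ : A →+* B} (he : e ∈ I)
    (mk : ∀ (n : ℕ) (r : A), r ∈ I ^ n → B) (hz : ∀ z, ∃ n r, ∃ hr : r ∈ I ^ n, z = mk n r hr)
    (hmul : ∀ (a : A) (n : ℕ) (r : A) (hr : r ∈ I ^ n),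
      φ a * mk n r hr = mk n (a * r) (Ideal.mul_mem_left _ a hr))
    (hzero : ∀ (n : ℕ) (r : A) (hr : r ∈ I ^ n), mk n r hr = 0 ↔ ∃ m : ℕ, e ^ m * r = 0)
    (hone : ∀ n, mk n (e ^ n) (Ideal.pow_mem_pow he n) = 1) : IsAwayChart φ I e := by
  have hbase : ∀ (n : ℕ) (r : A), φ r =
      mk n (r * e ^ n) (Ideal.mul_mem_left _ r (Ideal.pow_mem_pow he n)) := by
    intro n r
    rw [← hmul _ _ _ (Ideal.pow_mem_pow he n), hone, mul_one]
  refine ⟨he, ?_, fun f hf => ?_, fun z => ?_, fun r hr => ?_⟩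
  · refine mem_nonZeroDivisors_iff_right.mpr fun z h => ?_
    obtain ⟨n, r, hr, rfl⟩ := hz z
    rw [mul_comm, hmul, hzero] at h
    obtain ⟨m, hm⟩ := h
    rw [hzero]
    exact ⟨m + 1, by rw [← hm]; ring⟩
  · refine ⟨mk 1 f (by simpa using hf), ?_⟩
    rw [hmul, hbase 1 f]
    congr 1
    ring
  · obtain ⟨n, r, hr, rfl⟩ := hz z
    refine ⟨n, r, hr, ?_⟩
    rw [← map_pow, hmul, hbase n r]
    congr 1
    ring
  · rw [hbase 0 r, hzero] at hr
    obtain ⟨m, hm⟩ := hr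
    exact ⟨m, by simpa using hm⟩

/-- The chart `D₊(eT)` of the homogeneous spectrum of the Rees algebra. -/
theorem isAwayChart_awayBase (he : e ∈ I) :
    IsAwayChart (awayBase (reesGrading I) (reesMonomial I 1 e (by simpa using he))) I e := by
  have he' : e ∈ I ^ 1 := by simpa using he
  have hs := reesMonomial_mem I 1 e he'
  have hmk : ∀ (n : ℕ) (r : A) (hr : r ∈ I ^ n), reesMonomial I n r hr ∈ reesGrading I (n • 1) := by
    intro n r hr
    rw [nsmul_one]
    exact reesMonomial_mem I n r hr
  have hz : ∀ z : Away (reesGrading I) (reesMonomial I 1 e he'), ∃ n r, ∃ hr : r ∈ I ^ n,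
      z = Away.mk _ hs n (reesMonomial I n r hr) (hmk n r hr) := by
    intro z
    obtain ⟨n, p, hp, rfl⟩ := Away.mk_surjective _ hs z
    obtain ⟨r, hr, hpr⟩ := exists_reesMonomial hp
    have hr' : r ∈ I ^ n := by simpa using hr
    refine ⟨n, r, hr', ?_⟩
    congr 1
    rw [hpr]
    refine Subtype.ext ?_
    change monomial (n • 1) r = monomial n r
    simp
  have hmul : ∀ (a : A) (n : ℕ) (r : A) (hr : r ∈ I ^ n),
      awayBase (reesGrading I) (reesMonomial I 1 e he') a *
        Away.mk _ hs n (reesMonomial I n r hr) (hmk n r hr) =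
      Away.mk _ hs n (reesMonomial I n (a * r) (Ideal.mul_mem_left _ a hr)) (hmk n _ _) := by
    intro a n r hr
    rw [awayBase_mul_mk]
    congr 1
    exact smul_reesMonomial hr a
  have hzero : ∀ (n : ℕ) (r : A) (hr : r ∈ I ^ n),
      Away.mk _ hs n (reesMonomial I n r hr) (hmk n r hr) = 0 ↔ ∃ m : ℕ, e ^ m * r = 0 := by
    intro n r hr
    constructor
    · intro h
      obtain ⟨m, hm⟩ := away_mk_eq_zero _ _ _ _ _ h
      rw [reesMonomial_pow, reesMonomial_mul _ _ (by
        rw [pow_add]; exact Ideal.mul_mem_mul (Ideal.pow_mem_pow he m) hr),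
        reesMonomial_eq_zero] at hm
      exact ⟨m, hm⟩
    · rintro ⟨m, hm⟩
      apply HomogeneousLocalization.val_injective
      rw [Away.val_mk, HomogeneousLocalization.val_zero, Localization.mk_eq_mk',
        IsLocalization.mk'_eq_zero_iff]
      refine ⟨⟨_, m, rfl⟩, ?_⟩
      change reesMonomial I 1 e he' ^ m * _ = 0
      rw [reesMonomial_pow, reesMonomial_mul _ _ (by
        rw [pow_add]; exact Ideal.mul_mem_mul (Ideal.pow_mem_pow he m) hr),
        reesMonomial_eq_zero]
      exact hm
  have hone : ∀ (n : ℕ) (h : e ^ n ∈ I ^ n),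
      Away.mk _ hs n (reesMonomial I n (e ^ n) h) (hmk n _ h) = 1 := by
    intro n h
    apply HomogeneousLocalization.val_injective
    rw [Away.val_mk, HomogeneousLocalization.val_one, ← Localization.mk_one,
      Localization.mk_eq_mk_iff, Localization.r_iff_exists]
    refine ⟨1, ?_⟩
    simp [reesMonomial_pow]
  exact .of_fractions he (fun n r hr => Away.mk _ hs n (reesMonomial I n r hr) (hmk n r hr))
    hz hmul hzero fun n => hone n _
end Rees

section Charts
variable (I : X.IdealSheafData) (W : X.affineOpens)

/-- The blow-up of the affine open `W`, as an open subscheme of the blow-up. -/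
def blowUpι : Proj (reesGrading (I.ideal W)) ⟶ blowUp I :=
  (blowUpGluingData I).cover.f (⟨W.1, W.2⟩ : X.AffineZariskiSite)

instance : IsOpenImmersion (blowUpι I W) :=
  (blowUpGluingData I).cover.map_prop (⟨W.1, W.2⟩ : X.AffineZariskiSite)

theorem blowUpι_π : blowUpι I W ≫ blowUpπ I = projToSpec (reesGrading (I.ideal W)) ≫ W.2.fromSpec := by
  refine ((blowUpGluingData I).ι_toBase (⟨W.1, W.2⟩ : X.AffineZariskiSite)).trans ?_
  refine (Category.assoc _ _ _).trans ?_
  exact congrArg (_ ≫ ·) W.2.isoSpec_inv_ι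

theorem blowUpι_opensRange : blowUpπ I ⁻¹ᵁ W.1 = (blowUpι I W).opensRange := by
  have h := (blowUpGluingData I).toBase_preimage_eq_opensRange_ι
    (⟨W.1, W.2⟩ : X.AffineZariskiSite)
  refine Eq.trans ?_ h
  exact congrArg (fun W => blowUpπ I ⁻¹ᵁ W) (Scheme.Opens.opensRange_ι W.1).symm

variable {I W} {e : Γ(X, W.1)} (he : e ∈ I.ideal W)

/-- The element `e T` of degree one in the Rees algebra. -/
abbrev reesGen : reesAlgebra (I.ideal W) := reesMonomial (I.ideal W) 1 e (by simpa using he)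

theorem reesGen_mem : reesGen he ∈ reesGrading (I.ideal W) 1 := reesMonomial_mem _ _ _ _

/-- The chart `D₊(eT)` of the blow-up along `I`, for `e ∈ I`. -/
def blowUpChartι : Spec (.of (Away (reesGrading (I.ideal W)) (reesGen he))) ⟶ blowUp I :=
  Proj.awayι _ (reesGen he) (reesGen_mem he) one_pos ≫ blowUpι I W

instance : IsOpenImmersion (blowUpChartι he) := by unfold blowUpChartι; infer_instance

/-- The open subscheme of the blow-up on which `e` generates the inverse image of `I`. -/
def blowUpChart : (blowUp I).Opens := (blowUpChartι he).opensRange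

theorem isAffineOpen_blowUpChart : IsAffineOpen (blowUpChart he) := isAffineOpen_opensRange _

theorem blowUpChart_eq : blowUpChart he = blowUpι I W ''ᵁ Proj.basicOpen _ (reesGen he) := by
  rw [← Proj.opensRange_awayι _ (reesGen he) (reesGen_mem he) one_pos]
  exact Scheme.Hom.opensRange_comp _ _

theorem exists_ringEquiv_blowUpChart :
    ∃ (hle : blowUpChart he ≤ blowUpπ I ⁻¹ᵁ W.1)
      (β : Away (reesGrading (I.ideal W)) (reesGen he) ≃+* Γ(blowUp I, blowUpChart he)),
      (∀ c, β (awayBase _ _ c) = (blowUpπ I).appLE W.1 _ hle c) ∧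
      ∀ r, (blowUp I).basicOpen (β r) = blowUpChartι he ''ᵁ (PrimeSpectrum.basicOpen r) := by
  refine exists_ringEquiv_of_chart (blowUpChartι he) (blowUpπ I) W.2
    (CommRingCat.ofHom (awayBase _ (reesGen he))) ?_ rfl
  rw [blowUpChartι, Category.assoc, blowUpι_π, ← Category.assoc]
  exact congrArg (· ≫ W.2.fromSpec) (awayι_projToSpec _ (reesGen he) (reesGen_mem he) one_pos)

theorem IsAwayChart.of_ringEquiv {A B C : Type*} [CommRing A] [CommRing B] [CommRing C]
    {φ : A →+* B} {J : Ideal A} {e : A} (h : IsAwayChart φ J e) (β : B ≃+* C) {ψ : A →+* C}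
    (hψ : ∀ a, β (φ a) = ψ a) : IsAwayChart ψ J e := by
  refine ⟨h.mem, ?_, fun f hf => ?_, fun z => ?_, fun r hr => ?_⟩
  · rw [← hψ]
    exact (MulEquivClass.map_nonZeroDivisors β.toMulEquiv).le ⟨_, h.mem_nonZeroDivisors, rfl⟩
  · rw [← hψ, ← hψ]; exact map_dvd β (h.dvd f hf)
  · obtain ⟨n, r, hr, h1⟩ := h.exists_pow_mul_eq (β.symm z)
    refine ⟨n, r, hr, ?_⟩
    rw [← hψ, ← hψ, ← h1, map_mul, map_pow, RingEquiv.apply_symm_apply]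
  · rw [← hψ, map_eq_zero_iff β β.injective] at hr
    exact h.exists_pow_mul_eq_zero r hr

theorem blowUpChart_le : blowUpChart he ≤ blowUpπ I ⁻¹ᵁ W.1 := (exists_ringEquiv_blowUpChart he).1

theorem isAwayChart_blowUpChart :
    IsAwayChart ((blowUpπ I).appLE W.1 _ (blowUpChart_le he)).hom (I.ideal W) e := by
  obtain ⟨_, β, hβ, _⟩ := exists_ringEquiv_blowUpChart he
  exact (isAwayChart_awayBase he).of_ringEquiv β hβ

/-- The charts defined by generators of the ideal cover the blow-up. -/
theorem exists_mem_blowUpChart {T : Set Γ(X, W.1)} (hT : I.ideal W = Ideal.span T) {z : blowUp I}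
    (hz : z ∈ blowUpπ I ⁻¹ᵁ W.1) : ∃ (e : Γ(X, W.1)) (_ : e ∈ T) (he : e ∈ I.ideal W),
      z ∈ blowUpChart he := by
  rw [blowUpι_opensRange] at hz
  obtain ⟨z, rfl⟩ := hz
  by_contra! hcon
  refine z.not_irrelevant_le ?_
  have h1 : ∀ r (hr : r ∈ I.ideal W), reesGen hr ∈ z.asHomogeneousIdeal := by
    intro r hr
    have hr' := hr
    rw [hT] at hr'
    suffices H : ∃ hr : r ∈ I.ideal W, reesGen hr ∈ z.asHomogeneousIdeal from H.2
    refine Submodule.span_induction (p := fun r _ => ∃ hr : r ∈ I.ideal W,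
      reesGen hr ∈ z.asHomogeneousIdeal) ?_ ?_ ?_ ?_ hr'
    · intro e he
      have he' : e ∈ I.ideal W := hT ▸ Ideal.subset_span he
      refine ⟨he', ?_⟩
      by_contra h
      refine hcon e he he' ?_
      rw [blowUpChart_eq]
      exact ⟨z, h, rfl⟩
    · exact ⟨zero_mem _, by
        rw [reesGen, (reesMonomial_eq_zero _).mpr rfl]; exact zero_mem _⟩
    · rintro x y - - ⟨hx, hx'⟩ ⟨hy, hy'⟩
      refine ⟨add_mem hx hy, ?_⟩
      convert add_mem hx' hy'
      exact Subtype.ext (map_add (monomial 1) x y)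
    · rintro a x - ⟨hx, hx'⟩
      refine ⟨Ideal.mul_mem_left _ a hx, ?_⟩
      convert z.asHomogeneousIdeal.toIdeal.mul_mem_left (algebraMap _ _ a) hx'
      rw [← Algebra.smul_def]
      exact Iff.of_eq (congrArg (· ∈ z.asHomogeneousIdeal) (smul_reesMonomial _ a).symm)
  rw [HomogeneousIdeal.irrelevant_le]
  intro n hn b hb
  obtain ⟨r, hr, rfl⟩ := exists_reesMonomial hb
  obtain ⟨n, rfl⟩ := Nat.exists_eq_succ_of_ne_zero hn.ne'
  suffices H : ∃ hr, reesMonomial (I.ideal W) (n + 1) r hr ∈ z.asHomogeneousIdeal from H.2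
  have hr' := hr
  rw [pow_succ] at hr'
  refine Submodule.mul_induction_on hr' ?_ ?_
  · intro a ha c hc
    refine ⟨by rw [pow_succ]; exact Ideal.mul_mem_mul ha hc, ?_⟩
    rw [← reesMonomial_mul ha (by simpa using hc)]
    exact z.asHomogeneousIdeal.toIdeal.mul_mem_left _ (h1 c hc)
  · rintro x y ⟨hx, hx'⟩ ⟨hy, hy'⟩
    refine ⟨add_mem hx hy, ?_⟩
    convert add_mem hx' hy'
    exact Subtype.ext (map_add (monomial (n + 1)) x y)

theorem mem_nonZeroDivisors_of_flat {A B : Type*} [CommRing A] [CommRing B] {φ : A →+* B}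
    (hφ : φ.Flat) {a : A} (ha : a ∈ nonZeroDivisors A) : φ a ∈ nonZeroDivisors B := by
  algebraize [φ]
  have h : IsSMulRegular B a := Module.Flat.isSMulRegular_of_nonZeroDivisors ha
  refine mem_nonZeroDivisors_iff_right.mpr fun z hz => h ?_
  change a • z = a • 0
  rw [smul_zero, Algebra.smul_def, mul_comm]
  exact hz

theorem mem_nonZeroDivisors_fres {D V : Y.Opens} (hD : IsAffineOpen D)
    (h : V ≤ D) {e : Γ(Y, D)} (he : e ∈ nonZeroDivisors Γ(Y, D)) :
    fres h e ∈ nonZeroDivisors Γ(Y, V) := by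
  refine mem_nonZeroDivisors_iff_right.mpr fun z hz => functions_ext fun x hx => ?_
  obtain ⟨s, hs, hxs⟩ := hD.exists_basicOpen_le ⟨x, hx⟩ (h hx)
  refine ⟨Y.basicOpen s, hs, hxs, ?_⟩
  have : IsLocalization.Away s Γ(Y, Y.basicOpen s) := hD.isLocalization_basicOpen s
  have h1 : algebraMap Γ(Y, D) Γ(Y, Y.basicOpen s) e ∈ nonZeroDivisors _ :=
    IsLocalization.map_nonZeroDivisors_le (.powers s) _ ⟨e, he, rfl⟩
  have h2 := congrArg (fres hs) hz
  rw [map_mul, fres_fres, map_zero] at h2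
  rw [map_zero]
  exact mem_nonZeroDivisors_iff_right.mp h1 _ h2

/-- A point of the blow-up lies in the chart defined by `e` if `e` generates the inverse image
of the ideal near this point. -/
theorem mem_blowUpChart {z : blowUp I} {V : (blowUp I).Opens} (hz : z ∈ V)
    (hV : V ≤ blowUpπ I ⁻¹ᵁ W.1)
    (h : ∀ f ∈ I.ideal W, (blowUpπ I).appLE W.1 V hV e ∣ (blowUpπ I).appLE W.1 V hV f) :
    z ∈ blowUpChart he := by
  obtain ⟨e', -, he', hz'⟩ := exists_mem_blowUpChart (Ideal.span_eq (I.ideal W)).symm (hV hz)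
  obtain ⟨hle, β, hβ, hβ'⟩ := exists_ringEquiv_blowUpChart he'
  let l : Away _ (reesGen he') := Away.isLocalizationElem (reesGen_mem he') (reesGen_mem he)
  have hl : awayBase _ (reesGen he') e = awayBase _ (reesGen he') e' * l := by
    apply HomogeneousLocalization.val_injective
    rw [HomogeneousLocalization.val_mul, awayBase_val, awayBase_val, Away.val_mk,
      Localization.mk_mul, Localization.mk_eq_mk_iff, Localization.r_iff_exists]
    refine ⟨1, ?_⟩
    simp only [OneMemClass.coe_one, one_mul, pow_one, ← Algebra.smul_def, smul_reesMonomial]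
    rw [mul_comm, ← Algebra.smul_def, smul_reesMonomial]
    congr 1
    ring
  have hle' : (blowUp I).basicOpen (β l) ≤ blowUpChart he := by
    rw [hβ', blowUpChart_eq]
    rintro _ ⟨x, hx, rfl⟩
    refine ⟨Proj.awayι _ (reesGen he') (reesGen_mem he') one_pos x, ?_, rfl⟩
    exact (Proj.awayι_preimage_basicOpen _ (reesGen_mem he') one_pos (reesGen_mem he) one_pos).ge hx
  refine hle' ?_
  obtain ⟨s, hs, hzs⟩ := (isAffineOpen_blowUpChart he').exists_basicOpen_le ⟨z, hz⟩ hz'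
  have hsD : (blowUp I).basicOpen s ≤ blowUpChart he' := (blowUp I).basicOpen_le s
  have hnzd := mem_nonZeroDivisors_fres (isAffineOpen_blowUpChart he')
    hsD
    (isAwayChart_blowUpChart he').mem_nonZeroDivisors
  obtain ⟨c, hc⟩ := h e' he'
  have h1 := congrArg (fres hs) hc
  have h2 := congrArg (fun r => fres hsD (β r)) hl
  simp only [map_mul, hβ] at h2
  rw [map_mul, fres_appLE, fres_appLE] at h1
  change fres hsD ((blowUpπ I).appLE W.1 _ hle e) =
    fres hsD ((blowUpπ I).appLE W.1 _ hle e') * fres hsD (β l) at h2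
  change fres hsD ((blowUpπ I).appLE W.1 _ hle e') ∈ _ at hnzd
  rw [fres_appLE] at h2 hnzd
  rw [fres_appLE] at h2
  have h3 : fres hsD (β l) * fres hs c = 1 := by
    refine mul_cancel_left_mem_nonZeroDivisors hnzd |>.mp ?_
    rw [← mul_assoc, ← h2, ← h1, mul_one]
  have h4 : fres hsD (β l) * fres hs c = 1 → z ∈ (blowUp I).basicOpen (β l) := by
    intro h3
    have h5 : (blowUp I).basicOpen (fres hsD (β l)) = (blowUp I).basicOpen s :=
      Scheme.basicOpen_of_isUnit _ (IsUnit.of_mul_eq_one _ h3)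
    rw [Scheme.basicOpen_res] at h5
    exact (h5.ge hzs).2
  exact h4 h3

end Charts

end

/-! ### Charts of dilatations -/

section

variable {X P Y S : Scheme.{u}}

theorem isAffineOpen_image_ι_top (V : X.affineOpens) : IsAffineOpen (V.1.ι ''ᵁ ⊤) := by
  rw [show V.1.ι ''ᵁ ⊤ = V.1 by simp]
  exact V.2

theorem isAffineOpen_top_toScheme (V : X.affineOpens) : IsAffineOpen (⊤ : V.1.toScheme.Opens) := by
  have : IsAffine V.1.toScheme := V.2
  exact isAffineOpen_top _

theorem comap_ι_eq_iff {I J : X.IdealSheafData} (V : X.affineOpens) :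
    I.comap V.1.ι = J.comap V.1.ι ↔ I.ideal V = J.ideal V := by
  have : IsAffine V.1.toScheme := V.2
  have h1 : ∀ K : X.IdealSheafData, (K.ideal ⟨V.1.ι ''ᵁ ⊤, isAffineOpen_image_ι_top V⟩).map
      (X.presheaf.map (homOfLE (by simp)).op).hom = K.ideal V := fun K =>
    K.map_ideal' (U := V) (V := ⟨_, isAffineOpen_image_ι_top V⟩) (homOfLE (by simp)).op
  have h2 : ∀ K : X.IdealSheafData, (K.ideal V).map (X.presheaf.map (homOfLE (by simp)).op).hom =
      K.ideal ⟨V.1.ι ''ᵁ ⊤, isAffineOpen_image_ι_top V⟩ := fun K =>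
    K.map_ideal' (U := ⟨_, isAffineOpen_image_ι_top V⟩) (V := V) (homOfLE (by simp)).op
  have h3 : ∀ K : X.IdealSheafData, (K.comap V.1.ι).ideal ⟨⊤, isAffineOpen_top_toScheme V⟩ =
      K.ideal ⟨V.1.ι ''ᵁ ⊤, isAffineOpen_image_ι_top V⟩ := fun K => ideal_comap_ι K V.1 _ _
  constructor
  · intro h
    rw [← h1 I, ← h1 J, ← h3 I, ← h3 J, h]
  · intro h
    refine Scheme.IdealSheafData.ext_of_isAffine ((h3 I).trans (Eq.trans ?_ (h3 J).symm))
    rw [← h2 I, ← h2 J, h]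

theorem mem_agreementOpen {I J : X.IdealSheafData} {x : X} : x ∈ agreementOpen I J ↔
    ∃ V : X.Opens, x ∈ V ∧ ∀ V' : X.affineOpens, V'.1 ≤ V → I.ideal V' = J.ideal V' := by
  refine (TopologicalSpace.Opens.mem_sSup).trans ⟨?_, ?_⟩
  · rintro ⟨V, hV, hx⟩
    refine ⟨V, hx, fun V' h => (comap_ι_eq_iff V').mp ?_⟩
    have h1 := congrArg (fun K => K.comap (X.homOfLE h)) hV
    simpa [← Scheme.IdealSheafData.comap_comp] using h1
  · rintro ⟨V, hx, hV⟩
    obtain ⟨V', hV', hxV'⟩ := exists_affine_nhd hx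
    exact ⟨V'.1, (comap_ι_eq_iff V').mpr (hV V' (by first | exact hV' | exact hxV')),
      by first | exact hxV' | exact hV'⟩

section
variable {a a₀ : P ⟶ X} {Y : P.IdealSheafData} {R : X.IdealSheafData} (ha : R.comap a = R.comap a₀)
  {U : X.affineOpens} {t : Γ(X, U.1)} (ht : R.ideal U = Ideal.span {t})
  {W : P.affineOpens} (h : W.1 ≤ a ⁻¹ᵁ U.1)

include ha ht in
theorem comap_ideal_eq_span : (R.comap a₀).ideal W = Ideal.span {a.appLE U.1 W.1 h t} := by
  rw [← ha, ideal_comap a R h, ht, Ideal.map_span, Set.image_singleton]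

include ha ht in
theorem appLE_mem_dilatationIdeal : a.appLE U.1 W.1 h t ∈ (dilatationIdeal a₀ Y R).ideal W := by
  have h1 : (R.comap a₀).ideal W ≤ (dilatationIdeal a₀ Y R).ideal W :=
    (le_sup_right : R.comap a₀ ≤ Y ⊔ R.comap a₀) W
  exact h1 ((comap_ideal_eq_span ha ht h).ge (Ideal.mem_span_singleton_self _))

theorem agreementOpen_inf :
    agreementOpen (R.comap (blowUpπ (dilatationIdeal a₀ Y R) ≫ a₀))
      ((dilatationIdeal a₀ Y R).comap (blowUpπ (dilatationIdeal a₀ Y R))) ⊓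
        blowUpπ (dilatationIdeal a₀ Y R) ⁻¹ᵁ W.1 =
      blowUpChart (appLE_mem_dilatationIdeal (Y := Y) ha ht h) := by
  have he := appLE_mem_dilatationIdeal (Y := Y) ha ht h
  have h1 : ∀ (V : (blowUp (dilatationIdeal a₀ Y R)).affineOpens)
      (hV : V.1 ≤ blowUpπ (dilatationIdeal a₀ Y R) ⁻¹ᵁ W.1),
      (R.comap (blowUpπ (dilatationIdeal a₀ Y R) ≫ a₀)).ideal V =
        Ideal.span {(blowUpπ _).appLE W.1 V.1 hV (a.appLE U.1 W.1 h t)} := by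
    intro V hV
    rw [Scheme.IdealSheafData.comap_comp, ideal_comap _ _ hV, comap_ideal_eq_span ha ht h,
      Ideal.map_span, Set.image_singleton]
  ext z
  constructor
  · rintro ⟨hz, hzW⟩
    obtain ⟨V, hzV, hV⟩ := mem_agreementOpen.mp hz
    obtain ⟨V', hV', hzV'⟩ := exists_affine_nhd (V := V ⊓ blowUpπ _ ⁻¹ᵁ W.1) ⟨hzV, hzW⟩
    refine mem_blowUpChart he (V := V'.1) (by assumption) (hzV'.trans inf_le_right) fun f hf => ?_
    rw [← Ideal.mem_span_singleton, ← h1, hV V' (hzV'.trans inf_le_left),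
      ideal_comap _ _ (hzV'.trans inf_le_right)]
    exact Ideal.mem_map_of_mem _ hf
  · intro hz
    refine ⟨mem_agreementOpen.mpr ⟨_, hz, fun V' hV' => ?_⟩, blowUpChart_le he hz⟩
    have hV := hV'.trans (blowUpChart_le he)
    rw [h1 _ hV, ideal_comap _ _ hV]
    apply le_antisymm
    · rw [Ideal.span_singleton_le_iff_mem]
      exact Ideal.mem_map_of_mem _ he
    · refine Ideal.map_le_iff_le_comap.mpr fun f hf => Ideal.mem_span_singleton.mpr ?_
      have := map_dvd (fres hV') ((isAwayChart_blowUpChart he).dvd f hf)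
      erw [fres_appLE, fres_appLE] at this
      exact this

theorem preimage_ι_comp {Q Z : Scheme.{u}} {G : Z.Opens} {π : Z ⟶ Q} {W : Q.Opens} {D : Z.Opens}
    (hG : G ⊓ π ⁻¹ᵁ W = D) : (G.ι ≫ π) ⁻¹ᵁ W = G.ι ⁻¹ᵁ D := by
  rw [← hG, Scheme.Hom.comp_preimage]
  ext x
  exact ⟨fun hx => ⟨x.2, hx⟩, fun hx => hx.2⟩

theorem IsAwayChart.of_open {Q Z : Scheme.{u}} {G : Z.Opens} {π : Z ⟶ Q} {W : Q.Opens} {D : Z.Opens}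
    {I : Ideal Γ(Q, W)} {e : Γ(Q, W)} (hD : D ≤ π ⁻¹ᵁ W)
    (hc : IsAwayChart (π.appLE W D hD).hom I e) (hDG : D ≤ G) {V : G.toScheme.Opens}
    (hV : V = G.ι ⁻¹ᵁ D) (h : V ≤ (G.ι ≫ π) ⁻¹ᵁ W) :
    IsAwayChart ((G.ι ≫ π).appLE W V h).hom I e := by
  have hiso : IsIso (G.ι.app D) := Scheme.Hom.isIso_app _ _ (by simpa using hDG)
  subst hV
  refine hc.of_ringEquiv (asIso (G.ι.app D)).commRingCatIsoToRingEquiv fun c => ?_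
  change (π.appLE W D hD ≫ G.ι.app D) c = _
  rw [Scheme.Hom.app_eq_appLE, Scheme.Hom.appLE_comp_appLE]

theorem isAffineOpen_preimage_ι {Z : Scheme.{u}} {G D : Z.Opens} (hD : IsAffineOpen D)
    (hDG : D ≤ G) : IsAffineOpen (G.ι ⁻¹ᵁ D) :=
  hD.preimage_of_isOpenImmersion _ (by rwa [Scheme.Opens.opensRange_ι])

include ha ht in
theorem isAwayChart_dilatation :
    IsAwayChart ((dilatationMap a₀ Y R).appLE W.1 (dilatationMap a₀ Y R ⁻¹ᵁ W.1) le_rfl).hom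
      ((dilatationIdeal a₀ Y R).ideal W) (a.appLE U.1 W.1 h t) :=
  have h1 := agreementOpen_inf (Y := Y) ha ht h
  (isAwayChart_blowUpChart (appLE_mem_dilatationIdeal ha ht h)).of_open (blowUpChart_le _)
    (h1 ▸ inf_le_left) (preimage_ι_comp h1) le_rfl

include ha ht h in
theorem isAffineOpen_dilatation : IsAffineOpen (dilatationMap a₀ Y R ⁻¹ᵁ W.1) := by
  have h1 := agreementOpen_inf (Y := Y) ha ht h
  have h2 := isAffineOpen_preimage_ι (isAffineOpen_blowUpChart
    (appLE_mem_dilatationIdeal (Y := Y) ha ht h)) (h1 ▸ inf_le_left)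
  exact (preimage_ι_comp h1).symm ▸ h2
end

end

/-! ### Blow-up charts with étale coordinates -/

section Twist
open TensorProduct
variable {A B C' : Type u} [CommRing A] [CommRing B] [CommRing C'] {ι : Type}

/-- The endomorphism `Xᵢ ↦ hᵢ Xᵢ` of a polynomial ring. -/
def twistHom (h : ι → A) : MvPolynomial ι A →+* MvPolynomial ι A :=
  eval₂Hom MvPolynomial.C fun i => MvPolynomial.C (h i) * MvPolynomial.X i

/-- The polynomial ring, as an algebra over the polynomial ring by `Xᵢ ↦ hᵢ Xᵢ`. -/
def Twisted (_ : ι → A) : Type u := MvPolynomial ι A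

variable (h : ι → A)

instance : CommRing (Twisted h) := inferInstanceAs (CommRing (MvPolynomial ι A))

instance : Algebra (MvPolynomial ι A) (Twisted h) := (twistHom h).toAlgebra

variable {h}

theorem twistHom_C (a : A) : twistHom h (.C a) = MvPolynomial.C a := by
  simp [twistHom]

theorem twistHom_X (i : ι) : twistHom h (.X i) = MvPolynomial.C (h i) * MvPolynomial.X i := by
  simp [twistHom]

/-- The ideals for which the ring homomorphism `Xᵢ ↦ hᵢ Xᵢ` of polynomial rings defines a chart of
the blow-up. -/
structure IsTwistIdeal (h : ι → A) (J : Ideal (MvPolynomial ι A)) (ε : A) : Prop where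
  nzd : ε ∈ nonZeroDivisors A
  mem : MvPolynomial.C ε ∈ J
  dvd : ∀ f ∈ J, MvPolynomial.C ε ∣ twistHom h f
  h_dvd : ∀ i, h i ∣ ε
  X_mem : ∀ i, ∃ r ∈ J, MvPolynomial.C ε * MvPolynomial.X i = twistHom h r

theorem C_mem_nonZeroDivisors {ε : A} (hε : ε ∈ nonZeroDivisors A) :
    (.C ε : MvPolynomial ι A) ∈ nonZeroDivisors _ := by
  refine mem_nonZeroDivisors_iff_right.mpr fun p hp => MvPolynomial.ext _ _ fun m => ?_
  have h1 := congrArg (MvPolynomial.coeff m) hp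
  rw [mul_comm, MvPolynomial.coeff_C_mul, mul_comm, MvPolynomial.coeff_zero] at h1
  rw [MvPolynomial.coeff_zero]
  exact mem_nonZeroDivisors_iff_right.mp hε _ h1

/-- The twisted polynomial ring is a chart of the blow-up of affine space: it contains `Xᵢ = xᵢ / hᵢ`
and is generated by these quotients. -/
theorem IsTwistIdeal.isAwayChart {J : Ideal (MvPolynomial ι A)} {ε : A} (H : IsTwistIdeal h J ε) :
    IsAwayChart (algebraMap (MvPolynomial ι A) (Twisted h)) J (.C ε) := by
  change IsAwayChart (twistHom h) J (.C ε)
  choose k hk using H.h_dvd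
  let L := Localization.Away (.C ε : MvPolynomial ι A)
  let ε' : L := IsLocalization.Away.invSelf (.C ε : MvPolynomial ι A)
  have hε' : algebraMap (MvPolynomial ι A) L (.C ε) * ε' = 1 :=
    IsLocalization.Away.mul_invSelf _
  let χ : MvPolynomial ι A →+* L := eval₂Hom ((algebraMap (MvPolynomial ι A) L).comp MvPolynomial.C)
    fun i => algebraMap (MvPolynomial ι A) L (.C (k i) * MvPolynomial.X i) * ε'
  refine IsAwayChart.of_generators H.mem ?_ ?_
    (IsAwayChart.exists_pow_mul_eq_zero_of_lift (χ := χ) fun c => ?_)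
    (Set.range (.X : ι → MvPolynomial ι A)) ?_ ?_
  · rw [twistHom_C]; exact C_mem_nonZeroDivisors H.nzd
  · intro f hf; rw [twistHom_C]; exact H.dvd f hf
  · have : χ.comp (twistHom h) = algebraMap (MvPolynomial ι A) L := by
      refine MvPolynomial.ringHom_ext (fun a => ?_) (fun i => ?_)
      · simp [twistHom_C, χ]
      · rw [RingHom.comp_apply, twistHom_X, map_mul]
        simp only [χ, MvPolynomial.coe_eval₂Hom, MvPolynomial.eval₂_C, MvPolynomial.eval₂_X,
          RingHom.comp_apply, map_mul]
        have h1 := congrArg (fun z => algebraMap (MvPolynomial ι A) L (.C z) * ε') (hk i)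
        simp only [map_mul] at h1
        rw [hε'] at h1
        linear_combination -(algebraMap (MvPolynomial ι A) L (.X i)) * h1
    exact congrArg (fun g => g c) this
  · rintro _ ⟨i, rfl⟩
    obtain ⟨r, hr, h1⟩ := H.X_mem i
    exact ⟨r, hr, by rw [twistHom_C]; exact h1⟩
  · let _ := (twistHom h).toAlgebra
    rw [eq_top_iff]
    rintro p -
    induction p using MvPolynomial.induction_on with
    | C a =>
      have h1 := Subalgebra.algebraMap_mem (Algebra.adjoin (MvPolynomial ι A)
        (Set.range (.X : ι → MvPolynomial ι A))) (.C a)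
      have h2 : algebraMap (MvPolynomial ι A) (MvPolynomial ι A) (.C a) =
        MvPolynomial.C a := twistHom_C a
      rwa [h2] at h1
    | add p q hp hq => exact add_mem hp hq
    | mul_X p i hp => exact mul_mem hp (Algebra.subset_adjoin ⟨i, rfl⟩)

variable {J : Ideal (MvPolynomial ι A)} {ε : A} {x : MvPolynomial ι A →+* B} {φ : B →+* C'}
  {g : ι → C'}

/-- The chart of a blow-up of a flat algebra over a polynomial ring, as a tensor product. -/
theorem IsTwistIdeal.exists_ringEquiv (H : IsTwistIdeal h J ε) [Algebra (MvPolynomial ι A) B]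
    [Module.Flat (MvPolynomial ι A) B]
    (hφ : IsAwayChart φ (J.map (algebraMap (MvPolynomial ι A) B)) (algebraMap (MvPolynomial ι A) B (.C ε)))
    (hg : ∀ i, φ (algebraMap (MvPolynomial ι A) B (.C (h i))) * g i =
      φ (algebraMap (MvPolynomial ι A) B (.X i))) :
    ∃ α : B ⊗[MvPolynomial ι A] Twisted h ≃+* C', (∀ b, α (b ⊗ₜ 1) = φ b) ∧
      ∀ p : MvPolynomial ι A, α (1 ⊗ₜ (show Twisted h from p)) =
        MvPolynomial.eval₂ (φ.comp ((algebraMap (MvPolynomial ι A) B).comp MvPolynomial.C)) g p := by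
  obtain ⟨α, hα⟩ := (H.isAwayChart.baseChange (C := B)).exists_ringEquiv hφ
  have h0 : ∀ b, α (b ⊗ₜ 1) = φ b := hα
  have h1 : ∀ q : MvPolynomial ι A, (1 : B) ⊗ₜ[MvPolynomial ι A] (show Twisted h from twistHom h q) =
      algebraMap (MvPolynomial ι A) B q ⊗ₜ 1 := fun q => by
    rw [Algebra.algebraMap_eq_smul_one, TensorProduct.smul_tmul, Algebra.smul_def, mul_one]
    rfl
  refine ⟨α, h0, fun p => ?_⟩
  let ρ : MvPolynomial ι A →+* C' := (α : B ⊗[MvPolynomial ι A] Twisted h →+* C').comp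
    (Algebra.TensorProduct.includeRight : Twisted h →ₐ[MvPolynomial ι A] _ ).toRingHom
  have h2 : ρ = eval₂Hom (φ.comp ((algebraMap (MvPolynomial ι A) B).comp MvPolynomial.C)) g := by
    refine MvPolynomial.ringHom_ext (fun a => ?_) (fun i => ?_)
    · rw [eval₂Hom_C]
      have h3 := h1 (.C a)
      rw [twistHom_C] at h3
      exact (congrArg α h3).trans (h0 _)
    · rw [eval₂Hom_X']
      have hnzd : φ (algebraMap (MvPolynomial ι A) B (.C (h i))) ∈ nonZeroDivisors C' := by
        obtain ⟨k, hk⟩ := H.h_dvd i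
        have h4 := hφ.mem_nonZeroDivisors
        rw [hk] at h4
        simp only [map_mul] at h4
        exact (mul_mem_nonZeroDivisors.mp h4).1
      refine mul_cancel_left_mem_nonZeroDivisors hnzd |>.mp ?_
      rw [hg, ← h0, ← h0, ← h1, ← h1, twistHom_C, twistHom_X]
      let c : Twisted h := (.C (h i) : MvPolynomial ι A)
      let X : Twisted h := (.X i : MvPolynomial ι A)
      exact (map_mul α _ _).symm.trans (congrArg α (map_mul (Algebra.TensorProduct.includeRight :
        Twisted h →ₐ[MvPolynomial ι A] B ⊗[MvPolynomial ι A] Twisted h) c X).symm)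
  exact congrArg (fun f => f p) h2

/-- By flat base change from affine space, a chart of the blow-up of a scheme with étale coordinates
`xᵢ` has the étale coordinates `gᵢ = xᵢ / hᵢ`. -/
theorem IsTwistIdeal.etale (H : IsTwistIdeal h J ε) (hx : x.Etale)
    (hφ : IsAwayChart φ (J.map x) (x (.C ε)))
    (hg : ∀ i, φ (x (.C (h i))) * g i = φ (x (.X i))) :
    (eval₂Hom (φ.comp (x.comp MvPolynomial.C)) g).Etale := by
  algebraize [x]
  obtain ⟨α, hα, hα'⟩ := H.exists_ringEquiv hφ hg
  have h1 : (Algebra.TensorProduct.includeRight :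
      Twisted h →ₐ[MvPolynomial ι A] B ⊗[MvPolynomial ι A] Twisted h).toRingHom.Etale :=
    RingHom.Etale.stableUnderComposition _ _
      (RingHom.Etale.isStableUnderBaseChange.tensorProduct (Twisted h) hx)
      (.of_bijective (Algebra.TensorProduct.comm (MvPolynomial ι A) (Twisted h) B).bijective)
  have h2 : (eval₂Hom (φ.comp (x.comp MvPolynomial.C)) g) = (α : B ⊗[MvPolynomial ι A] Twisted h →+* C').comp
    (Algebra.TensorProduct.includeRight : Twisted h →ₐ[MvPolynomial ι A]  B ⊗[MvPolynomial ι A] Twisted h ).toRingHom :=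
    RingHom.ext fun p => (hα' p).symm
  rw [h2]
  exact RingHom.Etale.stableUnderComposition _ _ h1 (.of_bijective α.bijective)

theorem exists_tensorProduct_lift {Λ Λ' B D : Type*} [CommRing Λ] [CommRing Λ'] [CommRing B]
    [CommRing D] [Algebra Λ B] [Algebra Λ Λ'] (f : B →+* D) (g : Λ' →+* D)
    (h : ∀ l, f (algebraMap Λ B l) = g (algebraMap Λ Λ' l)) :
    ∃ ψ : B ⊗[Λ] Λ' →+* D, (∀ b, ψ (b ⊗ₜ 1) = f b) ∧ ∀ l, ψ (1 ⊗ₜ l) = g l := by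
  let _ : Algebra Λ D := (f.comp (algebraMap Λ B)).toAlgebra
  let f' : B →ₐ[Λ] D := { f with commutes' := fun _ => rfl }
  let g' : Λ' →ₐ[Λ] D := { g with commutes' := fun l => (h l).symm }
  refine ⟨(Algebra.TensorProduct.lift f' g' fun _ _ => .all _ _).toRingHom, fun b => ?_, fun l => ?_⟩
  · have h1 : Algebra.TensorProduct.lift f' g' (fun _ _ => .all _ _) (b ⊗ₜ 1) = f' b * g' 1 :=
      Algebra.TensorProduct.lift_tmul f' g' _ b 1
    have h2 : f' b * g' 1 = f b := by
      have : g' 1 = 1 := map_one g'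
      rw [this, mul_one]; rfl
    exact h1.trans h2
  · have h1 : Algebra.TensorProduct.lift f' g' (fun _ _ => .all _ _) (1 ⊗ₜ l) = f' 1 * g' l :=
      Algebra.TensorProduct.lift_tmul f' g' _ 1 l
    have h2 : f' 1 * g' l = g l := by
      have : f' 1 = 1 := map_one f'
      rw [this, one_mul]; rfl
    exact h1.trans h2

theorem isTwistIdeal_dilatation {t : A} (ht : t ∈ nonZeroDivisors A) :
    IsTwistIdeal (fun _ : ι => t) (Ideal.span (Set.range MvPolynomial.X) ⊔ Ideal.span {MvPolynomial.C t})
      t := by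
  refine ⟨ht, Ideal.mem_sup_right (Ideal.mem_span_singleton_self _), fun f hf => ?_,
    fun _ => dvd_rfl, fun i => ⟨MvPolynomial.X i, Ideal.mem_sup_left (Ideal.subset_span
      (Set.mem_range_self i)), (twistHom_X (h := fun _ : ι => t) i).symm⟩⟩
  suffices H : (Ideal.span (Set.range MvPolynomial.X) ⊔ Ideal.span {MvPolynomial.C t} :
      Ideal (MvPolynomial ι A)) ≤
      (Ideal.span {MvPolynomial.C t}).comap (twistHom fun _ : ι => t) from
    Ideal.mem_span_singleton.mp (Ideal.mem_comap.mp (H hf))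
  refine sup_le (Ideal.span_le.mpr ?_) ((Ideal.span_singleton_le_iff_mem _).mpr ?_)
  · rintro _ ⟨i, rfl⟩
    rw [SetLike.mem_coe, Ideal.mem_comap, twistHom_X]
    exact Ideal.mul_mem_right _ _ (Ideal.mem_span_singleton_self _)
  · rw [Ideal.mem_comap, twistHom_C]
    exact Ideal.mem_span_singleton_self _

/-- The ring of functions on a dilatation along a section with equations `xᵢ`, of thickening `t`:
it is étale over the polynomial ring in the `gᵢ = xᵢ / t`, and modulo `t` it is the polynomial ring
in the `gᵢ`. -/
theorem dilatation_ring {t : A} (ht : t ∈ nonZeroDivisors A) (hx : x.Etale) {σ : B →+* A}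
    (hσ : ∀ a, σ (x (.C a)) = a)
    (hker : RingHom.ker σ = Ideal.span (Set.range fun i => x (.X i)))
    (hφ : IsAwayChart φ (RingHom.ker σ ⊔ Ideal.span {x (.C t)}) (x (.C t)))
    (hg : ∀ i, φ (x (.C t)) * g i = φ (x (.X i))) :
    (eval₂Hom (φ.comp (x.comp MvPolynomial.C)) g).Etale ∧
    (∀ y, ∃ p, φ (x (.C t)) ∣
      y - MvPolynomial.eval₂ (φ.comp (x.comp MvPolynomial.C)) g p) ∧
    ∀ p, φ (x (.C t)) ∣ MvPolynomial.eval₂ (φ.comp (x.comp MvPolynomial.C)) g p →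
      MvPolynomial.C t ∣ p := by
  have hJ : (Ideal.span (Set.range MvPolynomial.X) ⊔ Ideal.span {MvPolynomial.C t}).map x =
      RingHom.ker σ ⊔ Ideal.span {x (.C t)} := by
    rw [Ideal.map_sup, Ideal.map_span, Ideal.map_span, Set.image_singleton, hker, ← Set.range_comp]
    rfl
  rw [← hJ] at hφ
  have H := isTwistIdeal_dilatation (ι := ι) ht
  refine ⟨H.etale hx hφ hg, ?_⟩
  algebraize [x]
  obtain ⟨α, hα, hα'⟩ := H.exists_ringEquiv hφ hg
  have hσX : ∀ i, σ (x (.X i)) = 0 := fun i => by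
    have : x (.X i) ∈ RingHom.ker σ := hker.ge (Ideal.subset_span ⟨i, rfl⟩)
    exact this
  constructor
  · intro y
    obtain ⟨z, rfl⟩ := α.surjective y
    induction z with
    | zero => exact ⟨0, by simp⟩
    | tmul b l =>
      refine ⟨MvPolynomial.C (σ b) * (show MvPolynomial ι A from l), ?_⟩
      have h1 : α (b ⊗ₜ l) = φ b * MvPolynomial.eval₂ (φ.comp (x.comp MvPolynomial.C)) g l := by
        refine Eq.trans ?_ (congrArg₂ (· * ·) (hα b) (hα' l))
        rw [← map_mul, Algebra.TensorProduct.tmul_mul_tmul, mul_one, one_mul]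
      rw [h1, MvPolynomial.eval₂_mul, MvPolynomial.eval₂_C, ← sub_mul]
      refine Dvd.dvd.mul_right ?_ _
      rw [RingHom.comp_apply, RingHom.comp_apply, ← map_sub]
      refine hφ.dvd _ ?_
      rw [hJ]
      refine Ideal.mem_sup_left ?_
      rw [RingHom.mem_ker, map_sub, hσ, sub_self]
    | add z w hz hw =>
      obtain ⟨p, hp⟩ := hz
      obtain ⟨q, hq⟩ := hw
      refine ⟨p + q, ?_⟩
      rw [map_add, MvPolynomial.eval₂_add, add_sub_add_comm]
      exact dvd_add hp hq
  · intro p hp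
    let k := Ideal.Quotient.mk (Ideal.span {t})
    obtain ⟨ψ, hψ, hψ'⟩ := exists_tensorProduct_lift (Λ := MvPolynomial ι A) (B := B)
      (Λ' := Twisted fun _ : ι => t) (D := MvPolynomial ι (A ⧸ Ideal.span {t}))
      (MvPolynomial.C.comp (k.comp σ)) (MvPolynomial.map k) (by
        suffices H : (MvPolynomial.C.comp (k.comp σ)).comp x =
            (MvPolynomial.map k).comp (twistHom fun _ : ι => t) from fun l => congrArg (fun f => f l) H
        have hk : k t = 0 := Ideal.Quotient.eq_zero_iff_mem.mpr (Ideal.mem_span_singleton_self t)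
        refine MvPolynomial.ringHom_ext (fun a => ?_) (fun i => ?_)
        · simp [twistHom_C, hσ]
        · simp [twistHom_X, hσX, hk])
    obtain ⟨c, hc⟩ := hp
    rw [MvPolynomial.C_dvd_iff_map_hom_eq_zero k t (fun r => by
      rw [← Ideal.mem_span_singleton]; exact Ideal.Quotient.eq_zero_iff_mem)]
    obtain ⟨z, rfl⟩ := α.surjective c
    have h1 := (hα' p).trans hc
    rw [← hα, ← map_mul] at h1
    have h2 := congrArg ψ (α.injective h1)
    rw [map_mul, hψ] at h2
    refine (hψ' p).symm.trans (h2.trans ?_)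
    rw [RingHom.comp_apply, RingHom.comp_apply, hσ]
    have hk : k t = 0 := Ideal.Quotient.eq_zero_iff_mem.mpr (Ideal.mem_span_singleton_self t)
    rw [hk, map_zero, zero_mul]

end Twist

/-! ### Functions on vector bundles -/

section

variable {X : Scheme.{u}}

section VectorBundleCharts
variable (E : X.Modules) [E.IsQuasicoherent]

theorem vectorBundleι_π (U : X.affineOpens) : vectorBundleι E U ≫ vectorBundleπ E =
    Spec.map (CommRingCat.ofHom (algebraMap Γ(X, U.1) (SymmetricAlgebra Γ(X, U.1) Γ(E, U.1)))) ≫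
      U.2.fromSpec := by
  refine ((vectorBundleGluingData E).ι_toBase (⟨U.1, U.2⟩ : X.AffineZariskiSite)).trans ?_
  refine (Category.assoc _ _ _).trans ?_
  rfl

theorem specMap_symMap_vectorBundleι {U U' : X.AffineZariskiSite} (i : U' ⟶ U) :
    Spec.map (CommRingCat.ofHom (symMap (affineRes i) (affineResModule E i))) ≫
      vectorBundleι E ⟨U.1, U.2⟩ = vectorBundleι E ⟨U'.1, U'.2⟩ :=
  (Scheme.Cover.LocallyDirected.w (𝒰 := (vectorBundleGluingData E).cover) i)

theorem vectorBundleι_le (U : X.affineOpens) :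
    ⊤ ≤ vectorBundleι E U ⁻¹ᵁ (vectorBundleπ E ⁻¹ᵁ U.1) := by
  rw [vectorBundleι_opensRange]
  exact fun x _ => ⟨x, rfl⟩

theorem appLE_vectorBundleFun (U : X.affineOpens) (m : Γ(E, U.1)) :
    (vectorBundleι E U).appLE _ ⊤ (vectorBundleι_le E U) (vectorBundleFun E U m) =
      (Scheme.ΓSpecIso (.of (SymmetricAlgebra Γ(X, U.1) Γ(E, U.1)))).inv
        (SymmetricAlgebra.ι _ _ m) := by
  set j := vectorBundleι E U
  have h1 := vectorBundleι_opensRange E U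
  have key : ∀ (D : (vectorBundle E).Opens) (h : D = j ''ᵁ ⊤) (h' : ⊤ ≤ j ⁻¹ᵁ D)
      (r : Γ(Spec (.of (SymmetricAlgebra Γ(X, U.1) Γ(E, U.1))), ⊤)),
      j.appLE D ⊤ h' ((vectorBundle E).presheaf.map (eqToHom h).op ((j.appIso ⊤).inv r)) = r := by
    rintro _ rfl h' r
    have h2 : (j.appIso ⊤).hom = j.appLE _ ⊤ h' := j.appIso_hom' ⊤
    rw [← h2]
    simp
  exact key _ (h1.trans j.image_top_eq_opensRange.symm) _ _

theorem bijective_vectorBundleι_appLE (U : X.affineOpens) : Function.Bijective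
    ((vectorBundleι E U).appLE (vectorBundleπ E ⁻¹ᵁ U.1) ⊤ (vectorBundleι_le E U)) := by
  set j := vectorBundleι E U
  have key : ∀ (D : (vectorBundle E).Opens) (h : D = j ''ᵁ ⊤) (h' : ⊤ ≤ j ⁻¹ᵁ D),
      Function.Bijective (j.appLE D ⊤ h') := by
    rintro _ rfl h'
    have h2 : (j.appIso ⊤).hom = j.appLE _ ⊤ h' := j.appIso_hom' ⊤
    rw [← h2]
    exact ConcreteCategory.bijective_of_isIso _
  exact key _ ((vectorBundleι_opensRange E U).trans j.image_top_eq_opensRange.symm) _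

theorem appLE_vectorBundleπ (U : X.affineOpens) (a : Γ(X, U.1)) :
    (vectorBundleι E U).appLE _ ⊤ (vectorBundleι_le E U) ((vectorBundleπ E).app U.1 a) =
      (Scheme.ΓSpecIso (.of (SymmetricAlgebra Γ(X, U.1) Γ(E, U.1)))).inv (algebraMap _ _ a) := by
  have h0 : ∀ (g : Spec _ ⟶ X) (hg : vectorBundleι E U ≫ vectorBundleπ E = g) (e : ⊤ ≤ g ⁻¹ᵁ U.1),
      (vectorBundleπ E).app U.1 ≫ (vectorBundleι E U).appLE _ ⊤ (vectorBundleι_le E U) = g.appLE U.1 ⊤ e := by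
    rintro _ rfl e
    rw [Scheme.Hom.app_eq_appLE, Scheme.Hom.appLE_comp_appLE]
  have e : (⊤ : (Spec (.of (SymmetricAlgebra Γ(X, U.1) Γ(E, U.1)))).Opens) ≤ (Spec.map (CommRingCat.ofHom (algebraMap Γ(X, U.1)
      (SymmetricAlgebra Γ(X, U.1) Γ(E, U.1)))) ≫ U.2.fromSpec) ⁻¹ᵁ U.1 := fun x _ =>
    U.2.range_fromSpec.le ⟨_, rfl⟩
  have h1 := h0 _ (vectorBundleι_π E U) e
  have h3 : (⊤ : (Spec Γ(X, U.1)).Opens) ≤ U.2.fromSpec ⁻¹ᵁ U.1 := U.2.fromSpec_preimage_self.ge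
  rw [← Scheme.Hom.appLE_comp_appLE (Spec.map _) U.2.fromSpec U ⊤ ⊤ h3 le_top] at h1
  have h4 : U.2.fromSpec.appLE U.1 ⊤ h3 = (Scheme.ΓSpecIso Γ(X, U.1)).inv := by
    rw [Scheme.Hom.appLE, U.2.fromSpec_app_self, Category.assoc, ← Functor.map_comp]
    exact (congrArg (_ ≫ ·) ((Spec Γ(X, U)).presheaf.map_id _)).trans (Category.comp_id _)
  rw [h4] at h1
  have h5 := Scheme.ΓSpecIso_inv_naturality (CommRingCat.ofHom (algebraMap Γ(X, U.1)
      (SymmetricAlgebra Γ(X, U.1) Γ(E, U.1))))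
  have h6 : (Spec.map (CommRingCat.ofHom (algebraMap Γ(X, U.1)
      (SymmetricAlgebra Γ(X, U.1) Γ(E, U.1))))).appTop = (Spec.map (CommRingCat.ofHom (algebraMap Γ(X, U.1)
      (SymmetricAlgebra Γ(X, U.1) Γ(E, U.1))))).appLE ⊤ ⊤ le_top := Scheme.Hom.app_eq_appLE _
  rw [h6] at h5
  exact congrArg (fun φ => φ.hom a) (h1.trans h5.symm)

/-- The ring of functions on the part of a vector bundle over an affine open subset. -/
theorem exists_vectorBundle_ringEquiv (U : X.affineOpens) :
    ∃ β : SymmetricAlgebra Γ(X, U.1) Γ(E, U.1) ≃+* Γ(vectorBundle E, vectorBundleπ E ⁻¹ᵁ U.1),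
      (∀ a, β (algebraMap _ _ a) = (vectorBundleπ E).app U.1 a) ∧
      ∀ m, β (SymmetricAlgebra.ι _ _ m) = vectorBundleFun E U m := by
  let γ := RingEquiv.ofBijective ((vectorBundleι E U).appLE (vectorBundleπ E ⁻¹ᵁ U.1) ⊤
    (vectorBundleι_le E U)).hom (bijective_vectorBundleι_appLE E U)
  let s := (Scheme.ΓSpecIso (.of (SymmetricAlgebra Γ(X, U.1) Γ(E, U.1)))).symm.commRingCatIsoToRingEquiv
  refine ⟨s.trans γ.symm, fun a => ?_, fun m => ?_⟩
  · exact (RingEquiv.symm_apply_eq γ).mpr (appLE_vectorBundleπ E U a).symm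
  · exact (RingEquiv.symm_apply_eq γ).mpr (appLE_vectorBundleFun E U m).symm

theorem isAffineOpen_vectorBundle (U : X.affineOpens) : IsAffineOpen (vectorBundleπ E ⁻¹ᵁ U.1) := by
  rw [vectorBundleι_opensRange]
  exact isAffineOpen_opensRange _

theorem vectorBundleFun_add (U : X.affineOpens) (m m' : Γ(E, U.1)) :
    vectorBundleFun E U (m + m') = vectorBundleFun E U m + vectorBundleFun E U m' := by
  obtain ⟨β, -, hβ⟩ := exists_vectorBundle_ringEquiv E U
  rw [← hβ, ← hβ, ← hβ, map_add, map_add]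

theorem vectorBundleFun_smul (U : X.affineOpens) (a : Γ(X, U.1)) (m : Γ(E, U.1)) :
    vectorBundleFun E U (a • m) = (vectorBundleπ E).app U.1 a * vectorBundleFun E U m := by
  obtain ⟨β, hβ', hβ⟩ := exists_vectorBundle_ringEquiv E U
  rw [← hβ, ← hβ, ← hβ', map_smul, Algebra.smul_def, map_mul]

theorem vectorBundleFun_sum (U : X.affineOpens) {ι : Type*} (s : Finset ι) (m : ι → Γ(E, U.1)) :
    vectorBundleFun E U (∑ i ∈ s, m i) = ∑ i ∈ s, vectorBundleFun E U (m i) :=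
  map_sum (AddMonoidHom.mk' (vectorBundleFun E U) (vectorBundleFun_add E U)) m s

theorem fres_vectorBundleFun_of_hom {U U' : X.AffineZariskiSite} (i : U' ⟶ U) (h : U'.1 ≤ U.1)
    (m : Γ(E, U.1)) :
    fres ((vectorBundleπ E).preimage_mono h) (vectorBundleFun E ⟨U.1, U.2⟩ m) =
      vectorBundleFun E ⟨U'.1, U'.2⟩ (mres E h m) := by
  refine (bijective_vectorBundleι_appLE E ⟨U'.1, U'.2⟩).injective ?_
  rw [appLE_vectorBundleFun]
  have h1 := specMap_symMap_vectorBundleι E i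
  set g := symMap (affineRes i) (affineResModule E i)
  have h0 : ∀ (f : Spec _ ⟶ vectorBundle E)
      (hg : Spec.map (CommRingCat.ofHom g) ≫ vectorBundleι E ⟨U.1, U.2⟩ = f)
      (e : ⊤ ≤ f ⁻¹ᵁ (vectorBundleπ E ⁻¹ᵁ U'.1)),
      f.appLE _ ⊤ e (fres ((vectorBundleπ E).preimage_mono h) (vectorBundleFun E ⟨U.1, U.2⟩ m)) =
       (Scheme.ΓSpecIso (.of (SymmetricAlgebra Γ(X, U'.1) Γ(E, U'.1)))).inv
        (g (SymmetricAlgebra.ι _ _ m)) := by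
    rintro _ rfl e
    rw [appLE_fres]
    have h2 : (Spec.map (CommRingCat.ofHom g)).appTop =
        (Spec.map (CommRingCat.ofHom g)).appLE ⊤ ⊤ le_top := Scheme.Hom.app_eq_appLE _
    have h3 := Scheme.Hom.appLE_comp_appLE (Spec.map (CommRingCat.ofHom g))
      (vectorBundleι E ⟨U.1, U.2⟩) _ _ ⊤ (vectorBundleι_le E ⟨U.1, U.2⟩) le_top
    rw [← h2] at h3
    refine (congrArg (fun φ => φ.hom (vectorBundleFun E ⟨U.1, U.2⟩ m)) h3).symm.trans ?_
    have h4 := Scheme.ΓSpecIso_inv_naturality (CommRingCat.ofHom g)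
    refine Eq.trans ?_ (congrArg (fun φ => φ.hom (SymmetricAlgebra.ι _ _ m)) h4).symm
    exact congrArg (Spec.map (CommRingCat.ofHom g)).appTop (appLE_vectorBundleFun E ⟨U.1, U.2⟩ m)
  refine (h0 _ h1 _).trans ?_
  congr 1
  exact symMap_ι _ _ _

theorem fres_vectorBundleFun {U U' : X.affineOpens} (h : U'.1 ≤ U.1) (m : Γ(E, U.1)) :
    fres ((vectorBundleπ E).preimage_mono h) (vectorBundleFun E U m) =
      vectorBundleFun E U' (mres E h m) := by
  refine functions_ext fun z hz => ?_
  obtain ⟨f, g, hfg, hx⟩ := exists_basicOpen_le_affine_inter U.2 U'.2 (vectorBundleπ E z) ⟨h hz, hz⟩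
  have hV : X.basicOpen g ≤ U'.1 := X.basicOpen_le g
  refine ⟨_, (vectorBundleπ E).preimage_mono hV, hfg ▸ hx, ?_⟩
  have h1 := fres_vectorBundleFun_of_hom E (U := ⟨U'.1, U'.2⟩)
    (U' := ⟨X.basicOpen g, U'.2.basicOpen g⟩) (homOfLE ⟨g, rfl⟩) hV (mres E h m)
  have h2 := fres_vectorBundleFun_of_hom E (U := ⟨U.1, U.2⟩)
    (U' := ⟨X.basicOpen g, U'.2.basicOpen g⟩) (homOfLE ⟨f, hfg⟩) (hV.trans h) m
  rw [mres_mres] at h1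
  rw [fres_fres]
  exact h2.trans h1.symm

/-- The ring of functions on the restriction of a trivialized vector bundle is the polynomial ring
in the basis. -/
theorem IsBasisOn.bijective_eval₂_vectorBundleFun {ι : Type*} [Fintype ι] {U : X.affineOpens}
    {e : ι → Γ(E, U.1)} (he : IsBasisOn E U.1 e) :
    Function.Bijective (MvPolynomial.eval₂ ((vectorBundleπ E).app U.1).hom
      fun i => vectorBundleFun E U (e i)) := by
  classical
  obtain ⟨β, hβ', hβ⟩ := exists_vectorBundle_ringEquiv E U
  let e' : Module.Basis ι Γ(X, U.1) Γ(E, U.1) := .ofEquivFun (he.equiv le_rfl).symm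
  have he' : ∀ i, e' i = e i := fun i => by
    rw [Module.Basis.coe_ofEquivFun]
    change he.equiv le_rfl (Pi.single i 1) = _
    change ∑ j, _ = _
    simp [Pi.single_apply, mres_self]
  have h : MvPolynomial.eval₂ ((vectorBundleπ E).app U.1).hom (fun i => vectorBundleFun E U (e i)) =
      β ∘ (SymmetricAlgebra.equivMvPolynomial e').symm := by
    have h1 : eval₂Hom ((vectorBundleπ E).app U.1).hom (fun i => vectorBundleFun E U (e i)) =
        β.toRingHom.comp (SymmetricAlgebra.equivMvPolynomial e').symm.toRingEquiv.toRingHom := by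
      refine MvPolynomial.ringHom_ext (fun a => ?_) fun i => ?_
      · rw [eval₂Hom_C, RingHom.comp_apply]
        refine (hβ' a).symm.trans (congrArg β ?_)
        exact ((SymmetricAlgebra.equivMvPolynomial e').symm.commutes a).symm
      · rw [eval₂Hom_X', RingHom.comp_apply, ← hβ]
        refine congrArg β ?_
        rw [← he']
        exact (SymmetricAlgebra.equivMvPolynomial_symm_X e' i).symm
    exact funext fun p => congrArg (fun f => f p) h1
  rw [h]
  exact β.bijective.comp (SymmetricAlgebra.equivMvPolynomial e').symm.bijective

end VectorBundleCharts

end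

/-! ### Gluing isomorphisms with a vector bundle -/

section

variable {X Y Q T Z : Scheme.{u}}

theorem appLE_comp (f : T ⟶ Z) (g : Z ⟶ Y) {U : Y.Opens} {V : Z.Opens} {W : T.Opens}
    (h : V ≤ g ⁻¹ᵁ U) (h' : W ≤ f ⁻¹ᵁ V) (a : Γ(Y, U)) :
    f.appLE V W h' (g.appLE U V h a) =
      (f ≫ g).appLE U W (h'.trans (f.preimage_mono h)) a :=
  congrArg (fun φ => φ.hom a) (Scheme.Hom.appLE_comp_appLE f g U V W h h')

theorem appLE_congr {f g : T ⟶ Y} (hfg : f = g) {U : Y.Opens} {W : T.Opens} (h : W ≤ f ⁻¹ᵁ U)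
    (h' : W ≤ g ⁻¹ᵁ U) (a : Γ(Y, U)) : f.appLE U W h a = g.appLE U W h' a := by
  subst hfg; rfl

theorem app_eq_appLE_apply (f : T ⟶ Y) {U : Y.Opens} (h : f ⁻¹ᵁ U ≤ f ⁻¹ᵁ U) (a : Γ(Y, U)) :
    f.app U a = f.appLE U _ h a :=
  congrArg (fun φ => φ.hom a) (Scheme.Hom.app_eq_appLE f)

/-- A morphism which locally lands in affine opens is determined by what it does to functions. -/
theorem hom_ext_of_appLE {f g : T ⟶ Y}
    (H : ∀ z : T, ∃ (D : Y.affineOpens) (O : T.Opens) (h : O ≤ f ⁻¹ᵁ D.1) (h' : O ≤ g ⁻¹ᵁ D.1),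
      z ∈ O ∧ ∀ a, f.appLE D.1 O h a = g.appLE D.1 O h' a) : f = g := by
  refine Scheme.hom_ext_of_forall _ _ fun z => ?_
  obtain ⟨D, O, h, h', hz, heq⟩ := H z
  obtain ⟨O', hzO, hO⟩ := exists_affine_nhd hz
  refine ⟨O'.1, hzO, ?_⟩
  have h1 := IsAffineOpen.SpecMap_appLE_fromSpec f D.2 O'.2 (hO.trans h)
  have h2 := IsAffineOpen.SpecMap_appLE_fromSpec g D.2 O'.2 (hO.trans h')
  have h3 : f.appLE D.1 O'.1 (hO.trans h) = g.appLE D.1 O'.1 (hO.trans h') :=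
    CommRingCat.hom_ext (RingHom.ext fun a => by
      have := congrArg (fres hO) (heq a)
      rwa [fres_appLE, fres_appLE] at this)
  rw [h3, h2] at h1
  rw [← cancel_epi O'.2.isoSpec.inv, ← Category.assoc, ← Category.assoc]
  exact h1.symm

theorem exists_hom_of_ringHom [IsAffine T] {D : Y.Opens} (hD : IsAffineOpen D)
    (φ : Γ(Y, D) →+* Γ(T, ⊤)) : ∃ (ψ : T ⟶ Y) (h : ⊤ ≤ ψ ⁻¹ᵁ D), ∀ a, ψ.appLE D ⊤ h a = φ a := by
  let ψ := T.isoSpec.hom ≫ Spec.map (CommRingCat.ofHom φ) ≫ hD.fromSpec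
  have hψ : ⊤ ≤ ψ ⁻¹ᵁ D := fun x _ => hD.range_fromSpec.le ⟨_, rfl⟩
  refine ⟨ψ, hψ, fun a => ?_⟩
  have h1 := IsAffineOpen.SpecMap_appLE_fromSpec ψ hD (isAffineOpen_top T) hψ
  rw [IsAffineOpen.fromSpec_top, Iso.inv_hom_id_assoc, cancel_mono] at h1
  exact congrArg (fun φ => φ.hom a) (Spec.map_injective h1)

section VectorBundleHoms
variable {E : X.Modules} [E.IsQuasicoherent] {ι : Type*} [Fintype ι] {U : X.affineOpens}
  {e : ι → Γ(E, U.1)}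

theorem exists_hom_vectorBundle [IsAffine T] (he : IsBasisOn E U.1 e) (c : T ⟶ X)
    (hc : ⊤ ≤ c ⁻¹ᵁ U.1) (g : ι → Γ(T, ⊤)) :
    ∃ (ψ : T ⟶ vectorBundle E) (h : ⊤ ≤ ψ ⁻¹ᵁ (vectorBundleπ E ⁻¹ᵁ U.1)), ψ ≫ vectorBundleπ E = c ∧
      ∀ i, ψ.appLE _ ⊤ h (vectorBundleFun E U (e i)) = g i := by
  let β := RingEquiv.ofBijective (eval₂Hom ((vectorBundleπ E).app U.1).hom
    fun i => vectorBundleFun E U (e i)) he.bijective_eval₂_vectorBundleFun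
  have hβC : ∀ a, β (.C a) = (vectorBundleπ E).app U.1 a := fun a =>
    eval₂Hom_C _ _ _
  have hβX : ∀ i, β (.X i) = vectorBundleFun E U (e i) := fun i =>
    eval₂Hom_X' _ _ _
  obtain ⟨ψ, h, hψ⟩ := exists_hom_of_ringHom (T := T) (isAffineOpen_vectorBundle E U)
    ((eval₂Hom (c.appLE U.1 ⊤ hc).hom g).comp β.symm.toRingHom)
  refine ⟨ψ, h, hom_ext_of_appLE fun z => ⟨U, ⊤, h, hc, trivial, fun a => ?_⟩, fun i => ?_⟩
  · rw [← appLE_comp ψ (vectorBundleπ E) le_rfl h, ← app_eq_appLE_apply, hψ, ← hβC]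
    change eval₂Hom _ _ (β.symm _) = _
    rw [RingEquiv.symm_apply_apply, eval₂Hom_C]
  · rw [hψ, ← hβX]
    change eval₂Hom _ _ (β.symm _) = _
    rw [RingEquiv.symm_apply_apply, eval₂Hom_X']

theorem hom_vectorBundle_ext {f₁ f₂ : T ⟶ vectorBundle E}
    (hf : f₁ ≫ vectorBundleπ E = f₂ ≫ vectorBundleπ E)
    (H : ∀ z : T, ∃ (n : ℕ) (U : X.affineOpens) (e : Fin n → Γ(E, U.1)) (_ : IsBasisOn E U.1 e)
      (O : T.Opens) (h₁ : O ≤ f₁ ⁻¹ᵁ (vectorBundleπ E ⁻¹ᵁ U.1))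
      (h₂ : O ≤ f₂ ⁻¹ᵁ (vectorBundleπ E ⁻¹ᵁ U.1)), z ∈ O ∧
      ∀ i, f₁.appLE _ O h₁ (vectorBundleFun E U (e i)) =
        f₂.appLE _ O h₂ (vectorBundleFun E U (e i))) : f₁ = f₂ := by
  refine hom_ext_of_appLE fun z => ?_
  obtain ⟨n, U, e, he, O, h₁, h₂, hz, heq⟩ := H z
  refine ⟨⟨_, isAffineOpen_vectorBundle E U⟩, O, h₁, h₂, hz, fun y => ?_⟩
  obtain ⟨p, rfl⟩ := he.bijective_eval₂_vectorBundleFun.surjective y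
  have h3 : ((f₁.appLE _ O h₁).hom.comp (eval₂Hom ((vectorBundleπ E).app U.1).hom
      fun i => vectorBundleFun E U (e i))) = ((f₂.appLE _ O h₂).hom.comp
      (eval₂Hom ((vectorBundleπ E).app U.1).hom
      fun i => vectorBundleFun E U (e i))) := by
    refine MvPolynomial.ringHom_ext (fun a => ?_) fun i => ?_
    · rw [RingHom.comp_apply, RingHom.comp_apply, eval₂Hom_C,
        app_eq_appLE_apply _ le_rfl]
      exact (appLE_comp _ _ _ _ _).trans ((appLE_congr hf _ _ _).trans (appLE_comp _ _ _ _ _).symm)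
    · rw [RingHom.comp_apply, RingHom.comp_apply, eval₂Hom_X']
      exact heq i
  exact congrArg (fun f => f p) h3

/-- The function on `V(E)` given by the section `m` of `E` over `U` and the function `g` on the open
subset `V` of `Q` have the same pull-back to `T`. -/
def Matches (f : T ⟶ vectorBundle E) (q : T ⟶ Q) (U : X.affineOpens) (m : Γ(E, U.1)) (V : Q.Opens)
    (g : Γ(Q, V)) : Prop :=
  ∀ (O : T.Opens) (h₁ : O ≤ q ⁻¹ᵁ V) (h₂ : O ≤ f ⁻¹ᵁ (vectorBundleπ E ⁻¹ᵁ U.1)),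
    f.appLE _ O h₂ (vectorBundleFun E U m) = q.appLE V O h₁ g

variable {f : T ⟶ vectorBundle E} {q : T ⟶ Q} {m : Γ(E, U.1)} {V : Q.Opens} {g : Γ(Q, V)}

theorem matches_of_local (H : ∀ z : T, q z ∈ V → vectorBundleπ E (f z) ∈ U.1 →
    ∃ (O : T.Opens) (h₁ : O ≤ q ⁻¹ᵁ V) (h₂ : O ≤ f ⁻¹ᵁ (vectorBundleπ E ⁻¹ᵁ U.1)), z ∈ O ∧
      f.appLE _ O h₂ (vectorBundleFun E U m) = q.appLE V O h₁ g) : Matches f q U m V g := by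
  intro O h₁ h₂
  refine functions_ext fun z hz => ?_
  obtain ⟨O', h₁', h₂', hz', heq⟩ := H z (h₁ hz) (h₂ hz)
  refine ⟨O ⊓ O', inf_le_left, ⟨hz, hz'⟩, ?_⟩
  have := congrArg (fres (inf_le_right : O ⊓ O' ≤ O')) heq
  rw [fres_appLE, fres_appLE] at this ⊢
  exact this

theorem Matches.comp (h : Matches f q U m V g) (r : Z ⟶ T) : Matches (r ≫ f) (r ≫ q) U m V g := by
  intro O h₁ h₂
  have h3 := congrArg (r.appLE _ O (show O ≤ r ⁻¹ᵁ (q ⁻¹ᵁ V ⊓ f ⁻¹ᵁ (vectorBundleπ E ⁻¹ᵁ U.1)) from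
    le_inf h₁ h₂)) (h (q ⁻¹ᵁ V ⊓ f ⁻¹ᵁ (vectorBundleπ E ⁻¹ᵁ U.1))
    inf_le_left inf_le_right)
  rwa [appLE_comp, appLE_comp] at h3

theorem matches_of_cover (H : ∀ z : T, ∃ W : T.Opens, z ∈ W ∧ Matches (W.ι ≫ f) (W.ι ≫ q) U m V g) :
    Matches f q U m V g := by
  refine matches_of_local fun z hz hz' => ?_
  obtain ⟨W, hzW, hW⟩ := H z
  refine ⟨W ⊓ (q ⁻¹ᵁ V ⊓ f ⁻¹ᵁ (vectorBundleπ E ⁻¹ᵁ U.1)), inf_le_right.trans inf_le_left,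
    inf_le_right.trans inf_le_right, ⟨hzW, hz, hz'⟩, ?_⟩
  set O := W ⊓ (q ⁻¹ᵁ V ⊓ f ⁻¹ᵁ (vectorBundleπ E ⁻¹ᵁ U.1))
  have h1 := hW (W.ι ⁻¹ᵁ O) (fun z hz => hz.2.1) (fun z hz => hz.2.2)
  rw [← appLE_comp W.ι f (V := O) (inf_le_right.trans inf_le_right) le_rfl,
    ← appLE_comp W.ι q (V := O) (inf_le_right.trans inf_le_left) le_rfl] at h1
  have h2 : IsIso (W.ι.app O) := Scheme.Hom.isIso_app _ _ (by simp [O])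
  refine (ConcreteCategory.bijective_of_isIso (W.ι.app O)).injective ?_
  rw [app_eq_appLE_apply _ le_rfl, app_eq_appLE_apply _ le_rfl]
  exact h1

end VectorBundleHoms

theorem isIso_of_affine_cover (f : T ⟶ Y) {κ : Type*} (D : κ → Y.affineOpens) (hD : ⨆ i, (D i).1 = ⊤)
    (h : ∀ i, IsAffineOpen (f ⁻¹ᵁ (D i).1)) (h' : ∀ i, Function.Bijective (f.app (D i).1)) :
    IsIso f := by
  refine (IsZariskiLocalAtTarget.iff_of_iSup_eq_top (P := MorphismProperty.isomorphisms Scheme)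
    (fun i => (D i).1) hD).mpr fun i => ?_
  have h1 : ∀ D' : Y.Opens, D' = (D i).1 → IsIso (f.app D') := by
    rintro _ rfl
    exact (ConcreteCategory.isIso_iff_bijective _).mpr (h' i)
  have h2 := h1 ((D i).1.ι ''ᵁ ⊤) (by simp)
  have h3 : IsIso (f ∣_ (D i).1).appTop := by
    rw [morphismRestrict_appTop]
    exact IsIso.comp_isIso' h2 (Functor.map_isIso _ _)
  have h4 : IsAffine (D i).1 := (D i).2
  have h5 : IsAffine (f ⁻¹ᵁ (D i).1) := h i
  exact (MorphismProperty.arrow_mk_iso_iff (MorphismProperty.isomorphisms Scheme)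
    (arrowIsoSpecΓOfIsAffine (f ∣_ (D i).1))).mpr
    (inferInstanceAs (IsIso (Spec.map ((f ∣_ (D i).1).appTop))))

section DivisorFiber
variable (b : Q ⟶ X) (R : X.IdealSheafData) {V : Q.Opens} {U : X.affineOpens}

theorem app_pullback_fst_eq_zero_iff (hV : IsAffineOpen V) (h : V ≤ b ⁻¹ᵁ U.1) {t : Γ(X, U.1)}
    (ht : R.ideal U = Ideal.span {t}) (g : Γ(Q, V)) :
    (pullback.fst b R.subschemeι).app V g = 0 ↔ b.appLE U.1 V h t ∣ g := by
  have h1 := (pullback.fst b R.subschemeι).ker_apply ⟨V, hV⟩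
  rw [Scheme.IdealSheafData.ker_fst_of_isClosedImmersion, Scheme.IdealSheafData.ker_subschemeι,
    ideal_comap b R (U := U) (V := ⟨V, hV⟩) h, ht, Ideal.map_span, Set.image_singleton] at h1
  rw [← Ideal.mem_span_singleton]
  exact (Ideal.ext_iff.mp h1 g).symm

theorem app_pullback_fst_surjective (hV : IsAffineOpen V) :
    Function.Surjective ((pullback.fst b R.subschemeι).app V) :=
  (pullback.fst b R.subschemeι).app_surjective V hV

end DivisorFiber

variable {E : X.Modules}

/-- A trivialization of `Q` over the part of `R` in an affine open subset `U` of `X`, by functions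
which are to correspond to the elements of a basis of `E`. -/
structure BundleChart (b : Q ⟶ X) (R : X.IdealSheafData) (E : X.Modules) where
  U : X.affineOpens
  n : ℕ
  e : Fin n → Γ(E, U.1)
  isBasisOn : IsBasisOn E U.1 e
  V : Q.Opens
  isAffineOpen : IsAffineOpen V
  le : V ≤ b ⁻¹ᵁ U.1
  fiber_le : pullback.fst b R.subschemeι ⁻¹ᵁ (b ⁻¹ᵁ U.1) ≤ pullback.fst b R.subschemeι ⁻¹ᵁ V
  g : Fin n → Γ(Q, V)
  t : Γ(X, U.1)
  ideal_eq : R.ideal U = Ideal.span {t}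
  exists_dvd : ∀ y, ∃ p, b.appLE U.1 V le t ∣ y - MvPolynomial.eval₂ (b.appLE U.1 V le).hom g p
  dvd_of_dvd : ∀ p, b.appLE U.1 V le t ∣ MvPolynomial.eval₂ (b.appLE U.1 V le).hom g p →
    MvPolynomial.C t ∣ p

namespace BundleChart
variable {b : Q ⟶ X} {R : X.IdealSheafData} (C : BundleChart b R E)

/-- The part of the fibre over `R` on which a chart is defined. -/
def fiber : (pullback b R.subschemeι).Opens := pullback.fst b R.subschemeι ⁻¹ᵁ C.V

theorem fiber_eq : C.fiber = (pullback.fst b R.subschemeι ≫ b) ⁻¹ᵁ C.U.1 :=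
  le_antisymm ((pullback.fst b R.subschemeι).preimage_mono C.le) C.fiber_le

theorem isAffineOpen_fiber : IsAffineOpen C.fiber := C.isAffineOpen.preimage _

/-- The morphism to the vector bundle defined by a chart. -/
theorem exists_hom [E.IsQuasicoherent] : ∃ ψ : C.fiber.toScheme ⟶ vectorBundle E,
    ψ ≫ vectorBundleπ E = C.fiber.ι ≫ pullback.fst b R.subschemeι ≫ b ∧
    ∀ i, Matches ψ (C.fiber.ι ≫ pullback.fst b R.subschemeι) C.U (C.e i) C.V (C.g i) := by
  have : IsAffine C.fiber.toScheme := C.isAffineOpen_fiber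
  have h1 : (⊤ : C.fiber.toScheme.Opens) ≤ (C.fiber.ι ≫ pullback.fst b R.subschemeι) ⁻¹ᵁ C.V :=
    fun z _ => z.2
  obtain ⟨ψ, h, hψ, hψ'⟩ := exists_hom_vectorBundle C.isBasisOn
    (C.fiber.ι ≫ pullback.fst b R.subschemeι ≫ b) (fun z _ => C.le z.2)
    (fun i => (C.fiber.ι ≫ pullback.fst b R.subschemeι).appLE C.V ⊤ h1 (C.g i))
  refine ⟨ψ, hψ, fun i O h₁ h₂ => ?_⟩
  have h3 := congrArg (fres (le_top : O ≤ ⊤)) (hψ' i)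
  rwa [fres_appLE, fres_appLE] at h3

end BundleChart

/-- The sections `m` and functions `g` satisfy the same relations, with respect to the chart `C`,
over a neighbourhood of the point `z` of the fibre over `R`. -/
def BundleChart.Compatible {b : Q ⟶ X} {R : X.IdealSheafData} (C : BundleChart b R E)
    (z : (pullback b R.subschemeι : Scheme.{u})) (U : X.Opens) (m : Γ(E, U)) (V : Q.Opens)
    (g : Γ(Q, V)) : Prop :=
  ∃ (U' : X.Opens) (hU : U' ≤ U) (hU' : U' ≤ C.U.1) (c : Fin C.n → Γ(X, U'))
    (O : (pullback b R.subschemeι).Opens) (hO : O ≤ (pullback.fst b R.subschemeι) ⁻¹ᵁ V)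
    (hO' : O ≤ (pullback.fst b R.subschemeι) ⁻¹ᵁ C.V)
    (hO'' : O ≤ (pullback.fst b R.subschemeι ≫ b) ⁻¹ᵁ U'), z ∈ O ∧
    mres E hU m = ∑ i, c i • mres E hU' (C.e i) ∧
    (pullback.fst b R.subschemeι).appLE V O hO g =
      ∑ i, (pullback.fst b R.subschemeι ≫ b).appLE U' O hO'' (c i) *
        (pullback.fst b R.subschemeι).appLE C.V O hO' (C.g i)

section Gluing
variable [E.IsQuasicoherent] {b : Q ⟶ X} {R : X.IdealSheafData}

/-- A correspondence for the basis in a chart extends to all compatible pairs. -/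
theorem matches_of_compatible {C : BundleChart b R E} {U : X.affineOpens} {m : Γ(E, U.1)}
    {V : Q.Opens} {g : Γ(Q, V)}
    (H : ∀ z : ↥(pullback b R.subschemeι), pullback.fst b R.subschemeι z ∈ V →
      (pullback.fst b R.subschemeι ≫ b) z ∈ U.1 → z ∈ C.fiber → C.Compatible z U.1 m V g)
    {r : T ⟶ pullback b R.subschemeι} {f : T ⟶ vectorBundle E}
    (hf : f ≫ vectorBundleπ E = r ≫ pullback.fst b R.subschemeι ≫ b)
    (hr : ∀ w, r w ∈ C.fiber)
    (hC : ∀ i, Matches f (r ≫ pullback.fst b R.subschemeι) C.U (C.e i) C.V (C.g i)) :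
    Matches f (r ≫ pullback.fst b R.subschemeι) U m V g := by
  refine matches_of_local fun w hw hw' => ?_
  have hb : ∀ w, vectorBundleπ E (f w) = (pullback.fst b R.subschemeι ≫ b) (r w) := fun w => by
    rw [← Scheme.Hom.comp_apply, hf, Scheme.Hom.comp_apply]
  obtain ⟨U', hU, hU', c, O, hO, hO', hO'', hz, h1, h2⟩ := H (r w) hw (hb w ▸ hw') (hr w)
  obtain ⟨U'', hx, hU''⟩ := exists_affine_nhd (V := U') (x := (pullback.fst b R.subschemeι ≫ b) (r w)) (hO'' hz)
  let O₁ : T.Opens := r ⁻¹ᵁ O ⊓ f ⁻¹ᵁ (vectorBundleπ E ⁻¹ᵁ U''.1)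
  have hm : mres E (hU''.trans hU) m = ∑ i, fres hU'' (c i) • mres E (hU''.trans hU') (C.e i) := by
    have := congrArg (mres E hU'') h1
    rw [map_sum, mres_mres] at this
    rw [this]
    exact Finset.sum_congr rfl fun i _ => by rw [mres_smul, mres_mres]
  have hO₁ : O₁ ≤ f ⁻¹ᵁ (vectorBundleπ E ⁻¹ᵁ U''.1) := inf_le_right
  have hO₂ : O₁ ≤ r ⁻¹ᵁ O := inf_le_left
  refine ⟨O₁, fun w hw => hO hw.1, fun w hw => (hU''.trans hU) hw.2, ⟨hz, ?_⟩, ?_⟩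
  · change vectorBundleπ E (f w) ∈ U''.1
    rw [hb]; exact hx
  have h3 := congrArg (f.appLE _ O₁ hO₁) (fres_vectorBundleFun E (hU''.trans hU) m)
  rw [appLE_fres] at h3
  rw [h3, hm, vectorBundleFun_sum, map_sum, ← appLE_comp r _ hO hO₂, h2, map_sum]
  refine Finset.sum_congr rfl fun i _ => ?_
  rw [vectorBundleFun_smul, map_mul, map_mul, appLE_comp, appLE_comp, app_eq_appLE_apply _ le_rfl,
    appLE_comp, appLE_fres, ← fres_vectorBundleFun, appLE_fres]
  congr 1
  · exact appLE_congr hf _ _ _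
  · exact hC i _ _ _

theorem vectorBundle_fiber_bijective {C : BundleChart b R E}
    {θ : pullback b R.subschemeι ⟶ pullback (vectorBundleπ E) R.subschemeι}
    (hθ : (θ ≫ pullback.fst _ _) ≫ vectorBundleπ E = pullback.fst b R.subschemeι ≫ b)
    (hC : ∀ i, Matches (θ ≫ pullback.fst _ _) (pullback.fst b R.subschemeι) C.U (C.e i) C.V
      (C.g i)) :
    Function.Bijective
      (θ.app (pullback.fst (vectorBundleπ E) R.subschemeι ⁻¹ᵁ (vectorBundleπ E ⁻¹ᵁ C.U.1))) := by
  set D := pullback.fst (vectorBundleπ E) R.subschemeι ⁻¹ᵁ (vectorBundleπ E ⁻¹ᵁ C.U.1)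
  have hD : θ ⁻¹ᵁ D = C.fiber := by
    rw [C.fiber_eq, ← hθ]; rfl
  let A := Γ(X, C.U.1)
  let ε₁ := eval₂Hom ((vectorBundleπ E).app C.U.1).hom
    fun i => vectorBundleFun E C.U (C.e i)
  let ε₂ := eval₂Hom (b.appLE C.U.1 C.V C.le).hom C.g
  let ρ₁ := (pullback.fst (vectorBundleπ E) R.subschemeι).appLE _ D le_rfl
  let ρ₂ := (pullback.fst b R.subschemeι).appLE C.V C.fiber le_rfl
  have hρ₁ : ∀ g, ρ₁ g = 0 ↔ (vectorBundleπ E).appLE C.U.1 _ le_rfl C.t ∣ g := fun g =>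
    (congrArg (· = 0) (app_eq_appLE_apply _ le_rfl g).symm).to_iff.trans
      (app_pullback_fst_eq_zero_iff (vectorBundleπ E) R (isAffineOpen_vectorBundle E C.U) le_rfl
        C.ideal_eq g)
  have hρ₂ : ∀ g, ρ₂ g = 0 ↔ b.appLE C.U.1 C.V C.le C.t ∣ g := fun g =>
    (congrArg (· = 0) (app_eq_appLE_apply _ le_rfl g).symm).to_iff.trans
      (app_pullback_fst_eq_zero_iff b R C.isAffineOpen C.le C.ideal_eq g)
  have hρ₁' : Function.Surjective ρ₁ := fun y =>
    (app_pullback_fst_surjective (vectorBundleπ E) R (isAffineOpen_vectorBundle E C.U) y).imp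
      fun z hz => (app_eq_appLE_apply _ le_rfl z).symm.trans hz
  have hρ₂' : Function.Surjective ρ₂ := fun y =>
    (app_pullback_fst_surjective b R C.isAffineOpen y).imp
      fun z hz => (app_eq_appLE_apply _ le_rfl z).symm.trans hz
  have hε : ∀ p, θ.appLE D C.fiber hD.ge (ρ₁ (ε₁ p)) = ρ₂ (ε₂ p) := by
    have h1 : ((θ.appLE D C.fiber hD.ge).hom.comp ρ₁.hom).comp ε₁ = ρ₂.hom.comp ε₂ := by
      refine MvPolynomial.ringHom_ext (fun a => ?_) fun i => ?_
      · simp only [RingHom.comp_apply, ε₁, ε₂, eval₂Hom_C]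
        rw [app_eq_appLE_apply _ le_rfl]
        refine (congrArg _ (appLE_comp _ _ _ _ _)).trans ?_
        refine (appLE_comp _ _ _ _ _).trans (Eq.trans ?_ (appLE_comp _ _ _ _ _).symm)
        exact appLE_congr ((Category.assoc _ _ _).symm.trans hθ) _ _ _
      · simp only [RingHom.comp_apply, ε₁, ε₂, eval₂Hom_X']
        refine (appLE_comp _ _ _ _ _).trans ?_
        exact hC i _ _ _
    exact fun p => congrArg (fun f => f p) h1
  have hε₁ : Function.Bijective ε₁ := C.isBasisOn.bijective_eval₂_vectorBundleFun
  have h2 : ∀ a, θ.appLE D C.fiber hD.ge a = fres hD.ge (θ.app D a) := fun a => by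
    rw [app_eq_appLE_apply _ le_rfl, fres_appLE]
  have h3 : Function.Bijective (fres hD.ge) := by
    have : ∀ (F G : (pullback b R.subschemeι).Opens) (h : F = G), Function.Bijective (fres h.ge) := by
      rintro F _ rfl
      exact ⟨fun a c h => by rwa [fres_self, fres_self] at h, fun a => ⟨a, fres_self _ a⟩⟩
    exact this _ _ hD
  suffices H : Function.Bijective (θ.appLE D C.fiber hD.ge) by
    refine (Function.Bijective.of_comp_iff' h3 _).mp ?_
    rwa [show ⇑(fres hD.ge) ∘ ⇑(θ.app D) = ⇑(θ.appLE D C.fiber hD.ge) from (_root_.funext h2).symm]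
  constructor
  · refine (injective_iff_map_eq_zero (θ.appLE D C.fiber hD.ge).hom).mpr fun y hy => ?_
    obtain ⟨z, rfl⟩ := hρ₁' y
    obtain ⟨p, rfl⟩ := hε₁.surjective z
    obtain ⟨q, rfl⟩ := C.dvd_of_dvd p ((hρ₂ _).mp ((hε p).symm.trans hy))
    rw [hρ₁, map_mul, eval₂Hom_C, ← app_eq_appLE_apply]
    exact dvd_mul_right _ _
  · intro y
    obtain ⟨z, rfl⟩ := hρ₂' y
    obtain ⟨p, hp⟩ := C.exists_dvd z
    refine ⟨_, (hε p).trans (sub_eq_zero.mp ?_)⟩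
    rw [← map_sub, hρ₂, ← dvd_neg, neg_sub]
    exact hp

/-- A bundle with compatible charts over a divisor is the corresponding vector bundle. -/
theorem existsUnique_bundleIso
    {𝒟 : ∀ (U : X.affineOpens) (_ : Γ(E, U.1)) (V : Q.Opens), Γ(Q, V) → Prop}
    (C : X → BundleChart b R E) (hx : ∀ x, x ∈ (C x).U.1)
    (hC : ∀ x i, 𝒟 (C x).U ((C x).e i) (C x).V ((C x).g i))
    (H : ∀ U m V g, 𝒟 U m V g → ∀ (x : X) (z : ↥(pullback b R.subschemeι)),
      pullback.fst b R.subschemeι z ∈ V → (pullback.fst b R.subschemeι ≫ b) z ∈ U.1 →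
      z ∈ (C x).fiber → (C x).Compatible z U.1 m V g) :
    ∃! θ : pullback b R.subschemeι ≅ pullback (vectorBundleπ E) R.subschemeι,
      θ.hom ≫ pullback.snd _ _ = pullback.snd _ _ ∧
      ∀ U m V g, 𝒟 U m V g → Corresponds b R E θ U m V g := by
  let p := pullback.fst b R.subschemeι
  have hF : ∀ z, z ∈ (C ((p ≫ b) z)).fiber := fun z => by
    rw [BundleChart.fiber_eq]; exact hx _
  have ext : ∀ {T : Scheme.{u}} (r : T ⟶ pullback b R.subschemeι) (f₁ f₂ : T ⟶ vectorBundle E),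
      f₁ ≫ vectorBundleπ E = r ≫ p ≫ b → f₂ ≫ vectorBundleπ E = r ≫ p ≫ b →
      (∀ U m V g, 𝒟 U m V g → Matches f₁ (r ≫ p) U m V g) →
      (∀ U m V g, 𝒟 U m V g → Matches f₂ (r ≫ p) U m V g) → f₁ = f₂ := by
    intro T r f₁ f₂ h₁ h₂ H₁ H₂
    refine hom_vectorBundle_ext (h₁.trans h₂.symm) fun w => ?_
    let x := (p ≫ b) (r w)
    have hle : ∀ f : T ⟶ vectorBundle E, f ≫ vectorBundleπ E = r ≫ p ≫ b →
        r ⁻¹ᵁ (C x).fiber ≤ f ⁻¹ᵁ (vectorBundleπ E ⁻¹ᵁ (C x).U.1) := fun f hf => by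
      rw [BundleChart.fiber_eq, ← Scheme.Hom.comp_preimage, ← Scheme.Hom.comp_preimage, hf]
    exact ⟨(C x).n, (C x).U, (C x).e, (C x).isBasisOn, r ⁻¹ᵁ (C x).fiber, hle _ h₁, hle _ h₂,
      hF (r w), fun i => (H₁ _ _ _ _ (hC x i) (r ⁻¹ᵁ (C x).fiber) (fun z hz => hz) _).trans
        (H₂ _ _ _ _ (hC x i) (r ⁻¹ᵁ (C x).fiber) (fun z hz => hz) _).symm⟩
  choose ψ hψ hψ' using fun x => (C x).exists_hom
  have key : ∀ {T : Scheme.{u}} (x : X) (r : T ⟶ (C x).fiber.toScheme) U m V g, 𝒟 U m V g →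
      Matches (r ≫ ψ x) ((r ≫ (C x).fiber.ι) ≫ p) U m V g := by
    intro T x r U m V g h
    refine matches_of_compatible (C := C x) (fun z => H U m V g h x z) (r := r ≫ (C x).fiber.ι)
      (by rw [Category.assoc, hψ, Category.assoc]) (fun w => (r w).2) fun i => ?_
    rw [Category.assoc]
    exact (hψ' x i).comp r
  let 𝒰 := (pullback b R.subschemeι).openCoverOfIsOpenCover (fun x => (C x).fiber)
    (TopologicalSpace.IsOpenCover.mk (by
      rw [eq_top_iff]
      exact fun z _ => TopologicalSpace.Opens.mem_iSup.mpr ⟨_, hF z⟩))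
  have hglue : ∀ {T : Scheme.{u}} (x y : X) (r₁ : T ⟶ (C x).fiber.toScheme)
      (r₂ : T ⟶ (C y).fiber.toScheme), r₁ ≫ (C x).fiber.ι = r₂ ≫ (C y).fiber.ι →
      r₁ ≫ ψ x = r₂ ≫ ψ y := by
    intro T x y r₁ r₂ hc
    refine ext (r₁ ≫ (C x).fiber.ι) _ _ ?_ ?_ (key x _) ?_
    · rw [Category.assoc, hψ, Category.assoc]
    · rw [hc, Category.assoc, hψ, Category.assoc]
    · rw [hc]; exact key y _
  let Ψ : pullback b R.subschemeι ⟶ vectorBundle E := 𝒰.glueMorphisms ψ fun x y => hglue x y _ _ pullback.condition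
  have hΨ : ∀ x, (C x).fiber.ι ≫ Ψ = ψ x := fun x => 𝒰.ι_glueMorphisms ψ _ x
  have hΨπ : Ψ ≫ vectorBundleπ E = p ≫ b := by
    refine Scheme.hom_ext_of_forall _ _ fun z => ⟨_, hF z, ?_⟩
    rw [← Category.assoc, hΨ, hψ]
  have hΨM : ∀ U m V g, 𝒟 U m V g → Matches Ψ p U m V g := by
    intro U m V g h
    refine matches_of_cover fun z => ⟨_, hF z, ?_⟩
    rw [hΨ]
    have := key ((p ≫ b) z) (𝟙 _) U m V g h
    rwa [Category.id_comp, Category.id_comp] at this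
  let θ : pullback b R.subschemeι ⟶ pullback (vectorBundleπ E) R.subschemeι :=
    pullback.lift Ψ (pullback.snd _ _) (hΨπ.trans pullback.condition)
  have hθ : θ ≫ pullback.fst _ _ = Ψ := pullback.lift_fst _ _ _
  have hθ' : θ ≫ pullback.snd _ _ = pullback.snd _ _ := pullback.lift_snd _ _ _
  have : IsIso θ := by
    refine isIso_of_affine_cover θ (fun x => ⟨pullback.fst (vectorBundleπ E) R.subschemeι ⁻¹ᵁ
      (vectorBundleπ E ⁻¹ᵁ (C x).U.1), (isAffineOpen_vectorBundle E _).preimage _⟩) ?_ ?_ ?_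
    · rw [eq_top_iff]
      exact fun z _ => TopologicalSpace.Opens.mem_iSup.mpr ⟨_, hx _⟩
    · intro x
      have : θ ⁻¹ᵁ (pullback.fst (vectorBundleπ E) R.subschemeι ⁻¹ᵁ
          (vectorBundleπ E ⁻¹ᵁ (C x).U.1)) = (C x).fiber := by
        rw [BundleChart.fiber_eq, ← hΨπ, ← hθ]; rfl
      rw [this]
      exact (C x).isAffineOpen_fiber
    · exact fun x => vectorBundle_fiber_bijective (by rw [hθ]; exact hΨπ)
        fun i => by rw [hθ]; exact hΨM _ _ _ _ (hC x i)
  refine ⟨asIso θ, ⟨hθ', fun U m V g h => ?_⟩, ?_⟩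
  · change Matches (θ ≫ pullback.fst _ _) p U m V g
    rw [hθ]
    exact hΨM U m V g h
  · rintro θ' ⟨h1, h2⟩
    refine Iso.ext (pullback.hom_ext ?_ (h1.trans hθ'.symm))
    have h3 := pullback.condition (f := vectorBundleπ E) (g := R.subschemeι)
    refine Eq.trans ?_ hθ.symm
    refine ext (𝟙 _) _ _ ?_ (by rw [hΨπ, Category.id_comp]) (fun U m V g h => ?_)
      (fun U m V g h => by rw [Category.id_comp]; exact hΨM U m V g h)
    · rw [Category.assoc, h3, reassoc_of% h1, Category.id_comp, pullback.condition]
    · rw [Category.id_comp]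
      exact h2 U m V g h

end Gluing

end

/-! ### Étale ring homomorphisms from polynomial rings -/

section EtaleCoordinates

theorem RingHom.Etale.of_comp {A B C : Type*} [CommRing A] [CommRing B] [CommRing C] {f : A →+* B}
    {g : B →+* C} (hf : f.Etale) (hgf : (g.comp f).Etale) : g.Etale := by
  algebraize [f, g, g.comp f]
  exact Algebra.Etale.of_restrictScalars A B C

variable {A B : Type u} [CommRing A] [CommRing B] {n : ℕ}

theorem RingHom.Etale.eval₂Hom_of_comp {A A' B B' : Type u} [CommRing A] [CommRing A'] [CommRing B]
    [CommRing B'] {ι : Type} {φ : A →+* B} {y : ι → B} {φ' : A' →+* B'} {y' : ι → B'}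
    {r : A →+* A'} {s : B →+* B'} (h : (eval₂Hom φ y).Etale) (hr : r.Etale) (hs : s.Etale)
    (hφ : s.comp φ = φ'.comp r) (hy : ∀ i, s (y i) = y' i) : (eval₂Hom φ' y').Etale := by
  have h1 : (MvPolynomial.map r : MvPolynomial ι A →+* MvPolynomial ι A').Etale := by
    algebraize [r]
    let _ : Algebra (MvPolynomial ι A) (MvPolynomial ι A') := MvPolynomial.algebraMvPolynomial
    have h2 : Algebra.IsPushout A A' (MvPolynomial ι A) (MvPolynomial ι A') := inferInstance
    exact RingHom.Etale.isStableUnderBaseChange A A' (MvPolynomial ι A) (MvPolynomial ι A') hr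
  refine h1.of_comp ?_
  have h2 : (eval₂Hom φ' y').comp (MvPolynomial.map r) =
      s.comp (eval₂Hom φ y) := by
    refine MvPolynomial.ringHom_ext (fun a => ?_) fun i => ?_
    · simpa using (congrArg (fun f => f a) hφ).symm
    · simpa using (hy i).symm
  rw [h2]
  exact RingHom.Etale.stableUnderComposition _ _ h hs

/-- A section of a scheme with étale coordinates which vanish along it is, near its image, defined
by the coordinates. -/
theorem RingHom.Etale.exists_mul_mem_span {x : MvPolynomial (Fin n) A →+* B} (hx : x.Etale) {σ : B →+* A}
    (hσ : ∀ a, σ (x (.C a)) = a) (h0 : ∀ i, σ (x (.X i)) = 0) :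
    ∃ r, σ r = 1 ∧ ∀ b, σ b = 0 → r * b ∈ Ideal.span (Set.range fun i => x (.X i)) := by
  set I := Ideal.span (Set.range fun i => x (.X i))
  set J := RingHom.ker σ
  have hIJ : I ≤ J := by
    rw [Ideal.span_le]
    rintro _ ⟨i, rfl⟩
    exact h0 i
  -- By unramifiedness, `b` and the constant `σ b` agree modulo `I + J²`.
  have h1 : J ≤ I ⊔ J • J := by
    intro b hb
    have hb' : σ b = 0 := hb
    let k := Ideal.Quotient.mk (I ⊔ J • J)
    algebraize [x, k.comp x]
    let g₁ : B →ₐ[MvPolynomial (Fin n) A] B ⧸ (I ⊔ J • J) := { k with commutes' := fun _ => rfl }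
    let g₂ : B →ₐ[MvPolynomial (Fin n) A] B ⧸ (I ⊔ J • J) :=
      { (k.comp (x.comp MvPolynomial.C)).comp σ with
        commutes' := fun p => by
          suffices H : ((k.comp (x.comp MvPolynomial.C)).comp σ).comp x = k.comp x from
            congrArg (fun f => f p) H
          refine MvPolynomial.ringHom_ext (fun a => ?_) fun i => ?_
          · simp only [RingHom.comp_apply, hσ]
          · simp only [RingHom.comp_apply, h0, map_zero]
            exact (Ideal.Quotient.eq_zero_iff_mem.mpr (Ideal.mem_sup_left
              (Ideal.subset_span (Set.mem_range_self i)))).symm }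
    have h2 : IsNilpotent (J.map k) := by
      refine ⟨2, ?_⟩
      rw [← Ideal.map_pow, Ideal.zero_eq_bot, Ideal.map_eq_bot_iff_le_ker, Ideal.mk_ker, pow_two]
      exact le_sup_right
    have h3 : g₁ = g₂ := Algebra.FormallyUnramified.ext (J.map k) h2 fun c => by
      change Ideal.Quotient.mk _ (k c) = Ideal.Quotient.mk _ (k (x (.C (σ c))))
      rw [← sub_eq_zero, ← map_sub, ← map_sub, Ideal.Quotient.eq_zero_iff_mem]
      refine Ideal.mem_map_of_mem k ?_
      change σ _ = 0
      rw [map_sub, hσ, sub_self]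
    have h4 : k b = k (x (.C (σ b))) := congrArg (fun f => f b) h3
    rw [hb', map_zero, map_zero, map_zero] at h4
    exact Ideal.Quotient.eq_zero_iff_mem.mp h4
  have hJ : J.FG := by
    algebraize [x, x.comp MvPolynomial.C]
    have h1 : Algebra.FinitePresentation A B := .trans A (MvPolynomial (Fin n) A) B
    let σ' : B →ₐ[A] A := { σ with commutes' := hσ }
    exact Algebra.FinitePresentation.ker_fG_of_surjective σ' fun a => ⟨_, hσ a⟩
  obtain ⟨r, hr, hr'⟩ := Submodule.exists_sub_one_mem_and_smul_le_of_fg_of_le_sup hJ le_rfl h1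
  refine ⟨r, ?_, fun b hb => hr' (Submodule.smul_mem_pointwise_smul b r _ hb)⟩
  have h2 : σ (r - 1) = 0 := hr
  rwa [map_sub, map_one, sub_eq_zero] at h2

theorem RingHom.Etale.eval₂Hom_sub {ι : Type} {φ : A →+* B} {y : ι → B}
    (h : (eval₂Hom φ y).Etale) (c : ι → A) :
    (eval₂Hom φ fun i => y i - φ (c i)).Etale := by
  let τ : (ι → A) → (MvPolynomial ι A →+* MvPolynomial ι A) := fun c =>
    eval₂Hom MvPolynomial.C fun i => MvPolynomial.X i - MvPolynomial.C (c i)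
  have hτ : ∀ c, (τ c).comp (τ (-c)) = RingHom.id _ := fun c => by
    refine MvPolynomial.ringHom_ext (fun a => ?_) fun i => ?_ <;> simp [τ]
  have h1 : Function.Bijective (τ c) := by
    refine Function.bijective_iff_has_inverse.mpr ⟨τ (-c), fun p => ?_, fun p => ?_⟩
    · have := hτ (-c)
      rw [neg_neg] at this
      exact congrArg (fun f => f p) this
    · exact congrArg (fun f => f p) (hτ c)
  have h2 : (eval₂Hom φ fun i => y i - φ (c i)) = (eval₂Hom φ y).comp (τ c) := by
    refine MvPolynomial.ringHom_ext (fun a => ?_) fun i => ?_ <;> simp [τ]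
  rw [h2]
  exact RingHom.Etale.stableUnderComposition _ _ (.of_bijective h1) h

end EtaleCoordinates

/-! ### Étale coordinates along a section -/

section

variable {X P : Scheme.{u}}

theorem id_appLE {U V : X.Opens} (h : V ≤ U) (c : Γ(X, U)) :
    (𝟙 X : X ⟶ X).appLE U V h c = fres h c := rfl

theorem etale_fres {W W' : P.Opens} (hW : IsAffineOpen W) (hW' : IsAffineOpen W') (h : W' ≤ W) :
    (fres h).Etale := by
  have h1 := HasRingHomProperty.appLE (P := @Etale) (𝟙 P) inferInstance ⟨W, hW⟩ ⟨W', hW'⟩ h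
  have h2 : ((𝟙 P : P ⟶ P).appLE W W' h).hom = fres h := RingHom.ext fun c => id_appLE h c
  rwa [h2] at h1

theorem appLE_section {a : P ⟶ X} {σ : X ⟶ P} (hσ : σ ≫ a = 𝟙 X) {U U' : X.Opens} {W : P.Opens}
    (h : W ≤ a ⁻¹ᵁ U) (h' : U' ≤ σ ⁻¹ᵁ W) (hU : U' ≤ U) (c : Γ(X, U)) :
    σ.appLE W U' h' (a.appLE U W h c) = fres hU c := by
  rw [appLE_comp, appLE_congr hσ _ hU]
  exact id_appLE _ _

theorem preimage_section_le {a : P ⟶ X} {σ : X ⟶ P} (hσ : σ ≫ a = 𝟙 X) {U : X.Opens} {W : P.Opens}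
    (h : W ≤ a ⁻¹ᵁ U) : σ ⁻¹ᵁ W ≤ U := by
  intro x hx
  have h1 : a (σ x) ∈ U := h hx
  rwa [← Scheme.Hom.comp_apply, hσ] at h1

theorem section_mem_preimage {a : P ⟶ X} {σ : X ⟶ P} (hσ : σ ≫ a = 𝟙 X) (x : X) : a (σ x) = x := by
  rw [← Scheme.Hom.comp_apply, hσ]; rfl

/-- The functions `y` on `W` form étale coordinates relative to `U`, which vanish along the section
`σ` of `a`. -/
structure IsSectionCoords (a : P ⟶ X) (σ : X ⟶ P) (U : X.affineOpens) (W : P.affineOpens) {n : ℕ}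
    (y : Fin n → Γ(P, W.1)) : Prop where
  le : W.1 ≤ a ⁻¹ᵁ U.1
  le_preimage : U.1 ≤ σ ⁻¹ᵁ W.1
  etale : (eval₂Hom (a.appLE U.1 W.1 le).hom y).Etale
  eq_zero : ∀ i, σ.appLE W.1 U.1 le_preimage (y i) = 0

/-- The functions `y` generate the ideal of the section `σ`. -/
def GeneratesKer (σ : X ⟶ P) (U : X.affineOpens) (W : P.affineOpens) {n : ℕ}
    (y : Fin n → Γ(P, W.1)) : Prop :=
  ∀ (h : U.1 ≤ σ ⁻¹ᵁ W.1) f, σ.appLE W.1 U.1 h f = 0 → f ∈ Ideal.span (Set.range y)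

section
variable {a : P ⟶ X} {σ : X ⟶ P} (hσ : σ ≫ a = 𝟙 X) {U U' : X.affineOpens} {W W' : P.affineOpens} {n : ℕ}
  {y : Fin n → Γ(P, W.1)}

theorem IsSectionCoords.restrict (hy : IsSectionCoords a σ U W y) (hU : U'.1 ≤ U.1) (hW : W'.1 ≤ W.1)
    (h : W'.1 ≤ a ⁻¹ᵁ U'.1) (h' : U'.1 ≤ σ ⁻¹ᵁ W'.1) :
    IsSectionCoords a σ U' W' fun i => fres hW (y i) where
  le := h
  le_preimage := h'
  etale := hy.etale.eval₂Hom_of_comp (etale_fres U.2 U'.2 hU) (etale_fres W.2 W'.2 hW)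
    (RingHom.ext fun c => (fres_appLE hy.le hW c).trans (appLE_fres h hU c).symm) fun _ => rfl
  eq_zero i := by
    have := congrArg (fres hU) (hy.eq_zero i)
    rw [map_zero, fres_appLE] at this
    rwa [appLE_fres]

include hσ

theorem exists_isSectionCoords [Smooth a] (x : X) : ∃ (U : X.affineOpens) (W : P.affineOpens) (n : ℕ)
    (y : Fin n → Γ(P, W.1)), x ∈ U.1 ∧ IsSectionCoords a σ U W y := by
  obtain ⟨U, hU, V, hV, hx, e, h⟩ := Smooth.exists_isStandardSmooth a (σ x)
  obtain ⟨n, g, hg, hg'⟩ := h.exists_etale_mvPolynomial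
  have hxU : x ∈ U := preimage_section_le hσ e hx
  obtain ⟨s, hs, hxs⟩ := hU.exists_basicOpen_le (V := U ⊓ σ ⁻¹ᵁ V) ⟨x, hxU, hx⟩ hxU
  let U' : X.affineOpens := ⟨X.basicOpen s, hU.basicOpen s⟩
  let W : P.affineOpens := ⟨P.basicOpen (a.appLE U V e s), hV.basicOpen _⟩
  have hWV : W.1 ≤ V := P.basicOpen_le _
  have hW : W.1 ≤ a ⁻¹ᵁ U'.1 := by
    change P.basicOpen (a.appLE U V e s) ≤ _
    rw [Scheme.basicOpen_appLE]; exact inf_le_right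
  have hW' : U'.1 ≤ σ ⁻¹ᵁ W.1 := by
    change _ ≤ σ ⁻¹ᵁ P.basicOpen (a.appLE U V e s)
    rw [Scheme.basicOpen_appLE]
    refine fun z hz => ⟨(hs hz).2, ?_⟩
    change a (σ z) ∈ X.basicOpen s
    rwa [section_mem_preimage hσ]
  have hU'U : U'.1 ≤ U := X.basicOpen_le s
  have hg0 : g = eval₂Hom (a.appLE U V e).hom fun i => g (.X i) :=
    MvPolynomial.ringHom_ext (fun c => by simpa using congrArg (fun f => f c) hg) fun i => by simp
  rw [hg0] at hg'
  have h1 := hg'.eval₂Hom_of_comp (etale_fres hU U'.2 hU'U) (etale_fres hV W.2 hWV)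
    (φ' := (a.appLE U'.1 W.1 hW).hom) (y' := fun i => fres hWV (g (.X i)))
    (RingHom.ext fun c => (fres_appLE e hWV c).trans (appLE_fres hW hU'U c).symm) fun _ => rfl
  refine ⟨U', W, n, _, hxs, hW, hW', h1.eval₂Hom_sub fun i =>
    σ.appLE W.1 U'.1 hW' (fres hWV (g (.X i))), fun i => ?_⟩
  rw [map_sub, sub_eq_zero]
  exact ((appLE_section hσ _ _ le_rfl _).trans (fres_self _ _)).symm

/-- Coordinates generate the ideal of the section after shrinking both charts; the second morphism
`a'` allows for the two projections of a self-product. -/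
theorem IsSectionCoords.exists_generatesKer {a' : P ⟶ X} (hσ' : σ ≫ a' = 𝟙 X)
    (hy : IsSectionCoords a σ U W y) {x : X} (hx : x ∈ U.1)
    {U₀ : X.Opens} (hxU : x ∈ U₀) {W₀ : P.Opens} (hxW : σ x ∈ W₀) :
    ∃ (U' : X.affineOpens) (W' : P.affineOpens) (_ : U'.1 ≤ U.1) (hW : W'.1 ≤ W.1), x ∈ U'.1 ∧
      U'.1 ≤ U₀ ∧ W'.1 ≤ W₀ ∧ W'.1 ≤ a' ⁻¹ᵁ U'.1 ∧
      IsSectionCoords a σ U' W' (fun i => fres hW (y i)) ∧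
      GeneratesKer σ U' W' fun i => fres hW (y i) := by
  have hxa' : σ x ∈ a' ⁻¹ᵁ U.1 := by
    change a' (σ x) ∈ U.1
    rwa [section_mem_preimage hσ']
  obtain ⟨b, hb, hxb⟩ := W.2.exists_basicOpen_le (V := W₀ ⊓ a' ⁻¹ᵁ U.1) ⟨σ x, hxW, hxa'⟩
    (hy.le_preimage hx)
  obtain ⟨s, hs, hxs⟩ := U.2.exists_basicOpen_le (V := U₀ ⊓ σ ⁻¹ᵁ P.basicOpen b) ⟨x, hxU, hxb⟩ hx
  let U' : X.affineOpens := ⟨X.basicOpen s, U.2.basicOpen s⟩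
  let W_b : P.affineOpens := ⟨P.basicOpen b, W.2.basicOpen b⟩
  have hWb : W_b.1 ≤ W.1 := P.basicOpen_le b
  have hWba : W_b.1 ≤ a ⁻¹ᵁ U.1 := hWb.trans hy.le
  have hWba' : W_b.1 ≤ a' ⁻¹ᵁ U.1 := hb.trans inf_le_right
  let W₁ : P.affineOpens := ⟨P.basicOpen (a.appLE U.1 W_b.1 hWba s * a'.appLE U.1 W_b.1 hWba' s),
    W_b.2.basicOpen _⟩
  have hU' : U'.1 ≤ U.1 := X.basicOpen_le s
  have hW₁b : W₁.1 ≤ W_b.1 := P.basicOpen_le _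
  have hW₁' : W₁.1 ≤ W.1 := hW₁b.trans hWb
  have hW₁ : W₁.1 ≤ a ⁻¹ᵁ U'.1 := by
    change P.basicOpen _ ≤ _
    rw [Scheme.basicOpen_mul, Scheme.basicOpen_appLE]
    exact inf_le_left.trans inf_le_right
  have hW₁a' : W₁.1 ≤ a' ⁻¹ᵁ U'.1 := by
    change P.basicOpen _ ≤ _
    rw [Scheme.basicOpen_mul, Scheme.basicOpen_appLE, Scheme.basicOpen_appLE]
    exact inf_le_right.trans inf_le_right
  have hUW : U'.1 ≤ σ ⁻¹ᵁ W₁.1 := by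
    change _ ≤ σ ⁻¹ᵁ P.basicOpen _
    rw [Scheme.basicOpen_mul, Scheme.basicOpen_appLE, Scheme.basicOpen_appLE]
    refine fun z hz => ⟨⟨(hs hz).2, ?_⟩, (hs hz).2, ?_⟩
    · change a (σ z) ∈ X.basicOpen s
      rwa [section_mem_preimage hσ]
    · change a' (σ z) ∈ X.basicOpen s
      rwa [section_mem_preimage hσ']
  have h1 := hy.restrict hU' hW₁' hW₁ hUW
  obtain ⟨r, hr, hr'⟩ := h1.etale.exists_mul_mem_span (σ := (σ.appLE W₁.1 U'.1 hUW).hom)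
    (fun c => by
      rw [eval₂Hom_C]
      exact (appLE_section hσ _ _ le_rfl _).trans (fres_self _ _))
    (fun i => by rw [eval₂Hom_X']; exact h1.eq_zero i)
  simp only [eval₂Hom_X'] at hr'
  let W' : P.affineOpens := ⟨P.basicOpen r, W₁.2.basicOpen r⟩
  have hW' : W'.1 ≤ W₁.1 := P.basicOpen_le r
  have hUW' : U'.1 ≤ σ ⁻¹ᵁ W'.1 := by
    have h2 := Scheme.basicOpen_appLE σ U'.1 W₁.1 hUW r
    have h3 : X.basicOpen (σ.appLE W₁.1 U'.1 hUW r) = U'.1 := by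
      have : σ.appLE W₁.1 U'.1 hUW r = 1 := hr
      rw [this]
      exact Scheme.basicOpen_of_isUnit _ isUnit_one
    rw [h3] at h2
    exact h2.le.trans inf_le_right
  refine ⟨U', W', hU', hW'.trans hW₁', hxs, hs.trans inf_le_left, hW'.trans (hW₁b.trans (hb.trans inf_le_left)),
    hW'.trans hW₁a',
    hy.restrict hU' _ (hW'.trans hW₁) hUW', fun h f hf => ?_⟩
  have hloc := W₁.2.isLocalization_basicOpen r
  obtain ⟨⟨c, _, m, rfl⟩, hc⟩ := IsLocalization.surj (.powers r) (S := Γ(P, P.basicOpen r)) f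
  have hc' : f * fres hW' (r ^ m) = fres hW' c := hc
  have hu : IsUnit (fres hW' r) := RingedSpace.isUnit_res_basicOpen _ r
  have h4 : r * c ∈ Ideal.span (Set.range fun i => fres hW₁' (y i)) := by
    refine hr' c ?_
    have h5 := congrArg (σ.appLE W'.1 U'.1 h) hc'
    rw [map_mul, hf, zero_mul, appLE_fres] at h5
    exact h5.symm
  have h6 := Ideal.mem_map_of_mem (fres hW') h4
  rw [Ideal.map_span, ← Set.range_comp, map_mul, ← hc', map_pow, mul_comm f, ← mul_assoc,
    Ideal.unit_mul_mem_iff_mem _ (hu.mul (hu.pow m))] at h6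
  refine (congrArg (fun S => f ∈ Ideal.span (Set.range S)) (_root_.funext fun i => ?_)).mp h6
  exact fres_fres _ _ _
end

end

/-! ### Smoothness of dilatations -/

section

variable {X P : Scheme.{u}}

section
variable {C C' : Type*} [CommRing C] [CommRing C'] {φ : C →+* C'} {e : C}

theorem IsAwayChart.isUnit_of_top (h : IsAwayChart φ ⊤ e) : IsUnit (φ e) :=
  isUnit_of_dvd_one (by simpa using h.dvd 1 trivial)

theorem IsAwayChart.isLocalization_away_of_top (h : IsAwayChart φ ⊤ e) :
    letI := φ.toAlgebra; IsLocalization.Away e C' := by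
  let _ := φ.toAlgebra
  refine (isLocalization_iff _ _).mpr ⟨?_, ?_, ?_⟩
  · rintro ⟨_, n, rfl⟩
    change IsUnit (φ (e ^ n))
    rw [map_pow]
    exact h.isUnit_of_top.pow n
  · intro z
    obtain ⟨n, r, -, hr⟩ := h.exists_pow_mul_eq z
    refine ⟨(r, ⟨_, n, rfl⟩), ?_⟩
    change z * φ (e ^ n) = φ r
    rw [map_pow, ← hr, mul_comm]
  · intro x y hxy
    have h0 : φ (x - y) = 0 := by
      rw [map_sub, sub_eq_zero]; exact hxy
    obtain ⟨n, hn⟩ := h.exists_pow_mul_eq_zero _ h0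
    refine ⟨⟨_, n, rfl⟩, ?_⟩
    rw [mul_sub, sub_eq_zero] at hn
    exact hn

theorem RingHom.Etale.smooth {A B : Type*} [CommRing A] [CommRing B] {f : A →+* B} (h : f.Etale) :
    f.Smooth := by
  algebraize [f]
  exact RingHom.smooth_algebraMap.mpr inferInstance

theorem IsAwayChart.etale_of_top {C C' : Type u} [CommRing C] [CommRing C'] {φ : C →+* C'} {e : C}
    (h : IsAwayChart φ ⊤ e) : φ.Etale := by
  have h1 := h.isLocalization_away_of_top
  algebraize [φ]
  exact (RingHom.etale_algebraMap).mpr (Algebra.Etale.of_isLocalizationAway e)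
end

variable {a a₀ : P ⟶ X} {σ : X ⟶ P} {R : X.IdealSheafData}
/-- The dilatation along a section. -/
local notation "𝔮" => dilatationMap a₀ σ.ker R

theorem ker_ideal_eq [QuasiCompact σ] {U : X.Opens} {W : P.affineOpens} (h : U ≤ σ ⁻¹ᵁ W.1)
    (h' : σ ⁻¹ᵁ W.1 ≤ U) : σ.ker.ideal W = RingHom.ker (σ.appLE W.1 U h).hom := by
  rw [Scheme.Hom.ker_apply]
  obtain rfl := le_antisymm h h'
  exact Ideal.ext fun f => (congrArg (· = 0) (app_eq_appLE_apply σ le_rfl f)).to_iff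

theorem dilatationIdeal_eq_top [QuasiCompact σ] {W : P.affineOpens} (h : ∀ x, σ x ∉ W.1) :
    (dilatationIdeal a₀ σ.ker R).ideal W = ⊤ := by
  refine eq_top_mono ((le_sup_left : σ.ker ≤ σ.ker ⊔ R.comap a₀) W) ?_
  have h0 : σ ⁻¹ᵁ W.1 ≤ ⊥ := fun x hx => (h x hx).elim
  rw [ker_ideal_eq bot_le h0, eq_top_iff]
  exact fun f _ => Subsingleton.elim _ _

section
variable [IsClosedImmersion σ] (ha : R.comap a = R.comap a₀) (hR : IsEffectiveCartier R)
include ha hR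

/-- Away from the section, the chart of the dilatation is an open subscheme. -/
theorem exists_chart_of_notMem_range {w : P} (hw : w ∉ Set.range σ) :
    ∃ (U : X.affineOpens) (W : P.affineOpens) (h : W.1 ≤ a ⁻¹ᵁ U.1) (t : Γ(X, U.1)), w ∈ W.1 ∧
      R.ideal U = Ideal.span {t} ∧
      IsAwayChart ((𝔮).appLE W.1 (𝔮 ⁻¹ᵁ W.1) le_rfl).hom
        ⊤ (a.appLE U.1 W.1 h t) := by
  obtain ⟨U, hU, t, -, ht⟩ := hR (a w)
  let V : P.Opens := ⟨(Set.range σ)ᶜ, σ.isClosedEmbedding.isClosed_range.isOpen_compl⟩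
  obtain ⟨W, hwW, hW⟩ := exists_affine_nhd (V := a ⁻¹ᵁ U.1 ⊓ V) (x := w) ⟨hU, hw⟩
  refine ⟨U, W, hW.trans inf_le_left, t, hwW, ht, ?_⟩
  rw [← dilatationIdeal_eq_top (a₀ := a₀) (σ := σ) (R := R) (W := W)
    fun x hx => (hW hx).2 ⟨x, rfl⟩]
  exact isAwayChart_dilatation ha ht _

/-- On the fibre over `R` the ideal of the section vanishes, so this fibre lies over the section. -/
theorem dilatationMap_mem_range
    (z : ↥(pullback (𝔮 ≫ a) R.subschemeι)) :
    𝔮 (pullback.fst (𝔮 ≫ a) R.subschemeι z) ∈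
      Set.range σ := by
  obtain ⟨p, hp⟩ : ∃ p, p = pullback.fst (𝔮 ≫ a) R.subschemeι z := ⟨_, rfl⟩
  have h4 : a (𝔮 p) =
      R.subschemeι (pullback.snd (𝔮 ≫ a) R.subschemeι z) := by
    rw [hp, ← Scheme.Hom.comp_apply, ← Scheme.Hom.comp_apply, pullback.condition,
      Scheme.Hom.comp_apply]
  rw [← hp]
  by_contra hw
  obtain ⟨U, W, h, t, hwW, ht, hc⟩ := exists_chart_of_notMem_range ha hR hw
  have h1 : p ∈ (dilatation a₀ σ.ker R).basicOpen
      ((𝔮).appLE W.1 _ le_rfl (a.appLE U.1 W.1 h t)) := by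
    rw [Scheme.basicOpen_of_isUnit _ hc.isUnit_of_top]
    exact hwW
  rw [Scheme.basicOpen_appLE, Scheme.basicOpen_appLE] at h1
  have h2 : a (𝔮 p) ∈ X.basicOpen t := h1.2.2
  have h3 := (mem_complement_iff ht (X.basicOpen_le t h2)).mpr h2
  refine h3 ?_
  rw [h4]
  have := Set.mem_range_self (f := R.subschemeι)
    (pullback.snd (𝔮 ≫ a) R.subschemeι z)
  rwa [Scheme.IdealSheafData.range_subschemeι] at this

theorem dilatationMap_eq (hσ : σ ≫ a = 𝟙 X)
    (z : ↥(pullback (𝔮 ≫ a) R.subschemeι)) :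
    𝔮 (pullback.fst (𝔮 ≫ a) R.subschemeι z) =
      σ ((pullback.fst (𝔮 ≫ a) R.subschemeι ≫
        𝔮 ≫ a) z) := by
  obtain ⟨x, hx⟩ := dilatationMap_mem_range ha hR z
  simp only [Scheme.Hom.comp_apply]
  rw [← hx, section_mem_preimage hσ]

variable [Smooth a] {U : X.affineOpens} {W : P.affineOpens} {n : ℕ} {y : Fin n → Γ(P, W.1)}
  (hσ : σ ≫ a = 𝟙 X)
  (hy : IsSectionCoords a σ U W y) (hker : GeneratesKer σ U W y) {t : Γ(X, U.1)}
  (ht : R.ideal U = Ideal.span {t})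
include hσ hy ht

omit hR [Smooth a] in
theorem IsSectionCoords.isAwayChart : IsAwayChart
    ((𝔮).appLE W.1 (𝔮 ⁻¹ᵁ W.1) le_rfl).hom
    (RingHom.ker (σ.appLE W.1 U.1 hy.le_preimage).hom ⊔ Ideal.span {a.appLE U.1 W.1 hy.le t})
    (a.appLE U.1 W.1 hy.le t) := by
  have h1 := isAwayChart_dilatation (Y := σ.ker) ha ht hy.le
  rw [← ker_ideal_eq hy.le_preimage (preimage_section_le hσ hy.le), ← comap_ideal_eq_span ha ht hy.le]
  exact h1

omit hR [Smooth a] in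
theorem IsSectionCoords.exists_quotient {f : Γ(P, W.1)} (hf : σ.appLE W.1 U.1 hy.le_preimage f = 0) :
    ∃ g, (𝔮).appLE W.1 (𝔮 ⁻¹ᵁ W.1) le_rfl
      (a.appLE U.1 W.1 hy.le t) * g =
      (𝔮).appLE W.1 (𝔮 ⁻¹ᵁ W.1) le_rfl f := by
  obtain ⟨g, hg⟩ := (hy.isAwayChart ha hσ ht).dvd f (Ideal.mem_sup_left hf)
  exact ⟨g, hg.symm⟩

include hker in
omit [Smooth a] in
theorem IsSectionCoords.dilatation_ring {g : Fin n → _}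
    (hg : ∀ i, (𝔮).appLE W.1 (𝔮 ⁻¹ᵁ W.1) le_rfl
      (a.appLE U.1 W.1 hy.le t) * g i =
      (𝔮).appLE W.1 (𝔮 ⁻¹ᵁ W.1) le_rfl (y i))
    (h : 𝔮 ⁻¹ᵁ W.1 ≤ (𝔮 ≫ a) ⁻¹ᵁ U.1) :
    (eval₂Hom ((𝔮 ≫ a).appLE U.1 _ h).hom g).Etale ∧
    (∀ y, ∃ p, (𝔮 ≫ a).appLE U.1 _ h t ∣
      y - MvPolynomial.eval₂ ((𝔮 ≫ a).appLE U.1 _ h).hom g p) ∧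
    ∀ p, (𝔮 ≫ a).appLE U.1 _ h t ∣
      MvPolynomial.eval₂ ((𝔮 ≫ a).appLE U.1 _ h).hom g p →
        MvPolynomial.C t ∣ p := by
  have hnzd : t ∈ nonZeroDivisors Γ(X, U.1) := by
    have := hR.fres_mem ht (le_refl U.1)
    rwa [fres_self] at this
  have hxC : ∀ c, eval₂Hom (a.appLE U.1 W.1 hy.le).hom y (.C c) =
    a.appLE U.1 W.1 hy.le c := fun c => eval₂Hom_C ..
  have hxX : ∀ i, eval₂Hom (a.appLE U.1 W.1 hy.le).hom y (.X i) = y i :=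
    fun i => eval₂Hom_X' ..
  have key := _root_.dilatation_ring hnzd hy.etale (σ := (σ.appLE W.1 U.1 hy.le_preimage).hom)
    (fun c => by
      rw [hxC]
      exact (appLE_section hσ _ _ le_rfl _).trans (fres_self _ _))
    (by
      simp only [hxX]
      refine le_antisymm (fun f hf => hker _ f hf) (Ideal.span_le.mpr ?_)
      rintro _ ⟨i, rfl⟩
      exact hy.eq_zero i)
    (φ := ((𝔮).appLE W.1 (𝔮 ⁻¹ᵁ W.1) le_rfl).hom)
    (by rw [hxC]; exact hy.isAwayChart ha hσ ht) (g := g)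
    (fun i => by rw [hxC, hxX]; exact hg i)
  have h1 : ((𝔮).appLE W.1 (𝔮 ⁻¹ᵁ W.1) le_rfl).hom.comp
      ((eval₂Hom (a.appLE U.1 W.1 hy.le).hom y).comp MvPolynomial.C) =
      ((𝔮 ≫ a).appLE U.1 _ h).hom := RingHom.ext fun c => by
    rw [RingHom.comp_apply, RingHom.comp_apply, hxC]
    exact appLE_comp _ _ _ _ _
  rw [h1, hxC] at key
  have h2 : ((𝔮).appLE W.1 (𝔮 ⁻¹ᵁ W.1) le_rfl).hom
      (a.appLE U.1 W.1 hy.le t) = (𝔮 ≫ a).appLE U.1 _ h t :=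
    appLE_comp _ _ _ _ _
  rw [h2] at key
  exact key

end

/-- A dilatation along a section of a smooth morphism is smooth. -/
theorem smooth_dilatation [IsClosedImmersion σ] (ha : R.comap a = R.comap a₀)
    (hR : IsEffectiveCartier R) [Smooth a] (hσ : σ ≫ a = 𝟙 X) :
    Smooth (𝔮 ≫ a) := by
  refine (HasRingHomProperty.iff_exists_appLE (P := @Smooth) (Q := RingHom.Smooth)
    (RingHom.Smooth.stableUnderComposition.stableUnderCompositionWithLocalizationAway
      RingHom.Smooth.holdsForLocalizationAway).1).mpr fun z => ?_
  by_cases hw : 𝔮 z ∈ Set.range σ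
  · obtain ⟨x, hx⟩ := hw
    obtain ⟨U, W, n, y, hxU, hy⟩ := exists_isSectionCoords hσ x
    obtain ⟨U₀, hxU₀, t₀, -, ht₀⟩ := hR x
    obtain ⟨U', W', hU, hW, hxU', hU', -, -, hy', hker⟩ := hy.exists_generatesKer hσ hσ hxU hxU₀
      (W₀ := ⊤) trivial
    have ht := ideal_eq_span_fres hU' ht₀
    choose g hg using fun i => hy'.exists_quotient ha hσ ht (hy'.eq_zero i)
    have hle : 𝔮 ⁻¹ᵁ W'.1 ≤ (𝔮 ≫ a) ⁻¹ᵁ U'.1 :=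
      fun w hw => hy'.le hw
    have hz : z ∈ 𝔮 ⁻¹ᵁ W'.1 := by
      change _ ∈ W'.1
      rw [← hx]; exact hy'.le_preimage hxU'
    refine ⟨U', ⟨_, isAffineOpen_dilatation ha ht hy'.le⟩, hz, hle, ?_⟩
    have h1 := (hy'.dilatation_ring ha hR hσ hker ht hg hle).1
    have h2 : (MvPolynomial.C : Γ(X, U'.1) →+* MvPolynomial (Fin n) Γ(X, U'.1)).Smooth :=
      RingHom.smooth_algebraMap.mpr ⟨inferInstance, inferInstance⟩
    have h3 := RingHom.Smooth.stableUnderComposition _ _ h2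
      h1.smooth
    rwa [MvPolynomial.eval₂Hom_comp_C] at h3
  · obtain ⟨U, W, h, t, hwW, ht, hc⟩ := exists_chart_of_notMem_range ha hR hw
    refine ⟨U, ⟨_, isAffineOpen_dilatation ha ht h⟩, hwW, fun w hw => h hw, ?_⟩
    have h1 := HasRingHomProperty.appLE (P := @Smooth) a inferInstance U W h
    have h2 : RingHom.Smooth
        ((𝔮).appLE W.1 (𝔮 ⁻¹ᵁ W.1) le_rfl).hom :=
      hc.etale_of_top.smooth
    have h3 := RingHom.Smooth.stableUnderComposition _ _ h1 h2
    convert h3 using 1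
    exact RingHom.ext fun c => (appLE_comp _ _ _ _ _).symm

end

/-! ### The fibre of a dilatation over the divisor -/

section

variable {X P S : Scheme.{u}}

theorem tmul_smul_right {A M N : Type*} [CommRing A] [AddCommGroup M] [AddCommGroup N] [Module A M]
    [Module A N] (c : A) (m : M) (n : N) :
    TensorProduct.tmul A m (c • n) = c • TensorProduct.tmul A m n :=
  TensorProduct.tmul_smul ..

section Tensor
variable (M N : X.Modules)

theorem mres_tensorSection {U V : X.Opens} (h : V ≤ U) (m : Γ(M, U)) (n : Γ(N, U)) :
    mres (tensorModule M N) h (tensorSection M N U m n) =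
      tensorSection M N V (mres M h m) (mres N h n) :=
  (sheafifySection_map _ (homOfLE h) _).trans (congrArg _
    (PresheafOfModules.Monoidal.tensorObj_map_tmul (R := X.presheaf) (M₁ := M.val) (M₂ := N.val)
      (homOfLE h).op m n))

theorem tensorSection_add {U : X.Opens} (m m' : Γ(M, U)) (n : Γ(N, U)) :
    tensorSection M N U (m + m') n = tensorSection M N U m n + tensorSection M N U m' n :=
  (congrArg _ (TensorProduct.add_tmul m m' n)).trans (sheafifySection_add _ _ _ _)

theorem tensorSection_smul {U : X.Opens} (c : Γ(X, U)) (m : Γ(M, U)) (n : Γ(N, U)) :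
    tensorSection M N U (c • m) n = c • tensorSection M N U m n :=
  (congrArg _ (TensorProduct.smul_tmul' c m n).symm).trans (sheafifySection_smul _ _ _ _)

theorem tensorSection_smul_right {U : X.Opens} (c : Γ(X, U)) (m : Γ(M, U)) (n : Γ(N, U)) :
    tensorSection M N U m (c • n) = c • tensorSection M N U m n :=
  (congrArg _ (tmul_smul_right (A := Γ(X, U)) (M := Γ(M, U)) (N := Γ(N, U)) c m n)).trans (sheafifySection_smul _ _ _ _)

theorem tensorSection_sum {ι : Type*} (s : Finset ι) {U : X.Opens} (m : ι → Γ(M, U)) (n : Γ(N, U)) :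
    tensorSection M N U (∑ i ∈ s, m i) n = ∑ i ∈ s, tensorSection M N U (m i) n :=
  map_sum (AddMonoidHom.mk' (fun m => tensorSection M N U m n) fun m m' =>
    tensorSection_add M N m m' n) m s

end Tensor

section Divisor
variable {R : X.IdealSheafData}

theorem mres_divisorSection {U V : X.Opens} (h : V ≤ U)
    {s : Γ(openPush (structureModule X) (complement R), U)} (hs : s ∈ divisorSections R U)
    (hs' : mres _ h s ∈ divisorSections R V) :
    mres _ h (divisorSection R U s hs) = divisorSection R V (mres _ h s) hs' :=
  sheafifySection_map _ (homOfLE h) _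

theorem divisorSection_smul {U : X.Opens} (c : Γ(X, U))
    {s s' : Γ(openPush (structureModule X) (complement R), U)} (hs : s ∈ divisorSections R U)
    (hs' : s' ∈ divisorSections R U) (h : s' = c • s) :
    divisorSection R U s' hs' = c • divisorSection R U s hs := by
  subst h
  exact sheafifySection_smul (submodulePresheaf _ (divisorSections R)
    (divisorSections_map R)).toPresheafOfModules U c ⟨s, hs⟩

theorem IsEffectiveCartier.openPush_eq_zero (hR : IsEffectiveCartier R) {U : X.affineOpens}
    {t : Γ(X, U.1)} (ht : R.ideal U = Ideal.span {t}) (O : X.Opens)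
    {s : Γ(openPush (structureModule X) O, U.1)} (h : t • s = 0) : s = 0 := by
  rw [openPush_smul] at h
  exact hR.eq_zero ht _ h

/-- The sections inverse to two equations of a divisor differ by a unit. -/
theorem IsEffectiveCartier.section_eq_smul (hR : IsEffectiveCartier R) {U : X.affineOpens}
    {t t' u : Γ(X, U.1)} (ht : R.ideal U = Ideal.span {t}) (hu : t' = t * u)
    {s s' : Γ(openPush (structureModule X) (complement R), U.1)} (h : t • s = t' • s') :
    s = u • s' := by
  rw [← sub_eq_zero]
  refine hR.openPush_eq_zero ht _ ?_
  rw [smul_sub, smul_smul, ← hu, h, sub_self]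

end Divisor

section Differential
variable (f : X ⟶ S)

theorem differential_add {U : X.Opens} (a b : Γ(X, U)) :
    differential f U (a + b) = differential f U a + differential f U b :=
  (congrArg _ (map_add (PresheafOfModules.DifferentialsConstruction.derivation'
    (inverseImageHom f)).d a b)).trans (sheafifySection_add _ _ _ _)

theorem differential_sum {ι : Type*} (s : Finset ι) {U : X.Opens} (a : ι → Γ(X, U)) :
    differential f U (∑ i ∈ s, a i) = ∑ i ∈ s, differential f U (a i) :=
  map_sum (AddMonoidHom.mk' (differential f U) fun a b => differential_add f a b) a s

theorem differential_mul {U : X.Opens} (a b : Γ(X, U)) :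
    differential f U (a * b) = a • differential f U b + b • differential f U a := by
  refine (congrArg _ ((PresheafOfModules.DifferentialsConstruction.derivation'
    (inverseImageHom f)).d_mul a b)).trans ((sheafifySection_add _ _ _ _).trans ?_)
  exact congrArg₂ (· + ·) (sheafifySection_smul _ _ _ _) (sheafifySection_smul _ _ _ _)

theorem differential_fres {U V : X.Opens} (h : V ≤ U) (a : Γ(X, U)) :
    differential f V (fres h a) = mres _ h (differential f U a) :=
  (differential_map f (homOfLE h) a).symm

theorem differential_appLE {U : S.Opens} {V : X.Opens} (h : V ≤ f ⁻¹ᵁ U) (a : Γ(S, U)) :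
    differential f V (f.appLE U V h a) = 0 := by
  obtain ⟨z, hz⟩ := exists_inverseImageHom_eq f U V h a
  rw [← hz]
  refine (congrArg _ ((PresheafOfModules.DifferentialsConstruction.derivation'
    (inverseImageHom f)).d_app z)).trans ?_
  exact (map_zero ((sheafifyModuleUnit (presheafDifferentials f)).app (.op V)).hom :)

end Differential

section PullbackDifferential
variable (σ : S ⟶ P) (M : P.Modules)

theorem pullbackSection_add {W : P.Opens} {U : S.Opens} (h : U ≤ σ ⁻¹ᵁ W) (m n : Γ(M, W)) :
    pullbackSection σ M W U h (m + n) = pullbackSection σ M W U h m + pullbackSection σ M W U h n := by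
  rw [pullbackSection_eq, pullSec_add, map_add]; rfl

theorem pullbackSection_sum {W : P.Opens} {U : S.Opens} (h : U ≤ σ ⁻¹ᵁ W) {ι : Type*} (s : Finset ι)
    (m : ι → Γ(M, W)) :
    pullbackSection σ M W U h (∑ i ∈ s, m i) = ∑ i ∈ s, pullbackSection σ M W U h (m i) :=
  map_sum (AddMonoidHom.mk' (pullbackSection σ M W U h) fun m n => pullbackSection_add σ M h m n) m s

theorem pullbackSection_smul {W : P.Opens} {U : S.Opens} (h : U ≤ σ ⁻¹ᵁ W) (c : Γ(P, W)) (m : Γ(M, W)) :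
    pullbackSection σ M W U h (c • m) = σ.appLE W U h c • pullbackSection σ M W U h m := by
  rw [pullbackSection_eq, pullSec_smul, mres_smul, app_eq_appLE_apply σ le_rfl, fres_appLE]; rfl

/-- A combination of functions which vanish along `σ` has the corresponding differential along
`σ`. -/
theorem pullbackSection_differential_sum (a : P ⟶ X) {n : ℕ} {W : P.Opens} {U : S.Opens}
    (h : U ≤ σ ⁻¹ᵁ W) (c y : Fin n → Γ(P, W)) (hy : ∀ i, σ.appLE W U h (y i) = 0) :
    pullbackSection σ (differentials a) W U h (differential a W (∑ i, c i * y i)) =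
      ∑ i, σ.appLE W U h (c i) • pullbackSection σ (differentials a) W U h (differential a W (y i)) := by
  rw [differential_sum, pullbackSection_sum]
  refine Finset.sum_congr rfl fun i _ => ?_
  rw [differential_mul, pullbackSection_add, pullbackSection_smul, pullbackSection_smul, hy, zero_smul,
    add_zero]

end PullbackDifferential

section Dilatation
variable {a a₀ : P ⟶ X} {σ : X ⟶ P} {R : X.IdealSheafData} {N : X.Modules}

/-- The sections `ω ⊗ s` of `N ⊗ 𝒪(R)` and the functions `f / t` on a dilatation along `σ`, for the
pairs of a function `f` and a section `ω` in a family `F` and the inverses `s` of the local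
equations `t` of `R`. -/
inductive DilatationRelation (a a₀ : P ⟶ X) (σ : X ⟶ P) (R : X.IdealSheafData) (N : X.Modules)
    (F : ∀ (U : X.affineOpens) (W : P.Opens), Γ(P, W) → Γ(N, U.1) → Prop) :
    ∀ (U : X.affineOpens) (_ : Γ(tensorModule N (divisorModule R), U.1))
      (V : (dilatation a₀ σ.ker R).Opens), Γ(dilatation a₀ σ.ker R, V) → Prop
  | mk (U : X.affineOpens) (W : P.Opens) (hW : W ≤ a ⁻¹ᵁ U.1) (t : Γ(X, U.1))
    (ht : R.ideal U = Ideal.span {t})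
    (s : Γ(openPush (structureModule X) (complement R), U.1)) (hs : s ∈ divisorSections R U.1)
    (hts : t • s = (openPushUnit (structureModule X) (complement R)).app U.1
      (structureSection (1 : Γ(X, U.1))))
    (f : Γ(P, W)) (ω : Γ(N, U.1)) (hf : F U W f ω)
    (g : Γ(dilatation a₀ σ.ker R, dilatationMap a₀ σ.ker R ⁻¹ᵁ W))
    (hg : (dilatationMap a₀ σ.ker R).app W (a.appLE U.1 W hW t) * g =
      (dilatationMap a₀ σ.ker R).app W f) :
    DilatationRelation a a₀ σ R N F U
      (tensorSection N (divisorModule R) U.1 ω (divisorSection R U.1 s hs))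
      (dilatationMap a₀ σ.ker R ⁻¹ᵁ W) g

/-- The dilatation along a section. -/
local notation "𝔮" => dilatationMap a₀ σ.ker R

variable {F : ∀ (U : X.affineOpens) (W : P.Opens), Γ(P, W) → Γ(N, U.1) → Prop}

variable [IsClosedImmersion σ] (ha : R.comap a = R.comap a₀) (hR : IsEffectiveCartier R)
   (hσ : σ ≫ a = 𝟙 X)
include ha hR hσ

theorem IsSectionCoords.fiber_le {U : X.affineOpens} {W : P.affineOpens} {n : ℕ}
    {y : Fin n → Γ(P, W.1)} (hy : IsSectionCoords a σ U W y) :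
    pullback.fst (𝔮 ≫ a) R.subschemeι ⁻¹ᵁ
      ((𝔮 ≫ a) ⁻¹ᵁ U.1) ≤
    pullback.fst (𝔮 ≫ a) R.subschemeι ⁻¹ᵁ
      (𝔮 ⁻¹ᵁ W.1) := by
  intro z hz
  change 𝔮 (pullback.fst (𝔮 ≫ a) R.subschemeι z) ∈ W.1
  rw [dilatationMap_eq ha hR hσ]
  exact hy.le_preimage hz

/-- The chart of the fibre over `R` given by étale coordinates along a section. -/
def IsSectionCoords.bundleChart {U : X.affineOpens} {W : P.affineOpens} {n : ℕ}
    {y : Fin n → Γ(P, W.1)} (hy : IsSectionCoords a σ U W y) (hker : GeneratesKer σ U W y)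
    {ω : Fin n → Γ(N, U.1)} (hω : IsBasisOn N U.1 ω) {t : Γ(X, U.1)}
    (ht : R.ideal U = Ideal.span {t})
    {s : Γ(openPush (structureModule X) (complement R), U.1)} (hs : s ∈ divisorSections R U.1)
    (hts : t • s = (openPushUnit (structureModule X) (complement R)).app U.1
        (structureSection (1 : Γ(X, U.1))))
    {g : Fin n → Γ(dilatation a₀ σ.ker R, 𝔮 ⁻¹ᵁ W.1)}
    (hg : ∀ i, (𝔮).appLE W.1 (𝔮 ⁻¹ᵁ W.1) le_rfl
        (a.appLE U.1 W.1 hy.le t) * g i =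
        (𝔮).appLE W.1 (𝔮 ⁻¹ᵁ W.1) le_rfl (y i)) :
    BundleChart (𝔮 ≫ a) R (tensorModule N (divisorModule R)) where
  U := U
  n := n
  e := fun i => tensorSection N (divisorModule R) U.1 (ω i) (divisorSection R U.1 s hs)
  isBasisOn := hω.tensor (isBasisOn_divisorModule hR ht hs hts)
  V := 𝔮 ⁻¹ᵁ W.1
  isAffineOpen := isAffineOpen_dilatation ha ht hy.le
  le := fun _ hw => hy.le hw
  fiber_le := hy.fiber_le ha hR hσ
  g := g
  t := t
  ideal_eq := ht
  exists_dvd := (hy.dilatation_ring ha hR hσ hker ht hg fun _ hw => hy.le hw).2.1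
  dvd_of_dvd := (hy.dilatation_ring ha hR hσ hker ht hg fun _ hw => hy.le hw).2.2

omit hR in
/-- On the fibre over `R`, a function on `P` is the pull-back of its restriction along the section. -/
theorem IsSectionCoords.appLE_fiber {U : X.affineOpens} {W : P.affineOpens} {n : ℕ}
    {y : Fin n → Γ(P, W.1)} (hy : IsSectionCoords a σ U W y) {t : Γ(X, U.1)}
    (ht : R.ideal U = Ideal.span {t}) (c : Γ(P, W.1))
    {O : (pullback (𝔮 ≫ a) R.subschemeι).Opens}
    (hO : O ≤ pullback.fst (𝔮 ≫ a) R.subschemeι ⁻¹ᵁ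
      (𝔮 ⁻¹ᵁ W.1))
    (hO' : O ≤ (pullback.fst (𝔮 ≫ a) R.subschemeι ≫
      𝔮 ≫ a) ⁻¹ᵁ U.1) :
    (pullback.fst (𝔮 ≫ a) R.subschemeι).appLE
      (𝔮 ⁻¹ᵁ W.1) O hO
      ((𝔮).appLE W.1 (𝔮 ⁻¹ᵁ W.1) le_rfl c) =
    (pullback.fst (𝔮 ≫ a) R.subschemeι ≫
      𝔮 ≫ a).appLE U.1 O hO' (σ.appLE W.1 U.1 hy.le_preimage c) := by
  have h0 : σ.appLE W.1 U.1 hy.le_preimage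
      (c - a.appLE U.1 W.1 hy.le (σ.appLE W.1 U.1 hy.le_preimage c)) = 0 := by
    rw [map_sub, appLE_section hσ _ _ le_rfl, fres_self, sub_self]
  obtain ⟨g, hg⟩ := hy.exists_quotient ha hσ ht h0
  have hle : 𝔮 ⁻¹ᵁ W.1 ≤ (𝔮 ≫ a) ⁻¹ᵁ U.1 :=
    fun _ hw => hy.le hw
  have h1 := (app_pullback_fst_eq_zero_iff (𝔮 ≫ a) R
    (isAffineOpen_dilatation ha ht hy.le) hle ht _).mpr ⟨g, by
      rw [← appLE_comp 𝔮 a hy.le le_rfl]⟩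
  have h2 := congrArg (fres hO) h1
  rw [app_eq_appLE_apply _ le_rfl, fres_appLE, hg, map_zero, map_sub, map_sub, sub_eq_zero] at h2
  refine h2.trans ?_
  rw [appLE_comp 𝔮 a hy.le le_rfl]
  exact appLE_comp _ _ _ _ _

omit hR in
/-- On the fibre over `R`, the function `f / t` for `f = ∑ cᵢ yᵢ` is linear in the `yᵢ / t`, with
coefficients the restrictions of the `cᵢ` to the section. -/
theorem IsSectionCoords.appLE_fiber_quotient {U : X.affineOpens} {W : P.affineOpens} {n : ℕ}
    {y : Fin n → Γ(P, W.1)} (hy : IsSectionCoords a σ U W y) {t t' u : Γ(X, U.1)}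
    (ht : R.ideal U = Ideal.span {t}) (hu : t' = t * u)
    {g : Fin n → Γ(dilatation a₀ σ.ker R, 𝔮 ⁻¹ᵁ W.1)}
    (hg : ∀ i, (𝔮).appLE W.1 (𝔮 ⁻¹ᵁ W.1) le_rfl
        (a.appLE U.1 W.1 hy.le t') * g i =
        (𝔮).appLE W.1 (𝔮 ⁻¹ᵁ W.1) le_rfl (y i))
    {f : Γ(P, W.1)} {c : Fin n → Γ(P, W.1)} (hc : f = ∑ i, c i * y i)
    {g' : Γ(dilatation a₀ σ.ker R, 𝔮 ⁻¹ᵁ W.1)}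
    (hg' : (𝔮).appLE W.1 (𝔮 ⁻¹ᵁ W.1) le_rfl
        (a.appLE U.1 W.1 hy.le t) * g' =
        (𝔮).appLE W.1 (𝔮 ⁻¹ᵁ W.1) le_rfl f)
    {O : (pullback (𝔮 ≫ a) R.subschemeι).Opens}
    (hO : O ≤ pullback.fst (𝔮 ≫ a) R.subschemeι ⁻¹ᵁ
      (𝔮 ⁻¹ᵁ W.1))
    (hO' : O ≤ (pullback.fst (𝔮 ≫ a) R.subschemeι ≫
      𝔮 ≫ a) ⁻¹ᵁ U.1) :
    (pullback.fst (𝔮 ≫ a) R.subschemeι).appLE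
      (𝔮 ⁻¹ᵁ W.1) O hO g' =
    ∑ i, (pullback.fst (𝔮 ≫ a) R.subschemeι ≫
      𝔮 ≫ a).appLE U.1 O hO' (u * σ.appLE W.1 U.1 hy.le_preimage (c i)) *
      (pullback.fst (𝔮 ≫ a) R.subschemeι).appLE
        (𝔮 ⁻¹ᵁ W.1) O hO (g i) := by
  have h1 : g' = ∑ i, (𝔮).appLE W.1 (𝔮 ⁻¹ᵁ W.1) le_rfl
      (a.appLE U.1 W.1 hy.le u * c i) * g i := by
    refine (mul_cancel_left_mem_nonZeroDivisors
      (hy.isAwayChart ha hσ ht).mem_nonZeroDivisors).mp (hg'.trans ?_)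
    rw [hc, map_sum, Finset.mul_sum]
    refine Finset.sum_congr rfl fun i _ => ?_
    rw [map_mul, ← hg, hu, map_mul, map_mul, map_mul]
    ring!
  rw [h1, map_sum]
  refine Finset.sum_congr rfl fun i _ => ?_
  rw [map_mul]
  congr 1
  rw [hy.appLE_fiber ha hσ ht _ hO hO', map_mul, appLE_section hσ _ _ le_rfl, fres_self]

/-- The fibre over `R` of a dilatation along a section of a smooth morphism is a vector bundle, with
linear coordinates the functions `f / t`, where `f` vanishes along the section. -/
theorem existsUnique_dilatationIso
    (hF : ∀ U W f ω, F U W f ω → ∃ hU : U.1 ≤ σ ⁻¹ᵁ W, σ.appLE W U.1 hU f = 0)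
    (hF' : ∀ (x : X) (U₀ : X.Opens), x ∈ U₀ → ∃ (U : X.affineOpens) (W : P.affineOpens) (n : ℕ)
      (y : Fin n → Γ(P, W.1)) (ω : Fin n → Γ(N, U.1)), x ∈ U.1 ∧ U.1 ≤ U₀ ∧
      IsSectionCoords a σ U W y ∧ GeneratesKer σ U W y ∧ IsBasisOn N U.1 ω ∧
      ∀ i, F U W.1 (y i) (ω i))
    (hF'' : ∀ (U₁ : X.affineOpens) (W₁ : P.affineOpens) (n : ℕ) (y : Fin n → Γ(P, W₁.1))
      (ω : Fin n → Γ(N, U₁.1)), IsSectionCoords a σ U₁ W₁ y → IsBasisOn N U₁.1 ω →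
      (∀ i, F U₁ W₁.1 (y i) (ω i)) →
      ∀ U W f η, F U W f η → ∀ (U' : X.affineOpens) (hU : U'.1 ≤ U.1) (hU₁ : U'.1 ≤ U₁.1)
      (W' : P.affineOpens) (hW : W'.1 ≤ W) (hW₁ : W'.1 ≤ W₁.1) (h : U'.1 ≤ σ ⁻¹ᵁ W'.1)
      (c : Fin n → Γ(P, W'.1)), fres hW f = ∑ i, c i * fres hW₁ (y i) →
      mres N hU η = ∑ i, σ.appLE W'.1 U'.1 h (c i) • mres N hU₁ (ω i))
    [(tensorModule N (divisorModule R)).IsQuasicoherent] :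
    ∃! θ : pullback (𝔮 ≫ a) R.subschemeι ≅
        pullback (vectorBundleπ (tensorModule N (divisorModule R))) R.subschemeι,
      θ.hom ≫ pullback.snd _ _ = pullback.snd _ _ ∧
      ∀ U m V g, DilatationRelation a a₀ σ R N F U m V g →
        Corresponds (𝔮 ≫ a) R _ θ U m V g := by
  choose U₀ hxU₀ t₀ ht₀' ht₀ using hR
  choose U W n y ω hxU hU hy hker hω hFy using fun x => hF' x (U₀ x).1 (hxU₀ x)
  have hR : IsEffectiveCartier R := fun x => ⟨_, hxU₀ x, _, ht₀' x, ht₀ x⟩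
  have ht := fun x => ideal_eq_span_fres (hU x) (ht₀ x)
  choose s hs hts using fun x => exists_divisorSections (ht x)
  choose g hg using fun x i => (hy x).exists_quotient ha hσ (ht x) ((hy x).eq_zero i)
  refine existsUnique_bundleIso (fun x => (hy x).bundleChart ha hR hσ (hker x) (hω x) (ht x) (hs x)
    (hts x) (hg x)) hxU (fun x i => ?_) ?_
  · refine .mk (U x) (W x).1 (hy x).le _ (ht x) (s x) (hs x) (hts x) _ _ (hFy x i) _ ?_
    have := hg x i
    rwa [← app_eq_appLE_apply, ← app_eq_appLE_apply] at this
  · rintro U₁ _ _ _ ⟨W₁, hW₁, t₁, ht₁, s₁, hs₁, hts₁, f, η, hf, g₁, hg₁⟩ x z hz hzU hzC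
    obtain ⟨hU₁, hf₀⟩ := hF _ _ _ _ hf
    have hσz := dilatationMap_eq ha hR hσ z
    have hzx : (pullback.fst (𝔮 ≫ a) R.subschemeι ≫
        𝔮 ≫ a) z ∈ (U x).1 := (hy x).le hzC
    obtain ⟨U', W', hU'x, hW'x, hxU', hU'U, hW'W, -, hy', hker'⟩ :=
      (hy x).exists_generatesKer hσ hσ hzx hzU (W₀ := W₁) (hσz ▸ hz)
    have hWx : 𝔮 ⁻¹ᵁ W'.1 ≤ 𝔮 ⁻¹ᵁ (W x).1 :=
      (𝔮).preimage_mono hW'x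
    have hWW : 𝔮 ⁻¹ᵁ W'.1 ≤ 𝔮 ⁻¹ᵁ W₁ :=
      (𝔮).preimage_mono hW'W
    have ht' := ideal_eq_span_fres hU'U ht₁
    obtain ⟨u, hu⟩ : ∃ u, fres (hU'x.trans (hU x)) (t₀ x) = fres hU'U t₁ * u := by
      refine (Ideal.mem_span_singleton.mp (ht'.le ?_))
      rw [ideal_eq_span_fres (hU'x.trans (hU x)) (ht₀ x)]
      exact Ideal.mem_span_singleton_self _
    -- The function `f` is a combination of the coordinates.
    have hf' : σ.appLE W'.1 U'.1 hy'.le_preimage (fres hW'W f) = 0 := by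
      have := congrArg (fres hU'U) hf₀
      rw [map_zero, fres_appLE] at this
      rwa [appLE_fres]
    obtain ⟨c, hc⟩ := Ideal.mem_span_range_iff_exists_fun.mp (hker' hy'.le_preimage _ hf')
    have hη := hF'' _ _ _ _ _ (hy x) (hω x) (hFy x) _ _ _ _ hf U' hU'U hU'x W' hW'W hW'x hy'.le_preimage c
      hc.symm
    have hO : pullback.fst (𝔮 ≫ a) R.subschemeι ⁻¹ᵁ
        (𝔮 ⁻¹ᵁ W'.1) ≤
        (pullback.fst (𝔮 ≫ a) R.subschemeι ≫
          𝔮 ≫ a) ⁻¹ᵁ U'.1 := fun _ hw => hy'.le hw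
    refine ⟨U'.1, hU'U, hU'x, fun i => u * σ.appLE W'.1 U'.1 hy'.le_preimage (c i),
      pullback.fst (𝔮 ≫ a) R.subschemeι ⁻¹ᵁ
        (𝔮 ⁻¹ᵁ W'.1), fun _ hw => hWW hw, fun _ hw => hWx hw, hO, ?_, ?_, ?_⟩
    · change 𝔮
        (pullback.fst (𝔮 ≫ a) R.subschemeι z) ∈ W'.1
      rw [hσz]
      exact hy'.le_preimage hxU'
    · have hs₂ := divisorSections_map R _ _ (homOfLE hU'U) s₁ hs₁
      have hs₃ := divisorSections_map R _ _ (homOfLE hU'x) (s x) (hs x)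
      have hss : mres (openPush (structureModule X) (complement R)) hU'U s₁ = u • mres _ hU'x (s x) := by
        refine hR.section_eq_smul ht' hu ?_
        have e1 := congrArg (mres _ hU'U) hts₁
        have e2 := congrArg (mres _ hU'x) (hts x)
        rw [mres_smul, openPushUnit_mres_one] at e1 e2
        rw [fres_fres] at e2
        exact e1.trans e2.symm
      rw [mres_tensorSection, mres_divisorSection hU'U hs₁ hs₂, divisorSection_smul u hs₃ hs₂ hss,
        tensorSection_smul_right, hη, tensorSection_sum, Finset.smul_sum]
      refine Finset.sum_congr rfl fun i _ => ?_
      rw [tensorSection_smul, smul_smul]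
      congr 1
      refine Eq.trans ?_ (mres_tensorSection _ _ hU'x _ _).symm
      rw [mres_divisorSection hU'x (hs x) hs₃]
    · have e1 : ∀ i, (𝔮).appLE W'.1 (𝔮 ⁻¹ᵁ W'.1) le_rfl
          (a.appLE U'.1 W'.1 hy'.le (fres (hU'x.trans (hU x)) (t₀ x))) * fres hWx (g x i) =
          (𝔮).appLE W'.1 (𝔮 ⁻¹ᵁ W'.1) le_rfl
            (fres hW'x (y x i)) := fun i => by
        have := congrArg (fres hWx) (hg x i)
        rw [map_mul, fres_appLE, fres_appLE] at this
        rw [appLE_fres, appLE_fres, ← this]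
        congr 1
        rw [appLE_fres, ← appLE_fres (σ := 𝔮) le_rfl hW'x, fres_appLE]
      have e2 : (𝔮).appLE W'.1 (𝔮 ⁻¹ᵁ W'.1) le_rfl
          (a.appLE U'.1 W'.1 hy'.le (fres hU'U t₁)) * fres hWW g₁ =
          (𝔮).appLE W'.1 (𝔮 ⁻¹ᵁ W'.1) le_rfl
            (fres hW'W f) := by
        have := congrArg (fres hWW) hg₁
        rw [map_mul, app_eq_appLE_apply _ le_rfl, app_eq_appLE_apply _ le_rfl, fres_appLE,
          fres_appLE] at this
        rw [appLE_fres, appLE_fres, ← this]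
        congr 1
        rw [← appLE_fres (σ := 𝔮) le_rfl hW'W, fres_appLE]
      have e3 := hy'.appLE_fiber_quotient ha hσ ht' hu e1 hc.symm e2 le_rfl hO
      rw [appLE_fres] at e3
      refine e3.trans (Finset.sum_congr rfl fun i _ => ?_)
      rw [appLE_fres]
      rfl
end Dilatation

end

/-! ### Dilatations along sections of smooth morphisms -/

section

variable {X P S : Scheme.{u}}

theorem RingHom.Etale.exists_basis_kaehlerDifferential {A B : Type u} [CommRing A] [CommRing B]
    [Algebra A B] {ι : Type} {y : ι → B}
    (h : (eval₂Hom (algebraMap A B) y).Etale) :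
    ∃ e : Module.Basis ι B Ω[B⁄A], ∀ i, e i = KaehlerDifferential.D A B (y i) := by
  let x : MvPolynomial ι A →+* B := eval₂Hom (algebraMap A B) y
  algebraize [x]
  have : IsScalarTower A (MvPolynomial ι A) B := .of_algebraMap_eq fun c =>
    (eval₂Hom_C ..).symm
  refine ⟨((KaehlerDifferential.mvPolynomialBasis A ι).baseChange B).map
    (KaehlerDifferential.tensorKaehlerEquivOfFormallyEtale A (MvPolynomial ι A) B), fun i => ?_⟩
  rw [Module.Basis.map_apply, Module.Basis.baseChange_apply, KaehlerDifferential.mvPolynomialBasis_apply,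
    ← KaehlerDifferential.tensorKaehlerEquivOfFormallyEtale_symm_D_algebraMap,
    LinearEquiv.apply_symm_apply]
  exact congrArg _ (eval₂Hom_X' ..)

theorem isBasisOn_differentials_of_etale (f : X ⟶ S) {U : S.affineOpens} {W : X.affineOpens}
    (h : W.1 ≤ f ⁻¹ᵁ U.1) {n : ℕ} {y : Fin n → Γ(X, W.1)}
    (hy : (eval₂Hom (f.appLE U.1 W.1 h).hom y).Etale) :
    IsBasisOn (differentials f) W.1 fun i => differential f W.1 (y i) := by
  refine isBasisOn_differentials f U.2 W.2 h y ?_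
  let _ := (f.appLE U.1 W.1 h).hom.toAlgebra
  exact RingHom.Etale.exists_basis_kaehlerDifferential (A := Γ(S, U.1)) hy

theorem HasLocalBases.tensor_divisorModule {N : X.Modules} (hN : HasLocalBases N)
    {R : X.IdealSheafData} (hR : IsEffectiveCartier R) :
    HasLocalBases (tensorModule N (divisorModule R)) := fun x => by
  obtain ⟨U₀, hxU₀, t, -, ht⟩ := hR x
  obtain ⟨U, n, e, hxU, he⟩ := hN x
  obtain ⟨W, hxW, hW⟩ := exists_affine_nhd (V := U ⊓ U₀.1) ⟨hxU, hxU₀⟩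
  have ht' := ideal_eq_span_fres (hW.trans inf_le_right) ht
  obtain ⟨s, hs, hts⟩ := exists_divisorSections ht'
  exact ⟨W.1, n, _, hxW, (he.restrict (hW.trans inf_le_left)).tensor
    (isBasisOn_divisorModule hR ht' hs hts)⟩

theorem smooth_dilatation_and_existsUnique {a : P ⟶ X} {σ : X ⟶ P} {R : X.IdealSheafData}
    [IsSeparated a] [Smooth a] (hσ : σ ≫ a = 𝟙 X) (hR : IsEffectiveCartier R) :
    Smooth (dilatationMap a σ.ker R ≫ a) ∧
      (twistedDifferentials a σ R).IsLocallyFree ∧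
      (twistedDifferentials a σ R).IsFiniteType ∧
      ∃ _ : (twistedDifferentials a σ R).IsQuasicoherent,
        ∃! θ : pullback (dilatationMap a σ.ker R ≫ a) R.subschemeι ≅
            pullback (vectorBundleπ (twistedDifferentials a σ R)) R.subschemeι,
          IsCanonicalIso a σ R θ := by
  have : IsClosedImmersion (σ ≫ a) := by rw [hσ]; infer_instance
  have : IsClosedImmersion σ := IsClosedImmersion.of_comp σ a
  let N := (Scheme.Modules.pullback σ).obj (differentials a)
  have hB : ∀ {U : X.affineOpens} {W : P.affineOpens} {n : ℕ} {y : Fin n → Γ(P, W.1)}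
      (hy : IsSectionCoords a σ U W y), IsBasisOn N U.1 fun i =>
        pullbackSection σ (differentials a) W.1 U.1 hy.le_preimage (differential a W.1 (y i)) :=
    fun hy => (isBasisOn_differentials_of_etale a hy.le hy.etale).pullback hy.le_preimage
  let F : ∀ (U : X.affineOpens) (W : P.Opens), Γ(P, W) → Γ(N, U.1) → Prop := fun U W f ω =>
    ∃ hU : U.1 ≤ σ ⁻¹ᵁ W, σ.appLE W U.1 hU f = 0 ∧
      ω = pullbackSection σ (differentials a) W U.1 hU (differential a W f)
  have hF' : ∀ (x : X) (U₀ : X.Opens), x ∈ U₀ → ∃ (U : X.affineOpens) (W : P.affineOpens) (n : ℕ)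
      (y : Fin n → Γ(P, W.1)) (ω : Fin n → Γ(N, U.1)), x ∈ U.1 ∧ U.1 ≤ U₀ ∧
      IsSectionCoords a σ U W y ∧ GeneratesKer σ U W y ∧ IsBasisOn N U.1 ω ∧
      ∀ i, F U W.1 (y i) (ω i) := by
    intro x U₀ hx
    obtain ⟨U, W, n, y, hxU, hy⟩ := exists_isSectionCoords hσ x
    obtain ⟨U', W', hU, hW, hxU', hU', -, -, hy', hker⟩ := hy.exists_generatesKer hσ hσ hxU hx
      (W₀ := ⊤) trivial
    exact ⟨U', W', n, _, _, hxU', hU', hy', hker, hB hy',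
      fun i => ⟨hy'.le_preimage, hy'.eq_zero i, rfl⟩⟩
  have hE : HasLocalBases (tensorModule N (divisorModule R)) :=
    HasLocalBases.tensor_divisorModule (fun x => by
      obtain ⟨U, W, n, y, ω, hxU, -, -, -, hω, -⟩ := hF' x ⊤ trivial
      exact ⟨U.1, n, ω, hxU, hω⟩) hR
  have hq : (tensorModule N (divisorModule R)).IsQuasicoherent := hE.isQuasicoherent
  refine ⟨smooth_dilatation rfl hR hσ, hE.isLocallyFree, hE.isFiniteType, hq, ?_⟩
  have key := existsUnique_dilatationIso (a := a) rfl hR hσ (F := F)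
    (fun U W f ω h => ⟨h.1, h.2.1⟩) hF' (by
      rintro U₁ W₁ n y ω hy - hω U W f _ ⟨hU, hf, rfl⟩ U' hU' hU₁ W' hW hW₁ h c hc
      have hy0 : ∀ i, σ.appLE W'.1 U'.1 h (fres hW₁ (y i)) = 0 := fun i => by
        have := congrArg (fres hU₁) (hy.eq_zero i)
        rw [map_zero, fres_appLE] at this
        rwa [appLE_fres]
      have e1 := pullbackSection_differential_sum σ a h c _ hy0
      rw [← hc, differential_fres, pullbackSection_mres (h := hU) (hU := hU')] at e1
      refine e1.trans (Finset.sum_congr rfl fun i _ => ?_)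
      obtain ⟨h2, -, h3⟩ := hω i
      rw [h3, differential_fres, pullbackSection_mres (h := h2) (hU := hU₁)])
  have hq' : (twistedDifferentials a σ R).IsQuasicoherent := hq
  refine (existsUnique_congr fun θ => ?_).mp key
  constructor
  · rintro ⟨h1, h2⟩
    exact ⟨h1, fun U W hW hU t ht s hs hts f hf g hg =>
      h2 _ _ _ _ (.mk U W hW t ht s hs hts f _ ⟨hU, hf, rfl⟩ g hg)⟩
  · rintro ⟨h1, h2⟩
    refine ⟨h1, ?_⟩
    rintro U _ _ _ ⟨W, hW, t, ht, s, hs, hts, f, _, ⟨hU, hf, rfl⟩, g, hg⟩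
    exact h2 U W hW hU t ht s hs hts f hf g hg

end

/-! ### The Jacobian criterion, and primality of étale coordinates -/

section JacobianCriterion
open TensorProduct KaehlerDifferential

/-- The Jacobian criterion: a formally smooth `k`-algebra whose differentials have the basis `D yᵢ`
is formally étale over the polynomial ring in the `yᵢ`, by the Jacobi–Zariski sequence. -/
theorem Algebra.FormallyEtale.of_basis_kaehlerDifferential {k Λ B : Type*} [CommRing k]
    [CommRing Λ] [CommRing B] [Algebra k Λ] [Algebra k B] [Algebra Λ B] [IsScalarTower k Λ B]
    [Algebra.FormallySmooth k B] {ι : Type*} (b : Module.Basis ι Λ Ω[Λ⁄k]) (e : Module.Basis ι B Ω[B⁄k])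
    (h : ∀ i, map k k Λ B (b i) = e i) : Algebra.FormallyEtale Λ B := by
  have hb : mapBaseChange k Λ B = ((b.baseChange B).equiv e (Equiv.refl ι)).toLinearMap :=
    (b.baseChange B).ext fun i => by
      rw [LinearEquiv.coe_coe, Module.Basis.equiv_apply, Module.Basis.baseChange_apply,
        mapBaseChange_tmul, h, one_smul]
      rfl
  have hbij : Function.Bijective (mapBaseChange k Λ B) := by
    rw [hb]; exact LinearEquiv.bijective _
  refine (Algebra.formallyEtale_iff _ _).mpr ⟨?_, ?_⟩
  · refine ⟨fun x y => ?_⟩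
    have h0 : ∀ x : Ω[B⁄Λ], x = 0 := fun x => by
      obtain ⟨y, rfl⟩ := map_surjective k Λ B x
      exact (exact_mapBaseChange_map k Λ B y).mpr (hbij.2 y)
    rw [h0 x, h0 y]
  · have h0 : ∀ x : Algebra.H1Cotangent Λ B, x = 0 := fun x => by
      have h1 : Algebra.H1Cotangent.δ k Λ B x = 0 := hbij.1 (by
        rw [map_zero]
        exact (Algebra.H1Cotangent.exact_δ_mapBaseChange k Λ B _).mpr ⟨x, rfl⟩)
      obtain ⟨y, rfl⟩ := (Algebra.H1Cotangent.exact_map_δ k Λ B x).mp h1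
      rw [Subsingleton.elim y 0, map_zero]
    exact ⟨fun x y => by rw [h0 x, h0 y]⟩

/-- Over a perfect field, functions which are independent modulo the square of the maximal ideal
have independent differentials, since the residue field is formally smooth. -/
theorem linearIndependent_tmul_D {k L : Type u} [Field k] [PerfectField k] [CommRing L]
    [IsLocalRing L] [Algebra k L] [Algebra.FormallySmooth k L] [Algebra.EssFiniteType k L] {ι : Type}
    (c : ι → IsLocalRing.maximalIdeal L)
    (hc : LinearIndependent (IsLocalRing.ResidueField L)
      fun i => (IsLocalRing.maximalIdeal L).toCotangent (c i)) :
    LinearIndependent (IsLocalRing.ResidueField L)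
      fun i => (1 ⊗ₜ D k L (c i : L) : IsLocalRing.ResidueField L ⊗[L] Ω[L⁄k]) := by
  have : Algebra.EssFiniteType k (IsLocalRing.ResidueField L) := .comp k L _
  have hs : Function.Surjective (algebraMap L (IsLocalRing.ResidueField L)) :=
    IsLocalRing.residue_surjective
  have hsm : Algebra.FormallySmooth k (IsLocalRing.ResidueField L) := .of_perfectField
  obtain ⟨l, hl⟩ := (Algebra.FormallySmooth.iff_split_injection (R := k) hs).mp hsm
  rw [linearIndependent_iff'] at hc ⊢
  intro s g hg i hi
  choose ρ hρ using fun i => hs (g i)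
  have hker : ∀ i, (c i : L) ∈ RingHom.ker (algebraMap L (IsLocalRing.ResidueField L)) := fun i =>
    (IsLocalRing.residue_eq_zero_iff _).mpr (c i).2
  let c' (i) : RingHom.ker (algebraMap L (IsLocalRing.ResidueField L)) := ⟨c i, hker i⟩
  have h1 : kerCotangentToTensor k L (IsLocalRing.ResidueField L)
      (Ideal.toCotangent _ (∑ i ∈ s, ρ i • c' i)) = 0 := by
    rw [map_sum, map_sum, ← hg]
    refine Finset.sum_congr rfl fun j _ => ?_
    rw [map_smul, map_smul, kerCotangentToTensor_toCotangent, ← hρ, algebraMap_smul]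
  have h2 : Ideal.toCotangent _ (∑ i ∈ s, ρ i • c' i) = 0 := by
    have := congrArg l h1
    rw [map_zero] at this
    rw [← this]
    exact (LinearMap.congr_fun hl _).symm
  rw [Ideal.toCotangent_eq_zero] at h2
  refine hc s g ?_ i hi
  have h3 : (IsLocalRing.maximalIdeal L).toCotangent (∑ i ∈ s, ρ i • c i) = 0 := by
    rw [Ideal.toCotangent_eq_zero]
    have h4 : RingHom.ker (algebraMap L (IsLocalRing.ResidueField L)) = IsLocalRing.maximalIdeal L :=
      IsLocalRing.ker_residue
    have h5 : ((∑ i ∈ s, ρ i • c i : IsLocalRing.maximalIdeal L) : L) = (∑ i ∈ s, ρ i • c' i :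
        RingHom.ker (algebraMap L (IsLocalRing.ResidueField L))) := by
      simp only [AddSubmonoidClass.coe_finsetSum, Submodule.coe_smul, c']
    exact h5 ▸ h4 ▸ h2
  rw [map_sum] at h3
  rw [← h3]
  refine Finset.sum_congr rfl fun j _ => ?_
  rw [map_smul, ← hρ, algebraMap_smul]

open IsLocalRing in
/-- Functions on a smooth algebra over a perfect field which are independent modulo the square of
the maximal ideal at a point extend, by functions invertible there, to étale coordinates. -/
theorem exists_etale_of_linearIndependent {k A L : Type u} [Field k] [PerfectField k] [CommRing A]
    [CommRing L] [IsLocalRing L] [Algebra k A] [Algebra A L] [Algebra.Smooth k A] (p : Ideal A)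
    [p.IsPrime] [IsLocalization.AtPrime L p] {ι : Type} [Finite ι] (t : ι → A)
    (c : ι → maximalIdeal L) (hct : ∀ i, (c i : L) = algebraMap A L (t i))
    (hc : LinearIndependent (ResidueField L) fun i => (maximalIdeal L).toCotangent (c i)) :
    ∃ (m : ℕ) (z : Fin m → A) (f : A), f ∉ p ∧ (∀ j, z j ∉ p) ∧
      ((algebraMap A (Localization.Away f)).comp
        (eval₂Hom (algebraMap k A) (Sum.elim t z))).Etale := by
  classical
  let _ : Algebra k L := ((algebraMap A L).comp (algebraMap k A)).toAlgebra
  have : IsScalarTower k A L := .of_algebraMap_eq' rfl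
  have : Algebra.FormallyEtale A L := .of_isLocalization p.primeCompl
  have : Algebra.FormallySmooth k L := .comp k A L
  have : Algebra.EssFiniteType A L := .of_isLocalization _ p.primeCompl
  have : Algebra.EssFiniteType k L := .comp k A L
  have : Module.Finite L Ω[L⁄k] := inferInstance
  have : Module.Projective L Ω[L⁄k] := inferInstance
  have : Module.FinitePresentation L Ω[L⁄k] := Module.finitePresentation_of_projective _ _
  let w : ι ⊕ { a : A // a ∉ p } → A := Sum.elim t Subtype.val
  let v : ι ⊕ { a : A // a ∉ p } → ResidueField L ⊗[L] Ω[L⁄k] := fun i => 1 ⊗ₜ D k L (algebraMap A L (w i))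
  have h1 : LinearIndependent (ResidueField L) (v ∘ Sum.inl) := by
    have := linearIndependent_tmul_D (k := k) c hc
    simp only [hct] at this
    exact this
  have h2 : LinearIndepOn (ResidueField L) v (Set.range Sum.inl) :=
    (linearIndepOn_range_iff Sum.inl_injective v).mpr h1
  obtain ⟨b, -, hb, hspan, hli⟩ := exists_linearIndepOn_extension h2 (Set.subset_univ _)
  have hspan' : Submodule.span (ResidueField L) (v '' b) = ⊤ := by
    rw [eq_top_iff]
    refine le_trans ?_ (Submodule.span_le.mpr hspan)
    have e1 : Submodule.span L (Set.range fun a : A => D k L (algebraMap A L a)) = ⊤ := by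
      have := span_range_map_derivation_of_isLocalization k A L p.primeCompl
      rw [← this]
      congr 2
      ext a
      exact (map_D k k A L a).symm
    have e2 := Submodule.baseChange_span (R := L) (M := Ω[L⁄k]) (A := ResidueField L) (Set.range fun a : A => D k L (algebraMap A L a))
    rw [e1, Submodule.baseChange_top] at e2
    rw [e2, Submodule.span_le]
    rintro _ ⟨_, ⟨a, rfl⟩, rfl⟩
    refine Submodule.subset_span ?_
    by_cases ha : a ∈ p
    · refine ⟨Sum.inr ⟨a + 1, fun h => ‹p.IsPrime›.ne_top ((Ideal.eq_top_iff_one p).mpr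
        ((Submodule.add_mem_iff_right p ha).mp h))⟩, trivial, ?_⟩
      change 1 ⊗ₜ D k L (algebraMap A L (a + 1)) = 1 ⊗ₜ D k L (algebraMap A L a)
      rw [map_add, map_one, map_add, Derivation.map_one_eq_zero, add_zero]
    · exact ⟨Sum.inr ⟨a, ha⟩, trivial, rfl⟩
  let s₂ : Set { a : A // a ∉ p } := Sum.inr ⁻¹' b
  have hfin : Finite b := by
    have : LinearIndependent (ResidueField L) fun i : b => v i := hli
    exact this.finite
  have hfin₂ : Finite s₂ := (Set.Finite.preimage Sum.inr_injective.injOn hfin).to_subtype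
  obtain ⟨m, ⟨e₀⟩⟩ := Finite.exists_equiv_fin s₂
  let u : ι ⊕ Fin m → ι ⊕ { a : A // a ∉ p } := Sum.map id fun j => (e₀.symm j).1
  have hu : Function.Injective u :=
    Sum.map_injective.mpr ⟨Function.injective_id, Subtype.val_injective.comp e₀.symm.injective⟩
  have hub : Set.range u = b := by
    ext i
    constructor
    · rintro ⟨j | j, rfl⟩
      · exact hb ⟨j, rfl⟩
      · exact (e₀.symm j).2
    · rcases i with i | a
      · exact fun _ => ⟨Sum.inl i, rfl⟩
      · exact fun h => ⟨Sum.inr (e₀ ⟨a, h⟩), by simp [u]⟩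
  obtain ⟨e, he⟩ := Module.exists_basis_of_basis_baseChange (R := L)
    (fun i => D k L (algebraMap A L (w (u i)))) (by
      rw [← hub] at hli
      exact (linearIndepOn_range_iff hu v).mp hli) (by
      rw [← hspan', ← hub, ← Set.range_comp]
      rfl) (Module.Flat.rTensor_preserves_injective_linearMap _ Subtype.val_injective)
  let z : Fin m → A := fun j => (e₀.symm j).1.1
  have hw : ∀ i, w (u i) = Sum.elim t z i := by
    rintro (i | i) <;> rfl
  let x : MvPolynomial (ι ⊕ Fin m) k →+* A := eval₂Hom (algebraMap k A) (Sum.elim t z)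
  algebraize [x]
  let _ : Algebra (MvPolynomial (ι ⊕ Fin m) k) L := ((algebraMap A L).comp x).toAlgebra
  have : IsScalarTower (MvPolynomial (ι ⊕ Fin m) k) A L := .of_algebraMap_eq' rfl
  have : IsScalarTower k (MvPolynomial (ι ⊕ Fin m) k) A := .of_algebraMap_eq fun r => by
    change _ = x (.C r)
    simp [x]
  have : IsScalarTower k (MvPolynomial (ι ⊕ Fin m) k) L := .to₁₂₄ _ _ A _
  have : Algebra.FormallyEtale (MvPolynomial (ι ⊕ Fin m) k) L :=
    .of_basis_kaehlerDifferential (mvPolynomialBasis k _) e fun i => by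
      rw [mvPolynomialBasis_apply, map_D, he, hw]
      change D k L (algebraMap A L (x (.X i))) = _
      simp [x]
  have : Algebra.IsEtaleAt (MvPolynomial (ι ⊕ Fin m) k) p :=
    Algebra.FormallyEtale.of_equiv
      ((IsLocalization.algEquiv p.primeCompl L (Localization.AtPrime p)).restrictScalars _)
  have : Algebra.FinitePresentation (MvPolynomial (ι ⊕ Fin m) k) A :=
    .of_restrict_scalars_finitePresentation k _ _
  obtain ⟨f, hf, hf'⟩ := Algebra.exists_etale_of_isEtaleAt (R := MvPolynomial (ι ⊕ Fin m) k) p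
  refine ⟨m, z, f, hf, fun j => (e₀.symm j).1.2, ?_⟩
  have := RingHom.etale_algebraMap.mpr hf'
  rwa [IsScalarTower.algebraMap_eq _ A _] at this

end JacobianCriterion

section NormalDomain
open TensorProduct

/-- An étale algebra over a normal domain is locally a domain: over the fraction field it is a
product of fields, whose idempotents are integral. -/
theorem Algebra.Etale.exists_mul_eq_zero_of_isFractionRing {Λ A : Type u} (K : Type u) [CommRing Λ]
    [IsDomain Λ] [IsIntegrallyClosed Λ] [CommRing A] [Algebra Λ A] [Algebra.Etale Λ A] [Field K]
    [Algebra Λ K] [IsFractionRing Λ K] (p : Ideal A) [p.IsPrime]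
    {a b : A} (hab : a * b = 0) : ∃ s ∉ p, s * a = 0 ∨ s * b = 0 := by
  classical
  have : Nontrivial A := ⟨0, 1, fun h => ‹p.IsPrime›.ne_top ((Ideal.eq_top_iff_one p).mpr (h ▸ p.zero_mem))⟩
  have : Algebra.Etale K (K ⊗[Λ] A) := inferInstance
  obtain ⟨I, _, F, _, _, e, -⟩ := (Algebra.Etale.iff_exists_algEquiv_prod K (K ⊗[Λ] A)).mp this
  have := Fintype.ofFinite I
  let e' : A ⊗[Λ] K ≃+* Π i, F i :=
    (Algebra.TensorProduct.comm Λ A K).toRingEquiv.trans e.toRingEquiv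
  let α : A →+* Π i, F i := e'.toRingHom.comp (algebraMap A (A ⊗[Λ] K))
  have hα : Function.Injective α := by
    refine e'.injective.comp ?_
    have h1 : Function.Injective (algebraMap Λ K) := IsFractionRing.injective Λ K
    have := Module.Flat.lTensor_preserves_injective_linearMap (M := A) (Algebra.linearMap Λ K) h1
    intro x y hxy
    refine (_root_.TensorProduct.rid Λ A).symm.injective (this ?_)
    rw [_root_.TensorProduct.rid_symm_apply, _root_.TensorProduct.rid_symm_apply,
      LinearMap.lTensor_tmul, LinearMap.lTensor_tmul, Algebra.linearMap_apply, map_one]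
    exact hxy
  -- The idempotents are integral over `A`, hence in `A`, since `Λ` is normal and integral
  -- closure commutes with smooth base change.
  have hid : ∀ i, ∃ c : A, α c = Pi.single i 1 := fun i => by
    have h1 : e'.symm (Pi.single i 1) ∈ integralClosure A (A ⊗[Λ] K) := by
      refine ⟨Polynomial.X ^ 2 - Polynomial.X, Polynomial.monic_X_pow_sub (by rw [Polynomial.degree_X]; norm_num), ?_⟩
      have : e'.symm (Pi.single i (1 : F i)) * e'.symm (Pi.single i (1 : F i)) =
          e'.symm (Pi.single i (1 : F i)) := by
        rw [← map_mul, ← Pi.single_mul, mul_one]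
      simp [pow_two, this]
    obtain ⟨y, hy⟩ := (TensorProduct.toIntegralClosure_bijective_of_smooth (R := Λ) (S := A)
      (B := K)).2 ⟨_, h1⟩
    have h2 : ∀ y, ∃ c : A, ((toIntegralClosure Λ A K y : integralClosure A (A ⊗[Λ] K)) :
        A ⊗[Λ] K) = algebraMap A _ c := fun y => by
      induction y with
      | zero => exact ⟨0, by simp⟩
      | tmul a l =>
        obtain ⟨r, hr⟩ := IsIntegrallyClosed.isIntegral_iff.mp l.2
        refine ⟨r • a, ?_⟩
        change a ⊗ₜ[Λ] (l : K) = (r • a) ⊗ₜ[Λ] 1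
        rw [TensorProduct.smul_tmul, ← hr, Algebra.algebraMap_eq_smul_one]
      | add y z hy hz =>
        obtain ⟨c, hc⟩ := hy
        obtain ⟨d, hd⟩ := hz
        exact ⟨c + d, by rw [map_add, map_add, ← hc, ← hd]; rfl⟩
    obtain ⟨c, hc⟩ := h2 y
    refine ⟨c, ?_⟩
    rw [hy] at hc
    change e' (algebraMap A _ c) = _
    rw [← hc]
    exact e'.apply_symm_apply _
  choose c hc using hid
  have hsum : ∑ i, c i = 1 := hα (by
    rw [map_sum, map_one]
    simp only [hc]
    exact Finset.univ_sum_single (1 : Π i, F i))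
  obtain ⟨i, hi⟩ : ∃ i, c i ∉ p := by
    by_contra! h
    refine ‹p.IsPrime›.ne_top ((Ideal.eq_top_iff_one p).mpr ?_)
    rw [← hsum]
    exact Ideal.sum_mem _ fun i _ => h i
  refine ⟨c i, hi, ?_⟩
  have h3 : α a i * α b i = 0 := by
    rw [← Pi.mul_apply, ← map_mul, hab, map_zero, Pi.zero_apply]
  have h4 : ∀ a, α a i = 0 → c i * a = 0 := fun a ha => hα (by
    rw [map_mul, hc, map_zero]
    ext j
    rw [Pi.mul_apply, Pi.zero_apply]
    by_cases hj : j = i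
    · subst hj
      rw [ha, mul_zero]
    · rw [Pi.single_eq_of_ne hj, zero_mul])
  exact (mul_eq_zero.mp h3).imp (h4 a) (h4 b)

theorem Algebra.Etale.exists_mul_eq_zero {Λ A : Type u} [CommRing Λ] [IsDomain Λ]
    [IsIntegrallyClosed Λ] [CommRing A] [Algebra Λ A] [Algebra.Etale Λ A] (p : Ideal A) [p.IsPrime]
    {a b : A} (hab : a * b = 0) : ∃ s ∉ p, s * a = 0 ∨ s * b = 0 :=
  exists_mul_eq_zero_of_isFractionRing (Λ := Λ) (FractionRing Λ) p hab

variable {k A : Type u} [Field k] [CommRing A] {κ : Type}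

theorem isDomain_of_etale_mvPolynomial [Finite κ] {x : MvPolynomial κ k →+* A} (hx : x.Etale) (p : Ideal A)
    [p.IsPrime] {L : Type u} [CommRing L] [Algebra A L] [IsLocalization.AtPrime L p] : IsDomain L := by
  algebraize [x]
  have hL : IsLocalRing L := IsLocalization.AtPrime.isLocalRing L p
  have : NoZeroDivisors L := ⟨fun {a b} hab => by
    obtain ⟨a, s, rfl⟩ := IsLocalization.exists_mk'_eq p.primeCompl a
    obtain ⟨b, t, rfl⟩ := IsLocalization.exists_mk'_eq p.primeCompl b
    rw [← IsLocalization.mk'_mul, IsLocalization.mk'_eq_zero_iff] at hab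
    obtain ⟨w, hw⟩ := hab
    rw [← mul_assoc] at hw
    obtain ⟨r, hr, h⟩ := Algebra.Etale.exists_mul_eq_zero (Λ := MvPolynomial κ k) p hw
    rw [IsLocalization.mk'_eq_zero_iff, IsLocalization.mk'_eq_zero_iff]
    rcases h with h | h
    · exact Or.inl ⟨⟨r, hr⟩ * w, by rw [Submonoid.coe_mul, mul_assoc]; exact h⟩
    · exact Or.inr ⟨⟨r, hr⟩, h⟩⟩
  exact NoZeroDivisors.to_isDomain L

theorem MvPolynomial.exists_quotient_X_ringEquiv (v : κ) :
    Nonempty (MvPolynomial { w // w ≠ v } k ≃+* MvPolynomial κ k ⧸ Ideal.span {(.X v : MvPolynomial κ k)}) := by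
  classical
  let ρ : MvPolynomial κ k →ₐ[k] MvPolynomial { w // w ≠ v } k :=
    MvPolynomial.aeval fun w => if h : w ≠ v then MvPolynomial.X ⟨w, h⟩ else 0
  let τ : MvPolynomial { w // w ≠ v } k →ₐ[k] MvPolynomial κ k := MvPolynomial.rename Subtype.val
  have h1 : ∀ q, ρ (τ q) = q := fun q => by
    have : ρ.comp τ = AlgHom.id k _ := MvPolynomial.algHom_ext fun w => by
      simp [ρ, τ, w.2]
    exact congrArg (fun f => f q) this
  have h2 : ∀ q, q - τ (ρ q) ∈ Ideal.span {(.X v : MvPolynomial κ k)} := fun q => by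
    rw [← Ideal.Quotient.eq_zero_iff_mem, map_sub, sub_eq_zero]
    have : Ideal.Quotient.mkₐ k (Ideal.span {(.X v : MvPolynomial κ k)}) =
        ((Ideal.Quotient.mkₐ k _).comp τ).comp ρ := MvPolynomial.algHom_ext fun w => by
      by_cases h : w = v
      · subst h
        simp [ρ]
      · simp [ρ, τ, h]
    exact congrArg (fun f => f q) this
  have h3 : RingHom.ker ρ = Ideal.span {(.X v : MvPolynomial κ k)} := by
    apply le_antisymm
    · intro q hq
      have := h2 q
      rw [show ρ q = 0 from hq, map_zero, sub_zero] at this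
      exact this
    · rw [Ideal.span_singleton_le_iff_mem, RingHom.mem_ker]
      simp [ρ]
  exact ⟨((Ideal.quotEquivOfEq h3.symm).trans
    (RingHom.quotientKerEquivOfSurjective (f := ρ.toRingHom) fun q => ⟨_, h1 q⟩)).symm⟩

/-- An étale coordinate is a prime element of the local ring at each of its zeros. -/
theorem prime_of_etale_mvPolynomial [Finite κ] {x : MvPolynomial κ k →+* A} (hx : x.Etale) (p : Ideal A)
    [p.IsPrime] {L : Type u} [CommRing L] [Algebra A L] [IsLocalization.AtPrime L p] (v : κ)
    (hv : x (.X v) ∈ p) : Prime (algebraMap A L (x (.X v))) := by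
  have := isDomain_of_etale_mvPolynomial hx p (L := L)
  let I := Ideal.span {(.X v : MvPolynomial κ k)}
  obtain ⟨e⟩ := MvPolynomial.exists_quotient_X_ringEquiv (k := k) v
  have hL : IsLocalRing L := IsLocalization.AtPrime.isLocalRing L p
  have hd : IsDomain (MvPolynomial κ k ⧸ I) := e.symm.toMulEquiv.isDomain _
  have hc : IsIntegrallyClosed (MvPolynomial κ k ⧸ I) := .of_equiv e
  algebraize [x]
  let J : Ideal A := I.map (algebraMap (MvPolynomial κ k) A)
  have hJ : J = Ideal.span {x (.X v)} := (Ideal.map_span _ _).trans (by rw [Set.image_singleton]; rfl)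
  have hJp : J ≤ p := by rw [hJ, Ideal.span_singleton_le_iff_mem]; exact hv
  have het : Algebra.Etale (MvPolynomial κ k ⧸ I) (A ⧸ J) := by
    let e₁ := (Algebra.TensorProduct.comm (MvPolynomial κ k) (MvPolynomial κ k ⧸ I) A).toRingEquiv.trans
      (Algebra.TensorProduct.quotIdealMapEquivTensorQuot A I).symm.toRingEquiv
    refine Algebra.Etale.of_equiv (A := (MvPolynomial κ k ⧸ I) ⊗[MvPolynomial κ k] A)
      (AlgEquiv.ofRingEquiv (f := e₁) fun q => ?_)
    obtain ⟨q, rfl⟩ := Ideal.Quotient.mk_surjective q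
    change (Algebra.TensorProduct.quotIdealMapEquivTensorQuot A I).symm
      ((1 : A) ⊗ₜ (algebraMap (MvPolynomial κ k) (MvPolynomial κ k ⧸ I) q)) = Ideal.Quotient.mk J (algebraMap _ A q)
    rw [AlgEquiv.symm_apply_eq]
    refine Eq.trans ?_ (AlgEquiv.commutes (Algebra.TensorProduct.quotIdealMapEquivTensorQuot A I)
      (algebraMap _ A q)).symm
    rw [Algebra.algebraMap_eq_smul_one, Algebra.TensorProduct.algebraMap_apply,
      Algebra.algebraMap_self_apply, Algebra.algebraMap_eq_smul_one, ← TensorProduct.smul_tmul]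
  have hp : (p.map (Ideal.Quotient.mk J)).IsPrime := Ideal.isPrime_map_quotientMk_of_isPrime hJp
  have key : ∀ a b : A, x (.X v) ∣ a * b → ∃ s ∉ p, x (.X v) ∣ s * a ∨
      x (.X v) ∣ s * b := fun a b hab => by
    have hk : ∀ a, Ideal.Quotient.mk J a = 0 ↔ x (.X v) ∣ a := fun a => by
      rw [Ideal.Quotient.eq_zero_iff_mem, hJ, Ideal.mem_span_singleton]
    rw [← hk, map_mul] at hab
    obtain ⟨s, hs, h⟩ := Algebra.Etale.exists_mul_eq_zero (Λ := MvPolynomial κ k ⧸ I)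
      (p.map (Ideal.Quotient.mk J)) hab
    obtain ⟨s, rfl⟩ := Ideal.Quotient.mk_surjective s
    rw [← map_mul, ← map_mul, hk, hk] at h
    exact ⟨s, fun h' => hs (Ideal.mem_map_of_mem _ h'), h⟩
  have hu : ∀ s : p.primeCompl, IsUnit (algebraMap A L s) := fun s => IsLocalization.map_units L s
  refine ⟨fun h0 => ?_, fun h => ?_, fun a b hab => ?_⟩
  · -- a variable is a nonzerodivisor of the polynomial ring, hence of flat algebras
    have h1 : Module.Flat A L := IsLocalization.flat L p.primeCompl
    have h2 : x.Flat := by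
      have : Module.Flat (MvPolynomial κ k) A := inferInstance
      exact this
    have h3 := mem_nonZeroDivisors_of_flat h2 (mem_nonZeroDivisors_of_ne_zero (MvPolynomial.X_ne_zero v))
    have h4 := mem_nonZeroDivisors_of_flat (φ := algebraMap A L) (RingHom.flat_algebraMap_iff.mpr h1) h3
    rw [h0] at h4
    exact zero_notMem_nonZeroDivisors h4
  · exact ((IsLocalization.AtPrime.isUnit_to_map_iff L p _).mp h) hv
  · obtain ⟨a, s, rfl⟩ := IsLocalization.exists_mk'_eq p.primeCompl a
    obtain ⟨b, t, rfl⟩ := IsLocalization.exists_mk'_eq p.primeCompl b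
    have h5 : ∀ (a : A) (s : p.primeCompl), algebraMap A L (x (.X v)) ∣ IsLocalization.mk' L a s ↔
        ∃ w ∉ p, x (.X v) ∣ w * a := fun a s => by
      rw [← IsLocalization.mk'_spec L a s |> fun h => (hu s).dvd_mul_right (a := _), IsLocalization.mk'_spec]
      constructor
      · rintro ⟨c, hc⟩
        obtain ⟨c, r, rfl⟩ := IsLocalization.exists_mk'_eq p.primeCompl c
        rw [IsLocalization.mul_mk'_eq_mk'_of_mul, IsLocalization.eq_mk'_iff_mul_eq, ← map_mul,
          IsLocalization.eq_iff_exists p.primeCompl] at hc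
        obtain ⟨w, hw⟩ := hc
        exact ⟨w * r, (w * r).2, w * c, by linear_combination hw⟩
      · rintro ⟨w, hw, h⟩
        have := map_dvd (algebraMap A L) h
        rw [map_mul] at this
        exact ((hu ⟨w, hw⟩).dvd_mul_left).mp this
    rw [← IsLocalization.mk'_mul, h5] at hab
    obtain ⟨w, hw, h⟩ := hab
    rw [← mul_assoc] at h
    obtain ⟨r, hr, h | h⟩ := key _ _ h
    · exact Or.inl ((h5 a s).mpr ⟨r * w, fun h' => (‹p.IsPrime›.mem_or_mem h').elim hr hw, by rwa [mul_assoc]⟩)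
    · exact Or.inr ((h5 b t).mpr ⟨r, hr, h⟩)

end NormalDomain

/-! ### Operations on étale coordinates -/

section CoordinateChanges
variable {A A' B C : Type u} [CommRing A] [CommRing A'] [CommRing B] [CommRing C] {ι κ κ' : Type}

theorem RingHom.Etale.eval₂Hom_of_equiv {φ : A →+* B} {y : ι → B} (h : (eval₂Hom φ y).Etale)
    (e : κ ≃ ι) : (eval₂Hom φ (y ∘ e)).Etale := by
  have h2 : eval₂Hom φ (y ∘ e) =
      (eval₂Hom φ y).comp (MvPolynomial.renameEquiv A e).toRingEquiv.toRingHom := by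
    refine MvPolynomial.ringHom_ext (fun a => ?_) fun i => ?_ <;> simp
  rw [h2]
  exact RingHom.Etale.stableUnderComposition _ _
    (.of_bijective (MvPolynomial.renameEquiv A e).bijective) h

theorem RingHom.Etale.eval₂Hom_sum_iff {φ : A →+* B} {y : ι → B} {z : κ → B} :
    (eval₂Hom φ (Sum.elim y z)).Etale ↔
      (eval₂Hom (eval₂Hom φ z) y).Etale := by
  let e := MvPolynomial.sumRingEquiv A ι κ
  have h1 : eval₂Hom φ (Sum.elim y z) =
      (eval₂Hom (eval₂Hom φ z) y).comp e.toRingHom := by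
    refine MvPolynomial.ringHom_ext (fun a => ?_) fun i => ?_
    · rw [RingHom.comp_apply]
      refine Eq.trans ?_ (congrArg _ (MvPolynomial.sumRingEquiv_C A ι κ a).symm)
      simp
    · rw [RingHom.comp_apply]
      rcases i with i | i
      · refine Eq.trans ?_ (congrArg _ (MvPolynomial.sumRingEquiv_X_inl A ι κ i).symm)
        simp
      · refine Eq.trans ?_ (congrArg _ (MvPolynomial.sumRingEquiv_X_inr A ι κ i).symm)
        simp
  have h2 : eval₂Hom (eval₂Hom φ z) y =
      (eval₂Hom φ (Sum.elim y z)).comp e.symm.toRingHom := by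
    rw [h1]
    refine RingHom.ext fun p => ?_
    exact congrArg _ (e.apply_symm_apply p).symm
  constructor <;> intro h
  · rw [h2]; exact RingHom.Etale.stableUnderComposition _ _ (.of_bijective e.symm.bijective) h
  · rw [h1]; exact RingHom.Etale.stableUnderComposition _ _ (.of_bijective e.bijective) h

theorem RingHom.Etale.eval₂Hom_mul {φ : A →+* B} {y : ι → B}
    (h : (eval₂Hom φ y).Etale) (c : ι → Aˣ) :
    (eval₂Hom φ fun i => φ (c i) * y i).Etale := by
  let τ : (ι → Aˣ) → (MvPolynomial ι A →+* MvPolynomial ι A) := fun c =>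
    eval₂Hom MvPolynomial.C fun i => MvPolynomial.C (c i : A) * MvPolynomial.X i
  have hτ : ∀ c, (τ c).comp (τ c⁻¹) = RingHom.id _ := fun c => by
    refine MvPolynomial.ringHom_ext (fun a => ?_) fun i => ?_
    · simp [τ]
    · simp only [τ, RingHom.comp_apply, MvPolynomial.coe_eval₂Hom, MvPolynomial.eval₂_X,
        MvPolynomial.eval₂_mul, MvPolynomial.eval₂_C, Pi.inv_apply, ← mul_assoc, ← map_mul,
        Units.inv_mul, map_one, one_mul, RingHom.id_apply]
  have h1 : Function.Bijective (τ c) := by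
    refine Function.bijective_iff_has_inverse.mpr ⟨τ c⁻¹, fun p => ?_, fun p => ?_⟩
    · have := hτ c⁻¹
      rw [inv_inv] at this
      exact congrArg (fun f => f p) this
    · exact congrArg (fun f => f p) (hτ c)
  have h2 : (eval₂Hom φ fun i => φ (c i) * y i) = (eval₂Hom φ y).comp (τ c) := by
    refine MvPolynomial.ringHom_ext (fun a => ?_) fun i => ?_ <;> simp [τ]
  rw [h2]
  exact RingHom.Etale.stableUnderComposition _ _ (.of_bijective h1) h

/-- The involution `Xᵢ ↦ Xᵢ⁻¹` of the ring of Laurent polynomials. -/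
theorem MvPolynomial.exists_inversion [Fintype ι] (L : Type u) [CommRing L]
    [Algebra (MvPolynomial ι A) L] [IsLocalization.Away (∏ i, MvPolynomial.X i : MvPolynomial ι A) L] :
    ∃ τ : L →+* L, Function.Bijective τ ∧
      (∀ a, τ (algebraMap (MvPolynomial ι A) L (.C a)) = algebraMap (MvPolynomial ι A) L (.C a)) ∧
      ∀ i, algebraMap (MvPolynomial ι A) L (.X i) * τ (algebraMap (MvPolynomial ι A) L (.X i)) = 1 := by
  have hX : ∀ i, IsUnit (algebraMap (MvPolynomial ι A) L (.X i)) := fun i =>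
    isUnit_of_dvd_unit (map_dvd _ (Finset.dvd_prod_of_mem _ (Finset.mem_univ i)))
      (IsLocalization.Away.algebraMap_isUnit (∏ i, MvPolynomial.X i : MvPolynomial ι A))
  choose X' hX' using fun i => (hX i).exists_right_inv
  let s : MvPolynomial ι A →+* L := eval₂Hom ((algebraMap (MvPolynomial ι A) L).comp MvPolynomial.C) X'
  have hsX : ∀ i, s (.X i) = X' i := fun i => eval₂Hom_X' _ _ _
  have hsC : ∀ a, s (.C a) = algebraMap (MvPolynomial ι A) L (.C a) :=
    fun a => eval₂Hom_C _ _ _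
  clear_value s
  have hs : IsUnit (s (∏ i, MvPolynomial.X i)) := by
    rw [map_prod, IsUnit.prod_iff]
    exact fun i _ => by rw [hsX]; exact IsUnit.of_mul_eq_one _ ((mul_comm _ _).trans (hX' i))
  obtain ⟨τ, hτ⟩ : ∃ τ : L →+* L, ∀ p, τ (algebraMap (MvPolynomial ι A) L p) = s p :=
    ⟨IsLocalization.Away.lift _ hs, fun p => IsLocalization.Away.lift_eq _ hs p⟩
  have hτX : ∀ i, τ (X' i) = algebraMap (MvPolynomial ι A) L (.X i) := fun i => by
    have h1 := congrArg τ (hX' i)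
    rw [map_mul, hτ, hsX, map_one] at h1
    linear_combination (algebraMap (MvPolynomial ι A) L (.X i)) * h1 - τ (X' i) * hX' i
  have hττ : τ.comp τ = RingHom.id L := by
    refine IsLocalization.ringHom_ext (.powers (∏ i, MvPolynomial.X i : MvPolynomial ι A)) ?_
    refine MvPolynomial.ringHom_ext (fun a => ?_) fun i => ?_
    · rw [RingHom.comp_apply, RingHom.comp_apply, hτ, hsC, hτ, hsC]; rfl
    · rw [RingHom.comp_apply, RingHom.comp_apply, hτ, hsX, hτX]; rfl
  exact ⟨τ, Function.bijective_iff_has_inverse.mpr ⟨τ, fun p => congrArg (fun f => f p) hττ,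
      fun p => congrArg (fun f => f p) hττ⟩, fun a => (hτ _).trans (hsC a),
      fun i => by rw [hτ, hsX]; exact hX' i⟩

theorem RingHom.Etale.eval₂Hom_of_factor {L : Type u} [CommRing L] {j : MvPolynomial ι A →+* L}
    {ρ : L →+* B} (hj : j.Etale) (hρ : ρ.Etale) {φ : A →+* B} {y : ι → B}
    (hC : ∀ a, ρ (j (.C a)) = φ a) (hX : ∀ i, ρ (j (.X i)) = y i) :
    (eval₂Hom φ y).Etale := by
  have h2 : eval₂Hom φ y = ρ.comp j := by
    refine MvPolynomial.ringHom_ext (fun a => ?_) fun i => ?_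
    · rw [RingHom.comp_apply, hC, eval₂Hom_C]
    · rw [RingHom.comp_apply, hX, eval₂Hom_X']
  rw [h2]
  exact RingHom.Etale.stableUnderComposition _ _ hj hρ

theorem RingHom.Etale.eval₂Hom_inv_of_factor {L : Type u} [CommRing L] {j : MvPolynomial ι A →+* L}
    (hj : j.Etale) {τ : L →+* L} (hτ : Function.Bijective τ) (hτC : ∀ a, τ (j (.C a)) = j (.C a))
    (hτX : ∀ i, j (.X i) * τ (j (.X i)) = 1) {φ : A →+* B} {y y' : ι → B}
    (h : (eval₂Hom φ y).Etale) (hy : ∀ i, y i * y' i = 1) (ψ : L →+* B)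
    (hψ : ∀ p, ψ (j p) = eval₂Hom φ y p) : (eval₂Hom φ y').Etale := by
  have h1 : ψ.Etale := hj.of_comp (by
    have : ψ.comp j = eval₂Hom φ y := RingHom.ext hψ
    rw [this]; exact h)
  refine RingHom.Etale.eval₂Hom_of_factor hj
    (RingHom.Etale.stableUnderComposition _ _ (.of_bijective hτ) h1) (fun a => ?_) fun i => ?_
  · rw [RingHom.comp_apply, hτC, hψ, eval₂Hom_C]
  · rw [RingHom.comp_apply]
    have h4 := congrArg ψ (hτX i)
    rw [map_mul, hψ, eval₂Hom_X', map_one] at h4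
    exact (left_inv_eq_right_inv ((mul_comm _ _).trans (hy i)) h4).symm

theorem RingHom.Etale.eval₂Hom_inv [Fintype ι] {φ : A →+* B} {y y' : ι → B}
    (h : (eval₂Hom φ y).Etale) (hy : ∀ i, y i * y' i = 1) :
    (eval₂Hom φ y').Etale := by
  let L := Localization.Away (∏ i, MvPolynomial.X i : MvPolynomial ι A)
  obtain ⟨τ, hτb, hτC, hτX⟩ := MvPolynomial.exists_inversion (ι := ι) (A := A) L
  have hu : IsUnit (eval₂Hom φ y (∏ i, MvPolynomial.X i)) := by
    rw [map_prod, IsUnit.prod_iff]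
    intro i _
    rw [eval₂Hom_X']
    exact IsUnit.of_mul_eq_one _ (hy i)
  exact eval₂Hom_inv_of_factor (j := algebraMap (MvPolynomial ι A) L) (RingHom.etale_algebraMap.mpr
      (Algebra.Etale.of_isLocalizationAway (∏ i, MvPolynomial.X i : MvPolynomial ι A)))
    hτb hτC hτX h hy (IsLocalization.Away.lift _ hu) fun p => IsLocalization.Away.lift_eq _ hu p

/-- Étale coordinates relative to a base with étale coordinates, as part of absolute ones. -/
theorem RingHom.Etale.eval₂Hom_of_sum {ψ : A →+* A'} {y' : κ' → A'} {ψC : A →+* C} {φ' : A' →+* C}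
    {g : κ → C} (h : (eval₂Hom ψC (Sum.elim g (φ' ∘ y'))).Etale)
    (h' : (eval₂Hom ψ y').Etale) (hψ : φ'.comp ψ = ψC) :
    (eval₂Hom φ' g).Etale := by
  rw [eval₂Hom_sum_iff] at h
  refine eval₂Hom_of_comp (s := RingHom.id C) h h' (.of_bijective Function.bijective_id) ?_ fun _ => rfl
  refine MvPolynomial.ringHom_ext (fun a => ?_) fun i => ?_
  · simpa using (congrArg (fun f => f a) hψ).symm
  · simp

theorem etale_of_isPushout {R S R' S' : CommRingCat.{u}} {f : R ⟶ S} {g : R ⟶ R'} {f' : S ⟶ S'}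
    {g' : R' ⟶ S'} (h : IsPushout f g f' g') (hf : f.hom.Etale) : g'.hom.Etale := by
  algebraize [f.hom, g.hom, f'.hom, g'.hom, f'.hom.comp f.hom]
  have : IsScalarTower R R' S' := .of_algebraMap_eq' (congrArg CommRingCat.Hom.hom h.w)
  have h2 : Algebra.IsPushout R S R' S' := CommRingCat.isPushout_iff_isPushout.mp h
  exact RingHom.Etale.isStableUnderBaseChange R S R' S' hf

theorem RingHom.Etale.eval₂Hom_of_isPushout {k A A' C : CommRingCat.{u}} {ψ : k ⟶ A} {ψ' : k ⟶ A'}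
    {φ : A ⟶ C} {φ' : A' ⟶ C} (hp : IsPushout ψ ψ' φ φ') {y : κ → A}
    (h : (eval₂Hom ψ.hom y).Etale) :
    (eval₂Hom φ'.hom (φ ∘ y)).Etale := by
  let m : CommRingCat.of (MvPolynomial κ k) ⟶ CommRingCat.of (MvPolynomial κ A') :=
    CommRingCat.ofHom (MvPolynomial.map ψ'.hom)
  have hp1 : IsPushout (CommRingCat.ofHom (MvPolynomial.C : k →+* MvPolynomial κ k)) ψ' m
      (CommRingCat.ofHom (MvPolynomial.C : A' →+* MvPolynomial κ A')) := by
    algebraize [ψ'.hom]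
    let _ : Algebra (MvPolynomial κ k) (MvPolynomial κ A') := MvPolynomial.algebraMvPolynomial
    have h2 : Algebra.IsPushout k A' (MvPolynomial κ k) (MvPolynomial κ A') := inferInstance
    exact (CommRingCat.isPushout_iff_isPushout.mpr h2).flip
  have hp2 : IsPushout (CommRingCat.ofHom (MvPolynomial.C : k →+* MvPolynomial κ k) ≫
      CommRingCat.ofHom (eval₂Hom ψ.hom y)) ψ' φ
      (CommRingCat.ofHom (MvPolynomial.C : A' →+* MvPolynomial κ A') ≫
        CommRingCat.ofHom (eval₂Hom φ'.hom (φ ∘ y))) := by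
    have e1 : CommRingCat.ofHom (MvPolynomial.C : k →+* MvPolynomial κ k) ≫
      CommRingCat.ofHom (eval₂Hom ψ.hom y) = ψ :=
        CommRingCat.hom_ext (RingHom.ext fun a => by simp)
    have e2 : CommRingCat.ofHom (MvPolynomial.C : A' →+* MvPolynomial κ A') ≫
        CommRingCat.ofHom (eval₂Hom φ'.hom (φ ∘ y)) = φ' :=
        CommRingCat.hom_ext (RingHom.ext fun a => by simp)
    rw [e2]
    exact (congrArg (fun f => IsPushout f ψ' φ φ') e1).mpr hp
  have hp3 : IsPushout (CommRingCat.ofHom (eval₂Hom ψ.hom y)) m φ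
      (CommRingCat.ofHom (eval₂Hom φ'.hom (φ ∘ y))) := by
    refine IsPushout.of_left (hp2) ?_ hp1
    refine CommRingCat.hom_ext (MvPolynomial.ringHom_ext (fun a => ?_) fun i => ?_)
    · have := congrArg (fun f => f.hom a) hp.w
      simpa [m] using this
    · simp [m]
  exact etale_of_isPushout hp3 h

variable [Fintype ι]

theorem Ideal.map_finsetProd (f : A →+* B) (I : ι → Ideal A) : (∏ i, I i).map f = ∏ i, (I i).map f :=
  _root_.map_prod (Ideal.mapHom f) I Finset.univ

/-- The product of the ideals `(Xᵢ, hᵢ)` is generated by `∏ hᵢ` on the chart with coordinates `Xᵢ / hᵢ`. -/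
theorem isTwistIdeal_prod {h : ι → A} (hh : ∀ i, h i ∈ nonZeroDivisors A) :
    IsTwistIdeal h (∏ i, Ideal.span {MvPolynomial.X i, MvPolynomial.C (h i)}) (∏ i, h i) := by
  classical
  refine ⟨prod_mem fun i _ => hh i, ?_, fun f hf => ?_, fun i => Finset.dvd_prod_of_mem _ (Finset.mem_univ i),
    fun i => ⟨MvPolynomial.X i * ∏ j ∈ Finset.univ.erase i, MvPolynomial.C (h j), ?_, ?_⟩⟩
  · rw [map_prod]
    exact Ideal.prod_mem_prod fun i _ => Ideal.subset_span (by simp)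
  · suffices H : (∏ i, Ideal.span {MvPolynomial.X i, MvPolynomial.C (h i)}) ≤
        (Ideal.span {MvPolynomial.C (∏ i, h i)}).comap (twistHom h) from
      Ideal.mem_span_singleton.mp (Ideal.mem_comap.mp (H hf))
    rw [← Ideal.map_le_iff_le_comap, Ideal.map_finsetProd, map_prod, ← Ideal.prod_span_singleton]
    refine Finset.prod_le_prod' fun i _ => ?_
    rw [Ideal.map_span, Ideal.span_le]
    rintro _ ⟨p, rfl | rfl, rfl⟩
    · rw [twistHom_X]
      exact Ideal.mul_mem_right _ _ (Ideal.mem_span_singleton_self _)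
    · rw [twistHom_C]
      exact Ideal.mem_span_singleton_self _
  · rw [← Finset.mul_prod_erase _ _ (Finset.mem_univ i)]
    exact Ideal.mul_mem_mul (Ideal.subset_span (by simp))
      (Ideal.prod_mem_prod fun j _ => Ideal.subset_span (by simp))
  · rw [map_mul, twistHom_X, map_prod (twistHom h)]
    have h1 : ∏ j ∈ Finset.univ.erase i, twistHom h (.C (h j)) =
        ∏ j ∈ Finset.univ.erase i, MvPolynomial.C (h j) := Finset.prod_congr rfl fun j _ => twistHom_C _
    rw [h1, ← Finset.mul_prod_erase _ _ (Finset.mem_univ i), map_mul, map_prod]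
    ring

/-- A chart of the blow-up of the product of the ideals `(y (q i), y (h i))`, where the `y` are étale
coordinates: étale coordinates are obtained by dividing `y (q i)` by `y (h i)`. -/
theorem etale_of_isAwayChart_prod [DecidableEq κ] {k : Type u} [Field k] {ψ : k →+* B} {y : κ → B}
    (hy : (eval₂Hom ψ y).Etale) {q h : ι → κ} (hq : Function.Injective q)
    (hqh : ∀ i j, h i ≠ q j) {φ : B →+* C}
    (hφ : IsAwayChart φ (∏ i, Ideal.span {y (q i), y (h i)}) (∏ i, y (h i))) {Y : κ → C}
    (hY : ∀ i, φ (y (h i)) * Y (q i) = φ (y (q i))) (hY' : ∀ v, (∀ i, v ≠ q i) → Y v = φ (y v)) :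
    (eval₂Hom (φ.comp ψ) Y).Etale := by
  let V := { v : κ // ∀ i, v ≠ q i }
  let e : κ ≃ ι ⊕ V :=
    (Equiv.ofBijective (Sum.elim q Subtype.val : ι ⊕ V → κ) ⟨by
      rintro (i | i) (j | j) hij
      · exact congrArg _ (hq hij)
      · exact absurd hij.symm (j.2 i)
      · exact absurd hij (i.2 j)
      · exact congrArg _ (Subtype.ext hij), fun v => by
      by_cases hv : ∀ i, v ≠ q i
      · exact ⟨Sum.inr ⟨v, hv⟩, rfl⟩
      · push Not at hv
        obtain ⟨i, rfl⟩ := hv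
        exact ⟨Sum.inl i, rfl⟩⟩).symm
  have he : ∀ {D : Type u} (z : κ → D), (Sum.elim (z ∘ q) (fun v : V => z v)) = z ∘ e.symm := fun z => by
    ext (i | i) <;> rfl
  have hy' := hy.eval₂Hom_of_equiv e.symm
  rw [← he, RingHom.Etale.eval₂Hom_sum_iff] at hy'
  let h' : ι → MvPolynomial V k := fun i => MvPolynomial.X ⟨h i, hqh i⟩
  have H := isTwistIdeal_prod (h := h') fun i =>
    mem_nonZeroDivisors_of_ne_zero (MvPolynomial.X_ne_zero _)
  have h1 := H.etale (g := Y ∘ q) hy' (φ := φ) (by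
    rw [Ideal.map_finsetProd]
    convert hφ using 1
    · refine Finset.prod_congr rfl fun i _ => ?_
      rw [Ideal.map_span, Set.image_pair]
      simp [h']
    · simp [h']) (fun i => by simpa [h'] using hY i)
  have h2 : (φ.comp ((eval₂Hom (eval₂Hom ψ fun v : V => y v) (y ∘ q)).comp
      MvPolynomial.C)) = eval₂Hom (φ.comp ψ) fun v : V => Y v := by
    refine MvPolynomial.ringHom_ext (fun a => ?_) fun i => ?_
    · simp
    · simp [hY' i.1 i.2]
  rw [h2, ← RingHom.Etale.eval₂Hom_sum_iff, he] at h1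
  have h3 := h1.eval₂Hom_of_equiv e
  rwa [Function.comp_assoc, Equiv.symm_comp_self, Function.comp_id] at h3

/-- Flat algebras over a polynomial ring: a product of other variables is a nonzerodivisor modulo a
variable. -/
theorem dvd_of_dvd_prod_mul {k : Type u} [Field k] {x : MvPolynomial κ k →+* B} (hx : x.Flat) {v : κ}
    {h : ι → κ} (hv : ∀ i, h i ≠ v) {c : B}
    (hc : x (.X v) ∣ (∏ i, x (.X (h i))) * c) : x (.X v) ∣ c := by
  obtain ⟨d, hd⟩ := hc
  algebraize [x]
  let Λ := MvPolynomial κ k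
  obtain ⟨n, a, z, h1, h2⟩ := Module.Flat.isTrivialRelation_of_sum_smul_eq_zero (R := Λ) (M := B)
    (f := ![∏ i, MvPolynomial.X (h i), -MvPolynomial.X v]) (x := ![c, d]) (by
      rw [Fin.sum_univ_two]
      simp only [Matrix.cons_val_zero, Matrix.cons_val_one, Algebra.smul_def]
      change x (∏ i, MvPolynomial.X (h i)) * c + x (-MvPolynomial.X v) * d = 0
      rw [map_prod, hd, map_neg, neg_mul, add_neg_cancel])
  have h3 : c = ∑ j, a 0 j • z j := h1 0
  rw [h3]
  refine Finset.dvd_sum fun j _ => ?_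
  have h4 := h2 j
  rw [Fin.sum_univ_two] at h4
  simp only [Matrix.cons_val_zero, Matrix.cons_val_one] at h4
  have h5 : (.X v : Λ) ∣ (∏ i, MvPolynomial.X (h i)) * a 0 j := ⟨a 1 j, by linear_combination h4⟩
  have h6 : ¬ (.X v : Λ) ∣ ∏ i, MvPolynomial.X (h i) := fun h => by
    obtain ⟨i, -, hi⟩ := (MvPolynomial.X_prime.dvd_finsetProd_iff _).mp h
    exact hv i (MvPolynomial.X_dvd_X.mp hi).symm
  have h7 := (MvPolynomial.X_prime.dvd_or_dvd h5).resolve_left h6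
  rw [Algebra.smul_def]
  exact Dvd.dvd.mul_right (map_dvd x h7) _

end CoordinateChanges

/-! ### Coordinates adapted to a divisor with strict normal crossings -/

section

variable {X P Y S : Scheme.{u}}

section
variable {k : Type u} [Field k]

/-- The structure homomorphism `k → Γ(X, U)` of a `k`-scheme `X`. -/
def baseHom (b : X ⟶ Spec (.of k)) (U : X.Opens) : k →+* Γ(X, U) :=
  (b.appLE ⊤ U le_top).hom.comp (Scheme.ΓSpecIso (.of k)).inv.hom

theorem appLE_baseHom (b : X ⟶ Spec (.of k)) (f : Y ⟶ X) {c : Y ⟶ Spec (.of k)} (hc : f ≫ b = c)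
    {U : X.Opens} {V : Y.Opens} (h : V ≤ f ⁻¹ᵁ U) :
    (f.appLE U V h).hom.comp (baseHom b U) = baseHom c V := by
  subst hc
  exact RingHom.ext fun r => appLE_comp f b le_top h ((Scheme.ΓSpecIso (.of k)).inv r)

theorem fres_comp_baseHom (b : X ⟶ Spec (.of k)) {U V : X.Opens} (h : V ≤ U) :
    (fres h).comp (baseHom b U) = baseHom b V :=
  RingHom.ext fun r => fres_appLE le_top h ((Scheme.ΓSpecIso (.of k)).inv r)

theorem smooth_baseHom (b : X ⟶ Spec (.of k)) [Smooth b] {U : X.Opens} (hU : IsAffineOpen U) :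
    (baseHom b U).Smooth := by
  have h1 := HasRingHomProperty.appLE (P := @Smooth) b inferInstance ⟨⊤, isAffineOpen_top _⟩
    ⟨U, hU⟩ le_top
  have h2 : (Scheme.ΓSpecIso (.of k)).inv.hom.Etale := .of_bijective
    (ConcreteCategory.bijective_of_isIso (Scheme.ΓSpecIso (.of k)).inv)
  exact RingHom.Smooth.stableUnderComposition _ _ h2.smooth h1

/-- Étale coordinates `(t, z)` on `U` over `k`, in which the functions `t i` with `i ∈ s` are local
equations of the divisors `D i`; the `D i` with `i ∉ s` do not meet `U`, and the remaining
coordinates `z` are units. -/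
structure IsLogCoords {ι : Type} (b : X ⟶ Spec (.of k)) (D : ι → X.IdealSheafData)
    (U : X.affineOpens) (s : Set ι) {m : ℕ} (t : ι → Γ(X, U.1)) (z : Fin m → Γ(X, U.1)) : Prop where
  eq : ∀ i, (D i).ideal U = Ideal.span {t i}
  unit : ∀ i, i ∉ s → IsUnit (t i)
  unit_z : ∀ j, IsUnit (z j)
  etale : (eval₂Hom (baseHom b U.1) (Sum.elim (fun i : s => t i) z)).Etale

variable {ι : Type} {b : X ⟶ Spec (.of k)} {D : ι → X.IdealSheafData}

/-- Equations of the components through `x` are part of étale coordinates near `x`, and the remaining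
coordinates can be chosen invertible at `x`. -/
theorem exists_isLogCoords [PerfectField k] [Fintype ι] [Smooth b] (hD : IsStrictNormalCrossing D)
    (x : X) {U₀ : X.Opens} (hx₀ : x ∈ U₀) :
    ∃ (U : X.affineOpens) (m : ℕ) (t : ι → Γ(X, U.1)) (z : Fin m → Γ(X, U.1)), x ∈ U.1 ∧ U.1 ≤ U₀ ∧
      IsLogCoords b D U {i | x ∈ (D i).support} t z := by
  classical
  obtain ⟨U₁, hx₁, t₁, c, ht₁, hct, hc⟩ := hD.parameters x
  obtain ⟨U₂, hx₂, h₂⟩ := exists_affine_nhd (V := U₁.1 ⊓ U₀) ⟨hx₁, hx₀⟩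
  have h₂₁ : U₂.1 ≤ U₁.1 := h₂.trans inf_le_left
  let p := (U₂.2.primeIdealOf ⟨x, hx₂⟩).asIdeal
  let _ : Algebra Γ(X, U₂.1) (X.presheaf.stalk x) :=
    X.presheaf.algebra_section_stalk (⟨x, hx₂⟩ : U₂.1)
  have hloc : IsLocalization.AtPrime (X.presheaf.stalk x) p := U₂.2.isLocalization_stalk ⟨x, hx₂⟩
  let _ : Algebra k Γ(X, U₂.1) := (baseHom b U₂.1).toAlgebra
  have : Algebra.Smooth k Γ(X, U₂.1) := smooth_baseHom b U₂.2
  have hp : ∀ g : Γ(X, U₂.1), g ∉ p ↔ x ∈ X.basicOpen g := fun g =>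
    (IsLocalization.AtPrime.isUnit_to_map_iff (X.presheaf.stalk x) p g).symm.trans
      (X.mem_basicOpen g x hx₂).symm
  obtain ⟨m, z, f, hf, hz, he⟩ := exists_etale_of_linearIndependent
    (k := k) (A := Γ(X, U₂.1)) (L := X.presheaf.stalk x) p
    (fun i : {i // x ∈ (D i).support} => fres h₂₁ (t₁ i.1)) c (fun i => by
      rw [hct]
      exact (TopCat.Presheaf.germ_res_apply X.presheaf (homOfLE h₂₁) x hx₂ _).symm) hc
  let w : Γ(X, U₂.1) := ∏ i, if x ∈ (D i).support then 1 else fres h₂₁ (t₁ i)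
  have hw : w ∉ p := by
    refine fun h => ?_
    obtain ⟨i, -, hi⟩ := (Ideal.IsPrime.prod_mem_iff (p := p)).mp h
    split_ifs at hi with hxi
    · exact (Ideal.ne_top_iff_one p).mp Ideal.IsPrime.ne_top' hi
    · refine (hp _).mpr ?_ hi
      have h3 := mt (Scheme.IdealSheafData.mem_support_iff_of_mem hx₂).mpr hxi
      rw [ideal_eq_span_fres h₂₁ (ht₁ i), Scheme.zeroLocus_span, Scheme.mem_zeroLocus_iff] at h3
      simpa using h3
  have hz' : ∏ j, z j ∉ p := fun h => by
    obtain ⟨j, -, hj⟩ := (Ideal.IsPrime.prod_mem_iff (p := p)).mp h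
    exact hz j hj
  let g : Γ(X, U₂.1) := f * (∏ j, z j) * w
  have hg : g ∉ p := by
    refine fun h => ?_
    rcases Ideal.IsPrime.mem_or_mem inferInstance h with h | h
    · rcases Ideal.IsPrime.mem_or_mem inferInstance h with h | h
      exacts [hf h, hz' h]
    · exact hw h
  let U : X.affineOpens := ⟨X.basicOpen g, U₂.2.basicOpen g⟩
  have hU : U.1 ≤ U₂.1 := X.basicOpen_le g
  have hgu : IsUnit (fres hU g) := RingedSpace.isUnit_res_basicOpen _ g
  have hgd : ∀ d, d ∣ g → IsUnit (fres hU d) := fun d hd =>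
    isUnit_of_dvd_unit (map_dvd (fres hU) hd) hgu
  refine ⟨U, m, fun i => fres (hU.trans h₂₁) (t₁ i), fun j => fres hU (z j), (hp g).mp hg,
    hU.trans (h₂.trans inf_le_right), fun i => ideal_eq_span_fres _ (ht₁ i), fun i hi => ?_,
    fun j => ?_, ?_⟩
  · have h4 : IsUnit (fres hU (fres h₂₁ (t₁ i))) := by
      refine hgd _ (Dvd.dvd.mul_left ?_ _)
      have := Finset.dvd_prod_of_mem
        (fun i => if x ∈ (D i).support then 1 else fres h₂₁ (t₁ i)) (Finset.mem_univ i)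
      rwa [if_neg (show ¬ x ∈ (D i).support from hi)] at this
    rwa [fres_fres] at h4
  · exact hgd _ (((Finset.dvd_prod_of_mem z (Finset.mem_univ j)).mul_left f).mul_right w)
  · have h5 : (IsLocalization.Away.lift (S := Localization.Away f) f (g := fres hU)
        (hgd f ⟨_, mul_assoc _ _ _⟩)).comp (algebraMap Γ(X, U₂.1) (Localization.Away f)) =
        fres hU := IsLocalization.lift_comp _
    have h6 : (algebraMap Γ(X, U₂.1) (Localization.Away f)).Etale := RingHom.etale_algebraMap.mpr
      (.of_isLocalizationAway f)
    have h7 := RingHom.Etale.of_comp h6 (h5 ▸ etale_fres U₂.2 U.2 hU)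
    have h8 := RingHom.Etale.stableUnderComposition _ _ he h7
    rw [← RingHom.comp_assoc, h5] at h8
    refine Eq.mp (congrArg RingHom.Etale ?_) h8
    refine MvPolynomial.ringHom_ext (fun c => ?_) fun i => ?_
    · rw [RingHom.comp_apply, eval₂Hom_C, eval₂Hom_C,
        ← fres_comp_baseHom b hU]
      rfl
    · rw [RingHom.comp_apply, eval₂Hom_X', eval₂Hom_X']
      cases i
      · exact fres_fres _ _ _
      · rfl
end

end

/-! ### Blow-ups of products of pairs of coordinates -/

section

variable {X P Y S : Scheme.{u}}

theorem dvd_pow_of_basicOpen_le {C : Y.Opens} (hC : IsAffineOpen C) {f g : Γ(Y, C)}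
    (h : Y.basicOpen f ≤ Y.basicOpen g) : ∃ n, g ∣ f ^ n := by
  have : IsLocalization.Away f Γ(Y, Y.basicOpen f) := hC.isLocalization_basicOpen f
  have h1 : IsUnit (algebraMap Γ(Y, C) Γ(Y, Y.basicOpen f) g) := by
    have h2 := (RingedSpace.isUnit_res_basicOpen Y.toRingedSpace g).map (fres h)
    have h3 : fres h (fres (Y.basicOpen_le g) g) = fres (Y.basicOpen_le f) g := fres_fres _ _ _
    exact h3 ▸ h2
  obtain ⟨w, hw⟩ := h1.exists_right_inv
  obtain ⟨⟨c, _, m, rfl⟩, hc⟩ := IsLocalization.surj (.powers f) w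
  have h2 : algebraMap Γ(Y, C) Γ(Y, Y.basicOpen f) (g * c) = algebraMap _ _ (f ^ m) := by
    rw [map_mul, ← hc, ← mul_assoc, hw, one_mul]
  obtain ⟨⟨_, l, rfl⟩, hl⟩ := (IsLocalization.eq_iff_exists (.powers f) _).mp h2
  exact ⟨l + m, f ^ l * c, by rw [pow_add]; exact (hl.symm.trans (by ring))⟩

/-- If `e` is a nonzerodivisor modulo `g`, then the zeros of `g` at which `e` does not vanish are
dense in all zeros of `g`. -/
theorem exists_mem_basicOpen_of_dvd {C : Y.Opens} (hC : IsAffineOpen C) {e g : Γ(Y, C)}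
    (h : ∀ c, g ∣ e * c → g ∣ c) {z : Y} (hzC : z ∈ C) (hz : z ∉ Y.basicOpen g) {O : Y.Opens}
    (hO : z ∈ O) : ∃ z₀ ∈ O, z₀ ∈ Y.basicOpen e ∧ z₀ ∉ Y.basicOpen g := by
  by_contra! hcon
  obtain ⟨f, hf, hzf⟩ := hC.exists_basicOpen_le ⟨z, hO⟩ hzC
  have h1 : Y.basicOpen (e * f) ≤ Y.basicOpen g := by
    rw [Scheme.basicOpen_mul]
    exact fun z₀ hz₀ => hcon z₀ (hf hz₀.2) hz₀.1
  obtain ⟨n, hn⟩ := dvd_pow_of_basicOpen_le hC h1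
  have h2 : ∀ n c, g ∣ e ^ n * c → g ∣ c := fun n => by
    induction n with
    | zero => intro c hc; rwa [pow_zero, one_mul] at hc
    | succ n ih => intro c hc; rw [pow_succ, mul_assoc] at hc; exact h _ (ih _ hc)
  rw [mul_pow] at hn
  obtain ⟨c, hc⟩ := h2 n _ hn
  have h3 : z ∈ Y.basicOpen (f ^ (n + 1)) := by
    rw [Scheme.basicOpen_pow _ f n.succ_pos]; exact hzf
  rw [pow_succ, hc, mul_assoc, Scheme.basicOpen_mul] at h3
  exact hz h3.1

section
variable {k : Type u} [Field k] {ι κ : Type} [Fintype ι]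

/-- The ideal sheaf `J` is locally the product of the ideals `(a i, b i)`, where those of the
functions `a i`, `b i` which are not units are part of a system of étale coordinates `y`. -/
structure IsCrossing (c : Y ⟶ Spec (.of k)) (J : Y.IdealSheafData) (W : Y.affineOpens)
    (a b : ι → Γ(Y, W.1)) {s s' : Set ι} (y : κ → Γ(Y, W.1)) (α : s → κ) (β : s' → κ) : Prop where
  ideal : J.ideal W = ∏ i, Ideal.span {a i, b i}
  etale : (eval₂Hom (baseHom c W.1) y).Etale
  injα : Function.Injective α
  injβ : Function.Injective β
  ne : ∀ i j, α i ≠ β j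
  eqα : ∀ i, a i.1 = y (α i)
  eqβ : ∀ i, b i.1 = y (β i)
  unitα : ∀ i, i ∉ s → IsUnit (a i)
  unitβ : ∀ i, i ∉ s' → IsUnit (b i)

variable {c : Y ⟶ Spec (.of k)} {J : Y.IdealSheafData} {W : Y.affineOpens}
    {a b : ι → Γ(Y, W.1)} {s s' : Set ι} {y : κ → Γ(Y, W.1)} {α : s → κ} {β : s' → κ}

theorem IsCrossing.symm (H : IsCrossing c J W a b y α β) : IsCrossing c J W b a y β α where
  ideal := by simp only [H.ideal, Set.pair_comm]
  etale := H.etale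
  injα := H.injβ
  injβ := H.injα
  ne i j := (H.ne j i).symm
  eqα := H.eqβ
  eqβ := H.eqα
  unitα := H.unitβ
  unitβ := H.unitα

theorem IsCrossing.prod_mem (H : IsCrossing c J W a b y α β) : ∏ i, a i ∈ J.ideal W := by
  rw [H.ideal]
  exact Ideal.prod_mem_prod fun i _ => Ideal.subset_span (Set.mem_insert _ _)

/-- A choice, for each pair of crossing equations `a i`, `b i`, of a denominator `y (h i)` and of a
numerator `y (q i)`. -/
structure IsChoice (α : s → κ) (β : s' → κ) (h q : {i // i ∈ s ∧ i ∈ s'} → κ) : Prop where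
  or : ∀ i, (h i = α ⟨i, i.2.1⟩ ∧ q i = β ⟨i, i.2.2⟩) ∨ (h i = β ⟨i, i.2.2⟩ ∧ q i = α ⟨i, i.2.1⟩)

theorem IsCrossing.ideal_eq [Fintype {i // i ∈ s ∧ i ∈ s'}]
    (H : IsCrossing c J W a b y α β) {h q} (hq : IsChoice α β h q) :
    J.ideal W = ∏ i, Ideal.span {y (q i), y (h i)} := by
  classical
  have h1 : ∀ i : {i // i ∈ s ∧ i ∈ s'}, Ideal.span {y (q i), y (h i)} =
      Ideal.span {a i, b i} := fun i => by
    rw [H.eqα ⟨i, i.2.1⟩, H.eqβ ⟨i, i.2.2⟩]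
    rcases hq.or i with ⟨h1, h2⟩ | ⟨h1, h2⟩
    · rw [h1, h2, Set.pair_comm]
    · rw [h1, h2]
  rw [H.ideal, Finset.prod_congr rfl fun i _ => h1 i]
  rw [← Finset.prod_subset (Finset.subset_univ (Finset.univ.filter fun i => i ∈ s ∧ i ∈ s'))]
  · exact Finset.prod_subtype _ (fun i => by simp) _
  · intro i _ hi
    rw [Ideal.one_eq_top]
    simp only [Finset.mem_filter, Finset.mem_univ, true_and, not_and_or] at hi
    rcases hi with hi | hi
    · exact Ideal.eq_top_of_isUnit_mem _ (Ideal.subset_span (Set.mem_insert _ _)) (H.unitα i hi)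
    · exact Ideal.eq_top_of_isUnit_mem _
        (Ideal.subset_span (Set.mem_insert_of_mem _ rfl)) (H.unitβ i hi)

theorem IsCrossing.injective_q (H : IsCrossing c J W a b y α β) {h q} (hq : IsChoice α β h q) :
    Function.Injective q := fun i j hij => by
  rcases hq.or i with ⟨-, h1⟩ | ⟨-, h1⟩ <;> rcases hq.or j with ⟨-, h2⟩ | ⟨-, h2⟩ <;>
    rw [h1, h2] at hij
  · exact Subtype.ext (congrArg (fun i => i.1) (H.injβ hij))
  · exact absurd hij.symm (H.ne _ _)
  · exact absurd hij (H.ne _ _)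
  · exact Subtype.ext (congrArg (fun i => i.1) (H.injα hij))

theorem IsCrossing.h_ne_q (H : IsCrossing c J W a b y α β) {h q} (hq : IsChoice α β h q) (i j) :
    h i ≠ q j := fun hij => by
  rcases hq.or i with ⟨h1, h1'⟩ | ⟨h1, h1'⟩ <;> rcases hq.or j with ⟨h2', h2⟩ | ⟨h2', h2⟩ <;>
    rw [h1, h2] at hij
  · exact H.ne _ _ hij
  · obtain rfl : i = j := Subtype.ext (congrArg (fun i => i.1) (H.injα hij))
    exact H.ne _ _ (h1.symm.trans h2')
  · obtain rfl : i = j := Subtype.ext (congrArg (fun i => i.1) (H.injβ hij))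
    exact H.ne _ _ (h2'.symm.trans h1)
  · exact H.ne _ _ hij.symm

theorem IsCrossing.exists_choice [Fintype {i // i ∈ s ∧ i ∈ s'}]
    (H : IsCrossing c J W a b y α β) {z : blowUp J}
    (hz : z ∈ blowUpπ J ⁻¹ᵁ W.1) : ∃ (h q : {i // i ∈ s ∧ i ∈ s'} → κ) (_ : IsChoice α β h q)
      (he : ∏ i, y (h i) ∈ J.ideal W), z ∈ blowUpChart he := by
  classical
  let h₀ : {i // i ∈ s ∧ i ∈ s'} → κ := fun i => α ⟨i, i.2.1⟩
  let q₀ : {i // i ∈ s ∧ i ∈ s'} → κ := fun i => β ⟨i, i.2.2⟩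
  have h1 := H.ideal_eq (h := h₀) (q := q₀) ⟨fun i => Or.inl ⟨rfl, rfl⟩⟩
  have h2 : J.ideal W = Ideal.span
      (Set.range fun ε : {i // i ∈ s ∧ i ∈ s'} → Bool => ∏ i, y (if ε i then h₀ i else q₀ i)) := by
    rw [h1, Ideal.prod_span]
    congr 1
    ext e
    rw [Set.mem_finsetProd]
    constructor
    · rintro ⟨g, hg, rfl⟩
      refine ⟨fun i => decide (g i = y (h₀ i)), Finset.prod_congr rfl fun i _ => ?_⟩
      have h3 := hg (Finset.mem_univ i)
      by_cases h4 : g i = y (h₀ i)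
      · simp [h4]
      · simpa [h4] using (h3.resolve_right h4).symm
    · rintro ⟨ε, rfl⟩
      refine ⟨fun i => y (if ε i then h₀ i else q₀ i), fun {i} _ => ?_, rfl⟩
      change y (if ε i then h₀ i else q₀ i) ∈ ({y (q₀ i), y (h₀ i)} : Set _)
      cases ε i
      · exact Or.inl rfl
      · exact Or.inr rfl
  obtain ⟨_, ⟨ε, rfl⟩, he, hze⟩ := exists_mem_blowUpChart h2 hz
  refine ⟨fun i => if ε i then h₀ i else q₀ i, fun i => if ε i then q₀ i else h₀ i, ⟨fun i => ?_⟩,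
    he, hze⟩
  cases ε i
  · exact Or.inr ⟨rfl, rfl⟩
  · exact Or.inl ⟨rfl, rfl⟩

/-- On a chart of the blow-up, the quotients `y (q i) / y (h i)` and the other `y v` are étale
coordinates. -/
theorem IsCrossing.exists_coords [Fintype {i // i ∈ s ∧ i ∈ s'}]
    (H : IsCrossing c J W a b y α β) {h q} (hq : IsChoice α β h q)
    (he : ∏ i, y (h i) ∈ J.ideal W) : ∃ Z : κ → Γ(blowUp J, blowUpChart he),
      (eval₂Hom (baseHom (blowUpπ J ≫ c) (blowUpChart he)) Z).Etale ∧
      (∀ i, (blowUpπ J).appLE W.1 _ (blowUpChart_le he) (y (h i)) * Z (q i) =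
        (blowUpπ J).appLE W.1 _ (blowUpChart_le he) (y (q i))) ∧
      ∀ v, (∀ i, v ≠ q i) → Z v = (blowUpπ J).appLE W.1 _ (blowUpChart_le he) (y v) := by
  classical
  have hφ := isAwayChart_blowUpChart he
  set φ := (blowUpπ J).appLE W.1 _ (blowUpChart_le he)
  have h1 : ∀ i, ∃ Z, φ (y (h i)) * Z = φ (y (q i)) := fun i => by
    have h2 : (∏ j ∈ Finset.univ.erase i, y (h j)) * y (q i) ∈ J.ideal W := by
      rw [H.ideal_eq hq, ← Finset.prod_erase_mul _ _ (Finset.mem_univ i)]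
      exact Ideal.mul_mem_mul
        (Ideal.prod_mem_prod fun j _ => Ideal.subset_span (Set.mem_insert_of_mem _ rfl))
        (Ideal.subset_span (Set.mem_insert _ _))
    obtain ⟨Z, hZ⟩ := hφ.dvd _ h2
    have h3 := hφ.mem_nonZeroDivisors
    have h4 : φ (∏ j, y (h j)) = φ (∏ j ∈ Finset.univ.erase i, y (h j)) * φ (y (h i)) := by
      rw [← map_mul, Finset.prod_erase_mul _ _ (Finset.mem_univ i)]
    have h3 : φ (∏ j, y (h j)) ∈ nonZeroDivisors _ := h3
    have hZ : φ _ = φ (∏ j, y (h j)) * Z := hZ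
    rw [h4] at h3 hZ
    rw [map_mul] at hZ
    refine ⟨Z, (mul_cancel_left_mem_nonZeroDivisors (mul_mem_nonZeroDivisors.mp h3).1).mp ?_⟩
    rw [← mul_assoc]
    exact hZ.symm
  choose Z hZ using h1
  have hqi := H.injective_q hq
  let Z' : κ → Γ(blowUp J, blowUpChart he) := fun v => if hv : ∃ i, v = q i then Z hv.choose
    else φ (y v)
  have hZ' : ∀ i, Z' (q i) = Z i := fun i => by
    have hv : ∃ j, q i = q j := ⟨i, rfl⟩
    have := hqi hv.choose_spec
    simp only [Z', dif_pos hv]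
    exact congrArg Z this.symm
  have hZ'' : ∀ v, (∀ i, v ≠ q i) → Z' v = φ (y v) := fun v hv =>
    dif_neg (by push Not; exact hv)
  refine ⟨Z', ?_, fun i => by rw [hZ']; exact hZ i, hZ''⟩
  have h4 := etale_of_isAwayChart_prod H.etale hqi (H.h_ne_q hq) (H.ideal_eq hq ▸ hφ)
    (Y := Z') (fun i => by rw [hZ']; exact hZ i) hZ''
  exact appLE_baseHom c (blowUpπ J) rfl (blowUpChart_le he) ▸ h4

/-- The chart on which all `b i / a i` are functions contains the complement of the strict transform
of the zero set of `∏ a i`. -/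
theorem IsCrossing.mem_strictTransform (H : IsCrossing c J W a b y α β) {Z : Set Y}
    (hZ : ∀ p ∈ W.1, p ∈ Z ↔ p ∉ Y.basicOpen (∏ i, a i)) {z : blowUp J}
    (hz : z ∈ blowUpπ J ⁻¹ᵁ W.1) (hza : z ∉ blowUpChart H.prod_mem) : z ∈ strictTransform J Z := by
  have : Fintype {i // i ∈ s ∧ i ∈ s'} := Fintype.ofFinite _
  classical
  obtain ⟨h, q, hq, he, hzC⟩ := H.exists_choice hz
  obtain ⟨T, hT, hT', hT''⟩ := H.exists_coords hq he
  have hφ := isAwayChart_blowUpChart he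
  have hle := blowUpChart_le he
  set φ := (blowUpπ J).appLE W.1 _ (blowUpChart_le he) with hφ₀
  -- The factors of the quotient of `∏ a i` by the equation of the chart.
  let w : ι → Γ(blowUp J, blowUpChart he) := fun i => if hi : i ∈ s ∧ i ∈ s' then
    (if q ⟨i, hi⟩ = α ⟨i, hi.1⟩ then T (q ⟨i, hi⟩) else 1) else φ (a i)
  have hw : φ (∏ i, a i) = φ (∏ i, y (h i)) * ∏ i, w i := by
    have h1 : ∀ i, φ (a i) = (if hi : i ∈ s ∧ i ∈ s' then φ (y (h ⟨i, hi⟩)) else 1) * w i := by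
      intro i
      by_cases hi : i ∈ s ∧ i ∈ s'
      · simp only [w, dif_pos hi]
        rw [H.eqα ⟨i, hi.1⟩]
        split_ifs with h2
        · rw [hT', h2]
        · have h3 := (hq.or ⟨i, hi⟩).resolve_right fun h3 => h2 h3.2
          rw [h3.1, mul_one]
      · simp only [w, dif_neg hi, one_mul]
    rw [map_prod, Finset.prod_congr rfl fun i _ => h1 i, Finset.prod_mul_distrib, map_prod]
    congr 1
    rw [← Finset.prod_subset (Finset.subset_univ (Finset.univ.filter fun i => i ∈ s ∧ i ∈ s'))]
    · rw [Finset.prod_subtype (p := fun i => i ∈ s ∧ i ∈ s') _ (fun i => by simp)]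
      exact Finset.prod_congr rfl fun i _ => dif_pos i.2
    · intro i _ hi
      simp only [Finset.mem_filter, Finset.mem_univ, true_and] at hi
      exact dif_neg hi
  have h1 : z ∉ (blowUp J).basicOpen (∏ i, w i) := by
    intro h1
    refine hza ?_
    have hV := (blowUp J).basicOpen_le (∏ i, w i)
    refine mem_blowUpChart _ h1 (hV.trans hle) fun f hf => ?_
    have h2 := congrArg (fres hV) hw
    have hu : IsUnit (fres hV (∏ i, w i)) := RingedSpace.isUnit_res_basicOpen _ _
    rw [map_mul, fres_appLE, fres_appLE] at h2
    have h3 := map_dvd (fres hV) (hφ.dvd f hf)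
    change fres hV ((blowUpπ J).appLE W.1 _ hle _) ∣ fres hV ((blowUpπ J).appLE W.1 _ hle _) at h3
    rw [fres_appLE, fres_appLE] at h3
    rw [h2]
    exact (hu.mul_right_dvd).mpr h3
  obtain ⟨l, hl⟩ : ∃ l, z ∉ (blowUp J).basicOpen (w l) := by
    by_contra! hcon
    refine h1 ?_
    rw [(blowUp J).mem_basicOpen _ z hzC, map_prod]
    exact IsUnit.prod_univ_iff.mpr fun l => ((blowUp J).mem_basicOpen _ z hzC).mp (hcon l)
  obtain ⟨v, hv, hv'⟩ : ∃ v, w l = T v ∧ ∀ i, h i ≠ v := by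
    by_cases hi : l ∈ s ∧ l ∈ s'
    · by_cases h2 : q ⟨l, hi⟩ = α ⟨l, hi.1⟩
      · exact ⟨q ⟨l, hi⟩, by simp only [w, dif_pos hi, if_pos h2], fun i => H.h_ne_q hq _ _⟩
      · refine absurd ?_ hl
        simp only [w, dif_pos hi, if_neg h2]
        rwa [Scheme.basicOpen_of_isUnit _ isUnit_one]
    · have hwl : w l = φ (a l) := by simp only [w, dif_neg hi]
      by_cases hls : l ∈ s
      · have hls' : l ∉ s' := fun h => hi ⟨hls, h⟩
        have hne : ∀ i : {i // i ∈ s ∧ i ∈ s'}, α ⟨i, i.2.1⟩ ≠ α ⟨l, hls⟩ := fun i hi' => by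
          have h3 := congrArg (fun i => i.1) (H.injα hi')
          exact hls' ((show i.1 = l from h3) ▸ i.2.2)
        refine ⟨α ⟨l, hls⟩, ?_, fun i => ?_⟩
        · rw [hT'' _ fun i => ?_, hwl, H.eqα ⟨l, hls⟩]
          rcases hq.or i with ⟨-, h3⟩ | ⟨-, h3⟩ <;> rw [h3]
          exacts [H.ne _ _, (hne i).symm]
        · rcases hq.or i with ⟨h3, -⟩ | ⟨h3, -⟩ <;> rw [h3]
          exacts [hne i, (H.ne _ _).symm]
      · refine absurd ?_ hl
        rw [hwl, Scheme.basicOpen_of_isUnit _ ((H.unitα l hls).map φ.hom)]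
        exact hzC
  rw [hv] at hl
  have hdvd : T v ∣ φ (∏ i, a i) := by
    rw [hw, ← hv]
    exact (Finset.dvd_prod_of_mem w (Finset.mem_univ l)).mul_left _
  -- The zeros of `T v` off the exceptional divisor are dense in all zeros of `T v`, as the coordinates
  -- `T` are étale; they lie in the inverse image of `Z`.
  have h2 : ∀ c, T v ∣ φ (∏ i, y (h i)) * c → T v ∣ c := fun c hc => by
    have h3 := dvd_of_dvd_prod_mul (RingHom.Etale.iff_flat_and_formallyUnramified.mp hT).1 hv' (c := c)
    simp only [eval₂Hom_X'] at h3
    refine h3 ?_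
    rwa [Finset.prod_congr rfl fun i _ => hT'' (h i) fun j => H.h_ne_q hq i j, ← map_prod]
  refine mem_closure_iff.mpr fun O hO hzO => ?_
  obtain ⟨z₀, hz₀O, hz₀e, hz₀⟩ := exists_mem_basicOpen_of_dvd (isAffineOpen_blowUpChart he) h2 hzC hl
    (O := ⟨O, hO⟩) hzO
  have hz₀W : blowUpπ J z₀ ∈ W.1 := hle ((blowUp J).basicOpen_le _ hz₀e)
  refine ⟨z₀, hz₀O, (hZ _ hz₀W).mpr fun h3 => hz₀ ?_, fun h3 => ?_⟩
  · obtain ⟨d, hd⟩ := hdvd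
    have h4 : z₀ ∈ (blowUp J).basicOpen (φ (∏ i, a i)) := by
      rw [hφ₀, Scheme.basicOpen_appLE]
      exact ⟨(blowUp J).basicOpen_le _ hz₀e, h3⟩
    rw [hd, Scheme.basicOpen_mul] at h4
    exact h4.1
  · have h4 := (Scheme.IdealSheafData.mem_support_iff_of_mem hz₀W).mp h3
    rw [hφ₀, Scheme.basicOpen_appLE] at hz₀e
    exact (Scheme.mem_zeroLocus_iff _ _ _).mp h4 _ he hz₀e.2

/-- Conversely, on this chart the inverse image of the zero set is the exceptional divisor. -/
theorem IsCrossing.notMem_strictTransform (H : IsCrossing c J W a b y α β) {Z : Set Y}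
    (hZ : ∀ p ∈ W.1, p ∈ Z ↔ p ∉ Y.basicOpen (∏ i, a i)) {z : blowUp J}
    (hza : z ∈ blowUpChart H.prod_mem) : z ∉ strictTransform J Z := by
  intro hz
  obtain ⟨z₀, hz₀, hz₀Z, hz₀J⟩ := mem_closure_iff.mp hz _ (blowUpChart H.prod_mem).2 hza
  have hle := blowUpChart_le H.prod_mem
  have hz₀W : blowUpπ J z₀ ∈ W.1 := hle hz₀
  refine hz₀J ((Scheme.IdealSheafData.mem_support_iff_of_mem hz₀W).mpr ?_)
  refine (Scheme.mem_zeroLocus_iff _ _ _).mpr fun f hf hf' => ?_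
  refine (hZ _ hz₀W).mp hz₀Z ?_
  obtain ⟨d, hd⟩ := (isAwayChart_blowUpChart H.prod_mem).dvd f hf
  have h1 : z₀ ∈ (blowUp J).basicOpen ((blowUpπ J).appLE W.1 _ hle f) := by
    rw [Scheme.basicOpen_appLE]
    exact ⟨hz₀, hf'⟩
  change (blowUpπ J).appLE W.1 _ hle f = (blowUpπ J).appLE W.1 _ hle _ * d at hd
  rw [hd, Scheme.basicOpen_mul, Scheme.basicOpen_appLE] at h1
  exact h1.1.2

end

end

/-! ### The product of two charts and its blow-up -/

section

variable {X P Y S : Scheme.{u}}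

theorem ideal_finsetProd {ι : Type*} (s : Finset ι) (D : ι → X.IdealSheafData) (U : X.affineOpens) :
    (∏ i ∈ s, D i).ideal U = ∏ i ∈ s, (D i).ideal U := by
  classical
  induction s using Finset.induction_on with
  | empty => rw [Finset.prod_empty, Finset.prod_empty]; exact Ideal.one_eq_top.symm
  | insert a s ha ih =>
    rw [Finset.prod_insert ha, Finset.prod_insert ha, ← ih]
    rfl

theorem ideal_finsetProd_eq_span {ι : Type*} [Fintype ι] {D : ι → X.IdealSheafData} {U : X.affineOpens}
    {t : ι → Γ(X, U.1)} (h : ∀ i, (D i).ideal U = Ideal.span {t i}) :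
    (∏ i, D i).ideal U = Ideal.span {∏ i, t i} := by
  rw [ideal_finsetProd, Finset.prod_congr rfl fun i _ => h i, Ideal.prod_span_singleton]

theorem RingHom.Etale.mvPolynomialMap {A B : Type u} [CommRing A] [CommRing B] {κ : Type}
    {f : A →+* B} (hf : f.Etale) :
    (MvPolynomial.map f : MvPolynomial κ A →+* MvPolynomial κ B).Etale := by
  algebraize [f]
  let _ : Algebra (MvPolynomial κ A) (MvPolynomial κ B) := MvPolynomial.algebraMvPolynomial
  have h2 : Algebra.IsPushout A B (MvPolynomial κ A) (MvPolynomial κ B) := inferInstance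
  exact RingHom.Etale.isStableUnderBaseChange A B (MvPolynomial κ A) (MvPolynomial κ B) hf

theorem RingHom.Etale.eval₂Hom_comp {A B C : Type u} [CommRing A] [CommRing B] [CommRing C] {κ : Type}
    {f : A →+* B} {g : B →+* C} {y : κ → C} (hg : (eval₂Hom g y).Etale) (hf : f.Etale) :
    (eval₂Hom (g.comp f) y).Etale := by
  have h7 := RingHom.Etale.stableUnderComposition _ _ (hf.mvPolynomialMap (κ := κ)) hg
  refine Eq.mp (congrArg RingHom.Etale ?_) h7
  exact MvPolynomial.ringHom_ext (fun c => by simp) fun i => by simp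

section
variable {k : Type u} [Field k]

theorem isAffineOpen_fst_inf_snd (b : X ⟶ Spec (.of k)) (U U' : X.affineOpens) :
    IsAffineOpen (pullback.fst b b ⁻¹ᵁ U.1 ⊓ pullback.snd b b ⁻¹ᵁ U'.1) := by
  have : IsAffine _ := U.2
  have : IsAffine _ := U'.2
  have : IsAffine _ := isAffineOpen_top (Spec (.of k))
  exact .of_isIso (Scheme.Hom.isPullback_resLE (IsPullback.of_hasPullback b b) (US := ⊤)
    (UX := U.1) (UT := U'.1) le_top le_top rfl).isoPullback.hom

/-- The affine open subscheme `U × U'` of `X × X`. -/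
def prodChart (b : X ⟶ Spec (.of k)) (U U' : X.affineOpens) : (pullback b b).affineOpens :=
  ⟨pullback.fst b b ⁻¹ᵁ U.1 ⊓ pullback.snd b b ⁻¹ᵁ U'.1, isAffineOpen_fst_inf_snd b U U'⟩

/-- The pull-back of functions along the first projection of `U × U'`. -/
def prodFst (b : X ⟶ Spec (.of k)) (U U' : X.affineOpens) :
    Γ(X, U.1) →+* Γ(pullback b b, (prodChart b U U').1) :=
  ((pullback.fst b b).appLE U.1 _ inf_le_left).hom

/-- The pull-back of functions along the second projection of `U × U'`. -/
def prodSnd (b : X ⟶ Spec (.of k)) (U U' : X.affineOpens) :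
    Γ(X, U'.1) →+* Γ(pullback b b, (prodChart b U U').1) :=
  ((pullback.snd b b).appLE U'.1 _ inf_le_right).hom

theorem isPushout_prodChart (b : X ⟶ Spec (.of k)) (U U' : X.affineOpens) :
    IsPushout (b.appLE ⊤ U.1 le_top) (b.appLE ⊤ U'.1 le_top)
      (CommRingCat.ofHom (prodFst b U U')) (CommRingCat.ofHom (prodSnd b U U')) := by
  have H := IsPullback.of_hasPullback b b
  exact (isIso_pushoutSection_iff H (US := ⊤) le_top le_top rfl).mp
    (isIso_pushoutSection_of_isAffineOpen H (US := ⊤) (UX := U.1) (UT := U'.1) le_top le_top rfl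
      (isAffineOpen_top _) U'.2 U.2)

variable {κ κ' : Type}

/-- Étale coordinates on a product. -/
theorem etale_prodChart (b : X ⟶ Spec (.of k)) {U U' : X.affineOpens} {y : κ → Γ(X, U.1)}
    {y' : κ' → Γ(X, U'.1)} (hy : (eval₂Hom (baseHom b U.1) y).Etale)
    (hy' : (eval₂Hom (baseHom b U'.1) y').Etale) :
    (eval₂Hom (baseHom (pullback.fst b b ≫ b) (prodChart b U U').1)
      (Sum.elim (prodFst b U U' ∘ y) (prodSnd b U U' ∘ y'))).Etale := by
  have h1 : (Scheme.ΓSpecIso (.of k)).inv.hom.Etale := .of_bijective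
    (ConcreteCategory.bijective_of_isIso (Scheme.ΓSpecIso (.of k)).inv)
  have h2 : (eval₂Hom (b.appLE ⊤ U.1 le_top).hom y).Etale :=
    hy.eval₂Hom_of_comp h1 (.of_bijective (f := RingHom.id _) Function.bijective_id) rfl fun _ => rfl
  have h3 := h2.eval₂Hom_of_isPushout (isPushout_prodChart b U U')
  have h4 : (eval₂Hom (prodSnd b U U') (prodFst b U U' ∘ y)).Etale := h3
  rw [RingHom.Etale.eval₂Hom_sum_iff]
  have h5 : (prodSnd b U U').comp (eval₂Hom (baseHom b U'.1) y') =
      eval₂Hom (baseHom (pullback.fst b b ≫ b) (prodChart b U U').1)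
        (prodSnd b U U' ∘ y') := by
    refine MvPolynomial.ringHom_ext (fun c => ?_) fun i => by simp
    simp only [RingHom.comp_apply, eval₂Hom_C]
    exact RingHom.congr_fun (appLE_baseHom b (pullback.snd b b) (c := pullback.fst b b ≫ b)
      pullback.condition.symm (U := U'.1) (V := (prodChart b U U').1) inf_le_right) c
  rw [← h5]
  exact h4.eval₂Hom_comp hy'

variable {ι : Type} [Fintype ι] {b : X ⟶ Spec (.of k)} {D : ι → X.IdealSheafData}
  {U U' : X.affineOpens} {s s' : Set ι} {m m' : ℕ} {t : ι → Γ(X, U.1)} {z : Fin m → Γ(X, U.1)}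
  {t' : ι → Γ(X, U'.1)} {z' : Fin m' → Γ(X, U'.1)}

theorem IsLogCoords.isCrossing (h : IsLogCoords b D U s t z) (h' : IsLogCoords b D U' s' t' z') :
    IsCrossing (pullback.fst b b ≫ b) (framedCenter b D) (prodChart b U U')
      (fun i => prodFst b U U' (t i)) (fun i => prodSnd b U U' (t' i))
      (Sum.elim (prodFst b U U' ∘ Sum.elim (fun i : s => t i) z)
        (prodSnd b U U' ∘ Sum.elim (fun i : s' => t' i) z'))
      (fun i => Sum.inl (Sum.inl i)) (fun i => Sum.inr (Sum.inl i)) where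
  ideal := by
    rw [framedCenter, ideal_finsetProd]
    refine Finset.prod_congr rfl fun i _ => ?_
    rw [Scheme.IdealSheafData.ideal_sup, Pi.sup_apply,
      ideal_comap (pullback.fst b b) (D i) (U := U) (V := prodChart b U U') inf_le_left,
      ideal_comap (pullback.snd b b) (D i) (U := U') (V := prodChart b U U') inf_le_right,
      h.eq, h'.eq, Ideal.map_span, Ideal.map_span, Set.image_singleton, Set.image_singleton,
      ← Ideal.span_union, Set.singleton_union]
    rfl
  etale := etale_prodChart b h.etale h'.etale
  injα _ _ h := Sum.inl_injective (Sum.inl_injective h)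
  injβ _ _ h := Sum.inl_injective (Sum.inr_injective h)
  ne _ _ := Sum.inl_ne_inr
  eqα _ := rfl
  eqβ _ := rfl
  unitα i hi := (h.unit i hi).map _
  unitβ i hi := (h'.unit i hi).map _

theorem mem_support_comap_finsetProd {f : Y ⟶ X} {t : ι → Γ(X, U.1)} (h : ∀ i, (D i).ideal U = Ideal.span {t i})
    {W : Y.affineOpens} (hW : W.1 ≤ f ⁻¹ᵁ U.1) {p : Y} (hp : p ∈ W.1) :
    p ∈ ((∏ i, D i).comap f).support ↔ p ∉ Y.basicOpen (∏ i, f.appLE U.1 W.1 hW (t i)) := by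
  rw [Scheme.IdealSheafData.mem_support_iff_of_mem hp, ideal_comap f _ hW,
    ideal_finsetProd_eq_span h, Ideal.map_span, Set.image_singleton, Scheme.zeroLocus_span,
    Scheme.mem_zeroLocus_iff]
  simp only [Set.mem_singleton_iff, forall_eq]
  rw [show (f.appLE U.1 W.1 hW).hom (∏ i, t i) = ∏ i, f.appLE U.1 W.1 hW (t i) from map_prod _ _ _]

/-- Locally, the framed self-product is the open subscheme of the blow-up on which the quotients of
the two pull-backs of the equations of the `D i` are invertible functions. -/
theorem IsLogCoords.framedOpen_inf (h : IsLogCoords b D U s t z) (h' : IsLogCoords b D U' s' t' z') :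
    framedOpen b D ⊓ blowUpπ (framedCenter b D) ⁻¹ᵁ (prodChart b U U').1 =
      blowUpChart (h.isCrossing h').prod_mem ⊓ blowUpChart (h.isCrossing h').symm.prod_mem := by
  have H := h.isCrossing h'
  have h1 : ∀ p ∈ (prodChart b U U').1,
      p ∈ (((∏ i, D i).comap (pullback.fst b b)).support : Set _) ↔
      p ∉ (pullback b b).basicOpen (∏ i, prodFst b U U' (t i)) := fun p hp =>
    mem_support_comap_finsetProd (f := pullback.fst b b) h.eq (W := prodChart b U U') inf_le_left hp
  have h2 : ∀ p ∈ (prodChart b U U').1,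
      p ∈ (((∏ i, D i).comap (pullback.snd b b)).support : Set _) ↔
      p ∉ (pullback b b).basicOpen (∏ i, prodSnd b U U' (t' i)) := fun p hp =>
    mem_support_comap_finsetProd (f := pullback.snd b b) h'.eq (W := prodChart b U U') inf_le_right hp
  ext p
  constructor
  · rintro ⟨hp, hpW⟩
    exact ⟨by_contra fun h3 => hp (Or.inl (H.mem_strictTransform h1 hpW h3)),
      by_contra fun h3 => hp (Or.inr (H.symm.mem_strictTransform h2 hpW h3))⟩
  · rintro ⟨hp, hp'⟩
    refine ⟨fun h3 => ?_, blowUpChart_le _ hp⟩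
    rcases h3 with h3 | h3
    · exact H.notMem_strictTransform h1 hp h3
    · exact H.symm.notMem_strictTransform h2 hp' h3
end

section
variable {k : Type u} [Field k] {ι κ : Type} [Fintype ι]
  {c : Y ⟶ Spec (.of k)} {J : Y.IdealSheafData} {W : Y.affineOpens}
    {a b : ι → Γ(Y, W.1)} {s s' : Set ι} {y : κ → Γ(Y, W.1)} {α : s → κ} {β : s' → κ}

theorem basicOpen_le_blowUpChart {J : Y.IdealSheafData} {W : Y.affineOpens} {e f : Γ(Y, W.1)}
    (he : e ∈ J.ideal W) (hf : f ∈ J.ideal W) {w : Γ(blowUp J, blowUpChart he)}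
    (hw : (blowUpπ J).appLE W.1 _ (blowUpChart_le he) f =
      (blowUpπ J).appLE W.1 _ (blowUpChart_le he) e * w) :
    (blowUp J).basicOpen w ≤ blowUpChart hf := fun z hz => by
  have hl := (blowUp J).basicOpen_le w
  refine mem_blowUpChart hf hz (hl.trans (blowUpChart_le he)) fun g hg => ?_
  have h1 := congrArg (fres hl) hw
  have h2 := map_dvd (fres hl) ((isAwayChart_blowUpChart he).dvd g hg)
  change fres hl ((blowUpπ J).appLE W.1 _ _ e) ∣ fres hl ((blowUpπ J).appLE W.1 _ _ g) at h2
  have hu : IsUnit (fres hl w) := RingedSpace.isUnit_res_basicOpen _ _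
  rw [map_mul, fres_appLE, fres_appLE] at h1
  rw [fres_appLE, fres_appLE] at h2
  rw [h1]
  exact hu.mul_right_dvd.mpr h2

theorem isAffineOpen_blowUpChart_inf {J : Y.IdealSheafData} {W : Y.affineOpens} {e f : Γ(Y, W.1)}
    (he : e ∈ J.ideal W) (hf : f ∈ J.ideal W) : IsAffineOpen (blowUpChart he ⊓ blowUpChart hf) := by
  obtain ⟨w, hw⟩ := (isAwayChart_blowUpChart he).dvd f hf
  change (blowUpπ J).appLE W.1 _ _ f = (blowUpπ J).appLE W.1 _ _ e * w at hw
  convert (isAffineOpen_blowUpChart he).basicOpen w using 1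
  apply le_antisymm
  · obtain ⟨w', hw'⟩ := (isAwayChart_blowUpChart hf).dvd e he
    change (blowUpπ J).appLE W.1 _ _ e = (blowUpπ J).appLE W.1 _ _ f * w' at hw'
    have hl : blowUpChart he ⊓ blowUpChart hf ≤ blowUpChart he := inf_le_left
    have hr : blowUpChart he ⊓ blowUpChart hf ≤ blowUpChart hf := inf_le_right
    have h1 := congrArg (fres hl) hw
    have h2 := congrArg (fres hr) hw'
    have h3 := mem_nonZeroDivisors_fres (isAffineOpen_blowUpChart he) hl
      (isAwayChart_blowUpChart he).mem_nonZeroDivisors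
    change fres hl ((blowUpπ J).appLE W.1 _ _ e) ∈ _ at h3
    rw [map_mul, fres_appLE, fres_appLE] at h1 h2
    rw [fres_appLE] at h3
    rw [h1] at h2
    have h4 : fres hl w * fres hr w' = 1 := by
      refine (mul_cancel_left_mem_nonZeroDivisors h3).mp ?_
      rw [mul_one, ← mul_assoc, ← h2]
    have h5 : (blowUp J).basicOpen (fres hl w) = blowUpChart he ⊓ blowUpChart hf :=
      Scheme.basicOpen_of_isUnit _ (IsUnit.of_mul_eq_one _ h4)
    rw [← h5, Scheme.basicOpen_res]
    exact inf_le_right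
  · exact le_inf ((blowUp J).basicOpen_le w) (basicOpen_le_blowUpChart he hf hw)

theorem IsCrossing.dvd (H : IsCrossing c J W a b y α β) {V : (blowUp J).Opens}
    (hV : V ≤ blowUpChart H.prod_mem) (i : ι) :
    (blowUpπ J).appLE W.1 V (hV.trans (blowUpChart_le _)) (a i) ∈ nonZeroDivisors _ ∧
    (blowUpπ J).appLE W.1 V (hV.trans (blowUpChart_le _)) (a i) ∣
      (blowUpπ J).appLE W.1 V (hV.trans (blowUpChart_le _)) (b i) := by
  classical
  have h1 : (∏ j ∈ Finset.univ.erase i, a j) * b i ∈ J.ideal W := by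
    rw [H.ideal, ← Finset.prod_erase_mul _ _ (Finset.mem_univ i)]
    exact Ideal.mul_mem_mul (Ideal.prod_mem_prod fun j _ => Ideal.subset_span (Set.mem_insert _ _))
      (Ideal.subset_span (Set.mem_insert_of_mem _ rfl))
  have h2 := mem_nonZeroDivisors_fres (isAffineOpen_blowUpChart H.prod_mem) hV
    (isAwayChart_blowUpChart H.prod_mem).mem_nonZeroDivisors
  have h3 := map_dvd (fres hV) ((isAwayChart_blowUpChart H.prod_mem).dvd _ h1)
  change fres hV ((blowUpπ J).appLE W.1 _ _ (∏ i, a i)) ∈ _ at h2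
  change fres hV ((blowUpπ J).appLE W.1 _ _ (∏ i, a i)) ∣ fres hV ((blowUpπ J).appLE W.1 _ _ _) at h3
  have h4 : (blowUpπ J).appLE W.1 V (hV.trans (blowUpChart_le _)) (∏ i, a i) =
      (blowUpπ J).appLE W.1 V (hV.trans (blowUpChart_le _)) (∏ j ∈ Finset.univ.erase i, a j) *
        (blowUpπ J).appLE W.1 V (hV.trans (blowUpChart_le _)) (a i) := by
    rw [← map_mul, Finset.prod_erase_mul _ _ (Finset.mem_univ i)]
  rw [fres_appLE, h4] at h2 h3
  rw [fres_appLE, map_mul] at h3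
  obtain ⟨h4, h5⟩ := mul_mem_nonZeroDivisors.mp h2
  obtain ⟨d, hd⟩ := h3
  refine ⟨h5, d, (mul_cancel_left_mem_nonZeroDivisors h4).mp ?_⟩
  rw [hd, mul_assoc]

theorem IsCrossing.exists_units (H : IsCrossing c J W a b y α β) {V : (blowUp J).Opens}
    (hV : V ≤ blowUpChart H.prod_mem) (hV' : V ≤ blowUpChart H.symm.prod_mem) :
    ∃ v : ι → Γ(blowUp J, V)ˣ, ∀ i, (blowUpπ J).appLE W.1 V (hV.trans (blowUpChart_le _)) (a i) =
      v i * (blowUpπ J).appLE W.1 V (hV.trans (blowUpChart_le _)) (b i) := by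
  have h1 : ∀ i, ∃ v : Γ(blowUp J, V)ˣ, (blowUpπ J).appLE W.1 V (hV.trans (blowUpChart_le _)) (a i) =
      v * (blowUpπ J).appLE W.1 V (hV.trans (blowUpChart_le _)) (b i) := fun i => by
    obtain ⟨h1, d, hd⟩ := H.dvd hV i
    obtain ⟨-, d', hd'⟩ := H.symm.dvd hV' i
    have h2 : d * d' = 1 := (mul_cancel_left_mem_nonZeroDivisors h1).mp (by
      rw [← mul_assoc, ← hd, ← hd', mul_one])
    exact ⟨⟨d', d, (mul_comm _ _).trans h2, h2⟩, hd'.trans (mul_comm _ _)⟩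
  choose v hv using h1
  exact ⟨v, hv⟩

/-- Étale coordinates on the framed self-product. -/
theorem IsCrossing.etale_blowUp {β : s → κ} (H : IsCrossing c J W a b y α β) {V : (blowUp J).Opens}
    (hVa : IsAffineOpen V) (hV : V ≤ blowUpChart H.symm.prod_mem) {v : ι → Γ(blowUp J, V)}
    (hv : ∀ i, (blowUpπ J).appLE W.1 V (hV.trans (blowUpChart_le _)) (a i) =
      v i * (blowUpπ J).appLE W.1 V (hV.trans (blowUpChart_le _)) (b i)) {T : κ → Γ(blowUp J, V)}
    (hT : ∀ i, T (α i) = v i)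
    (hT' : ∀ l, (∀ i, l ≠ α i) →
      T l = (blowUpπ J).appLE W.1 V (hV.trans (blowUpChart_le _)) (y l)) :
    (eval₂Hom (baseHom (blowUpπ J ≫ c) V) T).Etale := by
  have : Fintype {i // i ∈ s ∧ i ∈ s} := Fintype.ofFinite _
  classical
  let h : {i // i ∈ s ∧ i ∈ s} → κ := fun i => β ⟨i, i.2.2⟩
  let q : {i // i ∈ s ∧ i ∈ s} → κ := fun i => α ⟨i, i.2.1⟩
  have hq : IsChoice α β h q := ⟨fun i => Or.inr ⟨rfl, rfl⟩⟩
  have he : ∏ i, y (h i) ∈ J.ideal W := by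
    rw [H.ideal_eq hq]
    exact Ideal.prod_mem_prod fun i _ => Ideal.subset_span (Set.mem_insert_of_mem _ rfl)
  have hVW := hV.trans (blowUpChart_le _)
  have hVe : V ≤ blowUpChart he := fun p hp => mem_blowUpChart he hp hVW fun f hf => by
    have h1 := map_dvd (fres hV) ((isAwayChart_blowUpChart H.symm.prod_mem).dvd f hf)
    change fres hV ((blowUpπ J).appLE W.1 _ _ _) ∣ fres hV ((blowUpπ J).appLE W.1 _ _ f) at h1
    rw [fres_appLE, fres_appLE] at h1
    refine dvd_trans ?_ h1
    refine map_dvd ((blowUpπ J).appLE W.1 V hVW).hom ?_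
    have h2 : ∏ i, y (h i) = ∏ i ∈ Finset.univ.filter (fun i => i ∈ s ∧ i ∈ s), b i := by
      rw [Finset.prod_subtype (p := fun i => i ∈ s ∧ i ∈ s) _ (fun i => by simp)]
      exact Finset.prod_congr rfl fun i _ => (H.eqβ ⟨i, i.2.2⟩).symm
    rw [h2]
    exact Finset.prod_dvd_prod_of_subset _ _ _ (Finset.subset_univ _)
  obtain ⟨Z, hZ, hZ', hZ''⟩ := H.exists_coords hq he
  have h1 := RingHom.Etale.stableUnderComposition _ _ hZ
    (etale_fres (isAffineOpen_blowUpChart he) hVa hVe)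
  refine Eq.mp (congrArg RingHom.Etale ?_) h1
  refine MvPolynomial.ringHom_ext (fun c => ?_) fun l => ?_
  · simp only [RingHom.comp_apply, eval₂Hom_C]
    exact congrArg (fun f => f c) (fres_comp_baseHom (blowUpπ J ≫ _) hVe)
  simp only [RingHom.comp_apply, eval₂Hom_X']
  by_cases hl : ∃ i, l = α i
  · obtain ⟨i, rfl⟩ := hl
    rw [hT]
    have h2 := congrArg (fres hVe) (hZ' ⟨i, i.2, i.2⟩)
    rw [map_mul, fres_appLE, fres_appLE] at h2
    change (blowUpπ J).appLE W.1 V hVW (y (β i)) * fres hVe (Z (α i)) =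
      (blowUpπ J).appLE W.1 V hVW (y (α i)) at h2
    rw [← H.eqα, ← H.eqβ, hv, mul_comm] at h2
    exact (mul_cancel_right_mem_nonZeroDivisors (H.symm.dvd hV i).1).mp h2
  · push Not at hl
    rw [hT' l hl, hZ'' l fun i => hl _]
    exact fres_appLE _ _ _
end

end

/-! ### Charts of the framed self-product -/

section

variable {X P Y S : Scheme.{u}}

theorem RingHom.Etale.smooth_of_eval₂Hom {A B : Type u} [CommRing A] [CommRing B] {κ : Type} [_root_.Finite κ]
    {φ : A →+* B} {y : κ → B} (h : (eval₂Hom φ y).Etale) : φ.Smooth := by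
  have h2 : (MvPolynomial.C : A →+* MvPolynomial κ A).Smooth :=
    RingHom.smooth_algebraMap.mpr ⟨inferInstance, inferInstance⟩
  have h3 := RingHom.Smooth.stableUnderComposition _ _ h2 h.smooth
  rwa [MvPolynomial.eval₂Hom_comp_C] at h3

/-- Functions on an open subscheme. -/
theorem bijective_appLE_ι {G D : Y.Opens} (hD : D ≤ G) {V : G.toScheme.Opens} (hV : V = G.ι ⁻¹ᵁ D) :
    Function.Bijective (G.ι.appLE D V hV.le) := by
  subst hV
  have hiso : IsIso (G.ι.app D) := Scheme.Hom.isIso_app _ _ (by simpa using hD)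
  rw [← Scheme.Hom.app_eq_appLE]
  exact ConcreteCategory.bijective_of_isIso (G.ι.app D)

section
variable {k : Type u} [Field k] {ι : Type} [Fintype ι] (b : X ⟶ Spec (.of k)) (D : ι → X.IdealSheafData)

/-- The part of the framed self-product over `U × U'`. -/
def framedChart (U U' : X.affineOpens) : (framedProduct b D).Opens :=
  framedProductMap b D ⁻¹ᵁ (prodChart b U U').1

theorem framedChart_le_fst (U U' : X.affineOpens) : framedChart b D U U' ≤ framedFst b D ⁻¹ᵁ U.1 :=
  fun _ hz => hz.1

theorem framedChart_le_snd (U U' : X.affineOpens) : framedChart b D U U' ≤ framedSnd b D ⁻¹ᵁ U'.1 :=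
  fun _ hz => hz.2

theorem framedFst_comp : framedFst b D ≫ b = framedSnd b D ≫ b := by
  rw [framedFst, framedSnd, Category.assoc, Category.assoc, pullback.condition]

variable {b D} {U U' : X.affineOpens} {s s' : Set ι} {m m' : ℕ} {t : ι → Γ(X, U.1)} {z : Fin m → Γ(X, U.1)}
  {t' : ι → Γ(X, U'.1)} {z' : Fin m' → Γ(X, U'.1)}

theorem IsLogCoords.framedChart_eq (h : IsLogCoords b D U s t z) (h' : IsLogCoords b D U' s' t' z') :
    framedChart b D U U' = (framedOpen b D).ι ⁻¹ᵁ
      (blowUpChart (h.isCrossing h').prod_mem ⊓ blowUpChart (h.isCrossing h').symm.prod_mem) :=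
  preimage_ι_comp (h.framedOpen_inf h')

theorem IsLogCoords.isAffineOpen_framedChart (h : IsLogCoords b D U s t z)
    (h' : IsLogCoords b D U' s' t' z') : IsAffineOpen (framedChart b D U U') := by
  rw [h.framedChart_eq h']
  exact isAffineOpen_preimage_ι (isAffineOpen_blowUpChart_inf _ _) (h.framedOpen_inf h' ▸ inf_le_left)

/-- Functions on the corresponding part of the blow-up. -/
def IsLogCoords.framedRes (h : IsLogCoords b D U s t z) (h' : IsLogCoords b D U' s' t' z') :
    Γ(blowUp (framedCenter b D),
      blowUpChart (h.isCrossing h').prod_mem ⊓ blowUpChart (h.isCrossing h').symm.prod_mem) →+*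
    Γ(framedProduct b D, framedChart b D U U') :=
  ((framedOpen b D).ι.appLE _ _ (h.framedChart_eq h').le).hom

theorem IsLogCoords.bijective_framedRes (h : IsLogCoords b D U s t z)
    (h' : IsLogCoords b D U' s' t' z') : Function.Bijective (h.framedRes h') :=
  bijective_appLE_ι (h.framedOpen_inf h' ▸ inf_le_left) (h.framedChart_eq h')

theorem IsLogCoords.framedRes_prodFst (h : IsLogCoords b D U s t z)
    (h' : IsLogCoords b D U' s' t' z') (f : Γ(X, U.1)) :
    h.framedRes h' ((blowUpπ _).appLE _ _ (inf_le_left.trans (blowUpChart_le _)) (prodFst b U U' f)) =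
      (framedFst b D).appLE U.1 _ (framedChart_le_fst b D U U') f :=
  (appLE_comp _ _ _ _ _).trans (appLE_comp (framedProductMap b D) (pullback.fst b b)
    (V := (prodChart b U U').1) inf_le_left le_rfl f)

theorem IsLogCoords.framedRes_prodSnd (h : IsLogCoords b D U s t z)
    (h' : IsLogCoords b D U' s' t' z') (f : Γ(X, U'.1)) :
    h.framedRes h' ((blowUpπ _).appLE _ _ (inf_le_left.trans (blowUpChart_le _)) (prodSnd b U U' f)) =
      (framedSnd b D).appLE U'.1 _ (framedChart_le_snd b D U U') f :=
  (appLE_comp _ _ _ _ _).trans (appLE_comp (framedProductMap b D) (pullback.snd b b)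
    (V := (prodChart b U U').1) inf_le_right le_rfl f)

theorem IsLogCoords.exists_framed_units (h : IsLogCoords b D U s t z)
    (h' : IsLogCoords b D U' s' t' z') : ∃ v : ι → Γ(framedProduct b D, framedChart b D U U')ˣ,
      ∀ i, (framedFst b D).appLE U.1 _ (framedChart_le_fst b D U U') (t i) =
        v i * (framedSnd b D).appLE U'.1 _ (framedChart_le_snd b D U U') (t' i) := by
  obtain ⟨v, hv⟩ := (h.isCrossing h').exists_units inf_le_left inf_le_right
  refine ⟨fun i => Units.map (h.framedRes h').toMonoidHom (v i), fun i => ?_⟩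
  have h1 := congrArg (h.framedRes h') (hv i)
  rw [map_mul, h.framedRes_prodFst h', h.framedRes_prodSnd h'] at h1
  exact h1

/-- Étale coordinates on the framed self-product, over the second factor. -/
theorem IsLogCoords.etale_framedSnd (h : IsLogCoords b D U s t z)
    (h' : IsLogCoords b D U' s t' z') {v : ι → Γ(framedProduct b D, framedChart b D U U')}
    (hv : ∀ i, (framedFst b D).appLE U.1 _ (framedChart_le_fst b D U U') (t i) =
        v i * (framedSnd b D).appLE U'.1 _ (framedChart_le_snd b D U U') (t' i)) :
    (eval₂Hom ((framedSnd b D).appLE U'.1 _ (framedChart_le_snd b D U U')).hom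
      (Sum.elim (fun i : s => v i) fun j =>
        (framedFst b D).appLE U.1 _ (framedChart_le_fst b D U U') (z j))).Etale := by
  have H := h.isCrossing h'
  obtain ⟨w, hw⟩ : ∃ w : ι → _, ∀ i, h.framedRes h' (w i) = v i :=
    ⟨_, fun i => ((h.bijective_framedRes h').2 (v i)).choose_spec⟩
  have hw' : ∀ i, (blowUpπ _).appLE _ _ (inf_le_left.trans (blowUpChart_le _)) (prodFst b U U' (t i)) =
      w i * (blowUpπ _).appLE _ _ (inf_le_left.trans (blowUpChart_le _)) (prodSnd b U U' (t' i)) :=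
    fun i => (h.bijective_framedRes h').1 (by
      rw [map_mul, h.framedRes_prodFst h', h.framedRes_prodSnd h', hw, hv])
  have h1 := H.etale_blowUp (V := blowUpChart H.prod_mem ⊓ blowUpChart H.symm.prod_mem)
    (isAffineOpen_blowUpChart_inf _ _) inf_le_right hw'
    (T := Sum.elim (Sum.elim (fun i : s => w i) fun j =>
      (blowUpπ _).appLE _ _ (inf_le_left.trans (blowUpChart_le _)) (prodFst b U U' (z j)))
      fun l => (blowUpπ _).appLE _ _ (inf_le_left.trans (blowUpChart_le _))
        (prodSnd b U U' (Sum.elim (fun i : s => t' i) z' l)))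
    (fun i => rfl) (by
      rintro ((i | j) | l) hl
      · exact absurd rfl (hl i)
      · rfl
      · rfl)
  have h2 := RingHom.Etale.stableUnderComposition _ _ h1 (.of_bijective (h.bijective_framedRes h'))
  have h3 : (baseHom (framedSnd b D ≫ b) (framedChart b D U U')) = (h.framedRes h').comp
      (baseHom (blowUpπ (framedCenter b D) ≫ pullback.fst b b ≫ b)
        (blowUpChart H.prod_mem ⊓ blowUpChart H.symm.prod_mem)) := by
    refine (appLE_baseHom (blowUpπ (framedCenter b D) ≫ pullback.fst b b ≫ b) (framedOpen b D).ι
      ?_ (h.framedChart_eq h').le).symm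
    rw [← framedFst_comp]
    simp only [framedFst, framedProductMap, Category.assoc]
    exact (Category.assoc _ _ _).symm
  refine RingHom.Etale.eval₂Hom_of_sum (ψC := baseHom (framedSnd b D ≫ b) (framedChart b D U U'))
    ?_ h'.etale (appLE_baseHom b (framedSnd b D) rfl (framedChart_le_snd b D U U'))
  refine Eq.mp (congrArg RingHom.Etale ?_) h2
  refine MvPolynomial.ringHom_ext (fun c => ?_) fun l => ?_
  · simp only [RingHom.comp_apply, eval₂Hom_C, h3]
  · simp only [RingHom.comp_apply, eval₂Hom_X']
    rcases l with (i | j) | l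
    · exact hw i
    · exact h.framedRes_prodFst h' _
    · exact h.framedRes_prodSnd h' _

/-- Étale coordinates on the framed self-product, over the first factor. -/
theorem IsLogCoords.etale_framedFst (h : IsLogCoords b D U s t z)
    (h' : IsLogCoords b D U' s t' z') {v : ι → Γ(framedProduct b D, framedChart b D U U')}
    (hv : ∀ i, (framedSnd b D).appLE U'.1 _ (framedChart_le_snd b D U U') (t' i) =
        v i * (framedFst b D).appLE U.1 _ (framedChart_le_fst b D U U') (t i)) :
    (eval₂Hom ((framedFst b D).appLE U.1 _ (framedChart_le_fst b D U U')).hom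
      (Sum.elim (fun i : s => v i) fun j =>
        (framedSnd b D).appLE U'.1 _ (framedChart_le_snd b D U U') (z' j))).Etale := by
  have H := h.isCrossing h'
  obtain ⟨w, hw⟩ : ∃ w : ι → _, ∀ i, h.framedRes h' (w i) = v i :=
    ⟨_, fun i => ((h.bijective_framedRes h').2 (v i)).choose_spec⟩
  have hw' : ∀ i, (blowUpπ _).appLE _ _ (inf_le_left.trans (blowUpChart_le _)) (prodSnd b U U' (t' i)) =
      w i * (blowUpπ _).appLE _ _ (inf_le_left.trans (blowUpChart_le _)) (prodFst b U U' (t i)) :=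
    fun i => (h.bijective_framedRes h').1 (by
      rw [map_mul, h.framedRes_prodFst h', h.framedRes_prodSnd h', hw, hv])
  have h1 := H.symm.etale_blowUp (V := blowUpChart H.prod_mem ⊓ blowUpChart H.symm.prod_mem)
    (isAffineOpen_blowUpChart_inf _ _) inf_le_left hw'
    (T := Sum.elim (fun l => (blowUpπ _).appLE _ _ (inf_le_left.trans (blowUpChart_le _))
        (prodFst b U U' (Sum.elim (fun i : s => t i) z l)))
      (Sum.elim (fun i : s => w i) fun j =>
      (blowUpπ _).appLE _ _ (inf_le_left.trans (blowUpChart_le _)) (prodSnd b U U' (z' j))))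
    (fun i => rfl) (by
      rintro (l | (i | j)) hl
      · rfl
      · exact absurd rfl (hl i)
      · rfl)
  have h2 := RingHom.Etale.stableUnderComposition _ _ h1 (.of_bijective (h.bijective_framedRes h'))
  have h3 : (baseHom (framedFst b D ≫ b) (framedChart b D U U')) = (h.framedRes h').comp
      (baseHom (blowUpπ (framedCenter b D) ≫ pullback.fst b b ≫ b)
        (blowUpChart H.prod_mem ⊓ blowUpChart H.symm.prod_mem)) := by
    refine (appLE_baseHom (blowUpπ (framedCenter b D) ≫ pullback.fst b b ≫ b) (framedOpen b D).ι
      ?_ (h.framedChart_eq h').le).symm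
    simp only [framedFst, framedProductMap, Category.assoc]
    exact (Category.assoc _ _ _).symm
  have h4 : (eval₂Hom (baseHom (framedFst b D ≫ b) (framedChart b D U U'))
      (Sum.elim ((framedFst b D).appLE U.1 _ (framedChart_le_fst b D U U') ∘
        Sum.elim (fun i : s => t i) z) (Sum.elim (fun i : s => v i) fun j =>
        (framedSnd b D).appLE U'.1 _ (framedChart_le_snd b D U U') (z' j)))).Etale := by
    refine Eq.mp (congrArg RingHom.Etale ?_) h2
    refine MvPolynomial.ringHom_ext (fun c => ?_) fun l => ?_
    · simp only [RingHom.comp_apply, eval₂Hom_C, h3]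
    · simp only [RingHom.comp_apply, eval₂Hom_X']
      rcases l with l | (i | j)
      · exact h.framedRes_prodFst h' _
      · exact hw i
      · exact h.framedRes_prodSnd h' _
  refine RingHom.Etale.eval₂Hom_of_sum (ψC := baseHom (framedFst b D ≫ b) (framedChart b D U U'))
    ?_ h.etale (appLE_baseHom b (framedFst b D) rfl (framedChart_le_fst b D U U'))
  have h5 := h4.eval₂Hom_of_equiv (Equiv.sumComm _ _)
  refine Eq.mp (congrArg RingHom.Etale (congrArg (eval₂Hom _) ?_)) h5
  funext l
  rcases l with (i | j) | l <;> rfl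

section
variable [PerfectField k] [Smooth b] (hD : IsStrictNormalCrossing D)
include hD

/-- At a point of the framed self-product, the same `D i` contain its two projections. -/
theorem framed_support_eq (p : framedProduct b D) :
    {i | framedFst b D p ∈ (D i).support} = {i | framedSnd b D p ∈ (D i).support} := by
  obtain ⟨U, m, t, z, hU, -, h⟩ := exists_isLogCoords (b := b) hD (framedFst b D p) (U₀ := ⊤) trivial
  obtain ⟨U', m', t', z', hU', -, h'⟩ := exists_isLogCoords (b := b) hD (framedSnd b D p) (U₀ := ⊤)
    trivial
  obtain ⟨v, hv⟩ := h.exists_framed_units h'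
  have hp : p ∈ framedChart b D U U' := ⟨hU, hU'⟩
  ext i
  have h1 : (framedProduct b D).basicOpen ((framedFst b D).appLE U.1 _ (framedChart_le_fst b D U U') (t i)) =
    (framedProduct b D).basicOpen ((framedSnd b D).appLE U'.1 _ (framedChart_le_snd b D U U') (t' i)) := by
    rw [hv, Scheme.basicOpen_mul, Scheme.basicOpen_of_isUnit _ (v i).isUnit]
    exact inf_eq_right.mpr ((framedProduct b D).basicOpen_le _)
  rw [Scheme.basicOpen_appLE, Scheme.basicOpen_appLE] at h1
  have h2 : ∀ {V : X.affineOpens} {y : X} (hy : y ∈ V.1) {f : Γ(X, V.1)}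
      (hf : (D i).ideal V = Ideal.span {f}), y ∈ (D i).support ↔ y ∉ X.basicOpen f := fun hy _ hf => by
    rw [Scheme.IdealSheafData.mem_support_iff_of_mem hy, hf, Scheme.zeroLocus_span,
      Scheme.mem_zeroLocus_iff]
    simp
  refine (h2 hU (h.eq i)).trans (Iff.trans (not_congr ?_) (h2 hU' (h'.eq i)).symm)
  exact ⟨fun h3 => (h1.le ⟨hp, h3⟩).2, fun h3 => (h1.ge ⟨hp, h3⟩).2⟩

theorem exists_isLogCoords_framed (p : framedProduct b D) :
    ∃ (U U' : X.affineOpens) (s : Set ι) (m m' : ℕ) (t : ι → Γ(X, U.1)) (z : Fin m → Γ(X, U.1))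
      (t' : ι → Γ(X, U'.1)) (z' : Fin m' → Γ(X, U'.1)), p ∈ framedChart b D U U' ∧
      IsLogCoords b D U s t z ∧ IsLogCoords b D U' s t' z' := by
  obtain ⟨U, m, t, z, hU, -, h⟩ := exists_isLogCoords (b := b) hD (framedFst b D p) (U₀ := ⊤) trivial
  obtain ⟨U', m', t', z', hU', -, h'⟩ := exists_isLogCoords (b := b) hD (framedSnd b D p) (U₀ := ⊤)
    trivial
  rw [← framed_support_eq hD p] at h'
  exact ⟨U, U', _, m, m', t, z, t', z', ⟨hU, hU'⟩, h, h'⟩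

theorem smooth_framedSnd : Smooth (framedSnd b D) := by
  refine (HasRingHomProperty.iff_exists_appLE (P := @Smooth) (Q := RingHom.Smooth)
    (RingHom.Smooth.stableUnderComposition.stableUnderCompositionWithLocalizationAway
      RingHom.Smooth.holdsForLocalizationAway).1).mpr fun p => ?_
  obtain ⟨U, U', s, m, m', t, z, t', z', hp, h, h'⟩ := exists_isLogCoords_framed hD p
  obtain ⟨v, hv⟩ := h.exists_framed_units h'
  exact ⟨U', ⟨_, h.isAffineOpen_framedChart h'⟩, hp, framedChart_le_snd b D U U',
    (h.etale_framedSnd h' (v := fun i => v i) hv).smooth_of_eval₂Hom⟩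

theorem smooth_framedFst : Smooth (framedFst b D) := by
  refine (HasRingHomProperty.iff_exists_appLE (P := @Smooth) (Q := RingHom.Smooth)
    (RingHom.Smooth.stableUnderComposition.stableUnderCompositionWithLocalizationAway
      RingHom.Smooth.holdsForLocalizationAway).1).mpr fun p => ?_
  obtain ⟨U, U', s, m, m', t, z, t', z', hp, h, h'⟩ := exists_isLogCoords_framed hD p
  obtain ⟨v, hv⟩ := h.exists_framed_units h'
  exact ⟨U, ⟨_, h.isAffineOpen_framedChart h'⟩, hp, framedChart_le_fst b D U U',
    (h.etale_framedFst h' (v := fun i => ↑(v i)⁻¹) fun i => by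
      rw [hv, Units.inv_mul_cancel_left]).smooth_of_eval₂Hom⟩

theorem isAffineHom_framedProductMap : IsAffineHom (framedProductMap b D) := by
  refine isAffineHom_of_forall_exists_isAffineOpen _ fun p => ?_
  obtain ⟨U, m, t, z, hU, -, h⟩ := exists_isLogCoords (b := b) hD (pullback.fst b b p) (U₀ := ⊤) trivial
  obtain ⟨U', m', t', z', hU', -, h'⟩ := exists_isLogCoords (b := b) hD (pullback.snd b b p) (U₀ := ⊤)
    trivial
  exact ⟨(prodChart b U U').1, ⟨hU, hU'⟩, (prodChart b U U').2, h.isAffineOpen_framedChart h'⟩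

/-- The framed diagonal is a closed immersion. -/
theorem isClosedImmersion_framed [IsSeparated b] {δ : X ⟶ framedProduct b D}
    (hδ : δ ≫ framedProductMap b D = pullback.lift (𝟙 X) (𝟙 X) rfl) : IsClosedImmersion δ := by
  have := isAffineHom_framedProductMap (b := b) hD
  have h1 : IsClosedImmersion (δ ≫ framedProductMap b D) := by
    rw [hδ]
    exact inferInstanceAs (IsClosedImmersion (pullback.diagonal b))
  exact .of_comp δ (framedProductMap b D)
end
end

end

/-! ### The framed diagonal -/

section

variable {X P Y S : Scheme.{u}}

section
variable {k : Type u} [Field k] {ι : Type} {b : X ⟶ Spec (.of k)} {D : ι → X.IdealSheafData}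
  {U U' : X.affineOpens} {s s' : Set ι} {m m' : ℕ} {t : ι → Γ(X, U.1)} {z : Fin m → Γ(X, U.1)}

theorem IsLogCoords.mem_nonZeroDivisors (h : IsLogCoords b D U s t z) (i : ι) :
    t i ∈ nonZeroDivisors Γ(X, U.1) := by
  by_cases hi : i ∈ s
  · have h1 := mem_nonZeroDivisors_of_flat (RingHom.Etale.iff_flat_and_formallyUnramified.mp h.etale).1
      (mem_nonZeroDivisors_of_ne_zero (MvPolynomial.X_ne_zero (R := k)
        (Sum.inl ⟨i, hi⟩ : s ⊕ Fin m)))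
    rwa [eval₂Hom_X'] at h1
  · exact (h.unit i hi).mem_nonZeroDivisors

theorem flat_appLE (j : Y ⟶ X) [Flat j] {O : Y.Opens} (hO : IsAffineOpen O) (h : O ≤ j ⁻¹ᵁ U.1) :
    (j.appLE U.1 O h).hom.Flat :=
  HasRingHomProperty.appLE (P := @Flat) j inferInstance U ⟨O, hO⟩ h

variable [Fintype ι]

section
variable {j : Y ⟶ X} {δ : Y ⟶ pullback b b} (hδ : δ ≫ pullback.fst b b = j)
    (hδ' : δ ≫ pullback.snd b b = j)

include hδ in
theorem appLE_prodFst {O : Y.Opens} (hO : O ≤ j ⁻¹ᵁ U.1)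
    (hO' : O ≤ δ ⁻¹ᵁ (prodChart b U U').1) (f : Γ(X, U.1)) :
    δ.appLE _ O hO' (prodFst b U U' f) = j.appLE U.1 O hO f :=
  (appLE_comp δ (pullback.fst b b) (V := (prodChart b U U').1) inf_le_left hO' f).trans
    (appLE_congr hδ _ _ _)

include hδ' in
theorem appLE_prodSnd {O : Y.Opens} (hO : O ≤ j ⁻¹ᵁ U'.1)
    (hO' : O ≤ δ ⁻¹ᵁ (prodChart b U U').1) (f : Γ(X, U'.1)) :
    δ.appLE _ O hO' (prodSnd b U U' f) = j.appLE U'.1 O hO f :=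
  (appLE_comp δ (pullback.snd b b) (V := (prodChart b U U').1) inf_le_right hO' f).trans
    (appLE_congr hδ' _ _ _)

include hδ hδ' in
theorem le_preimage_prodChart {O : Y.Opens} (hO : O ≤ j ⁻¹ᵁ U.1) : O ≤ δ ⁻¹ᵁ (prodChart b U U).1 := by
  refine fun p hp => ⟨?_, ?_⟩
  · change (δ ≫ pullback.fst b b) p ∈ U.1
    rw [hδ]; exact hO hp
  · change (δ ≫ pullback.snd b b) p ∈ U.1
    rw [hδ']; exact hO hp
end

theorem comp_diagonal_fst (j : Y ⟶ X) :
    (j ≫ pullback.lift (𝟙 X) (𝟙 X) rfl) ≫ pullback.fst b b = j := by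
  rw [Category.assoc, pullback.lift_fst, Category.comp_id]

theorem comp_diagonal_snd (j : Y ⟶ X) :
    (j ≫ pullback.lift (𝟙 X) (𝟙 X) rfl) ≫ pullback.snd b b = j := by
  rw [Category.assoc, pullback.lift_snd, Category.comp_id]

/-- The framed diagonal is unique, also locally. -/
theorem framed_hom_ext [PerfectField k] [Smooth b] (hD : IsStrictNormalCrossing D) {j : Y ⟶ X} [Flat j]
    {f₁ f₂ : Y ⟶ framedProduct b D}
    (h₁ : f₁ ≫ framedProductMap b D = j ≫ pullback.lift (𝟙 X) (𝟙 X) rfl)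
    (h₂ : f₂ ≫ framedProductMap b D = j ≫ pullback.lift (𝟙 X) (𝟙 X) rfl) : f₁ = f₂ := by
  have hδ : (j ≫ pullback.lift (𝟙 X) (𝟙 X) rfl) ≫ pullback.fst b b = j := comp_diagonal_fst _
  have hδ' : (j ≫ pullback.lift (𝟙 X) (𝟙 X) rfl) ≫ pullback.snd b b = j := comp_diagonal_snd _
  generalize j ≫ pullback.lift (f := b) (g := b) (𝟙 X) (𝟙 X) rfl = δ at h₁ h₂ hδ hδ'
  refine (cancel_mono (framedOpen b D).ι).mp ?_
  refine hom_ext_of_appLE fun p => ?_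
  obtain ⟨U, m, t, z, hU, -, h⟩ := exists_isLogCoords (b := b) hD (j p) (U₀ := ⊤) trivial
  obtain ⟨O, hpO, hO⟩ := exists_affine_nhd (V := j ⁻¹ᵁ U.1) hU
  have H := h.isCrossing h
  have hOW : O.1 ≤ δ ⁻¹ᵁ (prodChart b U U).1 := le_preimage_prodChart hδ hδ' hO
  have hV : ∀ {f : Y ⟶ framedProduct b D}, f ≫ framedProductMap b D = δ →
      O.1 ≤ (f ≫ (framedOpen b D).ι) ⁻¹ᵁ blowUpChart H.symm.prod_mem := fun {f} hf p hp => by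
    have h3 : f p ∈ framedChart b D U U := by
      change (f ≫ framedProductMap b D) p ∈ (prodChart b U U).1
      rw [hf]; exact hOW hp
    rw [h.framedChart_eq h] at h3
    exact h3.2
  have hπ : ∀ {f : Y ⟶ framedProduct b D}, f ≫ framedProductMap b D = δ →
      (f ≫ (framedOpen b D).ι) ≫ blowUpπ _ = δ := fun {f} hf => (Category.assoc _ _ _).trans hf
  refine ⟨⟨_, isAffineOpen_blowUpChart H.symm.prod_mem⟩, O.1, hV h₁, hV h₂, hpO, ?_⟩
  refine RingHom.congr_fun ((isAwayChart_blowUpChart H.symm.prod_mem).hom_ext ?_ fun c => ?_)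
  · have h3 : ∏ i, j.appLE U.1 O.1 hO (t i) ∈ nonZeroDivisors _ := prod_mem fun i _ =>
      mem_nonZeroDivisors_of_flat (flat_appLE j O.2 hO) (h.mem_nonZeroDivisors i)
    have h4 : ∏ i, j.appLE U.1 O.1 hO (t i) = δ.appLE _ O.1 hOW (∏ i, prodSnd b U U (t i)) := by
      rw [map_prod]
      exact Finset.prod_congr rfl fun i _ => (appLE_prodSnd hδ' _ _ _).symm
    rw [h4] at h3
    refine Eq.mp (congrArg (fun x => x ∈ nonZeroDivisors Γ(Y, O.1)) ?_) h3
    exact ((appLE_comp _ _ _ _ _).trans (appLE_congr (hπ h₁) _ _ _)).symm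
  · exact ((appLE_comp _ _ _ _ _).trans (appLE_congr ((hπ h₁).trans (hπ h₂).symm) _ _ _)).trans
      (appLE_comp _ _ _ _ _).symm

section
variable {δ : Y ⟶ pullback b b} {j : Y ⟶ X} (hδ : δ ≫ pullback.fst b b = j)
  (hδ' : δ ≫ pullback.snd b b = j) {O : Y.Opens} (hO : O ≤ j ⁻¹ᵁ U.1)
  (hOW : O ≤ δ ⁻¹ᵁ (prodChart b U U).1)

include hδ in
theorem appLE_prod_prodFst (t : ι → Γ(X, U.1)) :
    δ.appLE _ O hOW (∏ i, prodFst b U U (t i)) = ∏ i, j.appLE U.1 O hO (t i) := by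
  rw [map_prod]
  exact Finset.prod_congr rfl fun i _ => appLE_prodFst hδ _ _ _

include hδ' in
theorem appLE_prod_prodSnd (t : ι → Γ(X, U.1)) :
    δ.appLE _ O hOW (∏ i, prodSnd b U U (t i)) = ∏ i, j.appLE U.1 O hO (t i) := by
  rw [map_prod]
  exact Finset.prod_congr rfl fun i _ => appLE_prodSnd hδ' _ _ _

include hδ hδ' in
/-- Along the diagonal, the center of the framed self-product becomes the invertible ideal of the
divisor. -/
theorem IsLogCoords.dvd_of_mem (h : IsLogCoords b D U s t z) {f}
    (hf : f ∈ (framedCenter b D).ideal (prodChart b U U)) :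
    ∏ i, j.appLE U.1 O hO (t i) ∣ δ.appLE _ O hOW f := by
  have h3 := Ideal.mem_map_of_mem (δ.appLE _ O hOW).hom hf
  rw [(h.isCrossing h).ideal, Ideal.map_finsetProd] at h3
  have h4 : ∀ i, (Ideal.span {prodFst b U U (t i), prodSnd b U U (t i)}).map (δ.appLE _ O hOW).hom =
      Ideal.span {j.appLE U.1 O hO (t i)} := fun i => by
    rw [Ideal.map_span, Set.image_pair]
    change Ideal.span {δ.appLE _ O hOW (prodFst b U U (t i)), δ.appLE _ O hOW (prodSnd b U U (t i))} = _
    rw [appLE_prodSnd hδ' hO, appLE_prodFst hδ hO, Set.pair_eq_singleton]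
  rw [Finset.prod_congr rfl fun i _ => h4 i, Ideal.prod_span_singleton,
    Ideal.mem_span_singleton] at h3
  exact h3
end

theorem IsAwayChart.exists_hom {A : Type*} [CommRing A] {I : Ideal A} {e : A} {C : Y.Opens}
    (hC : IsAffineOpen C) {φ : A →+* Γ(Y, C)} (H : IsAwayChart φ I e) {T : Scheme.{u}} [IsAffine T]
    (ψ : A →+* Γ(T, ⊤)) (he : ψ e ∈ nonZeroDivisors Γ(T, ⊤)) (h : ∀ f ∈ I, ψ e ∣ ψ f) :
    ∃ (g : T ⟶ Y) (hg : ⊤ ≤ g ⁻¹ᵁ C), ∀ c, g.appLE C ⊤ hg (φ c) = ψ c := by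
  obtain ⟨g, hg, hg'⟩ := exists_hom_of_ringHom (T := T) hC (H.lift ψ he h)
  exact ⟨g, hg, fun c => (hg' _).trans (H.lift_comp ψ he h c)⟩

theorem comp_eq_of_appLE {T Z Q : Scheme.{u}} {g : T ⟶ Z} {π : Z ⟶ Q} {δ : T ⟶ Q} {W : Q.affineOpens}
    {C : Z.Opens} (hC : C ≤ π ⁻¹ᵁ W.1) (hg : ⊤ ≤ g ⁻¹ᵁ C) (hδ : ⊤ ≤ δ ⁻¹ᵁ W.1)
    (h : ∀ c, g.appLE C ⊤ hg (π.appLE W.1 C hC c) = δ.appLE W.1 ⊤ hδ c) : g ≫ π = δ :=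
  hom_ext_of_appLE fun _ => ⟨W, ⊤, hg.trans (g.preimage_mono hC), hδ, trivial, fun a =>
    (appLE_comp g π hC hg a).symm.trans (h a)⟩

/-- The universal property of the blow-up, for maps from affine schemes into a chart. -/
theorem exists_blowUp_lift {J : Y.IdealSheafData} {W : Y.affineOpens} {e : Γ(Y, W.1)} (he : e ∈ J.ideal W)
    {T : Scheme.{u}} [IsAffine T] {δ : T ⟶ Y} (hδ : ⊤ ≤ δ ⁻¹ᵁ W.1)
    (hnzd : δ.appLE W.1 ⊤ hδ e ∈ nonZeroDivisors Γ(T, ⊤))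
    (hJ : ∀ f ∈ J.ideal W, δ.appLE W.1 ⊤ hδ e ∣ δ.appLE W.1 ⊤ hδ f) :
    ∃ g : T ⟶ blowUp J, ⊤ ≤ g ⁻¹ᵁ blowUpChart he ∧ g ≫ blowUpπ J = δ := by
  obtain ⟨g, hg, hg'⟩ := (isAwayChart_blowUpChart he).exists_hom (isAffineOpen_blowUpChart he)
    (δ.appLE W.1 ⊤ hδ).hom hnzd hJ
  exact ⟨g, hg, comp_eq_of_appLE (blowUpChart_le he) hg hδ hg'⟩

theorem le_preimage_blowUpChart {J : Y.IdealSheafData} {W : Y.affineOpens} {e f : Γ(Y, W.1)}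
    (he : e ∈ J.ideal W) (hf : f ∈ J.ideal W) {T : Scheme.{u}} {δ : T ⟶ Y} (hδ : ⊤ ≤ δ ⁻¹ᵁ W.1)
    (hnzd : δ.appLE W.1 ⊤ hδ e ∈ nonZeroDivisors Γ(T, ⊤))
    (hef : δ.appLE W.1 ⊤ hδ e = δ.appLE W.1 ⊤ hδ f) {g : T ⟶ blowUp J}
    (hg : ⊤ ≤ g ⁻¹ᵁ blowUpChart he) (hgπ : g ≫ blowUpπ J = δ) : ⊤ ≤ g ⁻¹ᵁ blowUpChart hf := by
  obtain ⟨w, hw⟩ := (isAwayChart_blowUpChart he).dvd _ hf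
  refine fun p hp => basicOpen_le_blowUpChart he hf hw ?_
  have h4 := congrArg (g.appLE _ ⊤ hg) hw
  change g.appLE _ ⊤ hg ((blowUpπ _).appLE _ _ _ _) =
    g.appLE _ ⊤ hg ((blowUpπ _).appLE _ _ _ _ * w) at h4
  rw [map_mul, appLE_comp, appLE_comp, appLE_congr hgπ _ hδ, appLE_congr hgπ _ hδ, ← hef] at h4
  have h5 : g.appLE _ ⊤ hg w = 1 := (mul_cancel_left_mem_nonZeroDivisors hnzd).mp (by
    rw [mul_one]; exact h4.symm)
  have h6 := Scheme.basicOpen_appLE g ⊤ _ hg w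
  rw [h5, Scheme.basicOpen_of_isUnit _ isUnit_one] at h6
  exact (h6.le hp).2

theorem exists_open_lift {Z Q T : Scheme.{u}} {G : Z.Opens} {π : Z ⟶ Q} {g : T ⟶ Z} (h : ∀ p, g p ∈ G) :
    ∃ g' : T ⟶ G.toScheme, g' ≫ G.ι ≫ π = g ≫ π := by
  have hrange : Set.range g ⊆ Set.range G.ι := by
    rintro _ ⟨p, rfl⟩
    rw [Scheme.Opens.range_ι]
    exact h p
  exact ⟨IsOpenImmersion.lift G.ι g hrange, by rw [← Category.assoc, IsOpenImmersion.lift_fac]⟩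

theorem IsLogCoords.exists_framed_lift (h : IsLogCoords b D U s t z) :
    ∃ g : U.1.toScheme ⟶ framedProduct b D,
      g ≫ framedProductMap b D = U.1.ι ≫ pullback.lift (𝟙 X) (𝟙 X) rfl := by
  have hδ : (U.1.ι ≫ pullback.lift (𝟙 X) (𝟙 X) rfl) ≫ pullback.fst b b = U.1.ι := comp_diagonal_fst _
  have hδ' : (U.1.ι ≫ pullback.lift (𝟙 X) (𝟙 X) rfl) ≫ pullback.snd b b = U.1.ι := comp_diagonal_snd _
  generalize U.1.ι ≫ pullback.lift (f := b) (g := b) (𝟙 X) (𝟙 X) rfl = δ at hδ hδ' ⊢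
  have H := h.isCrossing h
  have : IsAffine U.1.toScheme := U.2
  have hO : (⊤ : U.1.toScheme.Opens) ≤ U.1.ι ⁻¹ᵁ U.1 := fun x _ => x.2
  have hOW := le_preimage_prodChart hδ hδ' hO
  have h1 := appLE_prod_prodSnd hδ' hO hOW t
  have h2 := appLE_prod_prodFst hδ hO hOW t
  have hnzd : δ.appLE _ ⊤ hOW (∏ i, prodSnd b U U (t i)) ∈ nonZeroDivisors _ := by
    rw [h1]
    exact prod_mem fun i _ => mem_nonZeroDivisors_of_flat
      (flat_appLE U.1.ι (isAffineOpen_top _) hO) (h.mem_nonZeroDivisors i)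
  obtain ⟨g, hg, hgπ⟩ := exists_blowUp_lift H.symm.prod_mem hOW hnzd fun f hf => by
    rw [h1]; exact h.dvd_of_mem hδ hδ' hO hOW hf
  have hg' := le_preimage_blowUpChart H.symm.prod_mem H.prod_mem hOW hnzd (h1.trans h2.symm) hg hgπ
  have hG : ∀ p, g p ∈ framedOpen b D := fun p => by
    have hp : p ∈ (⊤ : U.1.toScheme.Opens) := trivial
    exact ((h.framedOpen_inf h).ge ⟨hg' hp, hg hp⟩).1
  obtain ⟨g', hg''⟩ := exists_open_lift (π := blowUpπ (framedCenter b D)) hG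
  exact ⟨g', hg''.trans hgπ⟩

/-- The diagonal lifts uniquely to the framed self-product. -/
theorem existsUnique_framedDiagonal [PerfectField k] [Smooth b] (hD : IsStrictNormalCrossing D) :
    ∃! δ : X ⟶ framedProduct b D,
      δ ≫ framedProductMap b D = pullback.lift (𝟙 X) (𝟙 X) rfl := by
  choose U m t z hU _ h using fun x => exists_isLogCoords (b := b) hD x (U₀ := ⊤) trivial
  choose g hg using fun x => (h x).exists_framed_lift
  let 𝒰 := X.openCoverOfIsOpenCover (fun x => (U x).1) (TopologicalSpace.IsOpenCover.mk (by
      rw [eq_top_iff]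
      exact fun x _ => TopologicalSpace.Opens.mem_iSup.mpr ⟨_, hU x⟩))
  have hglue : ∀ x y, pullback.fst (U x).1.ι (U y).1.ι ≫ g x = pullback.snd (U x).1.ι (U y).1.ι ≫ g y := by
    intro x y
    refine framed_hom_ext hD (j := pullback.fst (U x).1.ι (U y).1.ι ≫ (U x).1.ι) ?_ ?_
    · rw [Category.assoc, hg, Category.assoc]
    · rw [Category.assoc, hg, pullback.condition, Category.assoc]
  let δ : X ⟶ framedProduct b D := 𝒰.glueMorphisms g hglue
  have hδ : ∀ x, (U x).1.ι ≫ δ = g x := fun x => 𝒰.ι_glueMorphisms g _ x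
  refine ⟨δ, Scheme.hom_ext_of_forall _ _ fun x => ⟨_, hU x, ?_⟩, fun δ' hδ' => ?_⟩
  · rw [← Category.assoc, hδ, hg]
  · have h1 : δ ≫ framedProductMap b D = pullback.lift (𝟙 X) (𝟙 X) rfl :=
      Scheme.hom_ext_of_forall _ _ fun x => ⟨_, hU x, by rw [← Category.assoc, hδ, hg]⟩
    refine framed_hom_ext hD (j := 𝟙 X) ?_ ?_
    · exact hδ'.trans (Category.id_comp _).symm
    · exact h1.trans (Category.id_comp _).symm
end

end

/-! ### The framed self-product as a scheme with a section -/

section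

variable {X P Y S : Scheme.{u}}

section
variable {k : Type u} [Field k] {ι : Type} [Fintype ι] {b : X ⟶ Spec (.of k)} {D : ι → X.IdealSheafData}
  {U U' : X.affineOpens} {s s' : Set ι} {m m' : ℕ} {t : ι → Γ(X, U.1)} {z : Fin m → Γ(X, U.1)}
  {t' : ι → Γ(X, U'.1)} {z' : Fin m' → Γ(X, U'.1)}

theorem IsLogCoords.divisorSum_ideal (h : IsLogCoords b D U s t z) (r : ι → ℕ) :
    (divisorSum D r).ideal U = Ideal.span {∏ i, t i ^ r i} :=
  ideal_finsetProd_eq_span fun i => by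
    rw [Scheme.IdealSheafData.ideal_pow, Pi.pow_apply, h.eq, Ideal.span_singleton_pow]

theorem isEffectiveCartier_divisorSum [PerfectField k] [Smooth b] (hD : IsStrictNormalCrossing D)
    (r : ι → ℕ) : IsEffectiveCartier (divisorSum D r) := fun x => by
  obtain ⟨U, m, t, z, hU, -, h⟩ := exists_isLogCoords (b := b) hD x (U₀ := ⊤) trivial
  exact ⟨U, hU, _, prod_mem fun i _ => pow_mem (h.mem_nonZeroDivisors i) _, h.divisorSum_ideal r⟩

theorem isEffectiveCartier_prod [PerfectField k] [Smooth b] (hD : IsStrictNormalCrossing D) :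
    IsEffectiveCartier (∏ i, D i) := by
  simpa [divisorSum] using isEffectiveCartier_divisorSum (b := b) hD 1

theorem comap_framed_eq [PerfectField k] [Smooth b] (hD : IsStrictNormalCrossing D) (r : ι → ℕ) :
    (divisorSum D r).comap (framedFst b D) = (divisorSum D r).comap (framedSnd b D) := by
  choose U U' s m m' t z t' z' hp h h' using exists_isLogCoords_framed (b := b) hD
  refine Scheme.IdealSheafData.ext_of_iSup_eq_top
    (fun p => ⟨framedChart b D (U p) (U' p), (h p).isAffineOpen_framedChart (h' p)⟩)
    (eq_top_iff.mpr fun p _ => TopologicalSpace.Opens.mem_iSup.mpr ⟨p, hp p⟩) fun p => ?_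
  obtain ⟨v, hv⟩ := (h p).exists_framed_units (h' p)
  rw [ideal_comap _ _ (framedChart_le_fst b D _ _), ideal_comap _ _ (framedChart_le_snd b D _ _),
    (h p).divisorSum_ideal, (h' p).divisorSum_ideal, Ideal.map_span, Ideal.map_span,
    Set.image_singleton, Set.image_singleton]
  refine Eq.trans (congrArg (fun x => Ideal.span {x}) ?_)
    (Ideal.span_singleton_mul_right_unit (∏ i, v i ^ r i).isUnit _)
  rw [map_prod, map_prod, Units.coe_prod, ← Finset.prod_mul_distrib]
  refine Finset.prod_congr rfl fun i _ => ?_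
  rw [map_pow, map_pow, hv, mul_pow, mul_comm, Units.val_pow_eq_pow_val]

/-- The quotients of the two pull-backs of logarithmic coordinates give étale coordinates on the
framed self-product over both factors. -/
theorem IsLogCoords.exists_quotients (h : IsLogCoords b D U s t z) :
    ∃ v : s ⊕ Fin m → Γ(framedProduct b D, framedChart b D U U),
      (∀ l, (framedFst b D).appLE U.1 _ (framedChart_le_fst b D U U)
        (Sum.elim (fun i : s => t i) z l) = v l *
        (framedSnd b D).appLE U.1 _ (framedChart_le_snd b D U U) (Sum.elim (fun i : s => t i) z l)) ∧
      (eval₂Hom ((framedSnd b D).appLE U.1 _ (framedChart_le_snd b D U U)).hom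
        fun l => v l - 1).Etale ∧
      (eval₂Hom ((framedFst b D).appLE U.1 _ (framedChart_le_fst b D U U)).hom
        fun l => v l - 1).Etale := by
  obtain ⟨v, hv⟩ := h.exists_framed_units h
  choose w hw using h.unit_z
  have hwi : ∀ j, (↑(w j)⁻¹ : Γ(X, U.1)) * z j = 1 := fun j => by rw [← hw, Units.inv_mul]
  have hS : ∀ j, (framedSnd b D).appLE U.1 _ (framedChart_le_snd b D U U) ↑(w j)⁻¹ *
      (framedSnd b D).appLE U.1 _ (framedChart_le_snd b D U U) (z j) = 1 := fun j => by
    rw [← map_mul, hwi, map_one]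
  have hF : ∀ j, (framedFst b D).appLE U.1 _ (framedChart_le_fst b D U U) ↑(w j)⁻¹ *
      (framedFst b D).appLE U.1 _ (framedChart_le_fst b D U U) (z j) = 1 := fun j => by
    rw [← map_mul, hwi, map_one]
  refine ⟨Sum.elim (fun i => v i) fun j =>
    (framedSnd b D).appLE U.1 _ (framedChart_le_snd b D U U) ↑(w j)⁻¹ *
      (framedFst b D).appLE U.1 _ (framedChart_le_fst b D U U) (z j), ?_, ?_, ?_⟩
  · rintro (i | j)
    · exact hv i
    · simp only [Sum.elim_inr]
      linear_combination (-(framedFst b D).appLE U.1 _ (framedChart_le_fst b D U U) (z j)) * hS j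
  · have h1 := ((h.etale_framedSnd h (v := fun i => v i) hv).eval₂Hom_mul
      (Sum.elim 1 fun j => (w j)⁻¹)).eval₂Hom_sub 1
    refine Eq.mp (congrArg RingHom.Etale (congrArg (eval₂Hom _) ?_)) h1
    funext l
    rcases l with i | j <;> simp
  · have h1 := (h.etale_framedFst h (v := fun i => ↑(v i)⁻¹) fun i => by
      rw [hv, Units.inv_mul_cancel_left]).eval₂Hom_mul (Sum.elim 1 fun j => (w j)⁻¹)
    have hmul : ∀ {R : Type u} [CommRing R] {a b c d : R}, c * b = 1 → a * d = 1 →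
        a * b * (c * d) = 1 := fun {R} _ {a b c d} h h' => by
          linear_combination h + c * b * h'
    let _ := Fintype.ofFinite s
    have h2 := RingHom.Etale.eval₂Hom_inv (A := Γ(X, U.1)) (ι := s ⊕ Fin m)
      (B := Γ(framedProduct b D, framedChart b D U U)) h1 (y' := Sum.elim (fun i => (v i).1) fun j =>
      (framedSnd b D).appLE U.1 _ (framedChart_le_snd b D U U) ↑(w j)⁻¹ *
        (framedFst b D).appLE U.1 _ (framedChart_le_fst b D U U) (z j)) (by
      rintro (i | j)
      · simp
      · exact hmul (hS j) (hF j))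
    replace h2 := h2.eval₂Hom_sub 1
    refine Eq.mp (congrArg RingHom.Etale (congrArg (eval₂Hom _) ?_)) h2
    funext l
    rcases l with i | j <;> simp

variable {δ : X ⟶ framedProduct b D}
    (hδ : δ ≫ framedProductMap b D = pullback.lift (𝟙 X) (𝟙 X) rfl)
include hδ

theorem framedDiagonal_fst : δ ≫ framedFst b D = 𝟙 X := by
  rw [framedFst, ← Category.assoc, hδ, pullback.lift_fst]

theorem framedDiagonal_snd : δ ≫ framedSnd b D = 𝟙 X := by
  rw [framedSnd, ← Category.assoc, hδ, pullback.lift_snd]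

/-- The quotient of the two pull-backs of a function which is invertible off the divisor is equal
to `1` on the diagonal. -/
theorem appLE_framedQuotient [PerfectField k] [Smooth b] (hD : IsStrictNormalCrossing D)
    {W : (framedProduct b D).Opens} {U : X.Opens}
    (hfst : W ≤ framedFst b D ⁻¹ᵁ U) (hsnd : W ≤ framedSnd b D ⁻¹ᵁ U) (hU : U ≤ δ ⁻¹ᵁ W)
    {f : Γ(X, U)} (hf : IsUnit (fres (inf_le_left : U ⊓ divisorCompl D ≤ U) f))
    {v : Γ(framedProduct b D, W)}
    (hv : (framedFst b D).appLE U W hfst f = v * (framedSnd b D).appLE U W hsnd f) :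
    δ.appLE W U hU (v - 1) = 0 := by
  refine (isEffectiveCartier_prod (b := b) hD).eq_zero_of_complement inf_le_left
    (fun x hx hx' => ⟨hx, hx'⟩) (O := U ⊓ divisorCompl D) ?_
  have h1 := congrArg (δ.appLE W U hU) hv
  rw [map_mul, appLE_section (framedDiagonal_fst hδ) _ _ le_rfl,
    appLE_section (framedDiagonal_snd hδ) _ _ le_rfl, fres_self] at h1
  refine hf.mul_left_eq_zero.mp ?_
  rw [← map_mul, map_sub, map_one, sub_mul, ← h1, one_mul, sub_self, map_zero]

end

end

/-! ### A basis of the logarithmic differentials -/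

section

variable {X P Y S : Scheme.{u}}

/-- The divisors of a product of prime elements and units are products of the same elements, up to
units. -/
theorem exists_unit_mul_of_dvd {L : Type*} [CommRing L] [IsDomain L] {S : Set L}
    (hS : ∀ p ∈ S, Prime p ∨ IsUnit p) {x : L} (hx : x ∈ Submonoid.closure S) :
    ∀ {a : L}, a ∣ x → ∃ u : Lˣ, ∃ T ∈ Submonoid.closure S, a = u * T := by
  induction hx using Submonoid.closure_induction_left with
  | one => exact fun h => ⟨(isUnit_of_dvd_one h).unit, 1, one_mem _, (mul_one _).symm⟩
  | mul_left p hp T hT ih =>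
    rintro a ⟨c, hc⟩
    rcases hS p hp with hp' | hp'
    · rcases hp'.dvd_or_dvd (Dvd.intro _ hc) with ⟨a', rfl⟩ | ⟨c', rfl⟩
      · obtain ⟨u, T', hT', rfl⟩ := ih (a := a')
          ⟨c, mul_left_cancel₀ hp'.ne_zero (hc.trans (mul_assoc _ _ _))⟩
        exact ⟨u, p * T', mul_mem (Submonoid.subset_closure hp) hT', by ring⟩
      · exact ih ⟨c', mul_left_cancel₀ hp'.ne_zero (hc.trans (by ring))⟩
    · exact ih ((hp'.dvd_mul_left).mp ⟨c, hc⟩)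

section Subsheaf

theorem subsheafSection_sum_eq_zero {M : X.Modules} {N : ∀ V : X.Opens, Submodule Γ(X, V) Γ(M, V)}
    {h : ∀ (V V' : X.Opens) (i : V' ⟶ V), ∀ s ∈ N V, M.presheaf.map i.op s ∈ N V'}
    {V : X.Opens} {κ : Type*} [Fintype κ] {c : κ → Γ(X, V)} {e : κ → Γ(M, V)} {he : ∀ i, e i ∈ N V}
    (h0 : ∑ i, c i • subsheafSection M N h V (e i) (he i) = 0) : ∑ i, c i • e i = 0 := by
  have h1 : sheafifySection (submodulePresheaf M N h).toPresheafOfModules V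
      ⟨∑ i, c i • e i, sum_mem fun i _ => Submodule.smul_mem _ _ (he i)⟩ = 0 := by
    refine Eq.trans ?_ h0
    refine Eq.trans ?_ ((map_sum ((sheafifyModuleUnit
      (submodulePresheaf M N h).toPresheafOfModules).app (.op V)).hom
      (fun i => (⟨c i • e i, Submodule.smul_mem _ _ (he i)⟩ : ↥(N V))) _).trans
      (Finset.sum_congr rfl fun i _ =>
        sheafifySection_smul (submodulePresheaf M N h).toPresheafOfModules V (c i) ⟨e i, he i⟩))
    refine congrArg _ (Subtype.ext ?_)
    exact (map_sum (N V).subtype (fun i => ⟨c i • e i, Submodule.smul_mem _ _ (he i)⟩) _).symm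
  refine sections_ext M fun x hx => ?_
  obtain ⟨W, i, hxW, hW⟩ := exists_map_eq_zero_of_sheafifySection _ _ h1 x hx
  refine ⟨W, i.le, hxW, ?_⟩
  rw [map_zero]
  exact congrArg Subtype.val hW

theorem mres_subsheafSection {M : X.Modules} {N : ∀ V : X.Opens, Submodule Γ(X, V) Γ(M, V)}
    {h : ∀ (V V' : X.Opens) (i : V' ⟶ V), ∀ s ∈ N V, M.presheaf.map i.op s ∈ N V'}
    {V V' : X.Opens} (hV : V' ≤ V) {m : Γ(M, V)} (hm : m ∈ N V) :
    mres _ hV (subsheafSection M N h V m hm) =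
      subsheafSection M N h V' (mres M hV m) (h _ _ (homOfLE hV) m hm) :=
  sheafifySection_map _ (homOfLE hV) _

end Subsheaf

section OpenPush
variable {E : X.Modules} {O V : X.Opens}

theorem openPush_smul_bijective {a : Γ(X, V)} (ha : IsUnit (fres (inf_le_left : V ⊓ O ≤ V) a)) :
    Function.Bijective fun m : Γ(openPush E O, V) => a • m := by
  have h1 : O.ι ''ᵁ O.ι ⁻¹ᵁ V ≤ V ⊓ O := fun x hx => (mem_image_preimage.mp hx).symm
  have h2 := ha.map (fres h1)
  rw [fres_fres] at h2
  refine Eq.mp (congrArg Function.Bijective ?_) (h2.smul_bijective (β := Γ(E, O.ι ''ᵁ O.ι ⁻¹ᵁ V)))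
  exact funext fun m => (openPush_smul E O V a m).symm

theorem openPushUnit_injective (hV : V ≤ O) : Function.Injective ((openPushUnit E O).app V) := by
  intro m n h
  have h1 : V ≤ O.ι ''ᵁ O.ι ⁻¹ᵁ V := fun x hx => mem_image_preimage.mpr ⟨hV hx, hx⟩
  have h2 := congrArg (mres E h1) h
  rw [openPushUnit_app, openPushUnit_app, mres_mres, mres_mres, mres_self, mres_self] at h2
  exact h2

theorem mres_openPushUnit {W : X.Opens} (h : W ≤ V) (m : Γ(E, V)) :
    mres _ h ((openPushUnit E O).app V m) = (openPushUnit E O).app W (mres E h m) :=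
  hom_app_map (openPushUnit E O) (homOfLE h) m

theorem openPushUnit_sum_eq_zero (hV : V ≤ O) {κ : Type*} [Fintype κ] {c : κ → Γ(X, V)}
    {m : κ → Γ(openPush E O, V)} {w : κ → Γ(X, V)ˣ} {e : κ → Γ(E, V)}
    (hm : ∀ l, (w l : Γ(X, V)) • m l = (openPushUnit E O).app V (e l)) (h : ∑ l, c l • m l = 0) :
    ∑ l, (c l * ↑(w l)⁻¹) • e l = 0 := by
  refine openPushUnit_injective (O := O) hV ?_
  rw [map_zero, map_sum, ← h]
  refine Finset.sum_congr rfl fun l _ => ?_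
  rw [Scheme.Modules.Hom.app_smul, ← hm, smul_smul, mul_assoc, Units.inv_mul, mul_one]

end OpenPush

section
variable {k : Type u} [Field k] {ι : Type} [Fintype ι] {b : X ⟶ Spec (.of k)} {D : ι → X.IdealSheafData}
  {U : X.affineOpens} {s : Set ι} {m : ℕ} {t : ι → Γ(X, U.1)} {z : Fin m → Γ(X, U.1)}

theorem IsLogCoords.isUnit_fres (h : IsLogCoords b D U s t z) (l : s ⊕ Fin m) :
    IsUnit (fres (inf_le_left : U.1 ⊓ divisorCompl D ≤ U.1) (Sum.elim (fun i : s => t i) z l)) := by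
  rcases l with i | j
  · have h1 : U.1 ⊓ divisorCompl D ≤ X.basicOpen (∏ i, t i) := fun x hx =>
      (mem_complement_iff (ideal_finsetProd_eq_span h.eq) hx.1).mp hx.2
    have h2 := (RingedSpace.isUnit_res_basicOpen X.toRingedSpace (∏ i, t i)).map (fres h1)
    have h3 : fres h1 (fres (X.basicOpen_le _) (∏ i, t i)) = fres inf_le_left (∏ i, t i) :=
      fres_fres _ _ _
    exact isUnit_of_dvd_unit (map_dvd _ (Finset.dvd_prod_of_mem t (Finset.mem_univ i.1))) (h3 ▸ h2)
  · exact (h.unit_z j).map _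

/-- A function which is invertible off the divisor is locally the product of a unit and of powers of
the equations of the components. -/
theorem IsLogCoords.exists_factorization (h : IsLogCoords b D U s t z) {V : X.Opens} (hV : V ≤ U.1)
    {x : X} (hx : x ∈ V) {a : Γ(X, V)}
    (ha : IsUnit (fres (inf_le_left : V ⊓ divisorCompl D ≤ V) a)) :
    ∃ (W : X.Opens) (hW : W ≤ V), x ∈ W ∧ ∃ u : Γ(X, W)ˣ, ∃ T ∈ Submonoid.closure (Set.range t),
      fres hW a = u * fres (hW.trans hV) T := by
  obtain ⟨W, hxW, hW⟩ := exists_affine_nhd hx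
  -- `a` divides a power of the equation of the divisor. In the local ring at `x`, a domain in which
  -- the `t i` are prime or invertible, it is therefore a product of `t i` and a unit.
  obtain ⟨N, hN⟩ := dvd_pow_of_basicOpen_le W.2 (f := fres (hW.trans hV) (∏ i, t i)) (g := fres hW a) (by
    intro y hy
    have hyW : y ∈ W.1 := X.basicOpen_le _ hy
    have hyD : y ∈ V ⊓ divisorCompl D := ⟨hW hyW, (mem_complement_iff (ideal_finsetProd_eq_span h.eq)
      (hV (hW hyW))).mpr (((Scheme.basicOpen_res ..).le hy).2)⟩
    refine (Scheme.basicOpen_res ..).ge ⟨hyW, ?_⟩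
    have h1 := (Scheme.basicOpen_res X a (homOfLE inf_le_left).op).symm.trans
      (X.basicOpen_of_isUnit ha)
    exact (h1.ge hyD).2)
  let L := X.presheaf.stalk x
  let p := (U.2.primeIdealOf ⟨x, hV hx⟩).asIdeal
  let _ : Algebra Γ(X, U.1) L := X.presheaf.algebra_section_stalk (⟨x, hV hx⟩ : U.1)
  have hloc : IsLocalization.AtPrime L p := U.2.isLocalization_stalk ⟨x, hV hx⟩
  have hdom := isDomain_of_etale_mvPolynomial h.etale p (L := L)
  let γ : Γ(X, U.1) →+* L := algebraMap _ _
  have hγ : ∀ (W : X.Opens) (hW : W ≤ U.1) (hxW : x ∈ W) (f : Γ(X, U.1)),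
      X.presheaf.germ W x hxW (fres hW f) = γ f := fun W hW hxW f =>
    TopCat.Presheaf.germ_res_apply X.presheaf (homOfLE hW) x hxW f
  have hprime : ∀ q ∈ γ '' Set.range t, Prime q ∨ IsUnit q := by
    rintro _ ⟨_, ⟨i, rfl⟩, rfl⟩
    by_cases hp : t i ∈ p
    · refine Or.inl ?_
      have hi : i ∈ s := by
        by_contra hi
        exact Ideal.IsPrime.ne_top' (Ideal.eq_top_of_isUnit_mem _ hp (h.unit i hi))
      have := prime_of_etale_mvPolynomial h.etale p (L := L) (Sum.inl ⟨i, hi⟩) (by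
        rwa [eval₂Hom_X'])
      rwa [eval₂Hom_X'] at this
    · exact Or.inr ((IsLocalization.AtPrime.isUnit_to_map_iff L p _).mpr hp)
  obtain ⟨u, T, hT, huT⟩ := exists_unit_mul_of_dvd hprime (x := γ (∏ i, t i) ^ N)
    (pow_mem (by
      rw [map_prod]
      exact prod_mem fun i _ => Submonoid.subset_closure ⟨_, ⟨i, rfl⟩, rfl⟩) N)
    (a := X.presheaf.germ V x hx a) (by
      have h1 := map_dvd (X.presheaf.germ W.1 x hxW).hom hN
      rw [map_pow] at h1
      refine Eq.mp (congrArg₂ (fun c d => c ∣ d ^ N) ?_ (hγ W.1 _ hxW _)) h1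
      exact TopCat.Presheaf.germ_res_apply X.presheaf (homOfLE hW) x hxW a)
  rw [← MonoidHom.map_mclosure γ] at hT
  obtain ⟨T, hT, rfl⟩ := hT
  obtain ⟨W₁, hxW₁, u₁, hu₁⟩ := X.presheaf.exists_germ_eq u.1
  have hxu : x ∈ X.basicOpen u₁ := (X.mem_basicOpen u₁ x hxW₁).mpr (hu₁ ▸ u.isUnit)
  have hu₂ : IsUnit (fres (X.basicOpen_le u₁) u₁) := RingedSpace.isUnit_res_basicOpen _ u₁
  let Z := V ⊓ X.basicOpen u₁
  have hxZ : x ∈ Z := ⟨hx, hxu⟩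
  let u₂ : Γ(X, Z) := fres inf_le_right (fres (X.basicOpen_le u₁) u₁)
  have hu₃ : IsUnit u₂ := hu₂.map _
  have hu₄ : X.presheaf.germ Z x hxZ u₂ = u.1 := by
    refine Eq.trans ?_ hu₁
    refine (TopCat.Presheaf.germ_res_apply X.presheaf (homOfLE inf_le_right) x hxZ _).trans ?_
    exact TopCat.Presheaf.germ_res_apply X.presheaf (homOfLE (X.basicOpen_le u₁)) x hxu u₁
  obtain ⟨W₂, hxW₂, iV, iU, hW₂⟩ := X.presheaf.germ_eq x hx (V := Z) hxZ a
    (u₂ * fres (inf_le_left.trans hV) T)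
    (huT.trans ((congrArg₂ (· * ·) hu₄ (hγ Z _ hxZ T)).symm.trans
      (map_mul (X.presheaf.germ Z x hxZ).hom _ _).symm))
  obtain ⟨u₅, hu₅⟩ := hu₃.map (fres iU.le)
  refine ⟨W₂, iV.le, hxW₂, u₅, T, hT, ?_⟩
  rw [hu₅]
  exact hW₂.trans ((map_mul (fres iU.le) _ _).trans (congrArg _ (fres_fres _ _ _)))

end

end

/-! ### Generation and independence of logarithmic differentials -/

section

variable {X P Y S : Scheme.{u}}

theorem sum_smul_derivation_eq {A₀ B M κ ν : Type*} [CommRing A₀] [CommRing B] [Algebra A₀ B]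
    [AddCommGroup M] [Module B M] [Fintype κ] [Fintype ν] (d : B → M)
    (h₁ : ∀ a b, d (a + b) = d a + d b) (h₂ : ∀ a b, d (a * b) = a • d b + b • d a)
    (h₃ : ∀ a, d (algebraMap A₀ B a) = 0) {g a : κ → B} {c : κ → ν → B} {y : ν → B}
    (h : ∀ j, KaehlerDifferential.D A₀ B (g j) = ∑ l, c j l • KaehlerDifferential.D A₀ B (y l)) :
    ∑ j, a j • d (g j) = ∑ l, (∑ j, a j * c j l) • d (y l) := by
  rw [Finset.sum_congr rfl fun j _ => congrArg (a j • ·) (derivation_eq_sum d h₁ h₂ h₃ (h j))]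
  simp only [Finset.smul_sum, Finset.sum_smul, smul_smul]
  exact Finset.sum_comm

section
variable {k : Type u} [Field k] {ι : Type} [Fintype ι] {b : X ⟶ Spec (.of k)} {D : ι → X.IdealSheafData}
  {U : X.affineOpens} {s : Set ι} [Fintype s] {m : ℕ} {t : ι → Γ(X, U.1)} {z : Fin m → Γ(X, U.1)}

theorem differential_baseHom (U : X.Opens) (c : k) : differential b U (baseHom b U c) = 0 :=
  differential_appLE b le_top _

omit [Fintype ι] in
theorem IsLogCoords.isBasisOn_differentials (h : IsLogCoords b D U s t z) :
    IsBasisOn (differentials b) U.1 fun l => differential b U.1 (Sum.elim (fun i : s => t i) z l) := by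
  let e := (Fintype.equivFin (s ⊕ Fin m)).symm
  have h1 := h.etale.eval₂Hom_of_equiv e
  have h2 : (eval₂Hom (b.appLE ⊤ U.1 le_top).hom
      (Sum.elim (fun i : s => t i) z ∘ e)).Etale := by
    refine RingHom.Etale.eval₂Hom_of_comp h1 (.of_bijective
      (ConcreteCategory.bijective_of_isIso (Scheme.ΓSpecIso (.of k)).inv))
      (.of_bijective (f := RingHom.id _) Function.bijective_id) rfl fun _ => rfl
  have h3 := (isBasisOn_differentials_of_etale b (U := ⟨⊤, isAffineOpen_top _⟩) le_top h2).reindex e.symm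
  refine Eq.mp (congrArg (IsBasisOn _ _) (funext fun l => ?_)) h3
  simp

omit [Fintype ι] in
/-- Every derivation over `k` factors through the differentials. -/
theorem IsLogCoords.sum_derivation_eq_zero (h : IsLogCoords b D U s t z) {M : Type*} [AddCommGroup M]
    [Module Γ(X, U.1) M] (d : Γ(X, U.1) → M) (h₁ : ∀ a b, d (a + b) = d a + d b)
    (h₂ : ∀ a b, d (a * b) = a • d b + b • d a) (h₃ : ∀ c, d (baseHom b U.1 c) = 0)
    {κ : Type*} [Fintype κ] {a g : κ → Γ(X, U.1)}
    (h0 : ∑ j, a j • differential b U.1 (g j) = 0) : ∑ j, a j • d (g j) = 0 := by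
  let _ : Algebra k Γ(X, U.1) := (baseHom b U.1).toAlgebra
  obtain ⟨e, he⟩ := RingHom.Etale.exists_basis_kaehlerDifferential (A := k) h.etale
  have hc : ∀ j, KaehlerDifferential.D k Γ(X, U.1) (g j) =
      ∑ l, e.repr (KaehlerDifferential.D k Γ(X, U.1) (g j)) l •
        KaehlerDifferential.D k Γ(X, U.1) (Sum.elim (fun i : s => t i) z l) := fun j => by
    conv_lhs => rw [← e.sum_repr (KaehlerDifferential.D k Γ(X, U.1) (g j))]
    exact Finset.sum_congr rfl fun l _ => by rw [he]
  have h4 := (sum_smul_derivation_eq (A₀ := k) (differential b U.1) (differential_add b)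
    (differential_mul b) (differential_baseHom U.1) (a := a) hc).symm.trans h0
  have h5 := h.isBasisOn_differentials.eq_zero le_rfl
    ((Finset.sum_congr rfl fun l _ => congrArg _ (mres_self _ _ _)).trans h4)
  rw [sum_smul_derivation_eq d h₁ h₂ h₃ hc]
  exact Finset.sum_eq_zero fun l _ => by rw [congrFun h5 l, Pi.zero_apply, zero_smul]

/-- The logarithmic differentials of coordinates generate the logarithmic differentials. -/
theorem IsLogCoords.exists_eq_sum (h : IsLogCoords b D U s t z)
    {μ : s ⊕ Fin m → Γ(openPush (differentials b) (divisorCompl D), U.1)}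
    (hμ : ∀ l, Sum.elim (fun i : s => t i) z l • μ l = (openPushUnit (differentials b) (divisorCompl D)).app U.1
      (differential b U.1 (Sum.elim (fun i : s => t i) z l)))
    {V : X.Opens} (hV : V ≤ U.1) {n : Γ(openPush (differentials b) (divisorCompl D), V)}
    (hn : n ∈ logSections b (divisorCompl D) V) {x : X} (hx : x ∈ V) :
    ∃ (W : X.Opens) (hW : W ≤ V), x ∈ W ∧ ∃ c : s ⊕ Fin m → Γ(X, W),
      mres _ hW n = ∑ l, c l • mres _ (hW.trans hV) (μ l) := by
  have hμW : ∀ {W : X.Opens} (hW : W ≤ U.1) l, fres hW (Sum.elim (fun i : s => t i) z l) • mres _ hW (μ l) =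
      (openPushUnit (differentials b) (divisorCompl D)).app W
      (mres _ hW (differential b U.1 (Sum.elim (fun i : s => t i) z l))) := fun hW l => by
    rw [← mres_smul, hμ, mres_openPushUnit]
  have hunit : ∀ {W : X.Opens} (hW : W ≤ U.1) (ω : Γ(differentials b, W)), ∃ c : s ⊕ Fin m → Γ(X, W),
      (openPushUnit (differentials b) (divisorCompl D)).app W ω = ∑ l, c l • mres _ hW (μ l) := by
    intro W hW ω
    obtain ⟨c, hc⟩ := h.isBasisOn_differentials.exists_eq hW ω
    refine ⟨fun l => c l * fres hW (Sum.elim (fun i : s => t i) z l), ?_⟩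
    rw [← hc, map_sum]
    exact Finset.sum_congr rfl fun l _ => by rw [Scheme.Modules.Hom.app_smul, mul_smul, hμW]
  have hres : ∀ {W W' : X.Opens} (hW : W ≤ V) (hW' : W' ≤ W) {n} {c : s ⊕ Fin m → Γ(X, W)},
      mres (openPush (differentials b) (divisorCompl D)) hW n = ∑ l, c l • mres _ (hW.trans hV) (μ l) →
      mres _ (hW'.trans hW) n = ∑ l, fres hW' (c l) • mres _ ((hW'.trans hW).trans hV) (μ l) := by
    intro W W' hW hW' n c hc
    rw [← mres_mres _ hW hW', hc, map_sum]
    exact Finset.sum_congr rfl fun l _ => by rw [mres_smul, mres_mres]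
  induction hn using Submodule.span_induction with
  | mem n hn =>
    rcases hn with ⟨ω, rfl⟩ | ⟨a, ha, hn⟩
    · obtain ⟨c, hc⟩ := hunit hV ω
      exact ⟨V, le_rfl, hx, c, (mres_self _ _ _).trans hc⟩
    · obtain ⟨W, hW, hxW, v, T, hT, hv⟩ := h.exists_factorization hV hx ha
      have hWU := hW.trans hV
      -- the functions whose logarithmic differential is a combination of the `μ l`
      let Q : Submonoid Γ(X, W) :=
        { carrier := {f | ∃ c : s ⊕ Fin m → Γ(X, W), (openPushUnit (differentials b) (divisorCompl D)).app W
            (differential b W f) = f • ∑ l, c l • mres _ hWU (μ l)}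
          one_mem' := by
            obtain ⟨c, hc⟩ := hunit hWU (differential b W 1)
            exact ⟨c, hc.trans (one_smul _ _).symm⟩
          mul_mem' := by
            rintro f g ⟨c, hc⟩ ⟨c', hc'⟩
            refine ⟨c + c', ?_⟩
            rw [differential_mul, map_add, Scheme.Modules.Hom.app_smul, Scheme.Modules.Hom.app_smul, hc, hc']
            simp only [Pi.add_apply, add_smul, Finset.sum_add_distrib, smul_add, mul_smul]
            rw [add_comm, smul_comm g f] }
      have hQ : ∀ u : Γ(X, W), IsUnit u → u ∈ Q := by
        rintro _ ⟨u, rfl⟩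
        obtain ⟨c, hc⟩ := hunit hWU (differential b W u)
        refine ⟨fun l => ↑u⁻¹ * c l, hc.trans ?_⟩
        simp only [mul_smul, ← Finset.smul_sum]
        rw [smul_smul, Units.mul_inv, one_smul]
      have hT' : fres hWU T ∈ Q := by
        have : Submonoid.closure (Set.range t) ≤ Q.comap (fres hWU) := by
          rw [Submonoid.closure_le]
          rintro _ ⟨i, rfl⟩
          by_cases hi : i ∈ s
          · classical
            refine ⟨Pi.single (Sum.inl ⟨i, hi⟩) 1, ?_⟩
            rw [Finset.sum_eq_single (Sum.inl ⟨i, hi⟩) (fun l _ hl => by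
              rw [Pi.single_eq_of_ne hl, zero_smul]) (fun h => absurd (Finset.mem_univ _) h),
              Pi.single_eq_same, one_smul]
            refine Eq.trans ?_ (hμW hWU (Sum.inl ⟨i, hi⟩)).symm
            exact congrArg _ (differential_fres _ _ _)
          · exact hQ _ ((h.unit i hi).map _)
        exact this hT
      obtain ⟨c, hc⟩ := Q.mul_mem (hQ _ v.isUnit) hT'
      refine ⟨W, hW, hxW, c, (openPush_smul_bijective (O := divisorCompl D) (a := fres hW a) ?_).1 ?_⟩
      · rw [fres_fres]
        have := IsUnit.map (fres (inf_le_inf_right (divisorCompl D) hW)) ha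
        erw [fres_fres] at this
        exact this
      · refine Eq.trans ?_ ((hv ▸ hc :))
        simp only
        rw [← mres_smul, hn, mres_openPushUnit, differential_fres]
  | zero => exact ⟨V, le_rfl, hx, 0, by simp⟩
  | add n n' _ _ hn hn' =>
    obtain ⟨W, hW, hxW, c, hc⟩ := hn
    obtain ⟨W', hW', hxW', c', hc'⟩ := hn'
    refine ⟨W ⊓ W', inf_le_left.trans hW, ⟨hxW, hxW'⟩,
      fun l => fres inf_le_left (c l) + fres inf_le_right (c' l), ?_⟩
    simp only [add_smul, Finset.sum_add_distrib]
    exact (map_add (mres _ _) n n').trans <| congrArg₂ (· + ·) (hres hW inf_le_left hc) (hres hW' inf_le_right hc')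
  | smul a n _ hn =>
    obtain ⟨W, hW, hxW, c, hc⟩ := hn
    refine ⟨W, hW, hxW, fun l => fres hW a * c l, ?_⟩
    rw [mres_smul, hc, Finset.smul_sum]
    simp only [mul_smul]

/-- Independence is checked off the divisor, where the `μ l` are unit multiples of the differentials of
the coordinates. -/
theorem IsLogCoords.isBasisOn_logDifferentials [PerfectField k] [Smooth b]
    (hD : IsStrictNormalCrossing D) (h : IsLogCoords b D U s t z)
    {μ : s ⊕ Fin m → Γ(openPush (differentials b) (divisorCompl D), U.1)}
    (hμ : ∀ l, Sum.elim (fun i : s => t i) z l • μ l = (openPushUnit (differentials b) (divisorCompl D)).app U.1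
      (differential b U.1 (Sum.elim (fun i : s => t i) z l)))
    (hμ' : ∀ l, μ l ∈ logSections b (divisorCompl D) U.1) :
    IsBasisOn (logDifferentials b (divisorCompl D)) U.1 fun l => logSection b _ U.1 (μ l) (hμ' l) := by
  have hμW : ∀ {W : X.Opens} (hW : W ≤ U.1) l, fres hW (Sum.elim (fun i : s => t i) z l) • mres _ hW (μ l) =
      (openPushUnit (differentials b) (divisorCompl D)).app W
      (mres _ hW (differential b U.1 (Sum.elim (fun i : s => t i) z l))) := fun hW l => by
    rw [← mres_smul, hμ, mres_openPushUnit]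
  refine isBasisOn_sheafifyModule (M := (submodulePresheaf _ (logSections b (divisorCompl D))
    (logSections_map b (divisorCompl D))).toPresheafOfModules) (e := fun l => ⟨μ l, hμ' l⟩) ?_ ?_
  · rintro V hV ⟨n, hn⟩ x hx
    obtain ⟨W, hW, hxW, c, hc⟩ := h.exists_eq_sum hμ hV hn hx
    refine ⟨W, hW, hW.trans hV, hxW, c, Subtype.ext (hc.trans ?_)⟩
    exact (map_sum (logSections b (divisorCompl D) W).subtype
      (fun l => ⟨c l • mres _ (hW.trans hV) (μ l), Submodule.smul_mem _ _
        (logSections_map b _ _ _ (homOfLE (hW.trans hV)) _ (hμ' l))⟩) _).symm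
  · intro V hV c hc x hx
    refine ⟨V, le_rfl, hx, fun l => ?_⟩
    have h0 : ∑ l, c l • mres _ hV (μ l) = 0 := by
      refine Eq.trans ?_ (congrArg (logSections b (divisorCompl D) V).subtype hc)
      exact (map_sum (logSections b (divisorCompl D) V).subtype
        (fun l => ⟨c l • mres _ hV (μ l), Submodule.smul_mem _ _
          (logSections_map b _ _ _ (homOfLE hV) _ (hμ' l))⟩) _).symm
    choose w hw using fun l => (h.isUnit_fres l).map (fres (inf_le_inf_right (divisorCompl D) hV))
    rw [fres_self]
    refine (isEffectiveCartier_prod (b := b) hD).eq_zero_of_complement (O := V ⊓ divisorCompl D) inf_le_left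
      (fun y hy hy' => ⟨hy, hy'⟩) ?_
    have hVU : V ⊓ divisorCompl D ≤ U.1 := inf_le_left.trans hV
    have h1 := openPushUnit_sum_eq_zero (E := differentials b) (O := divisorCompl D) (V := V ⊓ divisorCompl D)
      inf_le_right (c := fun l => fres inf_le_left (c l)) (m := fun l => mres _ hVU (μ l)) (w := w)
      (e := fun l => mres _ hVU (differential b U.1 (Sum.elim (fun i : s => t i) z l)))
      (fun l => by
        rw [hw, fres_fres]; exact hμW hVU l)
      (by
        have := congrArg (mres _ (inf_le_left : V ⊓ divisorCompl D ≤ V)) h0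
        rw [map_sum, map_zero] at this
        refine Eq.trans (Finset.sum_congr rfl fun l _ => ?_) this
        rw [mres_smul, mres_mres])
    have h2 := h.isBasisOn_differentials.eq_zero hVU h1
    exact (Units.mul_left_eq_zero _).mp (congrFun h2 l)

end

end

/-! ### Dilatations of the framed self-product -/

section

variable {X P Y S : Scheme.{u}}

section
variable {k : Type u} [Field k] {ι : Type} [Fintype ι] {b : X ⟶ Spec (.of k)} {D : ι → X.IdealSheafData}
  {δ : X ⟶ framedProduct b D}

/-- The function `f` on `W` is `v - 1`, where `v` is the quotient of the two pull-backs of the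
function `g` on `U`, and `μ` is the logarithmic differential of `g`. -/
structure IsLogQuotient (b : X ⟶ Spec (.of k)) (D : ι → X.IdealSheafData) (δ : X ⟶ framedProduct b D)
    (U : X.Opens) (W : (framedProduct b D).Opens) (g : Γ(X, U))
    (μ : Γ(openPush (differentials b) (divisorCompl D), U)) (f : Γ(framedProduct b D, W)) : Prop where
  fst : W ≤ framedFst b D ⁻¹ᵁ U
  snd : W ≤ framedSnd b D ⁻¹ᵁ U
  le : U ≤ δ ⁻¹ᵁ W
  isUnit : IsUnit (fres (inf_le_left : U ⊓ divisorCompl D ≤ U) g)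
  smul_eq : g • μ = (openPushUnit (differentials b) (divisorCompl D)).app U (differential b U g)
  eq_mul : (framedFst b D).appLE U W fst g = (f + 1) * (framedSnd b D).appLE U W snd g

theorem IsLogQuotient.restrict {U U' : X.Opens} {W W' : (framedProduct b D).Opens} {g : Γ(X, U)}
    {μ : Γ(openPush (differentials b) (divisorCompl D), U)} {f : Γ(framedProduct b D, W)}
    (h : IsLogQuotient b D δ U W g μ f) (hU : U' ≤ U) (hW : W' ≤ W)
    (hfst : W' ≤ framedFst b D ⁻¹ᵁ U') (hsnd : W' ≤ framedSnd b D ⁻¹ᵁ U') (hle : U' ≤ δ ⁻¹ᵁ W') :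
    IsLogQuotient b D δ U' W' (fres hU g) (mres _ hU μ) (fres hW f) where
  fst := hfst
  snd := hsnd
  le := hle
  isUnit := by
    have := h.isUnit.map (fres (inf_le_inf_right (divisorCompl D) hU))
    rw [fres_fres] at this ⊢
    exact this
  smul_eq := by rw [← mres_smul, h.smul_eq, mres_openPushUnit, differential_fres]
  eq_mul := by
    have := congrArg (fres hW) h.eq_mul
    rw [map_mul, map_add, map_one, fres_appLE, fres_appLE] at this
    rwa [appLE_fres, appLE_fres]

variable (hδ : δ ≫ framedProductMap b D = pullback.lift (𝟙 X) (𝟙 X) rfl)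
include hδ

theorem IsLogQuotient.eq_zero [PerfectField k] [Smooth b] (hD : IsStrictNormalCrossing D) {U : X.Opens}
    {W : (framedProduct b D).Opens} {g : Γ(X, U)}
    {μ : Γ(openPush (differentials b) (divisorCompl D), U)} {f : Γ(framedProduct b D, W)}
    (h : IsLogQuotient b D δ U W g μ f) : δ.appLE W U h.le f = 0 := by
  have := appLE_framedQuotient hδ hD h.fst h.snd h.le h.isUnit h.eq_mul
  rwa [add_sub_cancel_right] at this

/-- The derivation `g ↦ δ^*(d(pr₁^* g) - d(pr₂^* g))`. -/
def diagonalDerivation (δ : X ⟶ framedProduct b D) (a : framedProduct b D ⟶ X) {U : X.Opens}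
    {W : (framedProduct b D).Opens} (hfst : W ≤ framedFst b D ⁻¹ᵁ U) (hsnd : W ≤ framedSnd b D ⁻¹ᵁ U)
    (hle : U ≤ δ ⁻¹ᵁ W) (g : Γ(X, U)) : Γ((Scheme.Modules.pullback δ).obj (differentials a), U) :=
  pullbackSection δ (differentials a) W U hle (differential a W ((framedFst b D).appLE U W hfst g)) -
    pullbackSection δ (differentials a) W U hle (differential a W ((framedSnd b D).appLE U W hsnd g))

theorem IsLogQuotient.smul_pullbackSection [PerfectField k] [Smooth b] (hD : IsStrictNormalCrossing D)
    (a : framedProduct b D ⟶ X) {U : X.Opens} {W : (framedProduct b D).Opens} {g : Γ(X, U)}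
    {μ : Γ(openPush (differentials b) (divisorCompl D), U)} {f : Γ(framedProduct b D, W)}
    (h : IsLogQuotient b D δ U W g μ f) :
    g • pullbackSection δ (differentials a) W U h.le (differential a W f) =
      diagonalDerivation δ a h.fst h.snd h.le g := by
  have h1 : differential a W (1 : Γ(framedProduct b D, W)) = 0 := by
    have := differential_appLE a (V := W) (U := ⊤) le_top 1
    rwa [map_one] at this
  rw [diagonalDerivation, eq_sub_iff_add_eq, h.eq_mul, differential_mul, differential_add, h1, add_zero,
    pullbackSection_add, pullbackSection_smul, pullbackSection_smul, map_add, map_one,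
    h.eq_zero hδ hD, zero_add, one_smul, appLE_section (framedDiagonal_snd hδ) _ _ le_rfl, fres_self,
    add_comm]

/-- A linear relation between logarithmic differentials holds for the corresponding differentials
along the diagonal. -/
theorem sum_pullbackSection_eq_zero [PerfectField k] [Smooth b] (hD : IsStrictNormalCrossing D)
    (a : framedProduct b D ⟶ X) {U : X.affineOpens} (hU : U.1 ≤ divisorCompl D) {s : Set ι} {m : ℕ}
    {t : ι → Γ(X, U.1)} {z : Fin m → Γ(X, U.1)} (h : IsLogCoords b D U s t z)
    {W : (framedProduct b D).Opens} {κ : Type*} [Fintype κ] {g c : κ → Γ(X, U.1)}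
    {μ : κ → Γ(openPush (differentials b) (divisorCompl D), U.1)} {f : κ → Γ(framedProduct b D, W)}
    (hf : ∀ j, IsLogQuotient b D δ U.1 W (g j) (μ j) (f j)) (h0 : ∑ j, c j • μ j = 0)
    (hfst : W ≤ framedFst b D ⁻¹ᵁ U.1) (hsnd : W ≤ framedSnd b D ⁻¹ᵁ U.1) (hle : U.1 ≤ δ ⁻¹ᵁ W) :
    ∑ j, c j • pullbackSection δ (differentials a) W U.1 hle (differential a W (f j)) = 0 := by
  let _ := Fintype.ofFinite s
  choose w hw using fun j => (by
    have := (hf j).isUnit.map (fres (le_inf le_rfl hU))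
    rwa [fres_fres, fres_self] at this : IsUnit (g j))
  have h1 := openPushUnit_sum_eq_zero (E := differentials b) hU (w := w) (e := fun j => differential b U.1 (g j))
    (fun j => by rw [hw]; exact (hf j).smul_eq) h0
  have h2 := h.sum_derivation_eq_zero (diagonalDerivation δ a hfst hsnd hle) (fun x y => by
      simp only [diagonalDerivation, map_add, differential_add, pullbackSection_add]
      abel) (fun x y => by
      simp only [diagonalDerivation, map_mul, differential_mul, pullbackSection_add, pullbackSection_smul,
        appLE_section (framedDiagonal_fst hδ) hfst hle le_rfl,
        appLE_section (framedDiagonal_snd hδ) hsnd hle le_rfl, fres_self, smul_sub]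
      abel) (fun c => by
      rw [diagonalDerivation, sub_eq_zero]
      have h3 := DFunLike.congr_fun (appLE_baseHom b (framedFst b D) (framedFst_comp b D) hfst) c
      have h4 := DFunLike.congr_fun (appLE_baseHom b (framedSnd b D) rfl hsnd) c
      exact congrArg (fun x => pullbackSection δ (differentials a) W U.1 hle (differential a W x))
        (h3.trans h4.symm)) h1
  refine Eq.trans (Finset.sum_congr rfl fun j _ => ?_) h2
  have h3 : ↑(w j)⁻¹ * g j = 1 := by rw [← hw, Units.inv_mul]
  rw [← (hf j).smul_pullbackSection hδ hD, smul_smul, mul_assoc, h3, mul_one]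

end

end

/-! ### The fibres of the framed dilatation -/

section

variable {X P Y S : Scheme.{u}}

section
variable {k : Type u} [Field k] {ι : Type} [Fintype ι] {b : X ⟶ Spec (.of k)} {D : ι → X.IdealSheafData}
  {δ : X ⟶ framedProduct b D}

/-- The function `f` is `v - 1`, where `v` is the quotient of the two pull-backs of a function which
is invertible off the divisor, and `ω` is the logarithmic differential of that function. -/
def LogRelation (b : X ⟶ Spec (.of k)) (D : ι → X.IdealSheafData) (δ : X ⟶ framedProduct b D)
    (U : X.affineOpens) (W : (framedProduct b D).Opens) (f : Γ(framedProduct b D, W))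
    (ω : Γ(logDifferentials b (divisorCompl D), U.1)) : Prop :=
  ∃ (g : Γ(X, U.1)) (μ : Γ(openPush (differentials b) (divisorCompl D), U.1))
    (hμ : μ ∈ logSections b (divisorCompl D) U.1),
    IsLogQuotient b D δ U.1 W g μ f ∧ ω = logSection b (divisorCompl D) U.1 μ hμ

variable [PerfectField k] [Smooth b] (hD : IsStrictNormalCrossing D)
  (hδ : δ ≫ framedProductMap b D = pullback.lift (𝟙 X) (𝟙 X) rfl)
  {a : framedProduct b D ⟶ X} (ha : a = framedSnd b D ∨ a = framedFst b D)
include hD hδ ha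

theorem exists_isSectionCoords_framed (x : X) (U₀ : X.Opens) (hx : x ∈ U₀) :
    ∃ (U : X.affineOpens) (W : (framedProduct b D).affineOpens) (n : ℕ)
      (y : Fin n → Γ(framedProduct b D, W.1)) (ω : Fin n → Γ(logDifferentials b (divisorCompl D), U.1)),
      x ∈ U.1 ∧ U.1 ≤ U₀ ∧ IsSectionCoords a δ U W y ∧ GeneratesKer δ U W y ∧
      IsBasisOn (logDifferentials b (divisorCompl D)) U.1 ω ∧ ∀ i, LogRelation b D δ U W.1 (y i) (ω i) := by
  obtain ⟨U, m, t, z, hxU, hU, h⟩ := exists_isLogCoords (b := b) hD x hx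
  have hδ₁ := framedDiagonal_fst hδ
  have hδ₂ := framedDiagonal_snd hδ
  have hle : U.1 ≤ δ ⁻¹ᵁ framedChart b D U U := fun y hy =>
    ⟨show framedFst b D (δ y) ∈ U.1 from (section_mem_preimage hδ₁ y).symm ▸ hy,
      show framedSnd b D (δ y) ∈ U.1 from (section_mem_preimage hδ₂ y).symm ▸ hy⟩
  let W : (framedProduct b D).affineOpens := ⟨framedChart b D U U, h.isAffineOpen_framedChart h⟩
  obtain ⟨v, hv, hS, hF⟩ := h.exists_quotients
  choose μ hμ using fun l => (openPush_smul_bijective (E := differentials b) (h.isUnit_fres l)).2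
    ((openPushUnit (differentials b) (divisorCompl D)).app U.1 (differential b U.1 _))
  have hμ' : ∀ l, μ l ∈ logSections b (divisorCompl D) U.1 := fun l =>
    Submodule.subset_span (Or.inr ⟨_, h.isUnit_fres l, hμ l⟩)
  have hq : ∀ l, IsLogQuotient b D δ U.1 W.1 _ (μ l) (v l - 1) := fun l =>
    ⟨framedChart_le_fst b D U U, framedChart_le_snd b D U U, hle, h.isUnit_fres l, hμ l, by
      rw [sub_add_cancel]; exact hv l⟩
  let _ := Fintype.ofFinite {i | x ∈ (D i).support}
  let e := (Fintype.equivFin ({i | x ∈ (D i).support} ⊕ Fin m)).symm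
  have hy : IsSectionCoords a δ U W fun i => v (e i) - 1 := by
    rcases ha with rfl | rfl
    · exact ⟨framedChart_le_snd b D U U, hle, hS.eval₂Hom_of_equiv e, fun i => (hq (e i)).eq_zero hδ hD⟩
    · exact ⟨framedChart_le_fst b D U U, hle, hF.eval₂Hom_of_equiv e, fun i => (hq (e i)).eq_zero hδ hD⟩
  have haδ : δ ≫ a = 𝟙 X := by rcases ha with rfl | rfl <;> assumption
  obtain ⟨U', W', hU', hW', hxU', -, -, hfst, hsnd, hy', hker⟩ : ∃ (U' : X.affineOpens)
      (W' : (framedProduct b D).affineOpens) (_ : U'.1 ≤ U.1) (hW : W'.1 ≤ W.1), x ∈ U'.1 ∧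
      U'.1 ≤ U.1 ∧ W'.1 ≤ ⊤ ∧ W'.1 ≤ framedFst b D ⁻¹ᵁ U'.1 ∧ W'.1 ≤ framedSnd b D ⁻¹ᵁ U'.1 ∧
      IsSectionCoords a δ U' W' (fun i => fres hW (v (e i) - 1)) ∧
      GeneratesKer δ U' W' fun i => fres hW (v (e i) - 1) := by
    rcases ha with rfl | rfl
    · obtain ⟨U', W', h1, h2, h3, h4, h5, h6, h7, h8⟩ :=
        hy.exists_generatesKer hδ₂ hδ₁ hxU hxU (W₀ := ⊤) trivial
      exact ⟨U', W', h1, h2, h3, h4, h5, h6, h7.le, h7, h8⟩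
    · obtain ⟨U', W', h1, h2, h3, h4, h5, h6, h7, h8⟩ :=
        hy.exists_generatesKer hδ₁ hδ₂ hxU hxU (W₀ := ⊤) trivial
      exact ⟨U', W', h1, h2, h3, h4, h5, h7.le, h6, h7, h8⟩
  exact ⟨U', W', _, _, _, hxU', hU'.trans hU, hy', hker,
    ((h.isBasisOn_logDifferentials hD hμ hμ').reindex e).restrict hU', fun i =>
    ⟨_, _, logSections_map b _ _ _ (homOfLE hU') _ (hμ' (e i)),
      (hq (e i)).restrict hU' hW' hfst hsnd hy'.le_preimage, mres_subsheafSection hU' (hμ' (e i))⟩⟩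

theorem hasLocalBases_logDifferentials : HasLocalBases (logDifferentials b (divisorCompl D)) := fun x => by
  obtain ⟨U, W, n, y, ω, hxU, -, -, -, hω, -⟩ := exists_isSectionCoords_framed hD hδ ha x ⊤ trivial
  exact ⟨U.1, n, ω, hxU, hω⟩

omit ha in
/-- The coefficients of a function in terms of coordinates which vanish along the diagonal give the
coefficients of the corresponding logarithmic differential. -/
theorem mres_eq_sum_of_logRelation (U₁ : X.affineOpens) (W₁ : (framedProduct b D).affineOpens) (n : ℕ)
    (y : Fin n → Γ(framedProduct b D, W₁.1)) (ω : Fin n → Γ(logDifferentials b (divisorCompl D), U₁.1))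
    (hy : IsSectionCoords a δ U₁ W₁ y) (hω : IsBasisOn (logDifferentials b (divisorCompl D)) U₁.1 ω)
    (hyω : ∀ i, LogRelation b D δ U₁ W₁.1 (y i) (ω i)) (U : X.affineOpens) (W : (framedProduct b D).Opens)
    (f : Γ(framedProduct b D, W)) (η : Γ(logDifferentials b (divisorCompl D), U.1))
    (hf : LogRelation b D δ U W f η) (U' : X.affineOpens) (hU : U'.1 ≤ U.1) (hU₁ : U'.1 ≤ U₁.1)
    (W' : (framedProduct b D).affineOpens) (hW : W'.1 ≤ W) (hW₁ : W'.1 ≤ W₁.1) (h : U'.1 ≤ δ ⁻¹ᵁ W'.1)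
    (c : Fin n → Γ(framedProduct b D, W'.1)) (hc : fres hW f = ∑ i, c i * fres hW₁ (y i)) :
    mres _ hU η = ∑ i, δ.appLE W'.1 U'.1 h (c i) • mres _ hU₁ (ω i) := by
  obtain ⟨c', hc'⟩ := hω.exists_eq hU₁ (mres _ hU η)
  suffices H : c' = fun i => δ.appLE W'.1 U'.1 h (c i) by rw [← hc', H]
  obtain ⟨g, μ, hμ, hgf, rfl⟩ := hf
  choose g' μ' hμ' hgy hω' using hyω
  -- it suffices to compare the coefficients off the divisor
  funext i
  rw [← sub_eq_zero]
  refine (isEffectiveCartier_prod (b := b) hD).eq_zero_of_complement (O := U'.1 ⊓ divisorCompl D)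
    inf_le_left (fun y hy hy' => ⟨hy, hy'⟩) (functions_ext fun x hx => ?_)
  obtain ⟨V, m, t, z, hxV, hV, hlog⟩ := exists_isLogCoords (b := b) hD x hx
  refine ⟨V.1, hV, hxV, ?_⟩
  have hVU' : V.1 ≤ U'.1 := hV.trans inf_le_left
  let Z := W'.1 ⊓ (framedFst b D ⁻¹ᵁ V.1 ⊓ framedSnd b D ⁻¹ᵁ V.1)
  have hZW : Z ≤ W'.1 := inf_le_left
  have hfst : Z ≤ framedFst b D ⁻¹ᵁ V.1 := inf_le_right.trans inf_le_left
  have hsnd : Z ≤ framedSnd b D ⁻¹ᵁ V.1 := inf_le_right.trans inf_le_right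
  have hZ : V.1 ≤ δ ⁻¹ᵁ Z := fun y hy => ⟨h (hVU' hy),
    show framedFst b D (δ y) ∈ V.1 from (section_mem_preimage (framedDiagonal_fst hδ) y).symm ▸ hy,
    show framedSnd b D (δ y) ∈ V.1 from (section_mem_preimage (framedDiagonal_snd hδ) y).symm ▸ hy⟩
  let d := fun f : Γ(framedProduct b D, Z) => pullbackSection δ (differentials a) Z V.1 hZ (differential a Z f)
  -- The differential of `f` along the diagonal is computed from the relation between the logarithmic
  -- differentials, and from the expansion of `f`; the differentials of the `y i` are a basis.
  have h1 : d (fres (hZW.trans hW) f) = ∑ i, fres hVU' (c' i) • d (fres (hZW.trans hW₁) (y i)) := by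
    have h2 := sum_pullbackSection_eq_zero hδ hD a (hV.trans inf_le_right) hlog (κ := Option (Fin n))
      (c := fun j => j.elim (-1) fun i => fres hVU' (c' i))
      (f := fun j => j.elim (fres (hZW.trans hW) f) fun i => fres (hZW.trans hW₁) (y i))
      (μ := fun j => j.elim (mres _ (hVU'.trans hU) μ) fun i => mres _ (hVU'.trans hU₁) (μ' i))
      (g := fun j => j.elim (fres (hVU'.trans hU) g) fun i => fres (hVU'.trans hU₁) (g' i))
      (fun j => by
        cases j with
        | none => exact hgf.restrict _ _ hfst hsnd hZ
        | some i => exact (hgy i).restrict _ _ hfst hsnd hZ)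
      (subsheafSection_sum_eq_zero (h := logSections_map b (divisorCompl D)) (he := fun j => by
        cases j with
        | none => exact logSections_map b _ _ _ (homOfLE (hVU'.trans hU)) _ hμ
        | some i => exact logSections_map b _ _ _ (homOfLE (hVU'.trans hU₁)) _ (hμ' i)) (by
        rw [Fintype.sum_option]
        have h3 := congrArg (mres _ hVU') hc'
        rw [map_sum, mres_mres] at h3
        simp only [mres_smul, mres_mres] at h3
        rw [Option.elim_none, neg_one_smul, neg_add_eq_zero]
        refine Eq.trans (mres_subsheafSection (hVU'.trans hU) hμ).symm (h3.symm.trans ?_)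
        refine Finset.sum_congr rfl fun i _ => congrArg _ ?_
        rw [hω']
        exact mres_subsheafSection (hVU'.trans hU₁) (hμ' i)))
      hfst hsnd hZ
    rw [Fintype.sum_option, Option.elim_none, neg_one_smul, neg_add_eq_zero] at h2
    exact h2
  have h4 : d (fres (hZW.trans hW) f) =
      ∑ i, δ.appLE Z V.1 hZ (fres hZW (c i)) • d (fres (hZW.trans hW₁) (y i)) := by
    refine Eq.trans (congrArg d ?_) (pullbackSection_differential_sum δ a hZ _ _ fun i => ?_)
    · have := congrArg (fres hZW) hc
      rw [map_sum, fres_fres] at this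
      simp only [map_mul, fres_fres] at this
      exact this
    · have := congrArg (fres (hVU'.trans hU₁)) (hy.eq_zero i)
      rw [map_zero, fres_appLE] at this
      rwa [appLE_fres]
  have h5 := (isBasisOn_differentials_of_etale a hy.le hy.etale).pullback hy.le_preimage
  have h6 := (h5 V.1 (hVU'.trans hU₁)).1 (a₁ := fun i => fres hVU' (c' i))
    (a₂ := fun i => δ.appLE Z V.1 hZ (fres hZW (c i))) (by
      refine Eq.trans (Finset.sum_congr rfl fun i _ => congrArg _ ?_)
        ((h1.symm.trans h4).trans (Finset.sum_congr rfl fun i _ => congrArg _ ?_)) <;>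
      · simp only [d]
        rw [differential_fres, pullbackSection_mres])
  rw [fres_fres, map_zero, map_sub, sub_eq_zero]
  refine (congrFun h6 i).trans ?_
  rw [appLE_fres]
  exact (fres_appLE _ _ _).symm

/-- The fibre over `R` of the dilatation along the framed diagonal is a vector bundle, with respect
to either projection. -/
theorem existsUnique_isCanonicalLogIso [IsSeparated b] (r : ι → ℕ)
    [(twistedLogDifferentials b D (divisorSum D r)).IsQuasicoherent] :
    ∃! θ : pullback (framedDilatationMap b D δ (divisorSum D r) ≫ a) (divisorSum D r).subschemeι ≅
        pullback (vectorBundleπ (twistedLogDifferentials b D (divisorSum D r)))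
          (divisorSum D r).subschemeι,
      IsCanonicalLogIso b D δ (divisorSum D r) a θ := by
  have := isClosedImmersion_framed hD hδ
  have hR := isEffectiveCartier_divisorSum (b := b) hD r
  have haδ : δ ≫ a = 𝟙 X := by
    rcases ha with rfl | rfl
    exacts [framedDiagonal_snd hδ, framedDiagonal_fst hδ]
  have haR : (divisorSum D r).comap a = (divisorSum D r).comap (framedSnd b D) := by
    rcases ha with rfl | rfl
    exacts [rfl, comap_framed_eq hD r]
  have hq : (tensorModule (logDifferentials b (divisorCompl D))
    (divisorModule (divisorSum D r))).IsQuasicoherent := ‹_›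
  have key := existsUnique_dilatationIso haR hR haδ (F := LogRelation b D δ)
    (fun U W f ω ⟨g, μ, hμ, h, _⟩ => ⟨h.le, h.eq_zero hδ hD⟩)
    (exists_isSectionCoords_framed hD hδ ha) (mres_eq_sum_of_logRelation hD hδ)
  refine (existsUnique_congr fun θ => ?_).mp key
  constructor
  · rintro ⟨h1, h2⟩
    refine ⟨h1, fun U W hfst hsnd hpr hU t ht s hs hts f hf m hm hfm v hv g hg => ?_⟩
    exact h2 _ _ _ _ (.mk U W hpr t ht s hs hts (v - 1) _ ⟨f, m, hm, ⟨hfst, hsnd, hU, hf, hfm, by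
      rw [sub_add_cancel]; exact hv⟩, rfl⟩ g hg)
  · rintro ⟨h1, h2⟩
    refine ⟨h1, ?_⟩
    rintro U _ _ _ ⟨W, hW, t, ht, s, hs, hts, f, _, ⟨f', m, hm, h, rfl⟩, g, hg⟩
    exact h2 U W h.fst h.snd hW h.le t ht s hs hts f' h.isUnit m hm h.smul_eq (f + 1) h.eq_mul g (by
      rw [add_sub_cancel_right]; exact hg)

end

end

end

theorem mainTheorem11 :
    (∀ (X P : Scheme.{u}) (a : P ⟶ X) (σ : X ⟶ P) (R : X.IdealSheafData),
      IsLocallyNoetherian X → IsSeparated a → Smooth a → σ ≫ a = 𝟙 X → IsEffectiveCartier R →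
      Smooth (dilatationMap a σ.ker R ≫ a) ∧
      (twistedDifferentials a σ R).IsLocallyFree ∧
      (twistedDifferentials a σ R).IsFiniteType ∧
      ∃ _ : (twistedDifferentials a σ R).IsQuasicoherent,
        ∃! θ : pullback (dilatationMap a σ.ker R ≫ a) R.subschemeι ≅
            pullback (vectorBundleπ (twistedDifferentials a σ R)) R.subschemeι,
          IsCanonicalIso a σ R θ) ∧
    (∀ (k : Type u) [Field k] [PerfectField k] (X : Scheme.{u}) (b : X ⟶ Spec (.of k))
      (ι : Type) [Fintype ι] (D : ι → X.IdealSheafData) (r : ι → ℕ),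
      Smooth b → IsSeparated b → QuasiCompact b → IsStrictNormalCrossing D →
      (∃! δ : X ⟶ framedProduct b D,
        δ ≫ framedProductMap b D = pullback.lift (𝟙 X) (𝟙 X) rfl) ∧
      ∀ δ : X ⟶ framedProduct b D,
        δ ≫ framedProductMap b D = pullback.lift (𝟙 X) (𝟙 X) rfl →
        Smooth (framedDilatationMap b D δ (divisorSum D r) ≫ framedSnd b D) ∧
        Smooth (framedDilatationMap b D δ (divisorSum D r) ≫ framedFst b D) ∧
        (twistedLogDifferentials b D (divisorSum D r)).IsLocallyFree ∧
        (twistedLogDifferentials b D (divisorSum D r)).IsFiniteType ∧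
        ∃ _ : (twistedLogDifferentials b D (divisorSum D r)).IsQuasicoherent,
          (∃! θ : pullback (framedDilatationMap b D δ (divisorSum D r) ≫ framedSnd b D)
                (divisorSum D r).subschemeι ≅
              pullback (vectorBundleπ (twistedLogDifferentials b D (divisorSum D r)))
                (divisorSum D r).subschemeι,
            IsCanonicalLogIso b D δ (divisorSum D r) (framedSnd b D) θ) ∧
          ∃! θ : pullback (framedDilatationMap b D δ (divisorSum D r) ≫ framedFst b D)
                (divisorSum D r).subschemeι ≅
              pullback (vectorBundleπ (twistedLogDifferentials b D (divisorSum D r)))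
                (divisorSum D r).subschemeι,
            IsCanonicalLogIso b D δ (divisorSum D r) (framedFst b D) θ) := by
  refine ⟨fun X P a σ R _ _ _ hσ hR => smooth_dilatation_and_existsUnique hσ hR,
    fun k _ _ X b ι _ D r _ _ _ hD => ⟨existsUnique_framedDiagonal hD, fun δ hδ => ?_⟩⟩
  have := isClosedImmersion_framed hD hδ
  have := smooth_framedSnd (b := b) hD
  have := smooth_framedFst (b := b) hD
  have hR := isEffectiveCartier_divisorSum (b := b) hD r
  have hE := (hasLocalBases_logDifferentials hD hδ (.inl rfl)).tensor_divisorModule hR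
  have hq : (twistedLogDifferentials b D (divisorSum D r)).IsQuasicoherent := hE.isQuasicoherent
  exact ⟨smooth_dilatation rfl hR (framedDiagonal_snd hδ),
    smooth_dilatation (comap_framed_eq hD r) hR (framedDiagonal_fst hδ), hE.isLocallyFree,
    hE.isFiniteType, hq, existsUnique_isCanonicalLogIso hD hδ (.inl rfl) r,
    existsUnique_isCanonicalLogIso hD hδ (.inr rfl) r⟩
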